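/- All objects are $C^\infty$ unless stated otherwise, and the summation convention is used. **Setting.** Let $t:\mathcal V\to\mathbb R$ be a manifold fibred over the real line with $n$-dimensional fibres, with fibred local coordinates $(t,q^1,\dots,q^n)$, let $j_1\mathcal V=\{v\in T\mathcal V: dt(v)=1\}$ be its first jet space, and let $\pi:\mathcal A\to\mathcal V$ be a manifold fibred over $\mathcal V$, with fibred local coordinates $(t,q^i,z^1,\dots,z^r)$, together with an imbedding $\mathcal A\to j_1\mathcal V$ over $\mathcal V$, locally written $\dot q^i=\psi^i(t,q,z)$. A section $\gamma:[t_0,t_1]\to\mathcal V$, $t_0<t_1$, is *admissible* if its velocity factors through a (necessarily unique) section $\hat\gamma:[t_0,t_1]\to\mathcal A$, its *lift*; in coordinates $dq^i/dt=\psi^i(t,q,z)$. Given a Lagrangian $\mathscr L:\mathcal A\to\mathbb R$, put $\mathcal I[\gamma]=\int_{t_0}^{t_1}\mathscr L(\hat\gamma(t))\,dt$. - $\gamma$ is an *extremal* if $\frac{d}{d\xi}\mathcal I[\gamma_\xi]\big|_{\xi=0}=0$ for every one-parameter family $\gamma_\xi$ of admissible sections (with $\hat\gamma_\xi(t)$ jointly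 smooth) with $\gamma_0=\gamma$ and the same end-points as $\gamma$. - $\gamma$ is *locally normal* if on each interval $[s_0,s_1]\subseteq[t_0,t_1]$, $s_0<s_1$, the equations $\frac{dp_i}{dt}+\frac{\partial\psi^k}{\partial q^i}p_k=0$, $p_i\frac{\partial\psi^i}{\partial z^A}=0$ along $\hat\gamma$ have only the solution $p=0$. - $\gamma$ is a *(weak local) minimum* if there is a neighbourhood $W$ of $\hat\gamma([t_0,t_1])$ in $\mathcal A$ with $\mathcal I[\gamma]\le\mathcal I[\eta]$ for every admissible $\eta:[t_0,t_1]\to\mathcal V$ that has the same end-points as $\gamma$ and a lift with values in $W$. - A *Pontryagin lift* $\tilde\gamma$ of $\gamma$ is a field $p_i(t)\,(dq^i-\psi^i dt)$ of contact $1$-forms along $\hat\gamma$ with $\frac{dp_i}{dt}+\frac{\partial\psi^k}{\partial q^i}p_k=\frac{\partial\mathscr L}{\partial q^i}$ and $p_i\frac{\partial\psi^i}{\partial z^A}=\frac{\partial\mathscr L}{\partial z^A}$. (A normal extremal has exactly one.) With $\mathscr H(t,q,z,p)=p_i\psi^i(t,q,z)-\mathscr L(t,q,z)$ let $G_{AB}(t)=-\left(\frac{\partial^2\mathscr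 H}{\partial z^A\partial z^B}\right)_{\tilde\gamma(t)}$. The extremal is *regular* if $\det G_{AB}(t)\ne0$ for all $t\in[t_0,t_1]$. - A function $S$ of class $C^3$ near $\gamma$ in $\mathcal V$ is *adapted* if $dS=\mathscr L\,dt+p_i(dq^i-\psi^idt)$ along $\tilde\gamma$; put $\mathscr L'=\mathscr L-\frac{\partial S}{\partial t}-\psi^k\frac{\partial S}{\partial q^k}$. A *Jacobi field* is a vector field $X=X^i\frac{\partial}{\partial q^i}$ along $\gamma$ for which there are an adapted $S$ and $\Gamma^A(t)$, $\bar\pi_i(t)$ (components of a field $\Gamma$ completing $X$ to a vector field $X^i\frac{\partial}{\partial q^i}+\Gamma^A\frac{\partial}{\partial z^A}$ along $\hat\gamma$, and of a field of contact $1$-forms) with, along $\hat\gamma$, $$\frac{dX^i}{dt}=\frac{\partial\psi^i}{\partial q^k}X^k+\frac{\partial\psi^i}{\partial z^A}\Gamma^A,\qquad \frac{d\bar\pi_i}{dt}+\bar\pi_k\frac{\partial\psi^k}{\partial q^i}=\frac{\partial^2\mathscr L'}{\partial q^i\partial q^k}X^k+\frac{\partial^2\mathscr L'}{\partial q^i\partial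 z^A}\Gamma^A,\qquad \bar\pi_i\frac{\partial\psi^i}{\partial z^A}=\frac{\partial^2\mathscr L'}{\partial z^A\partial q^k}X^k+\frac{\partial^2\mathscr L'}{\partial z^A\partial z^B}\Gamma^B .$$ The point $\gamma(\tau)$, $\tau\in(t_0,t_1]$, is *conjugate* to $\gamma(t_0)$ if there is a Jacobi field $X$ on $[t_0,t_1]$, not identically zero, with $X(t_0)=X(\tau)=0$. **Theorem (Necessary and sufficient conditions).** Let $\gamma:[t_0,t_1]\to\mathcal V$ be a regular, locally normal extremal of $\mathcal I$ with respect to the deformations with fixed end-points, and let $\tilde\gamma$ be its Pontryagin lift. 1. If the end-point $\gamma(t_1)$ is not conjugate to $\gamma(t_0)$, then $\gamma$ is a (weak local) minimum of $\mathcal I$ if and only if $G_{AB}(t)$ is positive definite for all $t\in[t_0,t_1]$ and no point $\gamma(\tau)$, $\tau\in(t_0,t_1]$, is conjugate to $\gamma(t_0)$. In particular the latter two conditions are always sufficient for a minimum. 2. In any case, if $\gamma$ is a (weak local) minimum of $\mathcal I$, then $G_{AB}(t)$ is positive definite for all $t\in[t_0,t_1]$ and no point $\gamma(\tau)$, $\tau\in(t_0,t_1)$,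 is conjugate to $\gamma(t_0)$. -/

import Mathlib

open Set Topology Manifold
open scoped ContDiff

/-- Model space of an event space: coordinates `(t, q)`. -/
abbrev EventModel (n : ℕ) : Type := ℝ × (Fin n → ℝ)

/-- Model space of a space of admissible velocities: coordinates `(t, q, z)`. -/
abbrev VelocityModel (n r : ℕ) : Type := ℝ × (Fin n → ℝ) × (Fin r → ℝ)

noncomputable section

namespace ConstrainedVariation

section Charts

variable {n r : ℕ} {V A : Type*}
  [TopologicalSpace V] [ChartedSpace (EventModel n) V]
  [TopologicalSpace A] [ChartedSpace (VelocityModel n r) A]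

/-- Fibred local coordinates: smooth local coordinates `(t, q)` on `V`, whose first entry is the
time function, and smooth local coordinates `(t, q, z)` on `A` which cover them, so that `proj`
reads `(t, q, z) ↦ (t, q)`. -/
structure FibredChart (time : V → ℝ) (proj : A → V) where
  base : OpenPartialHomeomorph V (EventModel n)
  total : OpenPartialHomeomorph A (VelocityModel n r)
  base_mem : base ∈ IsManifold.maximalAtlas 𝓘(ℝ, EventModel n) ∞ V
  total_mem : total ∈ IsManifold.maximalAtlas 𝓘(ℝ, VelocityModel n r) ∞ A
  mapsTo : MapsTo proj total.source base.source
  base_time : ∀ x ∈ base.source, (base x).1 = time x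
  total_time : ∀ a ∈ total.source, (total a).1 = (base (proj a)).1
  total_q : ∀ a ∈ total.source, (total a).2.1 = (base (proj a)).2

/-- The differential `⟨dF, v⟩` of a real function on `V`, as a real number. -/
def diff (F : V → ℝ) (x : V) (v : TangentSpace 𝓘(ℝ, EventModel n) x) : ℝ :=
  mfderiv 𝓘(ℝ, EventModel n) 𝓘(ℝ, ℝ) F x v

end Charts

/-- A constrained system: an event space `time : V → ℝ`, fibred over the real line with
`n`-dimensional fibres, a space of admissible velocities `proj : A → V`, fibred over `V` with
`r`-dimensional fibres, and an imbedding `vel` of `A`, fibred over `V`, in the first jet space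
`{v ∈ TV | dt(v) = 1}` of `V`. -/
structure ConstrainedSystem (n r : ℕ) (V A : Type*)
    [TopologicalSpace V] [ChartedSpace (EventModel n) V] [IsManifold 𝓘(ℝ, EventModel n) ∞ V]
    [TopologicalSpace A] [ChartedSpace (VelocityModel n r) A]
    [IsManifold 𝓘(ℝ, VelocityModel n r) ∞ A] where
  time : V → ℝ
  proj : A → V
  vel : ∀ a : A, TangentSpace 𝓘(ℝ, EventModel n) (proj a)
  time_smooth : ContMDiff 𝓘(ℝ, EventModel n) 𝓘(ℝ, ℝ) ∞ time
  proj_smooth : ContMDiff 𝓘(ℝ, VelocityModel n r) 𝓘(ℝ, EventModel n) ∞ proj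
  exists_chart : ∀ a : A, ∃ c : FibredChart (n := n) (r := r) time proj, a ∈ c.total.source
  vel_time : ∀ a : A, diff time (proj a) (vel a) = 1
  vel_embedding : Manifold.IsSmoothEmbedding 𝓘(ℝ, VelocityModel n r)
    (𝓘(ℝ, EventModel n)).tangent ∞
    (fun a => (⟨proj a, vel a⟩ : TangentBundle 𝓘(ℝ, EventModel n) V))

variable {n r : ℕ} {V A : Type*}
  [TopologicalSpace V] [ChartedSpace (EventModel n) V] [IsManifold 𝓘(ℝ, EventModel n) ∞ V]
  [TopologicalSpace A] [ChartedSpace (VelocityModel n r) A]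
  [IsManifold 𝓘(ℝ, VelocityModel n r) ∞ A]

namespace ConstrainedSystem

variable (B : ConstrainedSystem n r V A)

/-- The fibred charts of a constrained system. -/
abbrev Chart : Type _ := FibredChart (n := n) (r := r) B.time B.proj

end ConstrainedSystem

/-- The coordinate direction `∂/∂q^i` in the space of the `(t, q, z)`. -/
def dirQ (r : ℕ) {n : ℕ} (i : Fin n) : VelocityModel n r := (0, Pi.single i 1, 0)

/-- The coordinate direction `∂/∂z^A` in the space of the `(t, q, z)`. -/
def dirZ (n : ℕ) {r : ℕ} (α : Fin r) : VelocityModel n r := (0, 0, Pi.single α 1)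

namespace ConstrainedSystem

variable {B : ConstrainedSystem n r V A}

namespace Chart

variable (c : B.Chart)

/-- The functions `ψ^i(t, q, z)` in the local representation `q̇^i = ψ^i(t, q, z)` of the
imbedding. -/
def psi (y : VelocityModel n r) : Fin n → ℝ :=
  (mfderiv 𝓘(ℝ, EventModel n) 𝓘(ℝ, EventModel n) c.base
    (B.proj (c.total.symm y)) (B.vel (c.total.symm y)) : EventModel n).2

/-- Coordinate representation of a function on `A`. -/
def rep (F : A → ℝ) (y : VelocityModel n r) : ℝ := F (c.total.symm y)

/-- The components `(dt, dq^i, dz^A)` of a tangent vector of `A`. -/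
def comp (a : A) (X : TangentSpace 𝓘(ℝ, VelocityModel n r) a) : VelocityModel n r :=
  mfderiv 𝓘(ℝ, VelocityModel n r) 𝓘(ℝ, VelocityModel n r) c.total a X

/-- The tangent vector `∂/∂q^i` of `V` at `x`. -/
def partialQ (x : V) (i : Fin n) : TangentSpace 𝓘(ℝ, EventModel n) x :=
  mfderiv 𝓘(ℝ, EventModel n) 𝓘(ℝ, EventModel n) c.base.symm (c.base x)
    ((0, Pi.single i 1) : EventModel n)

/-- The components `p_i = ⟨σ, ∂/∂q^i⟩` of a covector `σ` of `V`. -/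
def mom (x : V) (σ : TangentSpace 𝓘(ℝ, EventModel n) x →L[ℝ] ℝ) (i : Fin n) : ℝ :=
  σ (c.partialQ x i)

/-- The Pontryagin Hamiltonian `p_i ψ^i(t, q, z) - L(t, q, z)`. -/
def hamiltonian (L : A → ℝ) (P : Fin n → ℝ) (y : VelocityModel n r) : ℝ :=
  ∑ i, P i * c.psi y i - c.rep L y

end Chart

variable (B)

/-- `g` is (on `[t₀, t₁]`) the lift `γ̂` of an admissible section `γ = proj ∘ g`:
`g` is smooth, `γ` is a section, and the velocity of `γ` is the image of `g` under the
imbedding. -/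
structure IsAdmissible (t₀ t₁ : ℝ) (g : ℝ → A) : Prop where
  smooth : ContMDiffOn 𝓘(ℝ, ℝ) 𝓘(ℝ, VelocityModel n r) ∞ g (Icc t₀ t₁)
  time_eq : ∀ t ∈ Icc t₀ t₁, B.time (B.proj (g t)) = t
  lift : ∀ t ∈ Icc t₀ t₁,
    mfderivWithin 𝓘(ℝ, ℝ) 𝓘(ℝ, EventModel n) (fun s => B.proj (g s)) (Icc t₀ t₁) t (1 : ℝ)
      = B.vel (g t)

/-- The action functional `∫ L dt` along the lift `g`. -/
def action (_B : ConstrainedSystem n r V A) (L : A → ℝ) (t₀ t₁ : ℝ) (g : ℝ → A) : ℝ :=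
  ∫ t in t₀..t₁, L (g t)

/-- `Γ ξ`, `|ξ| < ε`, are the lifts of a smooth one-parameter family of admissible sections with
the same end-points as the section with lift `g`, which is the one with `ξ = 0`. -/
structure IsDeformation (t₀ t₁ : ℝ) (g : ℝ → A) (ε : ℝ) (Γ : ℝ → ℝ → A) : Prop where
  smooth : ContMDiffOn 𝓘(ℝ, ℝ × ℝ) 𝓘(ℝ, VelocityModel n r) ∞ (fun x : ℝ × ℝ => Γ x.1 x.2)
    (Ioo (-ε) ε ×ˢ Icc t₀ t₁)
  admissible : ∀ ξ ∈ Ioo (-ε) ε, B.IsAdmissible t₀ t₁ (Γ ξ)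
  zero : ∀ t ∈ Icc t₀ t₁, Γ 0 t = g t
  left : ∀ ξ ∈ Ioo (-ε) ε, B.proj (Γ ξ t₀) = B.proj (g t₀)
  right : ∀ ξ ∈ Ioo (-ε) ε, B.proj (Γ ξ t₁) = B.proj (g t₁)

/-- Extremals of the action functional with respect to the deformations with fixed end-points. -/
def IsExtremal (L : A → ℝ) (t₀ t₁ : ℝ) (g : ℝ → A) : Prop :=
  B.IsAdmissible t₀ t₁ g ∧
    ∀ ε > 0, ∀ Γ : ℝ → ℝ → A, B.IsDeformation t₀ t₁ g ε Γ →
      HasDerivAt (fun ξ => B.action L t₀ t₁ (Γ ξ)) 0 0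

/-- Weak local minima with fixed end-points. As the lift is the jet-extension of the section, a
neighbourhood of the image of the lift in `A` is a `C¹` neighbourhood of the section. -/
def IsWeakLocalMin (L : A → ℝ) (t₀ t₁ : ℝ) (g : ℝ → A) : Prop :=
  ∃ W : Set A, IsOpen W ∧ (∀ t ∈ Icc t₀ t₁, g t ∈ W) ∧
    ∀ h : ℝ → A, B.IsAdmissible t₀ t₁ h → (∀ t ∈ Icc t₀ t₁, h t ∈ W) →
      B.proj (h t₀) = B.proj (g t₀) → B.proj (h t₁) = B.proj (g t₁) →
      B.action L t₀ t₁ g ≤ B.action L t₀ t₁ h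

/-- A field of contact `1`-forms `p(t) = p_i(t) (dq^i - ψ^i dt)` along the section with lift `g`
(that is, of covectors of `V` which annihilate the velocity) which solves on `[s₀, s₁]` the
Pontryagin equations
`dp_i/dt + p_k ∂ψ^k/∂q^i = ∂L/∂q^i` and `p_i ∂ψ^i/∂z^A = ∂L/∂z^A` in all fibred charts. -/
structure IsPontryaginLift (L : A → ℝ) (s₀ s₁ : ℝ) (g : ℝ → A)
    (p : ∀ t : ℝ, TangentSpace 𝓘(ℝ, EventModel n) (B.proj (g t)) →L[ℝ] ℝ) : Prop where
  contact : ∀ t ∈ Icc s₀ s₁, p t (B.vel (g t)) = 0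
  evolution : ∀ c : B.Chart, ∀ t ∈ Icc s₀ s₁, g t ∈ c.total.source → ∀ i : Fin n,
    HasDerivWithinAt (fun s => c.mom (B.proj (g s)) (p s) i)
      (fderiv ℝ (c.rep L) (c.total (g t)) (dirQ r i)
        - ∑ k, c.mom (B.proj (g t)) (p t) k * fderiv ℝ c.psi (c.total (g t)) (dirQ r i) k)
      (Icc s₀ s₁) t
  critical : ∀ c : B.Chart, ∀ t ∈ Icc s₀ s₁, g t ∈ c.total.source → ∀ α : Fin r,
    ∑ k, c.mom (B.proj (g t)) (p t) k * fderiv ℝ c.psi (c.total (g t)) (dirZ n α) k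
      = fderiv ℝ (c.rep L) (c.total (g t)) (dirZ n α)

/-- Local normality: on every closed subinterval the equations
`dp_i/dt + p_k ∂ψ^k/∂q^i = 0`, `p_i ∂ψ^i/∂z^A = 0` have only the zero solution. -/
def IsLocallyNormal (t₀ t₁ : ℝ) (g : ℝ → A) : Prop :=
  ∀ s₀ s₁ : ℝ, t₀ ≤ s₀ → s₀ < s₁ → s₁ ≤ t₁ →
    ∀ p : ∀ t : ℝ, TangentSpace 𝓘(ℝ, EventModel n) (B.proj (g t)) →L[ℝ] ℝ,
      B.IsPontryaginLift (fun _ => 0) s₀ s₁ g p → ∀ t ∈ Icc s₀ s₁, p t = 0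

variable {B} in
/-- The matrix `G_AB = -∂²ℋ/∂z^A∂z^B` (`ℋ` the Pontryagin Hamiltonian) at the point of the
contact bundle given by `a : A` and the covector `σ`. -/
def Chart.G (c : B.Chart) (L : A → ℝ) (a : A)
    (σ : TangentSpace 𝓘(ℝ, EventModel n) (B.proj a) →L[ℝ] ℝ) : Matrix (Fin r) (Fin r) ℝ :=
  Matrix.of fun α β =>
    -fderiv ℝ (fun y => fderiv ℝ (c.hamiltonian L (c.mom (B.proj a) σ)) y (dirZ n β))
      (c.total a) (dirZ n α)

/-- `S : V → ℝ` is adapted to the section with lift `g` and Pontryagin lift `p`: it is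
differentiable near the section, three times (which is what second derivatives of
`Ṡ = ∂S/∂t + ψ^i ∂S/∂q^i` need), and along it `dS = L dt + p_i (dq^i - ψ^i dt)`. -/
def IsAdapted (L : A → ℝ) (t₀ t₁ : ℝ) (g : ℝ → A)
    (p : ∀ t : ℝ, TangentSpace 𝓘(ℝ, EventModel n) (B.proj (g t)) →L[ℝ] ℝ) (S : V → ℝ) : Prop :=
  ∀ t ∈ Icc t₀ t₁,
    ContMDiffAt 𝓘(ℝ, EventModel n) 𝓘(ℝ, ℝ) 3 S (B.proj (g t)) ∧
    ∀ v : TangentSpace 𝓘(ℝ, EventModel n) (B.proj (g t)),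
      diff S (B.proj (g t)) v = L (g t) * diff B.time (B.proj (g t)) v + p t v

/-- The gauge equivalent Lagrangian `L' = L - Ṡ`, where `Ṡ = ∂S/∂t + ψ^i ∂S/∂q^i`. -/
def gauged (L : A → ℝ) (S : V → ℝ) (a : A) : ℝ :=
  L a - diff S (B.proj a) (B.vel a)

/-- The vector field `X^i ∂/∂q^i + Γ^A ∂/∂z^A` along `g` and the field `π_i (dq^i - ψ^i dt)` of
contact `1`-forms solve the linearized Pontryagin equations of the Lagrangian `L'`, supposed
critical along `g`:
`dX^i/dt = ψ^i_{q^k} X^k + ψ^i_{z^A} Γ^A`,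
`dπ_i/dt + π_k ψ^k_{q^i} = L'_{q^i q^k} X^k + L'_{q^i z^A} Γ^A`,
`π_i ψ^i_{z^A} = L'_{z^A q^k} X^k + L'_{z^A z^B} Γ^B`.
The sums on the right are written as derivatives in the direction `(0, X, Γ)`. -/
structure IsJacobiPair (L' : A → ℝ) (t₀ t₁ : ℝ) (g : ℝ → A)
    (X : ∀ t : ℝ, TangentSpace 𝓘(ℝ, VelocityModel n r) (g t))
    (ϖ : ∀ t : ℝ, TangentSpace 𝓘(ℝ, EventModel n) (B.proj (g t)) →L[ℝ] ℝ) : Prop where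
  vertical : ∀ c : B.Chart, ∀ t ∈ Icc t₀ t₁, g t ∈ c.total.source →
    (c.comp (g t) (X t)).1 = 0
  contact : ∀ t ∈ Icc t₀ t₁, ϖ t (B.vel (g t)) = 0
  variation : ∀ c : B.Chart, ∀ t ∈ Icc t₀ t₁, g t ∈ c.total.source →
    HasDerivWithinAt (fun s => (c.comp (g s) (X s)).2.1)
      (fderiv ℝ c.psi (c.total (g t)) (c.comp (g t) (X t))) (Icc t₀ t₁) t
  evolution : ∀ c : B.Chart, ∀ t ∈ Icc t₀ t₁, g t ∈ c.total.source → ∀ i : Fin n,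
    HasDerivWithinAt (fun s => c.mom (B.proj (g s)) (ϖ s) i)
      (fderiv ℝ (fun y => fderiv ℝ (c.rep L') y (dirQ r i)) (c.total (g t)) (c.comp (g t) (X t))
        - ∑ k, c.mom (B.proj (g t)) (ϖ t) k * fderiv ℝ c.psi (c.total (g t)) (dirQ r i) k)
      (Icc t₀ t₁) t
  critical : ∀ c : B.Chart, ∀ t ∈ Icc t₀ t₁, g t ∈ c.total.source → ∀ α : Fin r,
    ∑ k, c.mom (B.proj (g t)) (ϖ t) k * fderiv ℝ c.psi (c.total (g t)) (dirZ n α) k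
      = fderiv ℝ (fun y => fderiv ℝ (c.rep L') y (dirZ n α)) (c.total (g t))
          (c.comp (g t) (X t))

/-- `J` is a Jacobi field along the section with lift `g` and Pontryagin lift `p`: the projection
on `V` of a solution of the linearized Pontryagin equations. -/
def IsJacobiField (L : A → ℝ) (t₀ t₁ : ℝ) (g : ℝ → A)
    (p : ∀ t : ℝ, TangentSpace 𝓘(ℝ, EventModel n) (B.proj (g t)) →L[ℝ] ℝ)
    (J : ∀ t : ℝ, TangentSpace 𝓘(ℝ, EventModel n) (B.proj (g t))) : Prop :=
  ∃ S : V → ℝ, B.IsAdapted L t₀ t₁ g p S ∧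
    ∃ (X : ∀ t : ℝ, TangentSpace 𝓘(ℝ, VelocityModel n r) (g t))
      (ϖ : ∀ t : ℝ, TangentSpace 𝓘(ℝ, EventModel n) (B.proj (g t)) →L[ℝ] ℝ),
      B.IsJacobiPair (B.gauged L S) t₀ t₁ g X ϖ ∧
      ∀ t ∈ Icc t₀ t₁,
        J t = mfderiv 𝓘(ℝ, VelocityModel n r) 𝓘(ℝ, EventModel n) B.proj (g t) (X t)

/-- The point `γ(τ)`, `τ ∈ (t₀, t₁]`, is conjugate to `γ(t₀)`: some Jacobi field which is not
identically zero on `[t₀, t₁]` vanishes at `t₀` and at `τ`. -/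
def IsConjugate (L : A → ℝ) (t₀ t₁ : ℝ) (g : ℝ → A)
    (p : ∀ t : ℝ, TangentSpace 𝓘(ℝ, EventModel n) (B.proj (g t)) →L[ℝ] ℝ) (τ : ℝ) : Prop :=
  τ ∈ Ioc t₀ t₁ ∧
    ∃ J : ∀ t : ℝ, TangentSpace 𝓘(ℝ, EventModel n) (B.proj (g t)),
      B.IsJacobiField L t₀ t₁ g p J ∧ J t₀ = 0 ∧ J τ = 0 ∧ ∃ t ∈ Icc t₀ t₁, J t ≠ 0

end ConstrainedSystem

end ConstrainedVariation

end

/-!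
# Necessary and sufficient conditions for weak local minima of constrained variational problems

The section `γ` is contained in the domain of a single fibred chart (`exists_chart_along`), in which
the constraint is a control system `q' = ψ(t, q, z)`. Near `γ` there is a function `S` adapted to the
Pontryagin lift (`IsPontryaginLift.exists_isAdapted`). Replacing the Lagrangian `L` by
`L' = L - Ṡ` changes the action by a boundary term (`IsAdmissible.action_eq`), and the Pontryagin
equations say precisely that `L'` vanishes to first order along `γ̂`
(`IsAdapted.fderiv_rep_gauged_eq_zero`). Its Hessian along `γ̂` is therefore a tensor, with `G` as
its part along the fibres of `A → V` (`IsAdapted.G_eq`), and it is the second variation of the action.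

After the fundamental solution of the linearized constraint has been divided out, the Hessian
defines a linear-quadratic problem: the functional `∫ H((y, u), (y, u))` for the system `y' = β u`
(`IsAccessory`). Its extremals are the Jacobi fields (`IsAccessory.isLQSolution`,
`IsAccessory.isLinearized`; that solutions of the linearized equations in one chart solve them in all
charts is `IsAdapted.isJacobiPair`), and local normality says that it can be steered from `0` to any
point on any interval (`NormalOn.exists_steering`).

*Necessity.* By normality, every control `u` of the linear problem which steers from `0` to `0` is the
first order part of a family of admissible sections with the end-points of `γ`: the correction which
restores the end-points is found as a fixed point (`NormalOn.eventually_exists_solution`). So at a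
minimum the second variation is nonnegative (`IsAccessory.quad_nonneg`). Controls supported in
short intervals then give `G ≥ 0` (`NormalOn.legendre`), and regularity gives positivity. If an
extremal of the linear-quadratic problem vanishes at `t₀` and at `τ < t₁`, cutting it off at `τ` gives the value zero
to the nonnegative functional; the vanishing of the first variation there forces its costate at
`τ` to be zero, and with it the whole extremal (`jacobi_necessary`).

*Sufficiency.* If `G > 0` and there are no conjugate points, the extremals of a slightly
diminished quadratic functional that start at `t₀` with states small compared to their costates form
a field without focal points on all of `[t₀, t₁]` (`exists_transversal_solutions`). The quotient of
their costates and states solves a Riccati equation (`exists_riccati`), and subtracting the derivative of the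
corresponding quadratic form turns the integrand `L'` into one that is positive definite to second
order; hence `∫ L'` is nonnegative on all neighbouring sections with the same end-points
(`IsAccessory.exists_integral_nonneg`).
-/

set_option linter.unusedSectionVars false
set_option maxSynthPendingDepth 3

/-! ### Ordinary differential equations and calculus on an interval -/

/-- Solutions of two differential relations on adjacent intervals fit together. -/
theorem hasDerivWithinAt_Icc_glue {X : Type*} [NormedAddCommGroup X] [NormedSpace ℝ X]
    {a b c : ℝ} (hab : a ≤ b) (hbc : b ≤ c) {f f' g g' : ℝ → X}
    (hf : ∀ t ∈ Icc a b, HasDerivWithinAt f (f' t) (Icc a b) t)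
    (hg : ∀ t ∈ Icc b c, HasDerivWithinAt g (g' t) (Icc b c) t) (hfg : f b = g b)
    (hfg' : f' b = g' b) :
    ∀ t ∈ Icc a c, HasDerivWithinAt (fun s => if s ≤ b then f s else g s)
      (if t ≤ b then f' t else g' t) (Icc a c) t := by
  intro t ht
  have e1 : EqOn (fun s => if s ≤ b then f s else g s) f (Icc a b) := by
    intro s hs; simp [hs.2]
  have e2 : EqOn (fun s => if s ≤ b then f s else g s) g (Icc b c) := by
    intro s hs
    rcases hs.1.eq_or_lt with h | h
    · simp [← h, hfg]
    · simp [not_le.2 h]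
  rcases lt_trichotomy t b with h | h | h
  · rw [if_pos h.le]
    have h1 := (hf t ⟨ht.1, h.le⟩).congr (fun s hs => e1 hs) (e1 ⟨ht.1, h.le⟩)
    refine h1.mono_of_mem_nhdsWithin ?_
    filter_upwards [self_mem_nhdsWithin, mem_nhdsWithin_of_mem_nhds (Iio_mem_nhds h)] with s hs hs'
    exact ⟨hs.1, hs'.le⟩
  · subst h
    rw [if_pos le_rfl]
    have h1 := (hf t ⟨hab, le_rfl⟩).congr (fun s hs => e1 hs) (e1 ⟨hab, le_rfl⟩)
    have h2 := (hg t ⟨le_rfl, hbc⟩).congr (fun s hs => e2 hs) (e2 ⟨le_rfl, hbc⟩)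
    rw [← hfg'] at h2
    rw [← Icc_union_Icc_eq_Icc hab hbc]
    exact h1.union h2
  · rw [if_neg (not_le.2 h)]
    have h1 := (hg t ⟨h.le, ht.2⟩).congr (fun s hs => e2 hs) (e2 ⟨h.le, ht.2⟩)
    refine h1.mono_of_mem_nhdsWithin ?_
    filter_upwards [self_mem_nhdsWithin, mem_nhdsWithin_of_mem_nhds (Ioi_mem_nhds h)] with s hs hs'
    exact ⟨hs'.le, hs.2⟩

section LinearODE

variable {X : Type*} [NormedAddCommGroup X] [NormedSpace ℝ X]

theorem exists_linearODE_of_short [CompleteSpace X] {A : ℝ → X →L[ℝ] X} (hA : Continuous A) {a b K : ℝ}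
    (hab : a ≤ b) (hK : ∀ t ∈ Icc a b, ‖A t‖ ≤ K) (hKb : K * (b - a) ≤ 1 / 2) (x₀ : X) :
    ∃ z : ℝ → X, z a = x₀ ∧ ∀ t ∈ Icc a b, HasDerivWithinAt z (A t (z t)) (Icc a b) t := by
  have hK0 : 0 ≤ K := (norm_nonneg _).trans (hK a ⟨le_rfl, hab⟩)
  have hP : IsPicardLindelof (fun t x => A t x) (⟨a, le_rfl, hab⟩ : Icc a b) x₀ ‖x₀‖₊ 0
      (⟨K, hK0⟩ * (2 * ‖x₀‖₊)) ⟨K, hK0⟩ := by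
    refine ⟨fun t ht => ?_, fun x _ => ?_, fun t ht x hx => ?_, ?_⟩
    · exact (((A t).lipschitz).weaken (hK t ht)).lipschitzOnWith
    · exact (hA.clm_apply continuous_const).continuousOn
    · refine ((A t).le_of_opNorm_le (hK t ht) x).trans ?_
      have : ‖x‖ ≤ 2 * ‖x₀‖ := by
        have h1 : ‖x - x₀‖ ≤ ‖x₀‖ := by simpa [dist_eq_norm] using hx
        have := norm_le_norm_add_norm_sub' x x₀
        linarith
      exact mul_le_mul_of_nonneg_left this hK0
    · have : max (b - a) (a - a) = b - a := max_eq_left (by linarith)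
      change K * (2 * ‖x₀‖) * max (b - a) (a - a) ≤ ‖x₀‖ - 0
      rw [this]
      nlinarith [norm_nonneg x₀]
  exact hP.exists_eq_forall_mem_Icc_hasDerivWithinAt₀

/-- Linear initial value problems are solvable on every compact interval. -/
theorem exists_linearODE [CompleteSpace X] {A : ℝ → X →L[ℝ] X} (hA : Continuous A) {a b : ℝ} (hab : a ≤ b)
    (x₀ : X) :
    ∃ z : ℝ → X, z a = x₀ ∧ ∀ t ∈ Icc a b, HasDerivWithinAt z (A t (z t)) (Icc a b) t := by
  obtain ⟨K, hK⟩ := (isCompact_Icc (a := a) (b := b)).exists_bound_of_continuousOn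
    hA.continuousOn
  have hK0 : 0 ≤ K := (norm_nonneg _).trans (hK a ⟨le_rfl, hab⟩)
  set h : ℝ := 1 / (2 * (K + 1)) with hh
  have hpos : 0 < h := by positivity
  have hKh : K * h ≤ 1 / 2 := by
    rw [hh]; field_simp; linarith
  have key : ∀ N : ℕ, ∀ c ∈ Icc a b, c - a ≤ N * h → ∃ z : ℝ → X, z a = x₀ ∧
      ∀ t ∈ Icc a c, HasDerivWithinAt z (A t (z t)) (Icc a c) t := by
    intro N
    induction N with
    | zero =>
      intro c hc hca
      refine exists_linearODE_of_short hA hc.1 (fun t ht => hK t ⟨ht.1, ht.2.trans hc.2⟩) ?_ x₀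
      have : c - a ≤ 0 := by simpa using hca
      nlinarith
    | succ N ih =>
      intro c hc hca
      push_cast at hca
      set d := max a (c - h) with hd
      have had : a ≤ d := le_max_left _ _
      have hdc : d ≤ c := max_le hc.1 (by linarith)
      have hdN : d - a ≤ N * h := by
        rcases le_total a (c - h) with h1 | h1
        · rw [hd, max_eq_right h1]; linarith
        · rw [hd, max_eq_left h1]; simp; positivity
      obtain ⟨z, hz0, hz⟩ := ih d ⟨had, hdc.trans hc.2⟩ hdN
      have hcd : c - d ≤ h := by have := le_max_right a (c - h); linarith
      obtain ⟨w, hw0, hw⟩ := exists_linearODE_of_short hA hdc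
        (fun t ht => hK t ⟨had.trans ht.1, ht.2.trans hc.2⟩)
        ((mul_le_mul_of_nonneg_left hcd hK0).trans hKh) (z d)
      refine ⟨fun s => if s ≤ d then z s else w s, by simp [had, hz0], fun t ht => ?_⟩
      have := hasDerivWithinAt_Icc_glue had hdc hz hw hw0.symm (by rw [hw0]) t ht
      refine this.congr_deriv ?_
      dsimp only
      split_ifs <;> rfl
  obtain ⟨N, hN⟩ := exists_nat_ge ((b - a) / h)
  exact key N b ⟨hab, le_rfl⟩ ((div_le_iff₀ hpos).1 hN)

/-- Solutions of a linear differential equation are determined by their value at any time. -/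
theorem linearODE_eq_zero {A : ℝ → X →L[ℝ] X} (hA : Continuous A) {a b : ℝ} {z : ℝ → X}
    (hz : ∀ t ∈ Icc a b, HasDerivWithinAt z (A t (z t)) (Icc a b) t) {τ : ℝ} (hτ : τ ∈ Icc a b)
    (h0 : z τ = 0) : ∀ t ∈ Icc a b, z t = 0 := by
  obtain ⟨K, hK⟩ := (isCompact_Icc (a := a) (b := b)).exists_bound_of_continuousOn
    hA.continuousOn
  have hK0 : 0 ≤ K := (norm_nonneg _).trans (hK τ hτ)
  have hlip : ∀ t ∈ Icc a b, LipschitzOnWith ⟨K, hK0⟩ (fun x => A t x) univ := fun t ht =>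
    (((A t).lipschitz).weaken (hK t ht)).lipschitzOnWith
  have hc : ContinuousOn z (Icc a b) := fun t ht => (hz t ht).continuousWithinAt
  intro t ht
  rcases le_total τ t with h | h
  · refine ODE_solution_unique_of_mem_Icc_right (v := fun t x => A t x) (s := fun _ => univ)
      (a := τ) (b := b) (g := fun _ => 0) (fun s hs => hlip s ⟨hτ.1.trans hs.1, hs.2.le⟩)
      (hc.mono (Icc_subset_Icc_left hτ.1)) (fun s hs => ?_) (fun _ _ => mem_univ _)
      continuousOn_const (fun s hs => ?_) (fun _ _ => mem_univ _) h0 ⟨h, ht.2⟩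
    · refine (hz s ⟨hτ.1.trans hs.1, hs.2.le⟩).mono_of_mem_nhdsWithin ?_
      filter_upwards [self_mem_nhdsWithin, mem_nhdsWithin_of_mem_nhds (Iio_mem_nhds hs.2)]
        with r hr hr'
      exact ⟨hτ.1.trans (hs.1.trans hr), le_of_lt hr'⟩
    · simpa using hasDerivWithinAt_const s (Ici s) (0 : X)
  · refine ODE_solution_unique_of_mem_Icc_left (v := fun t x => A t x) (s := fun _ => univ)
      (a := a) (b := τ) (g := fun _ => 0) (fun s hs => hlip s ⟨hs.1.le, hs.2.trans hτ.2⟩)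
      (hc.mono (Icc_subset_Icc_right hτ.2)) (fun s hs => ?_) (fun _ _ => mem_univ _)
      continuousOn_const (fun s hs => ?_) (fun _ _ => mem_univ _) h0 ⟨ht.1, h⟩
    · refine (hz s ⟨hs.1.le, hs.2.trans hτ.2⟩).mono_of_mem_nhdsWithin ?_
      filter_upwards [self_mem_nhdsWithin, mem_nhdsWithin_of_mem_nhds (Ioi_mem_nhds hs.1)]
        with r hr hr'
      exact ⟨le_of_lt hr', (mem_Iic.1 hr).trans (hs.2.trans hτ.2)⟩
    · simpa using hasDerivWithinAt_const s (Iic s) (0 : X)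

/-- The fundamental solution of a linear differential equation and its inverse. -/
theorem exists_fundamentalSolution [CompleteSpace X] {A : ℝ → X →L[ℝ] X} (hA : Continuous A) {a b : ℝ}
    (hab : a ≤ b) :
    ∃ Φ Ψ : ℝ → X →L[ℝ] X, Φ a = ContinuousLinearMap.id ℝ X ∧
      (∀ t ∈ Icc a b, HasDerivWithinAt Φ (A t ∘L Φ t) (Icc a b) t) ∧
      (∀ t ∈ Icc a b, HasDerivWithinAt Ψ (-(Ψ t ∘L A t)) (Icc a b) t) ∧
      (∀ t ∈ Icc a b, Ψ t ∘L Φ t = ContinuousLinearMap.id ℝ X) ∧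
      ∀ t ∈ Icc a b, Φ t ∘L Ψ t = ContinuousLinearMap.id ℝ X := by
  let cl := ContinuousLinearMap.compL ℝ X X X
  obtain ⟨Φ, hΦ0, hΦ⟩ := exists_linearODE (X := X →L[ℝ] X) (A := fun t => cl (A t))
    (cl.continuous.comp hA) hab (ContinuousLinearMap.id ℝ X)
  obtain ⟨Ψ, hΨ0, hΨ⟩ := exists_linearODE (X := X →L[ℝ] X) (A := fun t => -cl.flip (A t))
    (cl.flip.continuous.comp hA).neg hab (ContinuousLinearMap.id ℝ X)
  have hΦ' : ∀ t ∈ Icc a b, HasDerivWithinAt Φ (A t ∘L Φ t) (Icc a b) t := hΦ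
  have hΨ' : ∀ t ∈ Icc a b, HasDerivWithinAt Ψ (-(Ψ t ∘L A t)) (Icc a b) t := hΨ
  refine ⟨Φ, Ψ, hΦ0, hΦ', hΨ', ?_, ?_⟩
  · -- `ΨΦ` is constant, by the product rule
    have h1 : ∀ t ∈ Icc a b, HasDerivWithinAt (fun s => Ψ s ∘L Φ s - ContinuousLinearMap.id ℝ X)
        ((0 : (X →L[ℝ] X) →L[ℝ] (X →L[ℝ] X)) (Ψ t ∘L Φ t - ContinuousLinearMap.id ℝ X))
        (Icc a b) t := by
      intro t ht
      have := ((hΨ' t ht).clm_comp (hΦ' t ht)).sub_const (ContinuousLinearMap.id ℝ X)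
      refine this.congr_deriv ?_
      ext x; simp
    intro t ht
    have := linearODE_eq_zero (A := fun _ => (0 : (X →L[ℝ] X) →L[ℝ] (X →L[ℝ] X)))
      continuous_const h1 (τ := a) ⟨le_rfl, hab⟩ (by rw [hΦ0, hΨ0]; ext; simp) t ht
    exact sub_eq_zero.1 this
  · -- `Z = ΦΨ - 1` solves `Z' = AZ - ZA`, as constants do
    have h1 : ∀ t ∈ Icc a b, HasDerivWithinAt (fun s => Φ s ∘L Ψ s - ContinuousLinearMap.id ℝ X)
        ((cl (A t) - cl.flip (A t)) (Φ t ∘L Ψ t - ContinuousLinearMap.id ℝ X))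
        (Icc a b) t := by
      intro t ht
      have := ((hΦ' t ht).clm_comp (hΨ' t ht)).sub_const (ContinuousLinearMap.id ℝ X)
      refine this.congr_deriv ?_
      ext x; simp [cl, sub_eq_add_neg]
    intro t ht
    have := linearODE_eq_zero (A := fun t => cl (A t) - cl.flip (A t))
      ((cl.continuous.comp hA).sub (cl.flip.continuous.comp hA)) h1 (τ := a) ⟨le_rfl, hab⟩
      (by rw [hΦ0, hΨ0]; ext; simp) t ht
    exact sub_eq_zero.1 this

end LinearODE

/-- A function that is `C^k` on a compact interval extends to a `C^k` function on the line. -/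
theorem exists_contDiff_extension {Y : Type*} [NormedAddCommGroup Y] [NormedSpace ℝ Y]
    [CompleteSpace Y] {a b : ℝ} (hab : a < b) (k : ℕ) {f : ℝ → Y}
    (hf : ContDiffOn ℝ k f (Icc a b)) : ∃ F : ℝ → Y, ContDiff ℝ k F ∧ EqOn F f (Icc a b) := by
  induction k generalizing f with
  | zero =>
    refine ⟨IccExtend hab.le ((Icc a b).domRestrict f), ?_, fun t ht => ?_⟩
    · have : Continuous (IccExtend hab.le ((Icc a b).domRestrict f)) :=
        (continuousOn_iff_continuous_domRestrict.1 hf.continuousOn).Icc_extend'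
      simpa using this
    · rw [IccExtend_of_mem _ _ ht]; rfl
  | succ k ih =>
    have hu := uniqueDiffOn_Icc hab
    have h1 := (contDiffOn_succ_iff_derivWithin hu).1 (by simpa using hf : ContDiffOn ℝ ((k : WithTop ℕ∞) + 1) f _)
    obtain ⟨G, hG, hGf⟩ := ih h1.2.2
    refine ⟨fun t => f a + ∫ s in a..t, G s, ?_, fun t ht => ?_⟩
    · have hd : ∀ t, HasDerivAt (fun t => f a + ∫ s in a..t, G s) (G t) t := fun t =>
        (intervalIntegral.integral_hasDerivAt_right (hG.continuous.intervalIntegrable _ _)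
          (hG.continuous.stronglyMeasurableAtFilter _ _) hG.continuous.continuousAt).const_add _
      have : ContDiff ℝ ((k : WithTop ℕ∞) + 1) (fun t => f a + ∫ s in a..t, G s) := by
        rw [contDiff_succ_iff_deriv]
        refine ⟨fun t => (hd t).differentiableAt, by simp, ?_⟩
        rwa [funext fun t => (hd t).deriv]
      exact_mod_cast this
    · have hint : IntervalIntegrable G MeasureTheory.volume a t :=
        hG.continuous.intervalIntegrable _ _
      have := intervalIntegral.integral_eq_sub_of_hasDeriv_right_of_le (f := f) (f' := G) ht.1
        (hf.continuousOn.mono (Icc_subset_Icc_right ht.2)) (fun s hs => ?_) hint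
      · simp [this]
      · have hs' : s ∈ Icc a b := ⟨hs.1.le, hs.2.le.trans ht.2⟩
        rw [hGf hs']
        refine ((h1.1 s hs').hasDerivWithinAt).mono_of_mem_nhdsWithin ?_
        filter_upwards [self_mem_nhdsWithin,
          mem_nhdsWithin_of_mem_nhds (Iio_mem_nhds (hs.2.trans_le ht.2))] with r hr hr'
        exact ⟨hs.1.le.trans (le_of_lt hr), le_of_lt hr'⟩

/-- The Cauchy–Schwarz inequality for `f` and `1`. -/
theorem sq_integral_le {a b : ℝ} (hab : a ≤ b) {f : ℝ → ℝ} (hf : ContinuousOn f (Icc a b)) :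
    (∫ t in a..b, f t) ^ 2 ≤ (b - a) * ∫ t in a..b, f t ^ 2 := by
  rcases hab.eq_or_lt with rfl | hlt
  · simp
  have h1 : IntervalIntegrable f MeasureTheory.volume a b :=
    (hf.mono (by rw [uIcc_of_le hab])).intervalIntegrable
  have h2 : IntervalIntegrable (fun t => f t ^ 2) MeasureTheory.volume a b :=
    ((hf.pow 2).mono (by rw [uIcc_of_le hab])).intervalIntegrable
  set m := (∫ t in a..b, f t) / (b - a) with hm
  have hm' : ∫ t in a..b, f t = m * (b - a) := by
    rw [hm]; field_simp [(sub_pos.2 hlt).ne']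
  have h3 : 0 ≤ ∫ t in a..b, (f t - m) ^ 2 :=
    intervalIntegral.integral_nonneg hab fun t _ => sq_nonneg _
  have h4 : ∫ t in a..b, (f t - m) ^ 2
      = (∫ t in a..b, f t ^ 2) - 2 * m * (∫ t in a..b, f t) + m ^ 2 * (b - a) := by
    have : ∀ t, (f t - m) ^ 2 = f t ^ 2 - 2 * m * f t + m ^ 2 := fun t => by ring
    simp_rw [this]
    rw [intervalIntegral.integral_add (h2.sub (h1.const_mul _)) (by simp),
      intervalIntegral.integral_sub h2 (h1.const_mul _), intervalIntegral.integral_const_mul,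
      intervalIntegral.integral_const]
    simp [mul_comm]
  rw [h4, hm'] at h3
  rw [hm']
  nlinarith [sub_pos.2 hlt]

section Calculus

variable {X Y : Type*} [NormedAddCommGroup X] [NormedSpace ℝ X] [NormedAddCommGroup Y]
  [NormedSpace ℝ Y]

/-- Strict differentiability of a `C¹` function, uniformly on a compact set. -/
theorem uniform_strict_deriv {f : X → Y} (hf : ContDiff ℝ 1 f) {K : Set X} (hK : IsCompact K)
    {ε : ℝ} (hε : 0 < ε) : ∃ δ > 0, ∀ p ∈ K, ∀ h h' : X, ‖h‖ < δ → ‖h'‖ < δ →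
      ‖f (p + h) - f (p + h') - fderiv ℝ f p (h - h')‖ ≤ ε * ‖h - h'‖ := by
  have h1 := hK.uniformContinuousAt_of_continuousAt (fderiv ℝ f)
    (fun x _ => (hf.continuous_fderiv one_ne_zero).continuousAt) (Metric.dist_mem_uniformity hε)
  obtain ⟨δ, hδ, h2⟩ := Metric.mem_uniformity_dist.1 h1
  refine ⟨δ, hδ, fun p hp h h' hh hh' => ?_⟩
  have hd : ∀ x ∈ Metric.ball p δ, HasFDerivWithinAt f (fderiv ℝ f x) (Metric.ball p δ) x :=
    fun x _ => ((hf.differentiable one_ne_zero) x).hasFDerivAt.hasFDerivWithinAt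
  have := (convex_ball p δ).norm_image_sub_le_of_norm_hasFDerivWithin_le' (f := f)
    (φ := fderiv ℝ f p) (C := ε) (x := p + h') (y := p + h) hd (fun x hx => ?_)
    (by simpa using hh') (by simpa using hh)
  · simpa using this
  · have := h2 (a := p) (b := x) (by rw [dist_comm]; exact hx) hp
    rw [← dist_eq_norm, dist_comm]
    exact le_of_lt this

/-- Second order Taylor expansion, uniformly on a compact set of critical zeros. -/
theorem uniform_taylor_two {f : X → ℝ} (hf : ContDiff ℝ 2 f) {K : Set X} (hK : IsCompact K)
    (h0 : ∀ p ∈ K, f p = 0) (h1 : ∀ p ∈ K, fderiv ℝ f p = 0) {ε : ℝ} (hε : 0 < ε) :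
    ∃ δ > 0, ∀ p ∈ K, ∀ h : X, ‖h‖ < δ →
      |f (p + h) - fderiv ℝ (fderiv ℝ f) p h h / 2| ≤ ε * ‖h‖ ^ 2 := by
  have hf' : ContDiff ℝ 1 (fderiv ℝ f) := hf.fderiv_right (by norm_num)
  obtain ⟨δ, hδ, H⟩ := uniform_strict_deriv hf' hK hε
  refine ⟨δ, hδ, fun p hp h hh => ?_⟩
  set B := fderiv ℝ (fderiv ℝ f) p with hB
  have hsymm : ∀ v w, B v w = B w v := fun v w =>
    (hf.contDiffAt.isSymmSndFDerivAt (by simp)) v w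
  let g : X → ℝ := fun k => f (p + k) - B k k / 2
  have hg : ∀ k, HasFDerivAt g (fderiv ℝ f (p + k) - B k) k := by
    intro k
    have e1 : HasFDerivAt (fun k => f (p + k)) (fderiv ℝ f (p + k)) k := by
      have h2 := ((hf.differentiable two_ne_zero) (p + k)).hasFDerivAt
      exact (h2.comp k ((hasFDerivAt_id k).const_add p)).congr_fderiv (by ext; simp)
    have e2 : HasFDerivAt (fun k => B k k / 2) (B k) k := by
      have h3 := (B.hasFDerivAt (x := k)).clm_apply (hasFDerivAt_id k)
      have h4 := h3.mul_const (1 / 2 : ℝ)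
      refine (h4.congr_fderiv ?_).congr_of_eventuallyEq
        (Filter.Eventually.of_forall fun k => by simp [div_eq_mul_inv])
      ext v
      simp [hsymm v k]
      ring
    exact e1.sub e2
  have hball : ∀ k ∈ segment ℝ (0 : X) h, ‖fderiv ℝ f (p + k) - B k‖ ≤ ε * ‖h‖ := by
    intro k hk
    have hk' : ‖k‖ ≤ ‖h‖ := by
      obtain ⟨s, hs, rfl⟩ := (segment_eq_image' ℝ (0 : X) h ▸ hk)
      simp only [zero_add, sub_zero, norm_smul, Real.norm_eq_abs, abs_of_nonneg hs.1]
      exact mul_le_of_le_one_left (norm_nonneg _) hs.2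
    have := H p hp k 0 (hk'.trans_lt hh) (by simpa using hδ)
    simp only [add_zero, sub_zero, h1 p hp] at this
    exact this.trans (mul_le_mul_of_nonneg_left hk' hε.le)
  have := (convex_segment (𝕜 := ℝ) (0 : X) h).norm_image_sub_le_of_norm_hasFDerivWithin_le
    (f := g) (fun k _ => (hg k).hasFDerivWithinAt) hball (left_mem_segment _ _ _)
    (right_mem_segment _ _ _)
  simp only [g, h0 p hp, add_zero, map_zero, zero_div, sub_zero, Real.norm_eq_abs] at this
  rw [pow_two, ← mul_assoc]
  exact this

/-- A function that is `C^k` near a compact set agrees near it with one that is `C^k` everywhere. -/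
theorem exists_contDiff_cutoff [FiniteDimensional ℝ X] {k : ℕ∞} {f : X → Y} {K Ω : Set X}
    (hK : IsCompact K) (hΩ : IsOpen Ω) (hKΩ : K ⊆ Ω) (hf : ContDiffOn ℝ k f Ω) :
    ∃ F : X → Y, ContDiff ℝ k F ∧ ∃ U : Set X, IsOpen U ∧ K ⊆ U ∧ U ⊆ Ω ∧ EqOn F f U := by
  obtain ⟨L, hL, hKL, hLΩ⟩ := exists_compact_between hK hΩ hKΩ
  obtain ⟨χ, hχ1, hχ0, -⟩ := exists_contMDiffMap_one_nhds_of_subset_interior 𝓘(ℝ, X)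
    (n := ⊤) hK.isClosed hKL
  have hχ : ContDiff ℝ k χ := (χ.contMDiff.contDiff).of_le (by exact_mod_cast le_top)
  obtain ⟨V, hV, hKV, hV1⟩ := mem_nhdsSet_iff_exists.1 hχ1
  refine ⟨fun x => χ x • f x, ?_, V ∩ interior L, hV.inter isOpen_interior,
    subset_inter hKV hKL, fun x hx => hLΩ (interior_subset hx.2), fun x hx => ?_⟩
  · refine contDiff_iff_contDiffAt.2 fun x => ?_
    by_cases hx : x ∈ Ω
    · exact hχ.contDiffAt.smul (hf.contDiffAt (hΩ.mem_nhds hx))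
    · have : (fun x => χ x • f x) =ᶠ[𝓝 x] fun _ => 0 := by
        filter_upwards [hL.isClosed.isOpen_compl.mem_nhds fun h => hx (hLΩ h)] with y hy
        rw [hχ0 y hy, zero_smul]
      exact contDiffAt_const.congr_of_eventuallyEq this
  · have : χ x = 1 := hV1 hx.1
    simp [this]

end Calculus

/-! ### Linear-quadratic problems: controls and the second variation -/

section Controls

variable {E F : Type*} [NormedAddCommGroup E] [NormedSpace ℝ E] [NormedAddCommGroup F]
  [NormedSpace ℝ F]

/-- The trajectory `y` with `y' = β u` which starts from `0` at the time `a`. -/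
noncomputable def traj (β : ℝ → F →L[ℝ] E) (a : ℝ) (u : ℝ → F) (t : ℝ) : E :=
  ∫ s in a..t, β s (u s)

/-- The quadratic functional `∫ H((y, u), (y, u))` of the control `u` with trajectory `y`. -/
noncomputable def quad (β : ℝ → F →L[ℝ] E) (H : ℝ → (E × F) →L[ℝ] (E × F) →L[ℝ] ℝ) (a b : ℝ)
    (u : ℝ → F) : ℝ :=
  ∫ t in a..b, H t (traj β a u t, u t) (traj β a u t, u t)

/-- Normality on `[a, b]` of the system `y' = β u`: no nonzero covector annihilates all the
`β t`. -/
def NormalOn (β : ℝ → F →L[ℝ] E) (a b : ℝ) : Prop :=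
  ∀ φ : E →L[ℝ] ℝ, (∀ t ∈ Icc a b, φ ∘L β t = 0) → φ = 0

theorem NormalOn.mono {β : ℝ → F →L[ℝ] E} {a b c d : ℝ} (h : NormalOn β a b) (hc : c ≤ a)
    (hd : b ≤ d) : NormalOn β c d :=
  fun φ hφ => h φ fun t ht => hφ t ⟨hc.trans ht.1, ht.2.trans hd⟩

variable {β : ℝ → F →L[ℝ] E} {a b : ℝ}

theorem hasDerivAt_traj [CompleteSpace E] (hβ : Continuous β) {u : ℝ → F} (hu : Continuous u)
    (a t : ℝ) : HasDerivAt (traj β a u) (β t (u t)) t := by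
  have hc : Continuous fun s => β s (u s) := hβ.clm_apply hu
  exact intervalIntegral.integral_hasDerivAt_right (hc.intervalIntegrable _ _)
    (hc.stronglyMeasurableAtFilter _ _) hc.continuousAt

theorem continuous_traj [CompleteSpace E] (hβ : Continuous β) {u : ℝ → F} (hu : Continuous u)
    (a : ℝ) : Continuous (traj β a u) :=
  continuous_iff_continuousAt.2 fun t => (hasDerivAt_traj hβ hu a t).continuousAt

/-- The endpoint of the trajectory depends linearly on the control. -/
noncomputable def endpointMap (hβ : Continuous β) (a b : ℝ) (D : Submodule ℝ (ℝ → F))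
    (hD : ∀ u ∈ D, Continuous u) : D →ₗ[ℝ] E where
  toFun u := traj β a u b
  map_add' u v := by
    have h1 : Continuous fun s => β s ((u : ℝ → F) s) := hβ.clm_apply (hD u u.2)
    have h2 : Continuous fun s => β s ((v : ℝ → F) s) := hβ.clm_apply (hD v v.2)
    simp only [traj, Submodule.coe_add, Pi.add_apply, map_add]
    exact intervalIntegral.integral_add (h1.intervalIntegrable _ _) (h2.intervalIntegrable _ _)
  map_smul' c u := by
    simp only [traj, Submodule.coe_smul, Pi.smul_apply, map_smul, RingHom.id_apply]
    exact intervalIntegral.integral_smul _ _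

/-- Bounded pointwise convergence of controls entails convergence of trajectories. -/
theorem tendsto_traj (hβ : Continuous β) {v : ℕ → ℝ → F}
    {u : ℝ → F} (hv : ∀ k, Continuous (v k)) {C : ℝ} (hC : ∀ k, ∀ t ∈ Icc a b, ‖v k t‖ ≤ C)
    {τ : ℝ} (hlim : ∀ t ∈ Icc a b, t ≠ τ → Filter.Tendsto (fun k => v k t) Filter.atTop (𝓝 (u t)))
    {t : ℝ} (ht : t ∈ Icc a b) :
    Filter.Tendsto (fun k => traj β a (v k) t) Filter.atTop (𝓝 (traj β a u t)) := by
  obtain ⟨M, hM⟩ := (isCompact_Icc (a := a) (b := b)).exists_bound_of_continuousOn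
    hβ.continuousOn
  have hsub : uIoc a t ⊆ Icc a b := by
    rw [uIoc_of_le ht.1]; exact fun s hs => ⟨hs.1.le, hs.2.trans ht.2⟩
  refine intervalIntegral.tendsto_integral_filter_of_dominated_convergence (fun _ => M * C)
    (Filter.Eventually.of_forall fun k => ((hβ.clm_apply (hv k)).aestronglyMeasurable))
    (Filter.Eventually.of_forall fun k => Filter.Eventually.of_forall fun s hs => ?_)
    (by simp) ?_
  · exact (β s).le_of_opNorm_le_of_le (hM s (hsub hs)) (hC k s (hsub hs))
  · have : ∀ᵐ s : ℝ, s ≠ τ := by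
      simp [MeasureTheory.ae_iff, MeasureTheory.measure_singleton]
    filter_upwards [this] with s hs hs'
    exact ((β s).continuous.tendsto _).comp (hlim s (hsub hs') hs)

/-- Bounded pointwise convergence of controls entails convergence of the quadratic functional. -/
theorem tendsto_quad [CompleteSpace E] (hβ : Continuous β)
    {H : ℝ → (E × F) →L[ℝ] (E × F) →L[ℝ] ℝ} (hH : Continuous H) (hab : a ≤ b) {v : ℕ → ℝ → F}
    {u : ℝ → F} (hv : ∀ k, Continuous (v k)) {C : ℝ} (hC : ∀ k, ∀ t ∈ Icc a b, ‖v k t‖ ≤ C)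
    {τ : ℝ} (hlim : ∀ t ∈ Icc a b, t ≠ τ →
      Filter.Tendsto (fun k => v k t) Filter.atTop (𝓝 (u t))) :
    Filter.Tendsto (fun k => quad β H a b (v k)) Filter.atTop (𝓝 (quad β H a b u)) := by
  obtain ⟨M, hM⟩ := (isCompact_Icc (a := a) (b := b)).exists_bound_of_continuousOn
    hβ.continuousOn
  obtain ⟨N, hN⟩ := (isCompact_Icc (a := a) (b := b)).exists_bound_of_continuousOn (f := H)
    hH.continuousOn
  have hM0 : 0 ≤ M := (norm_nonneg _).trans (hM a ⟨le_rfl, hab⟩)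
  have hC0 : 0 ≤ C := (norm_nonneg _).trans (hC 0 a ⟨le_rfl, hab⟩)
  have hsub : uIoc a b ⊆ Icc a b := by rw [uIoc_of_le hab]; exact Ioc_subset_Icc_self
  set R := max (M * C * (b - a)) C with hR
  have hbound : ∀ k, ∀ t ∈ Icc a b, ‖(traj β a (v k) t, v k t)‖ ≤ R := by
    intro k t ht
    rw [Prod.norm_mk]
    refine max_le_max ?_ (hC k t ht)
    have := intervalIntegral.norm_integral_le_of_norm_le_const (a := a) (b := t)
      (f := fun s => β s (v k s)) (C := M * C) fun s hs => by
        have hs' : s ∈ Icc a b := by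
          rw [uIoc_of_le ht.1] at hs; exact ⟨hs.1.le, hs.2.trans ht.2⟩
        exact (β s).le_of_opNorm_le_of_le (hM s hs') (hC k s hs')
    refine this.trans ?_
    rw [abs_of_nonneg (sub_nonneg.2 ht.1)]
    exact mul_le_mul_of_nonneg_left (by linarith [ht.2]) (by positivity)
  refine intervalIntegral.tendsto_integral_filter_of_dominated_convergence (fun _ => N * R * R)
    (Filter.Eventually.of_forall fun k => ?_)
    (Filter.Eventually.of_forall fun k => Filter.Eventually.of_forall fun s hs => ?_)
    (by simp) ?_
  · have h1 : Continuous fun t => (traj β a (v k) t, v k t) :=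
      (continuous_traj hβ (hv k) a).prodMk (hv k)
    exact ((hH.clm_apply h1).clm_apply h1).aestronglyMeasurable
  · have := hbound k s (hsub hs)
    exact ((H s _).le_of_opNorm_le_of_le ((H s).le_of_opNorm_le_of_le (hN s (hsub hs)) this) this)
  · have : ∀ᵐ s : ℝ, s ≠ τ := by
      simp [MeasureTheory.ae_iff, MeasureTheory.measure_singleton]
    filter_upwards [this] with s hs hs'
    have h1 : Filter.Tendsto (fun k => (traj β a (v k) s, v k s)) Filter.atTop
        (𝓝 (traj β a u s, u s)) :=
      (tendsto_traj hβ hv hC hlim (hsub hs')).prodMk_nhds (hlim s (hsub hs') hs)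
    have h2 : Continuous fun w : E × F => H s w w := by fun_prop
    exact (h2.tendsto _).comp h1

end Controls

section Steering

variable {n r : ℕ} {β : ℝ → (Fin r → ℝ) →L[ℝ] (Fin n → ℝ)} {a b : ℝ}

/-- The weight `(t - a)₊ (b - t)₊`, positive exactly on `(a, b)`. -/
def tent (a b t : ℝ) : ℝ := max 0 (t - a) * max 0 (b - t)

theorem continuous_tent (a b : ℝ) : Continuous (tent a b) := by
  unfold tent; fun_prop

theorem tent_nonneg (a b t : ℝ) : 0 ≤ tent a b t :=
  mul_nonneg (le_max_left _ _) (le_max_left _ _)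

theorem tent_pos {a b t : ℝ} (h : t ∈ Ioo a b) : 0 < tent a b t :=
  mul_pos (lt_max_of_lt_right (sub_pos.2 h.1)) (lt_max_of_lt_right (sub_pos.2 h.2))

theorem tent_eq_zero {a b t : ℝ} (h : t ∉ Ioo a b) : tent a b t = 0 := by
  unfold tent
  by_cases h1 : a < t
  · have : b ≤ t := not_lt.1 fun h2 => h ⟨h1, h2⟩
    rw [max_eq_left (sub_nonpos.2 this), mul_zero]
  · rw [max_eq_left (sub_nonpos.2 (not_lt.1 h1)), zero_mul]

/-- A nonnegative continuous function with vanishing integral vanishes. -/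
theorem eq_zero_of_integral_eq_zero {a b : ℝ} (hab : a < b) {f : ℝ → ℝ} (hf : Continuous f)
    (h0 : ∀ t, 0 ≤ f t) (hi : ∫ t in a..b, f t = 0) : ∀ t ∈ Icc a b, f t = 0 := by
  intro t ht
  by_contra hne
  have := intervalIntegral.integral_pos hab hf.continuousOn (fun t _ => h0 t)
    ⟨t, ht, lt_of_le_of_ne (h0 t) (Ne.symm hne)⟩
  exact this.ne' hi

/-- A normal system can be steered from `0` to any point: the controls `ρ β* c`, with a weight `ρ`
supported in `[a, b]`, suffice, as their endpoint map `c ↦ (∫ ρ β β*) c` is injective. -/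
theorem NormalOn.exists_steering (hβ : Continuous β) (hab : a < b) (hn : NormalOn β a b)
    (e : Fin n → ℝ) : ∃ u : ℝ → Fin r → ℝ, Continuous u ∧ (∀ t, t ∉ Ioo a b → u t = 0) ∧
      ∫ t in a..b, β t (u t) = e := by
  let adj : (Fin n → ℝ) → ℝ → Fin r → ℝ := fun c t i => c ⬝ᵥ β t (Pi.single i 1)
  have hadj : ∀ c, Continuous (adj c) := fun c => by
    refine continuous_pi fun i => ?_
    have : Continuous fun t => β t (Pi.single i 1) := hβ.clm_apply continuous_const
    simp only [adj, dotProduct]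
    fun_prop
  have hadj' : ∀ c t v, c ⬝ᵥ β t v = ∑ i, v i * adj c t i := by
    intro c t v
    conv_lhs => rw [pi_eq_sum_univ' v]
    simp only [map_sum, map_smul, dotProduct_sum, dotProduct_smul, smul_eq_mul, adj]
  let ctl : (Fin n → ℝ) → ℝ → Fin r → ℝ := fun c t => tent a b t • adj c t
  have hctl : ∀ c, Continuous (ctl c) := fun c => (continuous_tent a b).smul (hadj c)
  have hint : ∀ c, IntervalIntegrable (fun t => β t (ctl c t)) MeasureTheory.volume a b :=
    fun c => (hβ.clm_apply (hctl c)).intervalIntegrable _ _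
  let L : (Fin n → ℝ) →ₗ[ℝ] (Fin n → ℝ) :=
    { toFun := fun c => ∫ t in a..b, β t (ctl c t)
      map_add' := fun c d => by
        rw [← intervalIntegral.integral_add (hint c) (hint d)]
        refine intervalIntegral.integral_congr fun t _ => ?_
        have : adj (c + d) t = adj c t + adj d t := by
          ext i; simp [adj, add_dotProduct]
        simp [ctl, this]
      map_smul' := fun x c => by
        rw [RingHom.id_apply, ← intervalIntegral.integral_smul]
        refine intervalIntegral.integral_congr fun t _ => ?_
        have : adj (x • c) t = x • adj c t := by
          ext i; simp [adj, smul_dotProduct]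
        simp only [ctl, this, map_smul]
        rw [smul_comm] }
  have hL : Function.Injective L := by
    rw [← LinearMap.ker_eq_bot, LinearMap.ker_eq_bot']
    intro c hc
    let φ : (Fin n → ℝ) →L[ℝ] ℝ := LinearMap.toContinuousLinearMap
      { toFun := fun x => c ⬝ᵥ x
        map_add' := fun x y => dotProduct_add _ _ _
        map_smul' := fun s x => by simp [dotProduct_smul] }
    have hφ : ∀ x, φ x = c ⬝ᵥ x := fun x => rfl
    have h1 : ∫ t in a..b, tent a b t * ∑ i, adj c t i ^ 2 = 0 := by
      have h2 : φ (L c) = ∫ t in a..b, φ (β t (ctl c t)) :=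
        (φ.intervalIntegral_comp_comm (hint c)).symm
      rw [hc, map_zero] at h2
      rw [h2]
      refine intervalIntegral.integral_congr fun t _ => ?_
      simp only [hφ, hadj', ctl, Pi.smul_apply, smul_eq_mul, Finset.mul_sum]
      exact Finset.sum_congr rfl fun i _ => by ring
    have h3 := eq_zero_of_integral_eq_zero hab
      (f := fun t => tent a b t * ∑ i, adj c t i ^ 2)
      ((continuous_tent a b).mul (continuous_finsetSum _ fun i _ =>
        ((continuous_apply i).comp (hadj c)).pow 2))
      (fun t => mul_nonneg (tent_nonneg _ _ _) (Finset.sum_nonneg fun i _ => sq_nonneg _)) h1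
    have h4 : ∀ t ∈ Ioo a b, adj c t = 0 := fun t ht => by
      have := (mul_eq_zero.1 (h3 t (Ioo_subset_Icc_self ht))).resolve_left (tent_pos ht).ne'
      rw [Finset.sum_eq_zero_iff_of_nonneg fun i _ => sq_nonneg _] at this
      ext i
      exact pow_eq_zero_iff two_ne_zero |>.1 (this i (Finset.mem_univ i))
    have h5 : ∀ t ∈ Icc a b, adj c t = 0 := by
      intro t ht
      have : Icc a b ⊆ {t | adj c t = 0} := by
        rw [← closure_Ioo hab.ne]
        exact closure_minimal h4 (isClosed_eq (hadj c) continuous_const)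
      exact this ht
    have h6 : φ = 0 := hn φ fun t ht => by
      ext v
      simp [hφ, hadj', h5 t ht]
    have h7 : ∀ x, c ⬝ᵥ x = 0 := fun x => by rw [← hφ, h6]; rfl
    exact dotProduct_eq_zero_iff.1 h7
  obtain ⟨c, hc⟩ := (LinearMap.injective_iff_surjective.1 hL) e
  exact ⟨ctl c, hctl c, fun t ht => by simp [ctl, tent_eq_zero ht], hc⟩

/-- A normal system can be steered by smooth controls, which depend linearly on the endpoint. -/
theorem NormalOn.exists_smooth_steering (hβ : Continuous β) (hab : a < b) (hn : NormalOn β a b) :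
    ∃ U : (Fin n → ℝ) →ₗ[ℝ] (ℝ → Fin r → ℝ), (∀ e, ContDiff ℝ ∞ (U e)) ∧
      ∀ e, traj β a (U e) b = e := by
  let D : Submodule ℝ (ℝ → Fin r → ℝ) :=
    { carrier := {u | ContDiff ℝ ∞ u}
      add_mem' := fun {u v} (h1 : ContDiff ℝ ∞ u) (h2 : ContDiff ℝ ∞ v) => h1.add h2
      zero_mem' := show ContDiff ℝ ∞ fun _ => (0 : Fin r → ℝ) from contDiff_const
      smul_mem' := fun c u (h : ContDiff ℝ ∞ u) => h.const_smul c }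
  let L := endpointMap hβ a b D fun u (hu : ContDiff ℝ ∞ u) => hu.continuous
  have hL : LinearMap.range L = ⊤ := by
    have hcl : IsClosed (LinearMap.range L : Set (Fin n → ℝ)) :=
      Submodule.closed_of_finiteDimensional _
    rw [eq_top_iff]
    intro e _
    rw [← SetLike.mem_coe, ← hcl.closure_eq]
    obtain ⟨u, hu, -, hue⟩ := hn.exists_steering hβ hab e
    have hap : ∀ k : ℕ, ∃ w : ℝ → Fin r → ℝ, ContDiff ℝ ∞ w ∧
        ∀ t, dist (w t) (u t) < 1 / ((k : ℝ) + 1) := fun k => by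
      obtain ⟨w, hw, hw', -⟩ := hu.exists_contDiff_approx ⊤ (ε := fun _ => 1 / ((k : ℝ) + 1))
        continuous_const fun _ => by positivity
      exact ⟨w, hw, hw'⟩
    choose w hw hwu using hap
    obtain ⟨C, hC⟩ := (isCompact_Icc (a := a) (b := b)).exists_bound_of_continuousOn
      hu.continuousOn
    have hwt : ∀ t, Filter.Tendsto (fun k => w k t) Filter.atTop (𝓝 (u t)) := fun t =>
      tendsto_iff_dist_tendsto_zero.2 (squeeze_zero (fun _ => dist_nonneg)
        (fun k => (hwu k t).le) tendsto_one_div_add_atTop_nhds_zero_nat)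
    have := tendsto_traj (a := a) (b := b) hβ (fun k => (hw k).continuous) (C := C + 1)
      (fun k t ht => ?_) (τ := a) (fun t _ _ => hwt t) (t := b) ⟨hab.le, le_rfl⟩
    · rw [show traj β a u b = e from hue] at this
      exact mem_closure_of_tendsto this (Filter.Eventually.of_forall fun k => ⟨⟨w k, hw k⟩, rfl⟩)
    · have h1 := hC t ht
      have h2 := (hwu k t).le
      rw [dist_eq_norm] at h2
      have h3 : 1 / ((k : ℝ) + 1) ≤ 1 := by
        rw [div_le_one (by positivity)]; linarith [Nat.cast_nonneg (α := ℝ) k]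
      have := norm_le_norm_add_norm_sub' (w k t) (u t)
      linarith
  obtain ⟨R, hR⟩ := L.exists_rightInverse_of_surjective hL
  exact ⟨D.subtype ∘ₗ R, fun e => (R e).2, fun e => LinearMap.congr_fun hR e⟩

/-- If the quadratic functional is nonnegative on the smooth controls which steer from `0` to `0`,
it is so on the limits of continuous controls. -/
theorem NormalOn.quad_nonneg_of_tendsto (hβ : Continuous β) (hab : a < b) (hn : NormalOn β a b)
    {H : ℝ → ((Fin n → ℝ) × (Fin r → ℝ)) →L[ℝ] ((Fin n → ℝ) × (Fin r → ℝ)) →L[ℝ] ℝ}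
    (hH : Continuous H)
    (hQ : ∀ u : ℝ → Fin r → ℝ, ContDiff ℝ ∞ u → traj β a u b = 0 → 0 ≤ quad β H a b u)
    {c : ℕ → ℝ → Fin r → ℝ} {u : ℝ → Fin r → ℝ} (hc : ∀ k, Continuous (c k)) {C : ℝ}
    (hC : ∀ k, ∀ t ∈ Icc a b, ‖c k t‖ ≤ C) {τ : ℝ} (hlim : ∀ t ∈ Icc a b, t ≠ τ →
      Filter.Tendsto (fun k => c k t) Filter.atTop (𝓝 (u t)))
    (hu : traj β a u b = 0) : 0 ≤ quad β H a b u := by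
  obtain ⟨U, hU, hUe⟩ := hn.exists_smooth_steering hβ hab
  have hap : ∀ k : ℕ, ∃ w : ℝ → Fin r → ℝ, ContDiff ℝ ∞ w ∧
      ∀ t, dist (w t) (c k t) < 1 / ((k : ℝ) + 1) := fun k => by
    obtain ⟨w, hw, hw', -⟩ := (hc k).exists_contDiff_approx ⊤ (ε := fun _ => 1 / ((k : ℝ) + 1))
      continuous_const fun _ => by positivity
    exact ⟨w, hw, hw'⟩
  choose w hw hwc using hap
  have h1k : ∀ k : ℕ, 1 / ((k : ℝ) + 1) ≤ 1 := fun k => by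
    rw [div_le_one (by positivity)]; linarith [Nat.cast_nonneg (α := ℝ) k]
  have hwC : ∀ k, ∀ t ∈ Icc a b, ‖w k t‖ ≤ C + 1 := fun k t ht => by
    have h1 := hC k t ht
    have h2 := (hwc k t).le
    rw [dist_eq_norm] at h2
    have := norm_le_norm_add_norm_sub' (w k t) (c k t)
    linarith [h1k k]
  have hwt : ∀ t ∈ Icc a b, t ≠ τ → Filter.Tendsto (fun k => w k t) Filter.atTop (𝓝 (u t)) := by
    intro t ht htτ
    have h0 : Filter.Tendsto (fun k => dist (w k t) (c k t)) Filter.atTop (𝓝 0) :=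
      squeeze_zero (fun _ => dist_nonneg) (fun k => (hwc k t).le)
        tendsto_one_div_add_atTop_nhds_zero_nat
    exact (tendsto_iff_of_dist h0).2 (hlim t ht htτ)
  have hd : Filter.Tendsto (fun k => traj β a (w k) b) Filter.atTop (𝓝 0) := by
    have := tendsto_traj hβ (fun k => (hw k).continuous) hwC hwt (t := b) ⟨hab.le, le_rfl⟩
    rwa [hu] at this
  -- correct the endpoints
  have hUsum : ∀ e t, U e t = ∑ i, e i • U (Pi.single i 1) t := by
    intro e t
    have : U e = ∑ i, e i • U (Pi.single i 1) := by
      conv_lhs => rw [pi_eq_sum_univ' e]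
      simp only [map_sum, map_smul]
    rw [this, Finset.sum_apply]
    rfl
  have hUt : ∀ t, Filter.Tendsto (fun k => U (traj β a (w k) b) t) Filter.atTop (𝓝 0) := by
    intro t
    rw [funext fun k => hUsum (traj β a (w k) b) t]
    have : Continuous fun e : Fin n → ℝ => ∑ i, e i • U (Pi.single i 1) t := by fun_prop
    have h2 := (this.tendsto 0).comp hd
    simp only [Pi.zero_apply, zero_smul, Finset.sum_const_zero] at h2
    exact h2
  have hUb : ∃ M : ℝ, ∀ k, ∀ t ∈ Icc a b, ‖U (traj β a (w k) b) t‖ ≤ M := by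
    obtain ⟨B, hB⟩ := hd.norm.bddAbove_range
    have hM : ∀ i, ∃ M, ∀ t ∈ Icc a b, ‖U (Pi.single i 1) t‖ ≤ M := fun i =>
      (isCompact_Icc (a := a) (b := b)).exists_bound_of_continuousOn (hU _).continuous.continuousOn
    choose M hM using hM
    refine ⟨∑ i, B * M i, fun k t ht => ?_⟩
    rw [hUsum]
    refine (norm_sum_le _ _).trans (Finset.sum_le_sum fun i _ => ?_)
    rw [norm_smul]
    have h1 : ‖traj β a (w k) b‖ ≤ B := hB ⟨k, rfl⟩
    exact mul_le_mul ((norm_le_pi_norm _ i).trans h1) (hM i t ht) (norm_nonneg _)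
      ((norm_nonneg _).trans h1)
  obtain ⟨M, hM⟩ := hUb
  have hVc : ∀ k, ContDiff ℝ ∞ (w k - U (traj β a (w k) b)) := fun k => (hw k).sub (hU _)
  have key := tendsto_quad (H := H) hβ hH hab.le (v := fun k => w k - U (traj β a (w k) b)) (u := u)
    (fun k => (hVc k).continuous) (C := C + 1 + M)
    (fun k t ht => (norm_sub_le _ _).trans (add_le_add (hwC k t ht) (hM k t ht))) (τ := τ)
    (fun t ht htτ => by simpa using (hwt t ht htτ).sub (hUt t))
  refine ge_of_tendsto' key fun k => hQ _ (hVc k) ?_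
  have h1 : Continuous fun s => β s (w k s) := hβ.clm_apply (hw k).continuous
  have h2 : Continuous fun s => β s (U (traj β a (w k) b) s) := hβ.clm_apply (hU _).continuous
  have : traj β a (w k - U (traj β a (w k) b)) b
      = traj β a (w k) b - traj β a (U (traj β a (w k) b)) b := by
    simp only [traj, Pi.sub_apply, map_sub]
    exact intervalIntegral.integral_sub (h1.intervalIntegrable _ _) (h2.intervalIntegrable _ _)
  rw [this, hUe, sub_self]

end Steering

/-! ### Linear-quadratic problems: the Legendre condition -/

theorem exists_Icc_subset_of_mem {a b t η : ℝ} (hab : a < b) (ht : t ∈ Icc a b) (hη : 0 < η) :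
    ∃ c d, c < d ∧ a ≤ c ∧ d ≤ b ∧ d - c ≤ η ∧ ∀ s ∈ Icc c d, |s - t| ≤ η := by
  refine ⟨max a (t - η / 2), min b (t + η / 2), ?_, le_max_left _ _, min_le_left _ _, ?_, ?_⟩
  · rw [max_lt_iff, lt_min_iff, lt_min_iff]
    exact ⟨⟨hab, by linarith [ht.1]⟩, by linarith [ht.2], by linarith⟩
  · have := le_max_right a (t - η / 2)
    have := min_le_right b (t + η / 2)
    linarith
  · intro s hs
    have h1 := (le_max_right a (t - η / 2)).trans hs.1
    have h2 := hs.2.trans (min_le_right b (t + η / 2))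
    rw [abs_le]
    constructor <;> linarith

section Legendre

variable {n r : ℕ} {β : ℝ → (Fin r → ℝ) →L[ℝ] (Fin n → ℝ)} {a b : ℝ}

/-- On any interval there is a nonzero multiple `u = f v` of a given direction, with `f` a
polynomial times a weight vanishing at the ends, which steers from `0` to `0`. -/
theorem exists_scalar_control (hβ : Continuous β) {c d : ℝ} (hcd : c < d) (v : Fin r → ℝ) :
    ∃ f : ℝ → ℝ, Continuous f ∧ (∀ t, t ∉ Ioo c d → f t = 0) ∧ 0 < ∫ t in c..d, f t ^ 2 ∧
      ∫ t in c..d, β t (f t • v) = 0 := by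
  let w : Polynomial ℝ → ℝ → ℝ := fun P t => tent c d t * P.eval t
  have hw : ∀ P, Continuous (w P) := fun P => (continuous_tent c d).mul P.continuous
  have hi : ∀ P, IntervalIntegrable (fun t => β t (w P t • v)) MeasureTheory.volume c d :=
    fun P => (hβ.clm_apply ((hw P).smul continuous_const)).intervalIntegrable _ _
  let L : Polynomial ℝ →ₗ[ℝ] (Fin n → ℝ) :=
    { toFun := fun P => ∫ t in c..d, β t (w P t • v)
      map_add' := fun P Q => by
        rw [← intervalIntegral.integral_add (hi P) (hi Q)]
        refine intervalIntegral.integral_congr fun t _ => ?_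
        simp only [w, Polynomial.eval_add, mul_add, add_smul, map_add]
      map_smul' := fun x P => by
        rw [RingHom.id_apply, ← intervalIntegral.integral_smul]
        refine intervalIntegral.integral_congr fun t _ => ?_
        simp only [w, Polynomial.eval_smul, smul_eq_mul, map_smul, smul_smul]
        congr 1; ring }
  have hL : LinearMap.ker L ≠ ⊥ := fun h =>
    Polynomial.not_finite (R := ℝ) (Module.Finite.of_injective L (LinearMap.ker_eq_bot.1 h))
  obtain ⟨P, hP, hP0⟩ := Submodule.exists_mem_ne_zero_of_ne_bot hL
  refine ⟨w P, hw P, fun t ht => by simp [w, tent_eq_zero ht], ?_, LinearMap.mem_ker.1 hP⟩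
  refine lt_of_le_of_ne (intervalIntegral.integral_nonneg hcd.le fun t _ => sq_nonneg _)
    fun h0 => hP0 ?_
  have h1 := eq_zero_of_integral_eq_zero hcd ((hw P).pow 2) (fun t => sq_nonneg _) h0.symm
  refine Polynomial.eq_zero_of_infinite_isRoot P ((Ioo_infinite hcd).mono fun t ht => ?_)
  have h2 := pow_eq_zero_iff two_ne_zero |>.1 (h1 t (Ioo_subset_Icc_self ht))
  exact (mul_eq_zero.1 h2).resolve_left (tent_pos ht).ne'

/-- The Legendre condition: where the quadratic form of the controls is negative in a direction
`v`, controls `f v` supported in a short interval, which leave its end at rest, make the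
functional negative. -/
theorem NormalOn.legendre (hβ : Continuous β) (hab : a < b) (hn : NormalOn β a b)
    {H : ℝ → ((Fin n → ℝ) × (Fin r → ℝ)) →L[ℝ] ((Fin n → ℝ) × (Fin r → ℝ)) →L[ℝ] ℝ}
    (hH : Continuous H) (hsymm : ∀ t v w, H t v w = H t w v)
    (hQ : ∀ u : ℝ → Fin r → ℝ, ContDiff ℝ ∞ u → traj β a u b = 0 → 0 ≤ quad β H a b u)
    {t : ℝ} (ht : t ∈ Icc a b) (v : Fin r → ℝ) : 0 ≤ H t (0, v) (0, v) := by
  by_contra hneg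
  rw [not_le] at hneg
  set κ := -H t (0, v) (0, v) / 2 with hκ
  have hκ0 : 0 < κ := by rw [hκ]; linarith
  have hhc : Continuous fun s => H s (0, v) (0, v) :=
    (hH.clm_apply continuous_const).clm_apply continuous_const
  obtain ⟨η, hη, hball⟩ := Metric.continuous_iff.1 hhc t κ hκ0
  obtain ⟨Kv, hKv⟩ := (isCompact_Icc (a := a) (b := b)).exists_bound_of_continuousOn
    (hβ.clm_apply (continuous_const (y := v))).continuousOn
  obtain ⟨M, hM⟩ := (isCompact_Icc (a := a) (b := b)).exists_bound_of_continuousOn (f := H)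
    hH.continuousOn
  have hKv0 : 0 ≤ Kv := (norm_nonneg _).trans (hKv t ht)
  have hM0 : 0 ≤ M := (norm_nonneg _).trans (hM t ht)
  set A := M * Kv ^ 2 + 2 * M * Kv * ‖v‖ with hA
  have hA0 : 0 ≤ A := by positivity
  set η' := min (min (η / 2) 1) (κ / (2 * (A + 1))) with hη'
  have hη'0 : 0 < η' := by positivity
  obtain ⟨c, d, hcd, hac, hdb, hlen, hclose⟩ := exists_Icc_subset_of_mem hab ht hη'0
  have hη'1 : η' ≤ η / 2 := (min_le_left _ _).trans (min_le_left _ _)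
  have hη'2 : η' ≤ 1 := (min_le_left _ _).trans (min_le_right _ _)
  have hη'3 : η' ≤ κ / (2 * (A + 1)) := min_le_right _ _
  obtain ⟨f, hf, hf0, hfpos, hfβ⟩ := exists_scalar_control hβ hcd v
  set u : ℝ → Fin r → ℝ := fun t => f t • v with hu
  have huc : Continuous u := hf.smul continuous_const
  have hg : Continuous fun s => β s (u s) := hβ.clm_apply huc
  have hgi : ∀ x y, IntervalIntegrable (fun s => β s (u s)) MeasureTheory.volume x y :=
    fun x y => hg.intervalIntegrable _ _
  have hu0 : ∀ t, t ∉ Ioo c d → u t = 0 := fun t ht => by simp [hu, hf0 t ht]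
  have hleft : ∀ s ∈ Icc a c, traj β a u s = 0 := fun s hs => by
    refine (intervalIntegral.integral_congr (g := fun _ => 0) fun x hx => ?_).trans (by simp)
    rw [uIcc_of_le hs.1] at hx
    simp [hu0 x fun h => (h.1.trans_le (hx.2.trans hs.2)).false]
  have htc : ∀ s, traj β a u s = ∫ x in c..s, β x (u x) := fun s => by
    have h1 := hleft c ⟨hac, le_rfl⟩
    rw [traj, ← intervalIntegral.integral_add_adjacent_intervals (hgi a c) (hgi c s)]
    rw [traj] at h1
    rw [h1, zero_add]
  have hright : ∀ s ∈ Icc d b, traj β a u s = 0 := fun s hs => by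
    rw [htc, ← intervalIntegral.integral_add_adjacent_intervals (hgi c d) (hgi d s), hfβ, zero_add]
    refine (intervalIntegral.integral_congr (g := fun _ => 0) fun x hx => ?_).trans (by simp)
    rw [uIcc_of_le hs.1] at hx
    simp [hu0 x fun h => (h.2.trans_le hx.1).false]
  have hQu : 0 ≤ quad β H a b u := by
    obtain ⟨C, hC⟩ := (isCompact_Icc (a := a) (b := b)).exists_bound_of_continuousOn
      huc.continuousOn
    exact hn.quad_nonneg_of_tendsto hβ hab hH hQ (c := fun _ => u) (fun _ => huc) (fun _ => hC)
      (τ := a) (fun t _ _ => tendsto_const_nhds) (hright b ⟨hdb, le_rfl⟩)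
  -- the functional is an integral over `[c, d]`
  set y := traj β a u with hy
  have hyc : Continuous y := continuous_traj hβ huc a
  set I : ℝ → ℝ := fun s => H s (y s, u s) (y s, u s) with hI
  have hIc : Continuous I := (hH.clm_apply (hyc.prodMk huc)).clm_apply (hyc.prodMk huc)
  have hIi : ∀ x y, IntervalIntegrable I MeasureTheory.volume x y :=
    fun x y => hIc.intervalIntegrable _ _
  have hQcd : quad β H a b u = ∫ s in c..d, I s := by
    have e1 : ∫ s in a..c, I s = 0 := by
      refine (intervalIntegral.integral_congr (g := fun _ => 0) fun x hx => ?_).trans (by simp)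
      rw [uIcc_of_le hac] at hx
      have h1 : y x = 0 := hleft x hx
      have h2 := hu0 x fun h => (h.1.trans_le hx.2).false
      simp [hI, h1, h2, Prod.mk_zero_zero]
    have e2 : ∫ s in d..b, I s = 0 := by
      refine (intervalIntegral.integral_congr (g := fun _ => 0) fun x hx => ?_).trans (by simp)
      rw [uIcc_of_le hdb] at hx
      have h1 : y x = 0 := hright x hx
      have h2 := hu0 x fun h => (h.2.trans_le hx.1).false
      simp [hI, h1, h2, Prod.mk_zero_zero]
    change ∫ s in a..b, I s = _
    rw [← intervalIntegral.integral_add_adjacent_intervals (hIi a c) (hIi c b),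
      ← intervalIntegral.integral_add_adjacent_intervals (hIi c d) (hIi d b), e1, e2]
    ring
  set m := ∫ s in c..d, |f s| with hm
  have hm0 : 0 ≤ m := intervalIntegral.integral_nonneg hcd.le fun s _ => abs_nonneg _
  have hyb : ∀ s ∈ Icc c d, ‖y s‖ ≤ Kv * m := fun s hs => by
    rw [htc, hm, ← intervalIntegral.integral_const_mul]
    refine (intervalIntegral.norm_integral_le_integral_norm hs.1).trans ?_
    have h1 : ∀ x ∈ Icc c d, ‖β x (u x)‖ ≤ Kv * |f x| := fun x hx => by
      simp only [hu, map_smul, norm_smul, Real.norm_eq_abs]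
      rw [mul_comm]
      exact mul_le_mul_of_nonneg_right (hKv x ⟨hac.trans hx.1, hx.2.trans hdb⟩) (abs_nonneg _)
    refine (intervalIntegral.integral_mono_on hs.1 (hg.norm.intervalIntegrable _ _)
      ((hf.abs.const_mul Kv).intervalIntegrable c s)
      fun x hx => h1 x ⟨hx.1, hx.2.trans hs.2⟩).trans ?_
    refine intervalIntegral.integral_mono_interval le_rfl hs.1 hs.2
      (Filter.Eventually.of_forall fun x => mul_nonneg hKv0 (abs_nonneg _))
      ((hf.abs.const_mul Kv).intervalIntegrable c d)
  have hIle : ∀ s ∈ Icc c d,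
      I s ≤ M * (Kv * m) ^ 2 + 2 * (M * (Kv * m) * ‖v‖) * |f s| - κ * f s ^ 2 := by
    intro s hs
    have hsab : s ∈ Icc a b := ⟨hac.trans hs.1, hs.2.trans hdb⟩
    have hdec : (y s, u s) = (y s, 0) + f s • (0, v) := by simp [hu]
    have hexp : I s = H s (y s, 0) (y s, 0) + 2 * f s * H s (y s, 0) (0, v)
        + f s ^ 2 * H s (0, v) (0, v) := by
      simp only [hI]
      rw [hdec]
      simp only [map_add, add_apply, map_smul, smul_apply, smul_eq_mul]
      rw [hsymm s (0, v) (y s, 0)]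
      ring
    have b0 : ‖(y s, (0 : Fin r → ℝ))‖ ≤ Kv * m := by
      rw [Prod.norm_mk, norm_zero, max_eq_left (norm_nonneg _)]; exact hyb s hs
    have b1 : H s (y s, 0) (y s, 0) ≤ M * (Kv * m) * (Kv * m) := (le_abs_self _).trans
      ((H s _).le_of_opNorm_le_of_le ((H s).le_of_opNorm_le_of_le (hM s hsab) b0) b0)
    have b2 : |H s (y s, 0) (0, v)| ≤ M * (Kv * m) * ‖v‖ :=
      (H s _).le_of_opNorm_le_of_le ((H s).le_of_opNorm_le_of_le (hM s hsab) b0)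
        (by rw [Prod.norm_mk, norm_zero, max_eq_right (norm_nonneg _)])
    have b3 : f s * H s (y s, 0) (0, v) ≤ M * (Kv * m) * ‖v‖ * |f s| := by
      refine (le_abs_self _).trans ?_
      rw [abs_mul, mul_comm]
      exact mul_le_mul_of_nonneg_right b2 (abs_nonneg _)
    have b4 : H s (0, v) (0, v) ≤ -κ := by
      have h1 := hball s (by
        rw [Real.dist_eq]
        exact ((hclose s hs).trans hη'1).trans_lt (by linarith))
      rw [Real.dist_eq] at h1
      have h2 := (abs_lt.1 h1).2
      rw [hκ] at h2 ⊢
      linarith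
    have b5 : f s ^ 2 * H s (0, v) (0, v) ≤ f s ^ 2 * -κ :=
      mul_le_mul_of_nonneg_left b4 (sq_nonneg _)
    rw [hexp]
    linarith
  set S := ∫ s in c..d, f s ^ 2 with hS
  have hmS : m ^ 2 ≤ (d - c) * S := by
    have := sq_integral_le hcd.le hf.abs.continuousOn
    simpa only [sq_abs] using this
  have hint : ∫ s in c..d, I s ≤ M * (Kv * m) ^ 2 * (d - c) + 2 * (M * (Kv * m) * ‖v‖) * m
      - κ * S := by
    have i1 : IntervalIntegrable (fun s => 2 * (M * (Kv * m) * ‖v‖) * |f s|)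
        MeasureTheory.volume c d := (hf.abs.const_mul _).intervalIntegrable _ _
    have i2 : IntervalIntegrable (fun s => κ * f s ^ 2) MeasureTheory.volume c d :=
      ((hf.pow 2).const_mul _).intervalIntegrable _ _
    have i0 : IntervalIntegrable (fun _ : ℝ => M * (Kv * m) ^ 2) MeasureTheory.volume c d :=
      continuous_const.intervalIntegrable _ _
    refine (intervalIntegral.integral_mono_on hcd.le (hIi c d) ((i0.add i1).sub i2) hIle).trans ?_
    rw [intervalIntegral.integral_sub (i0.add i1) i2, intervalIntegral.integral_add i0 i1]
    simp only [intervalIntegral.integral_const_mul, intervalIntegral.integral_const, smul_eq_mul]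
    rw [← hm, ← hS]
    exact le_of_eq (by ring)
  have hl0 : 0 < d - c := sub_pos.2 hcd
  have hl1 : d - c ≤ 1 := hlen.trans hη'2
  have hA1 : A * (d - c) < κ := by
    have h1 : A * (d - c) ≤ A * (κ / (2 * (A + 1))) :=
      mul_le_mul_of_nonneg_left (hlen.trans hη'3) hA0
    refine h1.trans_lt ?_
    rw [mul_div_assoc', div_lt_iff₀ (by positivity)]
    nlinarith
  have h1 : M * (Kv * m) ^ 2 * (d - c) ≤ M * Kv ^ 2 * ((d - c) * S) := by
    have h2 : m ^ 2 * (d - c) ≤ (d - c) * S :=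
      (mul_le_of_le_one_right (sq_nonneg _) hl1).trans hmS
    calc M * (Kv * m) ^ 2 * (d - c) = M * Kv ^ 2 * (m ^ 2 * (d - c)) := by ring
      _ ≤ _ := mul_le_mul_of_nonneg_left h2 (by positivity)
  have h2 : 2 * (M * (Kv * m) * ‖v‖) * m ≤ 2 * M * Kv * ‖v‖ * ((d - c) * S) := by
    calc 2 * (M * (Kv * m) * ‖v‖) * m = 2 * M * Kv * ‖v‖ * m ^ 2 := by ring
      _ ≤ _ := mul_le_mul_of_nonneg_left hmS (by positivity)
  have h3 : A * (d - c) * S < κ * S := mul_lt_mul_of_pos_right hA1 hfpos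
  have h4 : M * Kv ^ 2 * ((d - c) * S) + 2 * M * Kv * ‖v‖ * ((d - c) * S) = A * (d - c) * S := by
    rw [hA]; ring
  rw [hQcd] at hQu
  linarith

end Legendre

/-! ### Linear-quadratic problems: the Hamiltonian system and conjugate points -/

/-- The fundamental theorem of calculus with one-sided derivatives at the ends. -/
theorem integral_eq_sub_of_hasDerivWithinAt_Icc {X : Type*} [NormedAddCommGroup X]
    [NormedSpace ℝ X] [CompleteSpace X] {a b : ℝ} (hab : a ≤ b) {f f' : ℝ → X}
    (hf : ∀ t ∈ Icc a b, HasDerivWithinAt f (f' t) (Icc a b) t)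
    (hf' : ContinuousOn f' (Icc a b)) : ∫ t in a..b, f' t = f b - f a := by
  refine intervalIntegral.integral_eq_sub_of_hasDerivAt_of_le hab
    (fun t ht => (hf t ht).continuousWithinAt)
    (fun t ht => (hf t (Ioo_subset_Icc_self ht)).hasDerivAt (Icc_mem_nhds ht.1 ht.2))
    ((hf'.mono (by rw [uIcc_of_le hab])).intervalIntegrable)

theorem isInvertible_of_injective {X Y : Type*} [NormedAddCommGroup X] [NormedSpace ℝ X]
    [NormedAddCommGroup Y] [NormedSpace ℝ Y] [FiniteDimensional ℝ X] [FiniteDimensional ℝ Y]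
    (h : Module.finrank ℝ X = Module.finrank ℝ Y) {L : X →L[ℝ] Y} (hL : Function.Injective L) :
    L.IsInvertible :=
  ⟨(LinearEquiv.ofInjectiveOfFinrankEq (L : X →ₗ[ℝ] Y) hL h).toContinuousLinearEquiv, by
    ext x; rfl⟩

theorem finrank_strongDual (X : Type*) [NormedAddCommGroup X] [NormedSpace ℝ X]
    [FiniteDimensional ℝ X] : Module.finrank ℝ (X →L[ℝ] ℝ) = Module.finrank ℝ X := by
  rw [← (LinearMap.toContinuousLinearMap (𝕜 := ℝ) (E := X) (F' := ℝ)).finrank_eq]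
  exact Subspace.dual_finrank_eq

section Hamiltonian

variable {E F : Type*} [NormedAddCommGroup E] [NormedSpace ℝ E] [FiniteDimensional ℝ E]
  [NormedAddCommGroup F] [NormedSpace ℝ F] [FiniteDimensional ℝ F]

/-- Restriction to the controls of a linear form on states and controls. -/
noncomputable def ctlPart : ((E × F) →L[ℝ] ℝ) →L[ℝ] (F →L[ℝ] ℝ) :=
  (ContinuousLinearMap.compL ℝ F (E × F) ℝ).flip (ContinuousLinearMap.inr ℝ E F)

/-- Restriction to the states of a linear form on states and controls. -/
noncomputable def statePart : ((E × F) →L[ℝ] ℝ) →L[ℝ] (E →L[ℝ] ℝ) :=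
  (ContinuousLinearMap.compL ℝ E (E × F) ℝ).flip (ContinuousLinearMap.inl ℝ E F)

@[simp] theorem ctlPart_apply (φ : (E × F) →L[ℝ] ℝ) (v : F) : ctlPart φ v = φ (0, v) := rfl

@[simp] theorem statePart_apply (φ : (E × F) →L[ℝ] ℝ) (x : E) : statePart φ x = φ (x, 0) := rfl

/-- The quadratic form of the controls. -/
noncomputable def ctlGram (H : (E × F) →L[ℝ] (E × F) →L[ℝ] ℝ) : F →L[ℝ] (F →L[ℝ] ℝ) :=
  ctlPart ∘L H ∘L ContinuousLinearMap.inr ℝ E F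

/-- The control `u` with `π β = H((y, u), (0, ·))`, a linear function of state and costate. -/
noncomputable def feedback (β : F →L[ℝ] E) (H : (E × F) →L[ℝ] (E × F) →L[ℝ] ℝ) :
    (E × (E →L[ℝ] ℝ)) →L[ℝ] F :=
  (ctlGram H).inverse ∘L
    ((ContinuousLinearMap.compL ℝ F E ℝ).flip β ∘L ContinuousLinearMap.snd ℝ E (E →L[ℝ] ℝ)
      - (ctlPart ∘L H ∘L ContinuousLinearMap.inl ℝ E F) ∘L
        ContinuousLinearMap.fst ℝ E (E →L[ℝ] ℝ))

/-- The Hamiltonian vector field `y' = β u`, `π' = H((y, u), (·, 0))`, with `u` the feedback. -/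
noncomputable def hamField (β : F →L[ℝ] E) (H : (E × F) →L[ℝ] (E × F) →L[ℝ] ℝ) :
    (E × (E →L[ℝ] ℝ)) →L[ℝ] (E × (E →L[ℝ] ℝ)) :=
  (β ∘L feedback β H).prod
    (statePart ∘L H ∘L (ContinuousLinearMap.fst ℝ E (E →L[ℝ] ℝ)).prod (feedback β H))

/-- Positivity of the quadratic form of the controls. -/
def CtlPos (H : (E × F) →L[ℝ] (E × F) →L[ℝ] ℝ) : Prop :=
  ∀ v : F, v ≠ 0 → 0 < H (0, v) (0, v)

variable {β₀ : F →L[ℝ] E} {H₀ : (E × F) →L[ℝ] (E × F) →L[ℝ] ℝ}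

theorem CtlPos.isInvertible (h : CtlPos H₀) : (ctlGram H₀).IsInvertible := by
  refine isInvertible_of_injective (finrank_strongDual F).symm ?_
  rw [injective_iff_map_eq_zero]
  intro v hv
  by_contra hne
  have h1 : ctlGram H₀ v v = 0 := by rw [hv]; rfl
  exact (h v hne).ne' h1

theorem CtlPos.feedback_spec (h : CtlPos H₀) (x : E × (E →L[ℝ] ℝ)) (v : F) :
    H₀ (x.1, feedback β₀ H₀ x) (0, v) = x.2 (β₀ v) := by
  have h1 : ctlGram H₀ (feedback β₀ H₀ x) = x.2 ∘L β₀ - ctlPart (H₀ (x.1, 0)) := by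
    simp only [feedback, ContinuousLinearMap.comp_apply, h.isInvertible.self_apply_inverse]
    rfl
  have h2 : H₀ (0, feedback β₀ H₀ x) (0, v) = x.2 (β₀ v) - H₀ (x.1, 0) (0, v) := by
    have := congrArg (fun φ : F →L[ℝ] ℝ => φ v) h1
    simpa [ctlGram] using this
  have h3 : (x.1, feedback β₀ H₀ x) = (x.1, 0) + (0, feedback β₀ H₀ x) := by simp
  rw [h3, map_add, add_apply, h2]
  ring

theorem CtlPos.eq_feedback (h : CtlPos H₀) {x : E × (E →L[ℝ] ℝ)} {u : F}
    (hu : ∀ v, x.2 (β₀ v) = H₀ (x.1, u) (0, v)) : u = feedback β₀ H₀ x := by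
  by_contra hne
  have h1 : H₀ (0, u - feedback β₀ H₀ x) (0, u - feedback β₀ H₀ x) = 0 := by
    have h3 : H₀ (0, u - feedback β₀ H₀ x) = H₀ (x.1, u) - H₀ (x.1, feedback β₀ H₀ x) := by
      rw [← map_sub]; simp
    rw [h3, sub_apply, ← hu, h.feedback_spec, sub_self]
  exact (h _ (sub_ne_zero.2 hne)).ne' h1

variable {β : ℝ → F →L[ℝ] E} {H : ℝ → (E × F) →L[ℝ] (E × F) →L[ℝ] ℝ} {a b : ℝ}

theorem continuous_feedback (hβ : Continuous β) (hH : Continuous H) (hpos : ∀ t, CtlPos (H t)) :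
    Continuous fun t => feedback (β t) (H t) := by
  have h1 : Continuous fun t => (ctlGram (H t)).inverse := by
    refine continuous_iff_continuousAt.2 fun t => ?_
    have h2 : Continuous fun t => ctlGram (H t) :=
      continuous_const.clm_comp (hH.clm_comp continuous_const)
    exact ((hpos t).isInvertible.contDiffAt_map_inverse (n := 0)).continuousAt.comp (f := fun t =>
      ctlGram (H t)) h2.continuousAt
  refine h1.clm_comp (Continuous.sub ?_ ?_)
  · exact (((ContinuousLinearMap.compL ℝ F E ℝ).flip.continuous.comp hβ)).clm_comp
      continuous_const
  · exact (continuous_const.clm_comp (hH.clm_comp continuous_const)).clm_comp continuous_const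

theorem continuous_hamField (hβ : Continuous β) (hH : Continuous H) (hpos : ∀ t, CtlPos (H t)) :
    Continuous fun t => hamField (β t) (H t) := by
  have h1 := continuous_feedback hβ hH hpos
  have h2 : Continuous fun t => (ContinuousLinearMap.fst ℝ E (E →L[ℝ] ℝ)).prod
      (feedback (β t) (H t)) :=
    (ContinuousLinearMap.prodₗᵢ ℝ).continuous.comp (continuous_const.prodMk h1)
  exact (ContinuousLinearMap.prodₗᵢ ℝ).continuous.comp
    ((hβ.clm_comp h1).prodMk (continuous_const.clm_comp (hH.clm_comp h2)))

/-- `(y, u, π)` is an extremal of the linear-quadratic problem on `[a, b]`: state, control and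
costate solve `y' = β u`, `π' = H((y, u), (·, 0))`, `π β = H((y, u), (0, ·))`. -/
structure IsLQSolution (β : ℝ → F →L[ℝ] E) (H : ℝ → (E × F) →L[ℝ] (E × F) →L[ℝ] ℝ) (a b : ℝ)
    (y : ℝ → E) (u : ℝ → F) (π : ℝ → E →L[ℝ] ℝ) : Prop where
  state : ∀ t ∈ Icc a b, HasDerivWithinAt y (β t (u t)) (Icc a b) t
  costate : ∀ t ∈ Icc a b, HasDerivWithinAt π (statePart (H t (y t, u t))) (Icc a b) t
  critical : ∀ t ∈ Icc a b, ∀ v, π t (β t v) = H t (y t, u t) (0, v)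

theorem IsLQSolution.eq_feedback {y : ℝ → E} {u : ℝ → F} {π : ℝ → E →L[ℝ] ℝ}
    (hs : IsLQSolution β H a b y u π) (hpos : ∀ t, CtlPos (H t)) {t : ℝ} (ht : t ∈ Icc a b) :
    u t = feedback (β t) (H t) (y t, π t) :=
  (hpos t).eq_feedback (hs.critical t ht)

theorem IsLQSolution.hasDerivWithinAt {y : ℝ → E} {u : ℝ → F} {π : ℝ → E →L[ℝ] ℝ}
    (hs : IsLQSolution β H a b y u π) (hpos : ∀ t, CtlPos (H t)) :
    ∀ t ∈ Icc a b, HasDerivWithinAt (fun t => (y t, π t))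
      (hamField (β t) (H t) (y t, π t)) (Icc a b) t := by
  intro t ht
  refine ((hs.state t ht).prodMk (hs.costate t ht)).congr_deriv ?_
  rw [hs.eq_feedback hpos ht]
  rfl

theorem isLQSolution_of_hasDerivWithinAt (hpos : ∀ t, CtlPos (H t)) {z : ℝ → E × (E →L[ℝ] ℝ)}
    (hz : ∀ t ∈ Icc a b, HasDerivWithinAt z (hamField (β t) (H t) (z t)) (Icc a b) t) :
    IsLQSolution β H a b (fun t => (z t).1) (fun t => feedback (β t) (H t) (z t))
      (fun t => (z t).2) where
  state t ht := ((ContinuousLinearMap.fst ℝ E (E →L[ℝ] ℝ)).hasFDerivAt.comp_hasDerivWithinAt t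
    (hz t ht))
  costate t ht := ((ContinuousLinearMap.snd ℝ E (E →L[ℝ] ℝ)).hasFDerivAt.comp_hasDerivWithinAt t
    (hz t ht))
  critical t _ v := ((hpos t).feedback_spec (z t) v).symm

theorem IsLQSolution.continuousOn_control (hβ : Continuous β) (hH : Continuous H)
    (hpos : ∀ t, CtlPos (H t)) {y : ℝ → E} {u : ℝ → F} {π : ℝ → E →L[ℝ] ℝ}
    (hs : IsLQSolution β H a b y u π) : ContinuousOn u (Icc a b) := by
  have h1 : ContinuousOn (fun t => feedback (β t) (H t) (y t, π t)) (Icc a b) :=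
    (continuous_feedback hβ hH hpos).continuousOn.clm_apply
      (fun t ht => (hs.hasDerivWithinAt hpos t ht).continuousWithinAt)
  exact h1.congr fun t ht => hs.eq_feedback hpos ht

theorem IsLQSolution.mono {y : ℝ → E} {u : ℝ → F} {π : ℝ → E →L[ℝ] ℝ}
    (hs : IsLQSolution β H a b y u π) {c d : ℝ} (hc : a ≤ c) (hd : d ≤ b) :
    IsLQSolution β H c d y u π := by
  have hsub : Icc c d ⊆ Icc a b := Icc_subset_Icc hc hd
  exact ⟨fun t ht => (hs.state t (hsub ht)).mono hsub,
    fun t ht => (hs.costate t (hsub ht)).mono hsub, fun t ht => hs.critical t (hsub ht)⟩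

/-- The second variation of an extremal against any variation is a boundary term. -/
theorem IsLQSolution.integral_eq (hab : a ≤ b) (hβ : Continuous β) (hH : Continuous H)
    (hpos : ∀ t, CtlPos (H t)) {y Y : ℝ → E} {u v : ℝ → F} {π : ℝ → E →L[ℝ] ℝ}
    (hs : IsLQSolution β H a b y u π)
    (hY : ∀ t ∈ Icc a b, HasDerivWithinAt Y (β t (v t)) (Icc a b) t)
    (hv : ContinuousOn v (Icc a b)) :
    ∫ t in a..b, H t (y t, u t) (Y t, v t) = π b (Y b) - π a (Y a) := by
  have hyc : ContinuousOn y (Icc a b) := fun t ht => (hs.state t ht).continuousWithinAt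
  have hYc : ContinuousOn Y (Icc a b) := fun t ht => (hY t ht).continuousWithinAt
  have huc := hs.continuousOn_control hβ hH hpos
  refine integral_eq_sub_of_hasDerivWithinAt_Icc (f := fun t => π t (Y t)) hab
    (fun t ht => ?_) ((hH.continuousOn.clm_apply (hyc.prodMk huc)).clm_apply (hYc.prodMk hv))
  refine ((hs.costate t ht).clm_apply (hY t ht)).congr_deriv ?_
  rw [hs.critical t ht, statePart_apply, ← map_add]
  simp

/-- A nonnegative polynomial `2 s x + s² c` has `x = 0`. -/
theorem eq_zero_of_quadratic_nonneg {x c : ℝ} (h : ∀ s : ℝ, 0 ≤ 2 * s * x + s ^ 2 * c) :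
    x = 0 := by
  by_contra hx
  have h1 := h (-x / (|c| + 1))
  have hc : 0 < |c| + 1 := by positivity
  have h2 : 2 * (-x / (|c| + 1)) * x + (-x / (|c| + 1)) ^ 2 * c
      = x ^ 2 / (|c| + 1) ^ 2 * (c - 2 * (|c| + 1)) := by field_simp; ring
  rw [h2] at h1
  have h3 : 0 < x ^ 2 / (|c| + 1) ^ 2 := by positivity
  have h4 : c - 2 * (|c| + 1) < 0 := by linarith [le_abs_self c, abs_nonneg c]
  nlinarith [mul_neg_of_pos_of_neg h3 h4]

end Hamiltonian

section Jacobi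

variable {n r : ℕ} {β : ℝ → (Fin r → ℝ) →L[ℝ] (Fin n → ℝ)} {a b : ℝ}
  {H : ℝ → ((Fin n → ℝ) × (Fin r → ℝ)) →L[ℝ] ((Fin n → ℝ) × (Fin r → ℝ)) →L[ℝ] ℝ}

/-- Jacobi's necessary condition. If an extremal vanishes at `a` and at `τ < b`, the control which
is cut off after `τ` gives the value `0` to the nonnegative functional. Its first variation,
`π(τ) e` in the direction of a variation with value `e` at `τ`, must vanish; so `π(τ) = 0`, and the
extremal is zero. -/
theorem jacobi_necessary (hβ : Continuous β) {τ : ℝ} (hτ : τ ∈ Ioo a b)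
    (hn₁ : NormalOn β a τ) (hn₂ : NormalOn β τ b) (hH : Continuous H)
    (hsymm : ∀ t v w, H t v w = H t w v) (hpos : ∀ t, CtlPos (H t))
    (hQ : ∀ u : ℝ → Fin r → ℝ, ContDiff ℝ ∞ u → traj β a u b = 0 → 0 ≤ quad β H a b u)
    {y : ℝ → Fin n → ℝ} {u : ℝ → Fin r → ℝ} {π : ℝ → (Fin n → ℝ) →L[ℝ] ℝ}
    (hs : IsLQSolution β H a b y u π) (hya : y a = 0) (hyτ : y τ = 0) :
    ∀ t ∈ Icc a b, y t = 0 := by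
  have hab : a < b := hτ.1.trans hτ.2
  have hτ' : τ ∈ Icc a b := Ioo_subset_Icc_self hτ
  have hn : NormalOn β a b := hn₁.mono le_rfl hτ.2.le
  -- a continuous extension of the control
  have huc := hs.continuousOn_control hβ hH hpos
  set u' : ℝ → Fin r → ℝ := IccExtend hab.le ((Icc a b).domRestrict u) with hu'
  have hu'c : Continuous u' := (continuousOn_iff_continuous_domRestrict.1 huc).Icc_extend'
  have hu'e : ∀ t ∈ Icc a b, u' t = u t := fun t ht => by
    rw [hu', IccExtend_of_mem _ _ ht]; rfl
  have hytraj : ∀ t ∈ Icc a b, traj β a u' t = y t := fun t ht => by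
    have h1 := integral_eq_sub_of_hasDerivWithinAt_Icc (f := y) (f' := fun s => β s (u' s)) ht.1
      (fun s hs' => by
        rw [hu'e s ⟨hs'.1, hs'.2.trans ht.2⟩]
        exact (hs.state s ⟨hs'.1, hs'.2.trans ht.2⟩).mono (Icc_subset_Icc_right ht.2))
      (hβ.clm_apply hu'c).continuousOn
    rw [traj, h1, hya, sub_zero]
  have hπ : π τ = 0 := by
    ext e
    rw [zero_apply]
    obtain ⟨v₁, hv₁, hv₁0, hv₁e⟩ := hn₁.exists_steering hβ hτ.1 e
    obtain ⟨v₂, hv₂, hv₂0, hv₂e⟩ := hn₂.exists_steering hβ hτ.2 (-e)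
    set v : ℝ → Fin r → ℝ := fun t => v₁ t + v₂ t with hv
    have hvc : Continuous v := hv₁.add hv₂
    have hi : ∀ {w : ℝ → Fin r → ℝ}, Continuous w → ∀ x z,
        IntervalIntegrable (fun s => β s (w s)) MeasureTheory.volume x z :=
      fun hw x z => (hβ.clm_apply hw).intervalIntegrable _ _
    have hsi : ∀ (s : ℝ) (x z : ℝ), IntervalIntegrable (fun x => s • β x (v x))
        MeasureTheory.volume x z := fun s x z => (hi hvc x z).smul s
    have hYτ : traj β a v τ = e := by
      rw [← hv₁e]
      refine intervalIntegral.integral_congr fun x hx => ?_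
      rw [uIcc_of_le hτ.1.le] at hx
      simp [hv, hv₂0 x fun h => (h.1.trans_le hx.2).false]
    have hYb : traj β a v b = 0 := by
      have h1 : ∫ s in τ..b, β s (v s) = -e := by
        rw [← hv₂e]
        refine intervalIntegral.integral_congr fun x hx => ?_
        rw [uIcc_of_le hτ.2.le] at hx
        simp [hv, hv₁0 x fun h => (h.2.trans_le hx.1).false]
      rw [traj, ← intervalIntegral.integral_add_adjacent_intervals (hi hvc a τ) (hi hvc τ b), h1]
      rw [traj] at hYτ
      rw [hYτ, add_neg_cancel]
    set Y := traj β a v with hY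
    have hYc : Continuous Y := continuous_traj hβ hvc a
    refine eq_zero_of_quadratic_nonneg (c := ∫ t in a..b, H t (Y t, v t) (Y t, v t)) fun s => ?_
    -- the control cut off at `τ`, plus a multiple of the variation
    set w : ℝ → Fin r → ℝ := fun t => (if t ≤ τ then u' t else 0) + s • v t with hw
    set χ : ℕ → ℝ → ℝ := fun k t => max 0 (min 1 (1 - k * (t - τ))) with hχ
    have hχ01 : ∀ k t, |χ k t| ≤ 1 := fun k t => by
      rw [hχ, abs_of_nonneg (le_max_left _ _)]
      exact max_le zero_le_one (min_le_left _ _)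
    have hwl : ∀ t ∈ Icc a τ, traj β a w t = y t + s • Y t := fun t ht => by
      have h1 : traj β a w t = ∫ x in a..t, (β x (u' x) + s • β x (v x)) := by
        refine intervalIntegral.integral_congr fun x hx => ?_
        rw [uIcc_of_le ht.1] at hx
        simp [hw, hx.2.trans ht.2]
      rw [h1, intervalIntegral.integral_add (hi hu'c _ _) (hsi s _ _),
        intervalIntegral.integral_smul, ← hytraj t ⟨ht.1, ht.2.trans hτ.2.le⟩]
      rfl
    have hint_w : ∀ x z, IntervalIntegrable (fun x => β x (w x)) MeasureTheory.volume x z := by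
      intro x z
      have h1 : (fun x => β x (w x)) = fun x => (Iic τ).indicator (fun x => β x (u' x)) x
          + s • β x (v x) := by
        funext x
        by_cases hx : x ≤ τ <;> simp [hw, indicator, hx]
      rw [h1]
      refine IntervalIntegrable.add ?_ (hsi s _ _)
      rw [intervalIntegrable_iff]
      exact ((hi hu'c x z).def').indicator measurableSet_Iic
    have hwr : ∀ t ∈ Icc τ b, traj β a w t = s • Y t := fun t ht => by
      have h1 := hwl τ ⟨hτ.1.le, le_rfl⟩
      have h2 : ∫ x in τ..t, β x (w x) = ∫ x in τ..t, s • β x (v x) := by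
        refine intervalIntegral.integral_congr_ae (Filter.Eventually.of_forall fun x hx => ?_)
        rw [uIoc_of_le ht.1] at hx
        simp [hw, not_le.2 hx.1]
      rw [traj, ← intervalIntegral.integral_add_adjacent_intervals (hint_w a τ) (hint_w τ t), h2,
        ← traj, h1, hyτ, zero_add, intervalIntegral.integral_smul, ← smul_add]
      congr 1
      exact intervalIntegral.integral_add_adjacent_intervals (hi hvc a τ) (hi hvc τ t)
    obtain ⟨C, hC⟩ := (isCompact_Icc (a := a) (b := b)).exists_bound_of_continuousOn
      hu'c.continuousOn
    obtain ⟨C', hC'⟩ := (isCompact_Icc (a := a) (b := b)).exists_bound_of_continuousOn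
      (hvc.const_smul s).continuousOn
    have hge : 0 ≤ quad β H a b w := by
      refine hn.quad_nonneg_of_tendsto hβ hab hH hQ (c := fun k t => χ k t • u' t + s • v t)
        (fun k => ?_) (C := C + C') (fun k t ht => ?_) (τ := τ) (fun t ht htτ => ?_) ?_
      · have : Continuous (χ k) := by simp only [hχ]; fun_prop
        exact (this.smul hu'c).add (hvc.const_smul s)
      · refine (norm_add_le _ _).trans (add_le_add ?_ (hC' t ht))
        rw [norm_smul, Real.norm_eq_abs]
        exact (mul_le_of_le_one_left (norm_nonneg _) (hχ01 k t)).trans (hC t ht)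
      · refine Filter.Tendsto.add ?_ tendsto_const_nhds
        rcases lt_or_gt_of_ne htτ with h | h
        · refine tendsto_const_nhds.congr fun k => ?_
          have : χ k t = 1 := by
            have h1 : (1 : ℝ) ≤ 1 - k * (t - τ) := by
              nlinarith [Nat.cast_nonneg (α := ℝ) k]
            simp [hχ, min_eq_left h1]
          rw [this, one_smul, if_pos h.le]
        · refine Filter.Tendsto.congr' ?_ tendsto_const_nhds
          obtain ⟨N, hN⟩ := exists_nat_ge (1 / (t - τ))
          filter_upwards [Filter.eventually_ge_atTop N] with k hk
          have h0 : 0 < t - τ := sub_pos.2 h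
          have h1 : 1 ≤ k * (t - τ) := by
            rw [div_le_iff₀ h0] at hN
            exact hN.trans (mul_le_mul_of_nonneg_right (by exact_mod_cast hk) h0.le)
          have : χ k t = 0 := by
            have h2 : min 1 (1 - k * (t - τ)) ≤ 0 := (min_le_right _ _).trans (by linarith)
            simp [hχ, max_eq_left h2]
          rw [this, zero_smul, if_neg (not_le.2 h)]
      · rw [hwr b ⟨hτ.2.le, le_rfl⟩, hYb, smul_zero]
    -- evaluate the functional
    have hIu : ∀ {p q : ℝ → Fin n → ℝ} {v w : ℝ → Fin r → ℝ} {c d : ℝ}, c ≤ d →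
        ContinuousOn p (Icc c d) → ContinuousOn q (Icc c d) → ContinuousOn v (Icc c d) →
        ContinuousOn w (Icc c d) → IntervalIntegrable (fun t => H t (p t, v t) (q t, w t))
          MeasureTheory.volume c d := by
      intro p q v w c d hcd hp hq hv hw
      refine ContinuousOn.intervalIntegrable ?_
      rw [uIcc_of_le hcd]
      exact (hH.continuousOn.clm_apply (hp.prodMk hv)).clm_apply (hq.prodMk hw)
    set q : ℝ → ℝ := fun t => H t (Y t, v t) (Y t, v t) with hq
    have hqc : Continuous q := (hH.clm_apply (hYc.prodMk hvc)).clm_apply (hYc.prodMk hvc)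
    have hsl := hs.mono le_rfl hτ.2.le
    have hyc : ContinuousOn y (Icc a τ) := fun t ht => (hsl.state t ht).continuousWithinAt
    have hucl : ContinuousOn u (Icc a τ) := huc.mono (Icc_subset_Icc_right hτ.2.le)
    have e1 := hsl.integral_eq hτ.1.le hβ hH hpos hsl.state hucl
    have e2 := hsl.integral_eq hτ.1.le hβ hH hpos (Y := Y) (v := v)
      (fun t _ => (hasDerivAt_traj hβ hvc a t).hasDerivWithinAt) hvc.continuousOn
    have hYa : Y a = 0 := by simp [hY, traj]
    rw [hya, hyτ, map_zero, map_zero, sub_zero] at e1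
    rw [hYτ, hYa, map_zero, sub_zero] at e2
    set I : ℝ → ℝ := fun t => H t (traj β a w t, w t) (traj β a w t, w t) with hI
    have hleft : ∀ t ∈ Icc a τ, I t = H t (y t, u t) (y t, u t)
        + 2 * s * H t (y t, u t) (Y t, v t) + s ^ 2 * q t := fun t ht => by
      have h1 : w t = u t + s • v t := by
        simp [hw, ht.2, hu'e t ⟨ht.1, ht.2.trans hτ.2.le⟩]
      have h2 : (y t + s • Y t, u t + s • v t) = (y t, u t) + s • (Y t, v t) := by simp
      simp only [hI]
      rw [hwl t ht, h1, h2]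
      simp only [map_add, add_apply, map_smul, smul_apply, smul_eq_mul, hq]
      rw [hsymm t (Y t, v t) (y t, u t)]
      ring
    have hright : ∀ t ∈ Ioc τ b, I t = s ^ 2 * q t := fun t ht => by
      have h1 : w t = s • v t := by simp [hw, not_le.2 ht.1]
      have h2 : (s • Y t, s • v t) = s • (Y t, v t) := by simp
      simp only [hI]
      rw [hwr t ⟨ht.1.le, ht.2⟩, h1, h2]
      simp only [map_smul, smul_apply, smul_eq_mul, hq]
      ring
    have ia := hIu hτ.1.le hyc hyc hucl hucl
    have ib := (hIu hτ.1.le hyc hYc.continuousOn hucl hvc.continuousOn).const_mul (2 * s)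
    have ic : ∀ x z, IntervalIntegrable (fun t => s ^ 2 * q t) MeasureTheory.volume x z :=
      fun x z => (hqc.intervalIntegrable x z).const_mul _
    have hl : ∫ t in a..τ, I t = 2 * s * π τ e + s ^ 2 * ∫ t in a..τ, q t := by
      rw [intervalIntegral.integral_congr (g := fun t => H t (y t, u t) (y t, u t)
        + 2 * s * H t (y t, u t) (Y t, v t) + s ^ 2 * q t)
        fun t ht => hleft t (by rwa [uIcc_of_le hτ.1.le] at ht)]
      rw [intervalIntegral.integral_add (ia.add ib) (ic _ _), intervalIntegral.integral_add ia ib,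
        e1, intervalIntegral.integral_const_mul, intervalIntegral.integral_const_mul, e2]
      ring
    have hr : ∫ t in τ..b, I t = s ^ 2 * ∫ t in τ..b, q t := by
      rw [intervalIntegral.integral_congr_ae (g := fun t => s ^ 2 * q t)
        (Filter.Eventually.of_forall fun t ht => hright t (by rwa [uIoc_of_le hτ.2.le] at ht)),
        intervalIntegral.integral_const_mul]
    have il : IntervalIntegrable I MeasureTheory.volume a τ :=
      ((ia.add ib).add (ic _ _)).congr (fun t ht => by
        rw [uIoc_of_le hτ.1.le] at ht
        exact (hleft t ⟨ht.1.le, ht.2⟩).symm)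
    have ir : IntervalIntegrable I MeasureTheory.volume τ b :=
      (ic _ _).congr (fun t ht => by
        rw [uIoc_of_le hτ.2.le] at ht
        exact (hright t ht).symm)
    have hsum : quad β H a b w = 2 * s * π τ e + s ^ 2 * ∫ t in a..b, q t := by
      change ∫ t in a..b, I t = _
      rw [← intervalIntegral.integral_add_adjacent_intervals il ir, hl, hr,
        ← intervalIntegral.integral_add_adjacent_intervals (hqc.intervalIntegrable a τ)
          (hqc.intervalIntegrable τ b)]
      ring
    rw [← hsum]
    exact hge
  intro t ht
  have := linearODE_eq_zero (continuous_hamField hβ hH hpos) (hs.hasDerivWithinAt hpos) hτ'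
    (by simp [hyτ, hπ]) t ht
  exact (Prod.mk_eq_zero.1 this).1

end Jacobi

/-! ### Linear-quadratic problems: the Riccati equation -/

/-- A continuous family of positive definite forms is uniformly positive on a compact interval. -/
theorem exists_pos_le_quadratic {X : Type*} [NormedAddCommGroup X] [NormedSpace ℝ X]
    [FiniteDimensional ℝ X] {a b : ℝ} {Q : ℝ → X →L[ℝ] X →L[ℝ] ℝ}
    (hQ : ContinuousOn Q (Icc a b)) (hpos : ∀ t ∈ Icc a b, ∀ x ≠ 0, 0 < Q t x x) :
    ∃ c > 0, ∀ t ∈ Icc a b, ∀ x, c * ‖x‖ ^ 2 ≤ Q t x x := by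
  have : ProperSpace X := FiniteDimensional.proper ℝ X
  have hK : IsCompact (Icc a b ×ˢ Metric.sphere (0 : X) 1) :=
    isCompact_Icc.prod (isCompact_sphere _ _)
  have hc : ContinuousOn (fun p : ℝ × X => Q p.1 p.2 p.2) (Icc a b ×ˢ Metric.sphere (0 : X) 1) :=
    ((hQ.comp continuousOn_fst fun p hp => hp.1).clm_apply continuousOn_snd).clm_apply
      continuousOn_snd
  have hmin : ∃ c > 0, ∀ p ∈ Icc a b ×ˢ Metric.sphere (0 : X) 1, c ≤ Q p.1 p.2 p.2 := by
    rcases (Icc a b ×ˢ Metric.sphere (0 : X) 1).eq_empty_or_nonempty with h | h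
    · exact ⟨1, one_pos, fun p hp => by rw [h] at hp; exact hp.elim⟩
    · obtain ⟨p, hp, hmin⟩ := hK.exists_isMinOn h hc
      refine ⟨_, hpos p.1 hp.1 p.2 fun h0 => ?_, fun q hq => hmin hq⟩
      have := hp.2
      rw [h0] at this
      simp at this
  obtain ⟨c, hc0, hc⟩ := hmin
  refine ⟨c, hc0, fun t ht x => ?_⟩
  by_cases hx : x = 0
  · simp [hx]
  have hn : ‖x‖ ≠ 0 := norm_ne_zero_iff.2 hx
  have h1 := hc (t, ‖x‖⁻¹ • x) ⟨ht, by simp [norm_smul, hn]⟩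
  simp only [map_smul, smul_apply, smul_eq_mul] at h1
  have h2 : Q t x x = ‖x‖ ^ 2 * (‖x‖⁻¹ * (‖x‖⁻¹ * Q t x x)) := by field_simp
  rw [h2, mul_comm c]
  exact mul_le_mul_of_nonneg_left h1 (sq_nonneg _)

section Riccati

variable {E F : Type*} [NormedAddCommGroup E] [NormedSpace ℝ E] [FiniteDimensional ℝ E]
  [NormedAddCommGroup F] [NormedSpace ℝ F] [FiniteDimensional ℝ F]
  {β : ℝ → F →L[ℝ] E} {H : ℝ → (E × F) →L[ℝ] (E × F) →L[ℝ] ℝ} {a b : ℝ}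

theorem exists_posDef_form (E : Type*) [NormedAddCommGroup E] [NormedSpace ℝ E]
    [FiniteDimensional ℝ E] :
    ∃ N : E →L[ℝ] E →L[ℝ] ℝ, (∀ x y, N x y = N y x) ∧ ∀ x ≠ 0, 0 < N x x := by
  refine ⟨(innerSL ℝ (E := EuclideanSpace ℝ (Fin (Module.finrank ℝ E)))).bilinearComp (toEuclidean : E ≃L[ℝ] _).toContinuousLinearMap
    (toEuclidean : E ≃L[ℝ] _).toContinuousLinearMap, fun x y => ?_, fun x hx => ?_⟩
  · exact (real_inner_comm (toEuclidean x : EuclideanSpace ℝ _) (toEuclidean y)).symm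
  · exact real_inner_self_pos.2 fun h => hx ((toEuclidean : E ≃L[ℝ] _).map_eq_zero_iff.1 h)

variable {N : E →L[ℝ] E →L[ℝ] ℝ}

/-- A bilinear form of the states, as a form on states and controls. -/
noncomputable def stateForm (F : Type*) [NormedAddCommGroup F] [NormedSpace ℝ F]
    (N : E →L[ℝ] E →L[ℝ] ℝ) : (E × F) →L[ℝ] (E × F) →L[ℝ] ℝ :=
  N.bilinearComp (ContinuousLinearMap.fst ℝ E F) (ContinuousLinearMap.fst ℝ E F)

@[simp]
theorem stateForm_apply (w w' : E × F) : stateForm F N w w' = N w.1 w'.1 := rfl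

theorem isInvertible_of_pos (hN : ∀ x ≠ 0, 0 < N x x) : N.IsInvertible := by
  refine isInvertible_of_injective (finrank_strongDual E).symm
    ((injective_iff_map_eq_zero N).2 fun x hx => ?_)
  by_contra hne
  exact (hN x hne).ne' (by rw [hx]; rfl)

theorem apply_inverse_pos (hN : ∀ x ≠ 0, 0 < N x x) {φ : E →L[ℝ] ℝ} (h : φ ≠ 0) :
    0 < φ (N.inverse φ) := by
  have h1 := (isInvertible_of_pos hN).self_apply_inverse φ
  have h2 := hN (N.inverse φ) fun h0 => h (by rw [← h1, h0, map_zero])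
  rwa [h1] at h2

/-- On a short interval the (perturbed) functional is nonnegative on the variations which vanish at
the right end. -/
theorem exists_short_nonneg (hab : a ≤ b) (hβ : Continuous β) (hH : Continuous H)
    (hsymm : ∀ t v w, H t v w = H t w v) (hpos : ∀ t, CtlPos (H t)) (hNs : ∀ x y, N x y = N y x)
    :
    ∃ δ > 0, ∀ s ∈ Icc (0 : ℝ) 1, ∀ τ ∈ Icc a b, τ - a ≤ δ → ∀ (y : ℝ → E) (u : ℝ → F),
      ContinuousOn u (Icc a τ) →
      (∀ t ∈ Icc a τ, HasDerivWithinAt y (β t (u t)) (Icc a τ) t) → y τ = 0 →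
      0 ≤ ∫ t in a..τ, (H t - s • stateForm F N) (y t, u t) (y t, u t) := by
  have hgc : Continuous fun t => ctlGram (H t) :=
    continuous_const.clm_comp (hH.clm_comp continuous_const)
  obtain ⟨c, hc0, hc⟩ := exists_pos_le_quadratic (a := a) (b := b) hgc.continuousOn
    fun t _ v hv => hpos t v hv
  obtain ⟨M₀, hM₀⟩ := (isCompact_Icc (a := a) (b := b)).exists_bound_of_continuousOn (f := H)
    hH.continuousOn
  obtain ⟨K, hK⟩ := (isCompact_Icc (a := a) (b := b)).exists_bound_of_continuousOn
    hβ.continuousOn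
  set M := M₀ + ‖stateForm F N‖ with hM
  have hM₀0 : 0 ≤ M₀ := (norm_nonneg _).trans (hM₀ a ⟨le_rfl, hab⟩)
  have hM0 : 0 ≤ M := by positivity
  have hK0 : 0 ≤ K := (norm_nonneg _).trans (hK a ⟨le_rfl, hab⟩)
  set A := (2 * M ^ 2 / c + M) * K ^ 2 with hA
  have hA0 : 0 ≤ A := by positivity
  refine ⟨min 1 (c / 2 / (A + 1)), by positivity, fun s hs τ hτ hτδ y u hu hy hyτ => ?_⟩
  have hsub : Icc a τ ⊆ Icc a b := Icc_subset_Icc_right hτ.2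
  have hl0 : 0 ≤ τ - a := sub_nonneg.2 hτ.1
  have hl1 : τ - a ≤ 1 := hτδ.trans (min_le_left _ _)
  have hl2 : A * (τ - a) ≤ c / 2 := by
    have h1 := hτδ.trans (min_le_right _ _)
    rw [le_div_iff₀ (by positivity)] at h1
    nlinarith
  have hyc : ContinuousOn y (Icc a τ) := fun t ht => (hy t ht).continuousWithinAt
  have hnu : ContinuousOn (fun t => ‖u t‖) (Icc a τ) := hu.norm
  set m := ∫ t in a..τ, ‖u t‖ with hm
  set S := ∫ t in a..τ, ‖u t‖ ^ 2 with hS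
  have hmS : m ^ 2 ≤ (τ - a) * S := sq_integral_le hτ.1 hnu
  have hm0 : 0 ≤ m := intervalIntegral.integral_nonneg hτ.1 fun t _ => norm_nonneg _
  have hS0 : 0 ≤ S := intervalIntegral.integral_nonneg hτ.1 fun t _ => sq_nonneg _
  have hyb : ∀ t ∈ Icc a τ, ‖y t‖ ≤ K * m := fun t ht => by
    have hsub' : Icc t τ ⊆ Icc a τ := Icc_subset_Icc_left ht.1
    have h1 := integral_eq_sub_of_hasDerivWithinAt_Icc (f := y) ht.2
      (fun x hx => (hy x (hsub' hx)).mono hsub')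
      (hβ.continuousOn.clm_apply (hu.mono hsub'))
    rw [hyτ, zero_sub] at h1
    rw [← norm_neg, ← h1, hm, ← intervalIntegral.integral_const_mul]
    have hi : IntervalIntegrable (fun x => K * ‖u x‖) MeasureTheory.volume a τ := by
      refine ((hnu.const_mul K).mono ?_).intervalIntegrable
      rw [uIcc_of_le hτ.1]
    refine (intervalIntegral.norm_integral_le_of_norm_le ht.2
      (g := fun x => K * ‖u x‖) (Filter.Eventually.of_forall fun x hx => ?_) ?_).trans ?_
    · exact (β x).le_of_opNorm_le (hK x (hsub (hsub' (Ioc_subset_Icc_self hx)))) _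
    · exact hi.mono_set (by rw [uIcc_of_le ht.2, uIcc_of_le hτ.1]; exact hsub')
    · exact intervalIntegral.integral_mono_interval ht.1 ht.2 le_rfl
        (Filter.Eventually.of_forall fun x => mul_nonneg hK0 (norm_nonneg _)) hi
  have hle : ∀ t ∈ Icc a τ, c / 2 * ‖u t‖ ^ 2 - A * m ^ 2
      ≤ (H t - s • stateForm F N) (y t, u t) (y t, u t) := fun t ht => by
    set H' := H t - s • stateForm F N with hH'
    have hH'n : ‖H'‖ ≤ M := by
      refine (norm_sub_le _ _).trans (add_le_add (hM₀ t (hsub ht)) ?_)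
      rw [norm_smul, Real.norm_eq_abs, abs_of_nonneg hs.1]
      exact mul_le_of_le_one_left (norm_nonneg _) hs.2
    have hH's : ∀ v w, H' v w = H' w v := fun v w => by
      simp only [hH', sub_apply, smul_apply, hsymm t v w, stateForm_apply, hNs v.1]
    have h3 : H' (0, u t) (0, u t) = H t (0, u t) (0, u t) := by
      simp [hH', stateForm_apply]
    have hdec : (y t, u t) = (y t, 0) + (0, u t) := by simp
    have hexp : H' (y t, u t) (y t, u t) = H' (y t, 0) (y t, 0) + 2 * H' (y t, 0) (0, u t)
        + H t (0, u t) (0, u t) := by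
      rw [hdec]
      simp only [map_add, add_apply]
      rw [hH's (0, u t) (y t, 0), h3]
      ring
    have n1 : ‖(y t, (0 : F))‖ = ‖y t‖ := by
      rw [Prod.norm_mk, norm_zero, max_eq_left (norm_nonneg _)]
    have n2 : ‖((0 : E), u t)‖ = ‖u t‖ := by
      rw [Prod.norm_mk, norm_zero, max_eq_right (norm_nonneg _)]
    have b1 : |H' (y t, 0) (y t, 0)| ≤ M * ‖y t‖ * ‖y t‖ :=
      (H' _).le_of_opNorm_le_of_le (H'.le_of_opNorm_le_of_le hH'n n1.le) n1.le
    have b2 : |H' (y t, 0) (0, u t)| ≤ M * ‖y t‖ * ‖u t‖ :=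
      (H' _).le_of_opNorm_le_of_le (H'.le_of_opNorm_le_of_le hH'n n1.le) n2.le
    have b3 : c * ‖u t‖ ^ 2 ≤ H t (0, u t) (0, u t) := hc t (hsub ht) (u t)
    have b4 : 2 * (M * ‖y t‖ * ‖u t‖) ≤ c / 2 * ‖u t‖ ^ 2 + 2 * M ^ 2 / c * ‖y t‖ ^ 2 := by
      have h4 : c / 2 * ‖u t‖ ^ 2 + 2 * M ^ 2 / c * ‖y t‖ ^ 2 - 2 * (M * ‖y t‖ * ‖u t‖)
          = (c * ‖u t‖ - 2 * M * ‖y t‖) ^ 2 / (2 * c) := by field_simp; ring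
      have h5 : 0 ≤ (c * ‖u t‖ - 2 * M * ‖y t‖) ^ 2 / (2 * c) := by positivity
      linarith
    have b5 : (2 * M ^ 2 / c + M) * ‖y t‖ ^ 2 ≤ A * m ^ 2 := by
      rw [hA, mul_assoc, ← mul_pow]
      exact mul_le_mul_of_nonneg_left (pow_le_pow_left₀ (norm_nonneg _) (hyb t ht) 2)
        (by positivity)
    rw [hexp]
    nlinarith [neg_abs_le (H' (y t, 0) (y t, 0)), neg_abs_le (H' (y t, 0) (0, u t))]
  have hi2 : IntervalIntegrable (fun t => ‖u t‖ ^ 2) MeasureTheory.volume a τ := by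
    refine ((hnu.pow 2).mono ?_).intervalIntegrable
    rw [uIcc_of_le hτ.1]
  have hiI : IntervalIntegrable (fun t => (H t - s • stateForm F N) (y t, u t) (y t, u t))
      MeasureTheory.volume a τ := by
    refine ContinuousOn.intervalIntegrable ?_
    rw [uIcc_of_le hτ.1]
    exact ((hH.sub continuous_const).continuousOn.clm_apply (hyc.prodMk hu)).clm_apply
      (hyc.prodMk hu)
  have key := intervalIntegral.integral_mono_on hτ.1
    ((hi2.const_mul (c / 2)).sub (continuous_const.intervalIntegrable _ _)) hiI hle
  refine le_trans ?_ key
  rw [intervalIntegral.integral_sub (hi2.const_mul _) (continuous_const.intervalIntegrable _ _),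
    intervalIntegral.integral_const_mul, intervalIntegral.integral_const, smul_eq_mul, ← hS]
  have h1 : (τ - a) * (A * m ^ 2) ≤ c / 2 * S := by
    calc (τ - a) * (A * m ^ 2) = (A * (τ - a)) * m ^ 2 := by ring
      _ ≤ c / 2 * S := by
        refine mul_le_mul hl2 (hmS.trans ?_) (sq_nonneg _) (by positivity)
        exact mul_le_of_le_one_left hS0 hl1
  linarith

/-- Solutions of the perturbed Hamiltonian system depend continuously on the parameter. -/
theorem exists_perturbed_solutions {X Y : Type*} [NormedAddCommGroup X] [NormedSpace ℝ X]
    [CompleteSpace X] [NormedAddCommGroup Y] [NormedSpace ℝ Y] (hab : a ≤ b)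
    {A : ℝ → X →L[ℝ] X} (hA : Continuous A) (C : X →L[ℝ] X) (J D : Y →L[ℝ] X) :
    ∃ Z : ℝ → ℝ → Y →L[ℝ] X, (∀ s, Z s a = J + s • D) ∧
      (∀ s, ∀ t ∈ Icc a b, HasDerivWithinAt (Z s) ((A t - s • C) ∘L Z s t) (Icc a b) t) ∧
      ∃ B, ∀ s ∈ Icc (0 : ℝ) 1, ∀ t ∈ Icc a b, ‖Z s t - Z 0 t‖ ≤ s * B := by
  let cl := ContinuousLinearMap.compL ℝ Y X X
  have hex : ∀ s : ℝ, ∃ z : ℝ → Y →L[ℝ] X, z a = J + s • D ∧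
      ∀ t ∈ Icc a b, HasDerivWithinAt z ((A t - s • C) ∘L z t) (Icc a b) t := fun s =>
    exists_linearODE (A := fun t => cl (A t - s • C))
      (cl.continuous.comp (hA.sub continuous_const)) hab _
  choose Z hZ0 hZ using hex
  refine ⟨Z, hZ0, hZ, ?_⟩
  have hZc : ∀ s, ContinuousOn (Z s) (Icc a b) := fun s t ht => (hZ s t ht).continuousWithinAt
  obtain ⟨K₀, hK₀⟩ := (isCompact_Icc (a := a) (b := b)).exists_bound_of_continuousOn
    hA.continuousOn
  obtain ⟨R, hR⟩ := (isCompact_Icc (a := a) (b := b)).exists_bound_of_continuousOn (hZc 0)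
  have hK₀0 : 0 ≤ K₀ := (norm_nonneg _).trans (hK₀ a ⟨le_rfl, hab⟩)
  have hR0 : 0 ≤ R := (norm_nonneg _).trans (hR a ⟨le_rfl, hab⟩)
  set K := K₀ + ‖C‖ + 1 with hK
  have hK0 : 0 < K := by positivity
  refine ⟨(‖D‖ + ‖C‖ * R / K) * Real.exp (K * (b - a)), fun s hs t ht => ?_⟩
  have hder : ∀ s, ∀ t ∈ Ico a b, HasDerivWithinAt (Z s) ((A t - s • C) ∘L Z s t) (Ici t) t := by
    intro s t ht
    refine (hZ s t ⟨ht.1, ht.2.le⟩).mono_of_mem_nhdsWithin ?_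
    filter_upwards [self_mem_nhdsWithin, mem_nhdsWithin_of_mem_nhds (Iio_mem_nhds ht.2)]
      with x hx hx'
    exact ⟨ht.1.trans hx, le_of_lt hx'⟩
  have hlip : ∀ t ∈ Ico a b, LipschitzOnWith ⟨K, hK0.le⟩
      (fun z : Y →L[ℝ] X => (A t - s • C) ∘L z) univ := fun t ht => by
    refine ((cl (A t - s • C)).lipschitz.weaken ?_).lipschitzOnWith
    have h1 : ‖A t - s • C‖ ≤ K := by
      refine (norm_sub_le _ _).trans ?_
      rw [norm_smul, Real.norm_eq_abs, abs_of_nonneg hs.1]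
      have h2 := hK₀ t ⟨ht.1, ht.2.le⟩
      have h3 := mul_le_of_le_one_left (norm_nonneg C) hs.2
      rw [hK]; linarith
    refine (ContinuousLinearMap.opNorm_le_bound _ (norm_nonneg (A t - s • C))
      fun z => ContinuousLinearMap.opNorm_comp_le _ _).trans h1
  have key := dist_le_of_approx_trajectories_ODE_of_mem (s := fun _ => univ)
    (f := Z s) (g := Z 0) (εf := 0) (εg := s * (‖C‖ * R)) (δ := s * ‖D‖) hlip (hZc s) (hder s)
    (fun t _ => by rw [dist_self]) (fun _ _ => mem_univ _) (hZc 0) (hder 0) (fun t ht => ?_)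
    (fun _ _ => mem_univ _) ?_ t ht
  · rw [dist_eq_norm] at key
    refine key.trans ?_
    rw [gronwallBound_of_K_ne_0 (by exact hK0.ne'), zero_add]
    have e1 : Real.exp (K * (t - a)) ≤ Real.exp (K * (b - a)) :=
      Real.exp_le_exp.2 (mul_le_mul_of_nonneg_left (by linarith [ht.2]) hK0.le)
    have e2 : Real.exp (K * (t - a)) - 1 ≤ Real.exp (K * (b - a)) := by linarith
    change s * ‖D‖ * Real.exp (K * (t - a)) + s * (‖C‖ * R) / K * (Real.exp (K * (t - a)) - 1) ≤ _
    have h1 : s * ‖D‖ * Real.exp (K * (t - a)) ≤ s * ‖D‖ * Real.exp (K * (b - a)) :=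
      mul_le_mul_of_nonneg_left e1 (mul_nonneg hs.1 (norm_nonneg _))
    have h2 : s * (‖C‖ * R) / K * (Real.exp (K * (t - a)) - 1)
        ≤ s * (‖C‖ * R) / K * Real.exp (K * (b - a)) :=
      mul_le_mul_of_nonneg_left e2 (div_nonneg (mul_nonneg hs.1 (by positivity)) hK0.le)
    calc _ ≤ _ := add_le_add h1 h2
      _ = _ := by ring
  · rw [dist_eq_norm, ← ContinuousLinearMap.sub_comp]
    refine (ContinuousLinearMap.opNorm_comp_le _ _).trans ?_
    have h1 : A t - (0 : ℝ) • C - (A t - s • C) = s • C := by simp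
    rw [h1, norm_smul, Real.norm_eq_abs, abs_of_nonneg hs.1, mul_assoc]
    exact mul_le_mul_of_nonneg_left (mul_le_mul_of_nonneg_left (hR t ⟨ht.1, ht.2.le⟩)
      (norm_nonneg _)) hs.1
  · rw [dist_eq_norm, hZ0, hZ0]
    simp [norm_smul, abs_of_nonneg hs.1]

theorem hamField_sub_smul (β₀ : F →L[ℝ] E) (H₀ : (E × F) →L[ℝ] (E × F) →L[ℝ] ℝ) (s : ℝ) :
    hamField β₀ (H₀ - s • stateForm F N) = hamField β₀ H₀ - s •
      (0 : (E × (E →L[ℝ] ℝ)) →L[ℝ] E).prod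
        (N ∘L ContinuousLinearMap.fst ℝ _ _) := by
  have h1 : ctlGram (H₀ - s • stateForm F N) = ctlGram H₀ := by
    ext v w
    simp [ctlGram, stateForm_apply]
  have h2 : ctlPart ∘L (H₀ - s • stateForm F N) ∘L ContinuousLinearMap.inl ℝ _ _
      = ctlPart ∘L H₀ ∘L ContinuousLinearMap.inl ℝ E F := by
    ext v w
    simp [stateForm_apply]
  have h3 : feedback β₀ (H₀ - s • stateForm F N) = feedback β₀ H₀ := by
    rw [feedback, h1, h2]; rfl
  refine ContinuousLinearMap.ext fun x => Prod.ext ?_ ?_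
  · simp [hamField, h3]
  · refine ContinuousLinearMap.ext fun w => ?_
    simp [hamField, h3]

/-- In the normal case an extremal with vanishing state vanishes. -/
theorem IsLQSolution.costate_eq_zero (hab : a < b) (hn : NormalOn β a b)
    (hpos : ∀ t, CtlPos (H t)) {y : ℝ → E} {u : ℝ → F} {π : ℝ → E →L[ℝ] ℝ}
    (hs : IsLQSolution β H a b y u π) (hy : ∀ t ∈ Icc a b, y t = 0) : π a = 0 := by
  have hu : ∀ x ∈ Icc a b, u x = 0 := fun x hx => by
    have h1 : β x (u x) = 0 := (uniqueDiffOn_Icc hab x hx).eq_deriv _ (hs.state x hx)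
      ((hasDerivWithinAt_const x (Icc a b) (0 : E)).congr hy (hy x hx))
    by_contra hne
    refine (hpos x _ hne).ne' ?_
    have h3 := hs.critical x hx (u x)
    rw [h1, map_zero, hy x hx] at h3
    exact h3.symm
  have h0 : ∀ x ∈ Icc a b, H x (y x, u x) = 0 := fun x hx => by
    rw [hy x hx, hu x hx]
    exact map_zero (H x)
  have hc : ∀ x ∈ Icc a b, HasDerivWithinAt π 0 (Icc a b) x := fun x hx =>
    (hs.costate x hx).congr_deriv (by rw [h0 x hx, map_zero])
  have hπ : ∀ x ∈ Icc a b, π x = π a := by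
    refine constant_of_has_deriv_right_zero (fun x hx => (hc x hx).continuousWithinAt)
      (fun x hx => (hc x ⟨hx.1, hx.2.le⟩).mono_of_mem_nhdsWithin ?_)
    filter_upwards [self_mem_nhdsWithin, mem_nhdsWithin_of_mem_nhds (Iio_mem_nhds hx.2)]
      with y hy hy'
    exact ⟨hx.1.trans hy, le_of_lt hy'⟩
  refine hn _ fun x hx => ContinuousLinearMap.ext fun v => ?_
  have h3 := hs.critical x hx v
  rw [h0 x hx, hπ x hx] at h3
  exact h3

/-- For the functional with `H` diminished by a small multiple of the square of the state, the
solutions which start close to the vertical subspace stay transversal to it on the whole interval.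
Near `a` this comes from the positivity of the functional, and away from `a` from the absence of
conjugate points. -/
theorem exists_transversal_solutions (hab : a < b) (hβ : Continuous β) (hn : NormalOn β a b)
    (hH : Continuous H) (hsymm : ∀ t v w, H t v w = H t w v) (hpos : ∀ t, CtlPos (H t))
    (hNs : ∀ x y, N x y = N y x) (hN : ∀ x ≠ 0, 0 < N x x)
    (hnc : ∀ y u π, IsLQSolution β H a b y u π → y a = 0 → ∀ τ ∈ Ioc a b, y τ = 0 →
      ∀ t ∈ Icc a b, y t = 0) :
    ∃ s : ℝ, 0 < s ∧ ∃ Z : ℝ → (E →L[ℝ] ℝ) →L[ℝ] (E × (E →L[ℝ] ℝ)),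
      Z a = ContinuousLinearMap.inr ℝ _ _ + s • N.inverse.prod 0 ∧
      (∀ t ∈ Icc a b, HasDerivWithinAt Z
        (hamField (β t) (H t - s • stateForm F N) ∘L Z t) (Icc a b) t) ∧
      ∀ t ∈ Icc a b, Function.Injective (ContinuousLinearMap.fst ℝ _ _ ∘L Z t) := by
  obtain ⟨δ, hδ, hshort⟩ := exists_short_nonneg hab.le hβ hH hsymm hpos hNs
  obtain ⟨Z, hZ0, hZ, B, hB⟩ := exists_perturbed_solutions hab.le (continuous_hamField hβ hH hpos)
    ((0 : (E × (E →L[ℝ] ℝ)) →L[ℝ] E).prod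
        (N ∘L ContinuousLinearMap.fst ℝ _ _))
    (ContinuousLinearMap.inr ℝ E (E →L[ℝ] ℝ)) (N.inverse.prod 0)
  simp_rw [← hamField_sub_smul] at hZ
  have hZφ : ∀ s φ, ∀ t ∈ Icc a b, HasDerivWithinAt (fun t => Z s t φ)
      (hamField (β t) (H t - s • stateForm F N) (Z s t φ)) (Icc a b) t := fun s φ t ht =>
    ((hZ s t ht).clm_apply (hasDerivWithinAt_const t _ φ)).congr_deriv (by simp)
  have hposs : ∀ s t, CtlPos (H t - s • stateForm F N) := fun s t v hv => by
    have h1 : (H t - s • stateForm F N) (0, v) (0, v) = H t (0, v) (0, v) - s * N 0 0 := rfl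
    rw [h1, map_zero, mul_zero, sub_zero]
    exact hpos t v hv
  have hHs : ∀ s : ℝ, Continuous fun t => H t - s • stateForm F N := fun s => by fun_prop
  -- away from `a`, where the unperturbed solutions are transversal
  have h0 : ∀ t ∈ Icc (a + δ) b, Function.Injective (ContinuousLinearMap.fst ℝ _ _ ∘L Z 0 t) := by
    intro t ht
    refine (injective_iff_map_eq_zero _).2 fun φ hφ => ?_
    have hs := isLQSolution_of_hasDerivWithinAt (a := a) (b := b) hpos (z := fun t => Z 0 t φ)
      (by simpa using hZφ 0 φ)
    have hy := hnc _ _ _ hs (by simp [hZ0]) t ⟨by linarith [ht.1], ht.2⟩ hφ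
    have := hs.costate_eq_zero hab hn hpos hy
    simpa [hZ0] using this
  have hcont : ∀ s, ContinuousOn (fun t => ContinuousLinearMap.fst ℝ _ _ ∘L Z s t) (Icc a b) :=
    fun s => continuousOn_const.clm_comp fun t ht => (hZ s t ht).continuousWithinAt
  obtain ⟨ε, hε, hεs⟩ := (isCompact_Icc.image_of_continuousOn ((hcont 0).mono
    (Icc_subset_Icc_left (by linarith : a ≤ a + δ)))).exists_thickening_subset_open
    (ContinuousLinearMap.isOpen_injective (𝕜 := ℝ) (E := E →L[ℝ] ℝ) (F := E))
    (by rintro _ ⟨t, ht, rfl⟩; exact h0 t ht)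
  obtain ⟨s, hs0, hs1, hsB⟩ : ∃ s : ℝ, 0 < s ∧ s ≤ 1 ∧ s * B < ε := by
    refine ⟨min 1 (ε / (2 * (|B| + 1))), by positivity, min_le_left _ _, ?_⟩
    have h1 : min 1 (ε / (2 * (|B| + 1))) * B ≤ ε / (2 * (|B| + 1)) * |B| :=
      (mul_le_mul_of_nonneg_left (le_abs_self B) (by positivity)).trans
        (mul_le_mul_of_nonneg_right (min_le_right _ _) (abs_nonneg B))
    refine h1.trans_lt ?_
    rw [div_mul_eq_mul_div, div_lt_iff₀ (by positivity)]
    nlinarith [abs_nonneg B]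
  refine ⟨s, hs0, Z s, hZ0 s, hZ s, fun t ht => ?_⟩
  rcases le_total (a + δ) t with htδ | htδ
  · refine hεs (Metric.mem_thickening_iff.2 ⟨_, mem_image_of_mem _ ⟨htδ, ht.2⟩, ?_⟩)
    rw [dist_eq_norm, ← ContinuousLinearMap.comp_sub]
    refine lt_of_le_of_lt ?_ hsB
    refine ((ContinuousLinearMap.opNorm_comp_le _ _).trans ?_).trans (hB s ⟨hs0.le, hs1⟩ t ht)
    exact mul_le_of_le_one_left (norm_nonneg _) (ContinuousLinearMap.norm_fst_le ..)
  · rw [injective_iff_map_eq_zero]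
    intro φ hφ
    have hsol := (isLQSolution_of_hasDerivWithinAt (a := a) (b := b) (hposs s)
      (hZφ s φ)).mono le_rfl ht.2
    have h1 := hsol.integral_eq ht.1 hβ (hHs s) (hposs s) hsol.state
      (hsol.continuousOn_control hβ (hHs s) (hposs s))
    have h2 := hshort s ⟨hs0.le, hs1⟩ t ht (by linarith) _ _
      (hsol.continuousOn_control hβ (hHs s) (hposs s)) hsol.state hφ
    have hφ' : (Z s t φ).1 = 0 := hφ
    rw [h1, hφ', hZ0] at h2
    by_contra hne
    have h3 := mul_pos hs0 (apply_inverse_pos hN hne)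
    simp at h2
    linarith

end Riccati

section Riccati

variable {E F : Type*} [NormedAddCommGroup E] [NormedSpace ℝ E] [FiniteDimensional ℝ E]
  [NormedAddCommGroup F] [NormedSpace ℝ F] [FiniteDimensional ℝ F]
  {β : ℝ → F →L[ℝ] E} {H : ℝ → (E × F) →L[ℝ] (E × F) →L[ℝ] ℝ} {a b : ℝ}

/-- Completion of the square: if the derivative `W'` of the field of forms `W` satisfies the Riccati
equation of `H₀` at `x`, then `H₀(w, w) - W'(x, x) - 2 W(x, β u)`, `w = (x, u)`, is the square of the
deviation of `u` from the feedback. -/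
theorem CtlPos.completion_of_square {β₀ : F →L[ℝ] E} {H₀ : (E × F) →L[ℝ] (E × F) →L[ℝ] ℝ}
    (h : CtlPos H₀) (hsymm : ∀ v w, H₀ v w = H₀ w v) {W W' : E →L[ℝ] E →L[ℝ] ℝ}
    (hW : ∀ x y, W x y = W y x) {x : E}
    (hW' : W' x + W (β₀ (feedback β₀ H₀ (x, W x))) = statePart (H₀ (x, feedback β₀ H₀ (x, W x))))
    (u : F) : H₀ (x, u) (x, u) - W' x x - 2 * W x (β₀ u)
      = H₀ (0, u - feedback β₀ H₀ (x, W x)) (0, u - feedback β₀ H₀ (x, W x)) := by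
  set Γ := feedback β₀ H₀ (x, W x) with hΓ
  set v := u - Γ with hv
  have hu : u = Γ + v := by rw [hv]; abel
  have e1 : W' x x = H₀ (x, Γ) (x, 0) - W x (β₀ Γ) := by
    have := congrArg (fun φ : E →L[ℝ] ℝ => φ x) hW'
    simp only [add_apply, statePart_apply] at this
    rw [hW x, ← this]
    ring
  have e2 : ∀ w, H₀ (x, Γ) (0, w) = W x (β₀ w) := h.feedback_spec (x, W x)
  have e3 : (x, u) = (x, Γ) + (0, v) := by rw [hu]; simp
  have e4 : H₀ (x, Γ) (x, Γ) = H₀ (x, Γ) (x, 0) + H₀ (x, Γ) (0, Γ) := by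
    rw [← map_add]; simp
  have e5 : H₀ (x, u) (x, u) = H₀ (x, Γ) (x, 0) + W x (β₀ Γ) + 2 * W x (β₀ v)
      + H₀ (0, v) (0, v) := by
    rw [e3]
    simp only [map_add, add_apply]
    rw [hsymm (0, v) (x, Γ), e4, e2, e2]
    ring
  rw [e5, e1, hu, map_add, map_add]
  ring

/-- In the absence of conjugate points the accessory problem has a field of extremals on the whole
interval: it turns the second variation into a positive definite form. -/
theorem exists_riccati (hab : a < b) (hβ : Continuous β) (hn : NormalOn β a b)
    (hH : Continuous H) (hsymm : ∀ t v w, H t v w = H t w v) (hpos : ∀ t, CtlPos (H t))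
    (hnc : ∀ y u π, IsLQSolution β H a b y u π → y a = 0 → ∀ τ ∈ Ioc a b, y τ = 0 →
      ∀ t ∈ Icc a b, y t = 0) :
    ∃ W W' : ℝ → E →L[ℝ] E →L[ℝ] ℝ, ContinuousOn W' (Icc a b) ∧
      (∀ t ∈ Icc a b, HasDerivWithinAt W (W' t) (Icc a b) t) ∧
      (∀ t ∈ Icc a b, ∀ x y, W t x y = W t y x) ∧
      ∀ t ∈ Icc a b, ∀ x u, (x, u) ≠ 0 →
        0 < H t (x, u) (x, u) - W' t x x - 2 * W t x (β t u) := by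
  obtain ⟨N, hNs, hN⟩ := exists_posDef_form E
  obtain ⟨s, hs, Z, hZ0, hZ, hinj⟩ := exists_transversal_solutions hab hβ hn hH hsymm hpos hNs hN hnc
  set Hs : ℝ → (E × F) →L[ℝ] (E × F) →L[ℝ] ℝ := fun t => H t - s • stateForm F N with hHs
  have hHs_apply : ∀ t w w', Hs t w w' = H t w w' - s * N w.1 w'.1 := fun t w w' => rfl
  have hHsc : Continuous Hs := hH.sub continuous_const
  have hpos' : ∀ t, CtlPos (Hs t) := fun t v hv => by
    rw [hHs_apply, map_zero, mul_zero, sub_zero]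
    exact hpos t v hv
  have hsymm' : ∀ t v w, Hs t v w = Hs t w v := fun t v w => by
    rw [hHs_apply, hHs_apply, hsymm, hNs]
  have hsol : ∀ φ, IsLQSolution β Hs a b (fun t => (Z t φ).1)
      (fun t => feedback (β t) (Hs t) (Z t φ)) (fun t => (Z t φ).2) := fun φ =>
    isLQSolution_of_hasDerivWithinAt hpos' fun t ht =>
      ((hZ t ht).clm_apply (hasDerivWithinAt_const t _ φ)).congr_deriv (by simp [hHs])
  set X : ℝ → (E →L[ℝ] ℝ) →L[ℝ] E := fun t => ContinuousLinearMap.fst ℝ _ _ ∘L Z t with hX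
  set P : ℝ → (E →L[ℝ] ℝ) →L[ℝ] (E →L[ℝ] ℝ) := fun t => ContinuousLinearMap.snd ℝ _ _ ∘L Z t
    with hP
  set V : ℝ → (E →L[ℝ] ℝ) →L[ℝ] E × (E →L[ℝ] ℝ) := fun t => hamField (β t) (Hs t) ∘L Z t with hV
  have hZc : ContinuousOn Z (Icc a b) := fun t ht => (hZ t ht).continuousWithinAt
  have hVc : ContinuousOn V (Icc a b) :=
    (continuous_hamField hβ hHsc hpos').continuousOn.clm_comp hZc
  have hXinv : ∀ t ∈ Icc a b, (X t).IsInvertible := fun t ht =>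
    isInvertible_of_injective (finrank_strongDual E) (hinj t ht)
  have hXd : ∀ t ∈ Icc a b, HasDerivWithinAt X (ContinuousLinearMap.fst ℝ _ _ ∘L V t)
      (Icc a b) t := fun t ht =>
    ((hasDerivWithinAt_const t _ (ContinuousLinearMap.fst ℝ E (E →L[ℝ] ℝ))).clm_comp
      (hZ t ht)).congr_deriv (by simp [hV, hHs])
  have hPd : ∀ t ∈ Icc a b, HasDerivWithinAt P (ContinuousLinearMap.snd ℝ _ _ ∘L V t)
      (Icc a b) t := fun t ht =>
    ((hasDerivWithinAt_const t _ (ContinuousLinearMap.snd ℝ E (E →L[ℝ] ℝ))).clm_comp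
      (hZ t ht)).congr_deriv (by simp [hV, hHs])
  set Y : ℝ → E →L[ℝ] (E →L[ℝ] ℝ) := fun t => (X t).inverse with hY
  have hYdiff : ∀ t ∈ Icc a b, DifferentiableWithinAt ℝ Y (Icc a b) t := fun t ht =>
    (((hXinv t ht).contDiffAt_map_inverse (n := 1)).differentiableAt
      one_ne_zero).comp_differentiableWithinAt t (hXd t ht).differentiableWithinAt
  set W : ℝ → E →L[ℝ] E →L[ℝ] ℝ := fun t => P t ∘L Y t with hW
  have hWX : ∀ t ∈ Icc a b, ∀ φ, W t (X t φ) = P t φ := fun t ht φ =>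
    congrArg (P t) ((hXinv t ht).inverse_apply_self φ)
  have hWdiff : ∀ t ∈ Icc a b, DifferentiableWithinAt ℝ W (Icc a b) t := fun t ht =>
    (hPd t ht).differentiableWithinAt.clm_comp (hYdiff t ht)
  set W' : ℝ → E →L[ℝ] E →L[ℝ] ℝ := fun t =>
    ((ContinuousLinearMap.snd ℝ _ _ ∘L V t) - W t ∘L (ContinuousLinearMap.fst ℝ _ _ ∘L V t)) ∘L Y t
    with hW'
  have hWd : ∀ t ∈ Icc a b, HasDerivWithinAt W (W' t) (Icc a b) t := fun t ht => by
    have h1 := (hWdiff t ht).hasDerivWithinAt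
    have h2 : derivWithin W (Icc a b) t ∘L X t + W t ∘L (ContinuousLinearMap.fst ℝ _ _ ∘L V t)
        = ContinuousLinearMap.snd ℝ _ _ ∘L V t :=
      (uniqueDiffOn_Icc hab t ht).eq_deriv _ (h1.clm_comp (hXd t ht))
        ((hPd t ht).congr (fun x hx => ContinuousLinearMap.ext (hWX x hx))
          (ContinuousLinearMap.ext (hWX t ht)))
    refine h1.congr_deriv ?_
    rw [hW']
    simp only
    rw [← h2, add_sub_cancel_right]
    refine ContinuousLinearMap.ext fun x => ?_
    exact congrArg _ ((hXinv t ht).self_apply_inverse x).symm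
  have hYc : ContinuousOn Y (Icc a b) := fun t ht => (hYdiff t ht).continuousWithinAt
  have hWc : ContinuousOn W (Icc a b) := fun t ht => (hWdiff t ht).continuousWithinAt
  have hWsymm : ∀ t ∈ Icc a b, ∀ x y, W t x y = W t y x := by
    intro t ht
    -- the Wronskian of two solutions of the field is constant, and vanishes at `a`
    have key : ∀ φ φ', P t φ (X t φ') = P t φ' (X t φ) := fun φ φ' => by
      have i1 := ((hsol φ).mono le_rfl ht.2).integral_eq ht.1 hβ hHsc hpos'
        ((hsol φ').mono le_rfl ht.2).state
        (((hsol φ').mono le_rfl ht.2).continuousOn_control hβ hHsc hpos')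
      have i2 := ((hsol φ').mono le_rfl ht.2).integral_eq ht.1 hβ hHsc hpos'
        ((hsol φ).mono le_rfl ht.2).state
        (((hsol φ).mono le_rfl ht.2).continuousOn_control hβ hHsc hpos')
      simp only [hsymm' _ (((Z _ φ').1), _)] at i2
      rw [i1] at i2
      have h0 : φ (N.inverse φ') = φ' (N.inverse φ) := by
        conv_lhs => rw [← (isInvertible_of_pos hN).self_apply_inverse φ]
        conv_rhs => rw [← (isInvertible_of_pos hN).self_apply_inverse φ']
        exact hNs _ _
      simp only [hZ0] at i2
      simp [h0] at i2
      exact i2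
    intro x y
    have := key (Y t x) (Y t y)
    rwa [(hXinv t ht).self_apply_inverse, (hXinv t ht).self_apply_inverse] at this
  refine ⟨W, W', ?_, hWd, hWsymm, fun t ht x u hxu => ?_⟩
  · exact ((continuousOn_const.clm_comp hVc).sub
      (hWc.clm_comp (continuousOn_const.clm_comp hVc))).clm_comp hYc
  · have hZY : Z t (Y t x) = (x, W t x) := Prod.ext ((hXinv t ht).self_apply_inverse x) rfl
    have h1 : W' t x + W t (β t (feedback (β t) (Hs t) (x, W t x)))
        = statePart (Hs t (x, feedback (β t) (Hs t) (x, W t x))) := by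
      have h2 : V t (Y t x) = hamField (β t) (Hs t) (x, W t x) := by
        rw [← hZY]; rfl
      have h3 : W' t x = (V t (Y t x)).2 - W t (V t (Y t x)).1 := rfl
      rw [h3, h2]
      exact sub_add_cancel _ _
    have h4 := (hpos' t).completion_of_square (hsymm' t) (hWsymm t ht) h1 u
    rw [hHs_apply t (x, u)] at h4
    have h5 : H t (x, u) (x, u) - W' t x x - 2 * W t x (β t u) = s * N x x
        + Hs t (0, u - feedback (β t) (Hs t) (x, W t x))
          (0, u - feedback (β t) (Hs t) (x, W t x)) := by
      rw [← h4]; ring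
    rw [h5]
    by_cases hx : x = 0
    · have hu : u ≠ 0 := fun h => hxu (by rw [hx, h]; rfl)
      subst hx
      have h6 : feedback (β t) (Hs t) (0, W t 0) = 0 := by
        rw [map_zero]; exact map_zero _
      rw [h6, sub_zero, map_zero, mul_zero, zero_add]
      exact hpos' t u hu
    · refine add_pos_of_pos_of_nonneg (mul_pos hs (hN x hx)) ?_
      by_cases hv : u - feedback (β t) (Hs t) (x, W t x) = 0
      · rw [hv]; exact (map_zero (Hs t _)).ge
      · exact (hpos' t _ hv).le

end Riccati

/-! ### The second variation at a minimum -/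

theorem norm_integral_le_of_le_Icc {X : Type*} [NormedAddCommGroup X] [NormedSpace ℝ X] {a b c : ℝ}
    (hc : 0 ≤ c) {h : ℝ → X} (hh : ∀ t ∈ Icc a b, ‖h t‖ ≤ c) {t : ℝ} (ht : t ∈ Icc a b) :
    ‖∫ s in a..t, h s‖ ≤ c * (b - a) := by
  refine (intervalIntegral.norm_integral_le_of_norm_le_const (C := c) fun s hs => ?_).trans ?_
  · rw [uIoc_of_le ht.1] at hs
    exact hh s ⟨hs.1.le, hs.2.trans ht.2⟩
  · rw [abs_of_nonneg (sub_nonneg.2 ht.1)]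
    exact mul_le_mul_of_nonneg_left (by linarith [ht.2]) hc

theorem exists_bound_linear_family {n : ℕ} {F : Type*} [NormedAddCommGroup F] [NormedSpace ℝ F]
    {a b : ℝ} (U : (Fin n → ℝ) →ₗ[ℝ] (ℝ → F)) (hU : ∀ e, Continuous (U e)) :
    ∃ C, 0 ≤ C ∧ ∀ e, ∀ t ∈ Icc a b, ‖U e t‖ ≤ C * ‖e‖ := by
  have h1 : ∀ i : Fin n, ∃ C, ∀ t ∈ Icc a b, ‖U (Pi.single i 1) t‖ ≤ C := fun i =>
    (isCompact_Icc (a := a) (b := b)).exists_bound_of_continuousOn (hU _).continuousOn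
  choose C hC using h1
  refine ⟨∑ i, |C i|, Finset.sum_nonneg fun i _ => abs_nonneg _, fun e t ht => ?_⟩
  conv_lhs => rw [pi_eq_sum_univ' e]
  rw [map_sum, Finset.sum_apply, Finset.sum_mul]
  refine norm_sum_le_of_le _ fun i _ => ?_
  rw [map_smul, Pi.smul_apply, norm_smul, mul_comm]
  exact mul_le_mul ((hC i t ht).trans (le_abs_self _)) (norm_le_pi_norm e i) (norm_nonneg _)
    (abs_nonneg _)

section Perturbation

variable {n r : ℕ} {β : ℝ → (Fin r → ℝ) →L[ℝ] (Fin n → ℝ)} {a b : ℝ}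

set_option maxHeartbeats 1000000 in
/-- Let the linearization of `y' = f(t, y, v)` along the zero solution be the normal system
`y' = β v`. Every solution `(y, v)` of the linearization which vanishes at both ends is tangent to a
family of solutions of the nonlinear system which vanish at both ends. The family solves a fixed
point equation for `y` and for the correction of the control which restores the end condition. -/
theorem NormalOn.eventually_exists_solution (hβ : Continuous β) (hab : a < b)
    (hn : NormalOn β a b) {f : ℝ → (Fin n → ℝ) × (Fin r → ℝ) → (Fin n → ℝ)}
    (hf : Continuous (Function.uncurry f)) (hf0 : ∀ t ∈ Icc a b, f t 0 = 0)
    (hfs : ∀ ε > 0, ∃ δ > 0, ∀ t ∈ Icc a b, ∀ w w', ‖w‖ < δ → ‖w'‖ < δ →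
      ‖f t w - f t w' - β t (w.2 - w'.2)‖ ≤ ε * ‖w - w'‖)
    {u : ℝ → Fin r → ℝ} (hu : ContDiff ℝ ∞ u) (hub : traj β a u b = 0) {ε : ℝ} (hε : 0 < ε) :
    ∀ᶠ ξ in 𝓝 (0 : ℝ), ∃ (y : ℝ → Fin n → ℝ) (v : ℝ → Fin r → ℝ), ContDiff ℝ ∞ v ∧
      y a = 0 ∧ y b = 0 ∧
      (∀ t ∈ Icc a b, HasDerivWithinAt y (f t (y t, v t)) (Icc a b) t) ∧
      ∀ t ∈ Icc a b, ‖y t - ξ • traj β a u t‖ ≤ ε * |ξ| ∧ ‖v t - ξ • u t‖ ≤ ε * |ξ| := by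
  obtain ⟨U, hU, hUe⟩ := hn.exists_smooth_steering hβ hab
  have hUc : ∀ e, Continuous (U e) := fun e => (hU e).continuous
  obtain ⟨C, hC0, hC⟩ := exists_bound_linear_family (a := a) (b := b) U hUc
  obtain ⟨Mβ, hMβ⟩ := (isCompact_Icc (a := a) (b := b)).exists_bound_of_continuousOn
    hβ.continuousOn
  obtain ⟨Mu, hMu⟩ := (isCompact_Icc (a := a) (b := b)).exists_bound_of_continuousOn
    hu.continuous.continuousOn
  obtain ⟨Ty, hTy⟩ := (isCompact_Icc (a := a) (b := b)).exists_bound_of_continuousOn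
    (continuous_traj hβ hu.continuous a).continuousOn
  have ha : a ∈ Icc a b := ⟨le_rfl, hab.le⟩
  have hb : b ∈ Icc a b := ⟨hab.le, le_rfl⟩
  have hMβ0 : 0 ≤ Mβ := (norm_nonneg _).trans (hMβ a ha)
  have hMu0 : 0 ≤ Mu := (norm_nonneg _).trans (hMu a ha)
  have hTy0 : 0 ≤ Ty := (norm_nonneg _).trans (hTy a ha)
  have hl : 0 < b - a := sub_pos.2 hab
  set T := Mβ * C * (b - a) with hT
  have hT0 : 0 ≤ T := by positivity
  have htU : ∀ e, ∀ t ∈ Icc a b, ‖traj β a (U e) t‖ ≤ T * ‖e‖ := fun e t ht => by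
    have := norm_integral_le_of_le_Icc (a := a) (b := b) (c := Mβ * (C * ‖e‖)) (by positivity)
      (h := fun s => β s (U e s)) (fun s hs => (β s).le_of_opNorm_le_of_le (hMβ s hs) (hC e s hs)) ht
    refine this.trans (le_of_eq ?_)
    rw [hT]; ring
  have htUsub : ∀ e e' t, traj β a (U e) t - traj β a (U e') t = traj β a (U (e - e')) t := by
    intro e e' t
    rw [traj, traj, traj, ← intervalIntegral.integral_sub]
    · simp
    · exact (hβ.clm_apply (hUc e)).intervalIntegrable _ _
    · exact (hβ.clm_apply (hUc e')).intervalIntegrable _ _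
  -- the constants: `R |ξ|` is the radius of a ball of candidates, whose values at a time are bounded
  -- by `D |ξ|`
  set R := Ty + 1 with hR
  set D := R + Mu + C * R with hD
  have hR1 : 1 ≤ R := by rw [hR]; linarith
  have hCR : 0 ≤ C * R := mul_nonneg hC0 (zero_le_one.trans hR1)
  have hD1 : 1 ≤ D := by rw [hD]; linarith
  set m := min (ε / (C + 1)) (1 / 2) with hm
  have hm0 : 0 < m := by positivity
  set Q := (1 + C) * (b - a) * (1 + T) * D with hQ
  have hQ0 : 0 < Q := by positivity
  set e₀ := m / Q with he₀
  have he₀0 : 0 < e₀ := by positivity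
  obtain ⟨δ, hδ, hfδ⟩ := hfs e₀ he₀0
  have hsmall : ∀ᶠ ξ in 𝓝 (0 : ℝ), D * |ξ| < δ := by
    have : Filter.Tendsto (fun ξ : ℝ => D * |ξ|) (𝓝 0) (𝓝 (D * |(0 : ℝ)|)) :=
      (continuous_const.mul continuous_abs).tendsto 0
    rw [abs_zero, mul_zero] at this
    exact this.eventually_lt_const hδ
  filter_upwards [hsmall] with ξ hξ
  set g : ℝ → (Fin n → ℝ) × (Fin r → ℝ) → (Fin n → ℝ) := fun t w => f t w - β t w.2 with hg
  have hgc : Continuous (Function.uncurry g) :=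
    hf.sub ((hβ.comp continuous_fst).clm_apply (continuous_snd.comp continuous_snd))
  have hgd : ∀ t ∈ Icc a b, ∀ w w', ‖w‖ ≤ D * |ξ| → ‖w'‖ ≤ D * |ξ| →
      ‖g t w - g t w'‖ ≤ e₀ * ‖w - w'‖ := fun t ht w w' hw hw' => by
    have := hfδ t ht w w' (hw.trans_lt hξ) (hw'.trans_lt hξ)
    rw [map_sub] at this
    convert this using 2
    simp only [hg]; abel
  have hg0 : ∀ t ∈ Icc a b, g t 0 = 0 := fun t ht => by simp [hg, hf0 t ht]
  let X := C(Icc a b, Fin n → ℝ) × (Fin n → ℝ)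
  let Y : X → ℝ → Fin n → ℝ := fun w => IccExtend hab.le w.1
  let v : X → ℝ → Fin r → ℝ := fun w t => ξ • u t + U w.2 t
  have hY : ∀ w, Continuous (Y w) := fun w => w.1.continuous.Icc_extend'
  have hv : ∀ w, Continuous (v w) := fun w => (hu.continuous.const_smul ξ).add (hUc _)
  let k : X → ℝ → Fin n → ℝ := fun w t => g t (Y w t, v w t)
  have hk : ∀ w, Continuous (k w) := fun w =>
    hgc.comp (continuous_id.prodMk ((hY w).prodMk (hv w)))
  let K : X → ℝ → Fin n → ℝ := fun w t => ∫ s in a..t, k w s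
  have hKd : ∀ w t, HasDerivAt (K w) (k w t) t := fun w t =>
    intervalIntegral.integral_hasDerivAt_right ((hk w).intervalIntegrable _ _)
      ((hk w).stronglyMeasurableAtFilter _ _) (hk w).continuousAt
  let y : X → ℝ → Fin n → ℝ := fun w t =>
    ξ • traj β a u t + traj β a (U (-K w b)) t + K w t
  have hyc : ∀ w, Continuous (y w) := fun w =>
    (((continuous_traj hβ hu.continuous a).const_smul ξ).add (continuous_traj hβ (hUc _) a)).add
      (continuous_iff_continuousAt.2 fun t => (hKd w t).continuousAt)
  let Nw : X → X := fun w => (⟨fun t => y w t, (hyc w).comp continuous_subtype_val⟩, -K w b)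
  have hYsub : ∀ w w' : X, ∀ t, ‖Y w t - Y w' t‖ ≤ ‖w - w'‖ := fun w w' t => by
    refine le_trans ?_ (norm_fst_le (w - w'))
    exact (w.1 - w'.1).norm_coe_le_norm (projIcc a b hab.le t)
  have hdif : ∀ w w' : X, ∀ t ∈ Icc a b, ‖(Y w t, v w t) - (Y w' t, v w' t)‖
      ≤ (1 + C) * ‖w - w'‖ := fun w w' t ht => by
    rw [Prod.mk_sub_mk, Prod.norm_mk]
    refine max_le ?_ ?_
    · exact (hYsub w w' t).trans (le_mul_of_one_le_left (norm_nonneg _) (by linarith))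
    · have h1 : v w t - v w' t = U (w - w').2 t := by
        have h2 : (w - w').2 = w.2 - w'.2 := rfl
        rw [h2, map_sub, Pi.sub_apply]
        simp only [v]; abel
      rw [h1]
      exact (hC _ t ht).trans (mul_le_mul (by linarith) (norm_snd_le (w - w')) (norm_nonneg _)
        (by linarith))
  have hball : ∀ w : X, ‖w‖ ≤ R * |ξ| → ∀ t ∈ Icc a b, ‖(Y w t, v w t)‖ ≤ D * |ξ| := by
    intro w hw t ht
    have hξ0 := abs_nonneg ξ
    rw [Prod.norm_mk]
    refine max_le ?_ ?_
    · have h1 := hYsub w 0 t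
      have h2 : Y 0 t = 0 := rfl
      rw [h2, sub_zero, sub_zero] at h1
      refine (h1.trans hw).trans (mul_le_mul_of_nonneg_right ?_ hξ0)
      rw [hD]; linarith
    · have h1 : ‖v w t‖ ≤ |ξ| * Mu + C * (R * |ξ|) := by
        refine (norm_add_le _ _).trans (add_le_add ?_ ?_)
        · rw [norm_smul, Real.norm_eq_abs]
          exact mul_le_mul_of_nonneg_left (hMu t ht) hξ0
        · exact (hC _ t ht).trans (mul_le_mul_of_nonneg_left ((norm_snd_le w).trans hw) hC0)
      have h2 : D * |ξ| = R * |ξ| + (|ξ| * Mu + C * (R * |ξ|)) := by rw [hD]; ring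
      have h3 : 0 ≤ R * |ξ| := by positivity
      linarith
  have hKsub : ∀ w w' : X, ‖w‖ ≤ R * |ξ| → ‖w'‖ ≤ R * |ξ| → ∀ t ∈ Icc a b,
      ‖K w t - K w' t‖ ≤ e₀ * ((1 + C) * ‖w - w'‖) * (b - a) := by
    intro w w' hw hw' t ht
    have h1 : K w t - K w' t = ∫ s in a..t, (k w s - k w' s) :=
      (intervalIntegral.integral_sub ((hk w).intervalIntegrable _ _)
        ((hk w').intervalIntegrable _ _)).symm
    rw [h1]
    refine norm_integral_le_of_le_Icc (by positivity) (fun s hs => ?_) ht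
    exact (hgd s hs _ _ (hball w hw s hs) (hball w' hw' s hs)).trans
      (mul_le_mul_of_nonneg_left (hdif w w' s hs) he₀0.le)
  have hK0 : ∀ w : X, ‖w‖ ≤ R * |ξ| → ∀ t ∈ Icc a b, ‖K w t‖ ≤ e₀ * (D * |ξ|) * (b - a) := by
    intro w hw t ht
    refine norm_integral_le_of_le_Icc (by positivity) (fun s hs => ?_) ht
    have h1 := hgd s hs (Y w s, v w s) 0 (hball w hw s hs) (by rw [norm_zero]; positivity)
    rw [hg0 s hs, sub_zero, sub_zero] at h1
    exact h1.trans (mul_le_mul_of_nonneg_left (hball w hw s hs) he₀0.le)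
  have hyest : ∀ w : X, ‖w‖ ≤ R * |ξ| → ∀ t ∈ Icc a b,
      ‖y w t - ξ • traj β a u t‖ ≤ (1 + T) * (e₀ * (D * |ξ|) * (b - a)) := by
    intro w hw t ht
    have h1 : y w t - ξ • traj β a u t = traj β a (U (-K w b)) t + K w t := by
      simp only [y]; abel
    rw [h1]
    refine (norm_add_le _ _).trans ?_
    have h2 := htU (-K w b) t ht
    rw [norm_neg] at h2
    have h3 := mul_le_mul_of_nonneg_left (hK0 w hw b hb) hT0
    have h4 := hK0 w hw t ht
    linarith
  have hQm : e₀ * Q = m := by rw [he₀]; field_simp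
  have hmε : (1 + T) * (e₀ * (D * |ξ|) * (b - a)) ≤ m * |ξ| := by
    have h1 : (1 + T) * (e₀ * (D * |ξ|) * (b - a)) * (1 + C) = m * |ξ| := by
      rw [← hQm, hQ]; ring
    have h2 : 0 ≤ (1 + T) * (e₀ * (D * |ξ|) * (b - a)) := by positivity
    exact (le_mul_of_one_le_right h2 (by linarith)).trans h1.le
  have hsε : e₀ * (D * |ξ|) * (b - a) ≤ m * |ξ| := by
    refine le_trans ?_ hmε
    have h2 : 0 ≤ e₀ * (D * |ξ|) * (b - a) := by positivity
    exact le_mul_of_one_le_left h2 (by linarith)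
  have hm1 : m ≤ 1 / 2 := min_le_right _ _
  have hξ0 := abs_nonneg ξ
  have hmaps : MapsTo Nw (Metric.closedBall 0 (R * |ξ|)) (Metric.closedBall 0 (R * |ξ|)) := by
    intro w hw
    rw [mem_closedBall_zero_iff] at hw ⊢
    refine max_le ?_ ?_
    · refine (ContinuousMap.norm_le _ (by positivity)).2 fun t => ?_
      have h1 : ‖y w t‖ ≤ ‖y w t - ξ • traj β a u t‖ + ‖ξ • traj β a u t‖ := by
        have := norm_add_le (y w t - ξ • traj β a u t) (ξ • traj β a u t)
        rwa [sub_add_cancel] at this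
      have h2 : ‖ξ • traj β a u t‖ ≤ |ξ| * Ty := by
        rw [norm_smul, Real.norm_eq_abs]
        exact mul_le_mul_of_nonneg_left (hTy t t.2) hξ0
      have h3 := (hyest w hw t t.2).trans hmε
      have h4 : R * |ξ| = |ξ| * Ty + |ξ| := by rw [hR]; ring
      have h5 : m * |ξ| ≤ |ξ| := mul_le_of_le_one_left hξ0 (by linarith)
      change ‖y w t‖ ≤ _
      linarith
    · change ‖-K w b‖ ≤ _
      rw [norm_neg]
      refine ((hK0 w hw b hb).trans hsε).trans (mul_le_mul_of_nonneg_right (by linarith) hξ0)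
  have hcontr : ContractingWith (1 / 2) (hmaps.restrict Nw _ _) := by
    refine ⟨by norm_num, LipschitzWith.of_dist_le_mul fun w w' => ?_⟩
    have hw := mem_closedBall_zero_iff.1 w.2
    have hw' := mem_closedBall_zero_iff.1 w'.2
    have hb1 := hKsub w w' hw hw'
    have hc : (1 + T) * (e₀ * ((1 + C) * ‖(w : X) - w'‖) * (b - a)) ≤ 1 / 2 * ‖(w : X) - w'‖ := by
      have h1 : (1 + T) * (e₀ * ((1 + C) * ‖(w : X) - w'‖) * (b - a)) * D
          = m * ‖(w : X) - w'‖ := by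
        rw [← hQm, hQ]; ring
      have h2 : 0 ≤ (1 + T) * (e₀ * ((1 + C) * ‖(w : X) - w'‖) * (b - a)) := by positivity
      refine (le_mul_of_one_le_right h2 hD1).trans (h1.le.trans ?_)
      exact mul_le_mul_of_nonneg_right hm1 (norm_nonneg _)
    have hpos : 0 ≤ e₀ * ((1 + C) * ‖(w : X) - w'‖) * (b - a) := by positivity
    rw [Subtype.dist_eq, Subtype.dist_eq, dist_eq_norm, dist_eq_norm]
    change ‖Nw w - Nw w'‖ ≤ ((1 / 2 : NNReal) : ℝ) * _
    have hcoe : ((1 / 2 : NNReal) : ℝ) = 1 / 2 := by norm_num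
    rw [hcoe]
    refine max_le ?_ ?_
    · refine (ContinuousMap.norm_le _ (by positivity)).2 fun t => ?_
      change ‖y w t - y w' t‖ ≤ _
      have h1 : y w t - y w' t = traj β a (U (-K w b - -K w' b)) t + (K w t - K w' t) := by
        rw [← htUsub]; simp only [y]; abel
      rw [h1]
      refine (norm_add_le _ _).trans ?_
      have h2 := htU (-K w b - -K w' b) t t.2
      have h3 : ‖-K w b - -K w' b‖ = ‖K w b - K w' b‖ := by
        rw [← norm_neg]; congr 1; abel
      rw [h3] at h2
      have h4 := mul_le_mul_of_nonneg_left (hb1 b hb) hT0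
      have h5 := hb1 t t.2
      linarith
    · change ‖-K w b - -K w' b‖ ≤ _
      have h3 : ‖-K w b - -K w' b‖ = ‖K w b - K w' b‖ := by
        rw [← norm_neg]; congr 1; abel
      rw [h3]
      refine (hb1 b hb).trans (le_trans ?_ hc)
      exact le_mul_of_one_le_left hpos (by linarith)
  obtain ⟨w, hw, hfix, -⟩ := hcontr.exists_fixedPoint' Metric.isClosed_closedBall.isComplete hmaps
    (x := 0) (Metric.mem_closedBall_self (by positivity)) (edist_ne_top _ _)
  rw [mem_closedBall_zero_iff] at hw
  have hs : -K w b = w.2 := congrArg Prod.snd hfix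
  have hYy : ∀ t ∈ Icc a b, Y w t = y w t := fun t ht => by
    have h1 := congrArg (fun z : X => z.1 ⟨t, ht⟩) hfix
    exact (IccExtend_of_mem hab.le w.1 ht).trans h1.symm
  refine ⟨y w, v w, (hu.const_smul ξ).add (hU _), ?_, ?_, fun t ht => ?_, fun t ht => ⟨?_, ?_⟩⟩
  · simp [y, K, traj]
  · simp only [y, hub, hUe, smul_zero, zero_add, neg_add_cancel]
  · have h1 := (((hasDerivAt_traj hβ hu.continuous a t).const_smul ξ).add
      (hasDerivAt_traj hβ (hUc (-K w b)) a t)).add (hKd w t)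
    refine (h1.congr_deriv ?_).hasDerivWithinAt
    simp only [k, hg]
    rw [hYy t ht, hs]
    simp only [v, map_add, map_smul]
    abel
  · refine ((hyest w hw t ht).trans hmε).trans (mul_le_mul_of_nonneg_right ?_ hξ0)
    refine (min_le_left _ _).trans (div_le_self hε.le (by linarith))
  · have h1 : v w t - ξ • u t = U w.2 t := by simp only [v]; abel
    rw [h1, ← hs]
    refine (hC _ t ht).trans ?_
    rw [norm_neg]
    have h2 := (hK0 w hw b hb).trans hsε
    have h3 : m * (C + 1) ≤ ε := by
      rw [← le_div_iff₀ (by linarith)]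
      exact min_le_left _ _
    refine (mul_le_mul_of_nonneg_left h2 hC0).trans ?_
    rw [← mul_assoc]
    exact mul_le_mul_of_nonneg_right (by linarith) hξ0

end Perturbation

/-! ### The accessory problem of a trajectory in coordinates -/

section Accessory

variable {E F : Type*} [NormedAddCommGroup E] [NormedSpace ℝ E] [FiniteDimensional ℝ E]
  [NormedAddCommGroup F] [NormedSpace ℝ F] [FiniteDimensional ℝ F]

/-- The partial derivative `∂ψ/∂q` of a map of the variables `(t, q, z)`. -/
noncomputable def derivQ (ψ : ℝ × E × F → E) (p : ℝ × E × F) : E →L[ℝ] E :=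
  fderiv ℝ ψ p ∘L ContinuousLinearMap.inr ℝ ℝ (E × F) ∘L ContinuousLinearMap.inl ℝ E F

/-- The partial derivative `∂ψ/∂z` of a map of the variables `(t, q, z)`. -/
noncomputable def derivZ (ψ : ℝ × E × F → E) (p : ℝ × E × F) : F →L[ℝ] E :=
  fderiv ℝ ψ p ∘L ContinuousLinearMap.inr ℝ ℝ (E × F) ∘L ContinuousLinearMap.inr ℝ E F

theorem derivQ_add_derivZ (ψ : ℝ × E × F → E) (p : ℝ × E × F) (x : E) (v : F) :
    derivQ ψ p x + derivZ ψ p v = fderiv ℝ ψ p (0, x, v) := by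
  simp [derivQ, derivZ, ← map_add]

/-- The linear-quadratic problem which a trajectory `w` of the system `q' = ψ(t, q, z)` and the
function `ℓ`, critical along `w`, define on `[a, b]`. The state `y = Ψ (q - γ)` is measured by the
fundamental solution `Φ = Ψ⁻¹` of the linearized equation, so that the linearized system reads
`y' = β u`; `H` is the Hessian of `ℓ`. Outside `[a, b]` all data are constant. -/
structure IsAccessory (ψ : ℝ × E × F → E) (ℓ : ℝ × E × F → ℝ) (w : ℝ → ℝ × E × F) (a b : ℝ)
    (Φ Ψ : ℝ → E →L[ℝ] E) (β : ℝ → F →L[ℝ] E)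
    (H : ℝ → (E × F) →L[ℝ] (E × F) →L[ℝ] ℝ) : Prop where
  continuous_Φ : Continuous Φ
  continuous_Ψ : Continuous Ψ
  continuous_β : Continuous β
  continuous_H : Continuous H
  hasDeriv_Φ : ∀ t ∈ Icc a b, HasDerivWithinAt Φ (derivQ ψ (w t) ∘L Φ t) (Icc a b) t
  hasDeriv_Ψ : ∀ t ∈ Icc a b, HasDerivWithinAt Ψ (-(Ψ t ∘L derivQ ψ (w t))) (Icc a b) t
  left_inv : ∀ t x, Ψ t (Φ t x) = x
  right_inv : ∀ t x, Φ t (Ψ t x) = x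
  β_eq : ∀ t ∈ Icc a b, β t = Ψ t ∘L derivZ ψ (w t)
  H_apply : ∀ t ∈ Icc a b, ∀ y v y' v', H t (y, v) (y', v')
    = fderiv ℝ (fderiv ℝ ℓ) (w t) (0, Φ t y, v) (0, Φ t y', v')
  symm : ∀ t v v', H t v v' = H t v' v
  exists_eq : ∀ t, ∃ s ∈ Icc a b, H t = H s

theorem exists_isAccessory {a b : ℝ} (hab : a ≤ b) {ψ : ℝ × E × F → E} {ℓ : ℝ × E × F → ℝ}
    {w : ℝ → ℝ × E × F} {Ω : Set (ℝ × E × F)} (hΩ : IsOpen Ω) (hψ : ContDiffOn ℝ 1 ψ Ω)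
    (hℓ : ContDiffOn ℝ 2 ℓ Ω) (hw : ContinuousOn w (Icc a b)) (hwΩ : ∀ t ∈ Icc a b, w t ∈ Ω) :
    ∃ Φ Ψ β H, IsAccessory ψ ℓ w a b Φ Ψ β H := by
  set P : ℝ → ℝ := fun t => projIcc a b hab t with hP
  have hPc : Continuous P := continuous_subtype_val.comp continuous_projIcc
  have hPm : ∀ t, P t ∈ Icc a b := fun t => (projIcc a b hab t).2
  have hPe : ∀ t ∈ Icc a b, P t = t := fun t ht => by simp [hP, projIcc_of_mem hab ht]
  have hwP : Continuous fun t => w (P t) := hw.comp_continuous hPc hPm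
  have hψ' : Continuous fun t => fderiv ℝ ψ (w (P t)) :=
    (hψ.continuousOn_fderiv_of_isOpen hΩ le_rfl).comp_continuous hwP fun t => hwΩ _ (hPm t)
  have hℓ' : Continuous fun t => fderiv ℝ (fderiv ℝ ℓ) (w (P t)) :=
    ((hℓ.fderiv_of_isOpen hΩ (m := 1) (by norm_num)).continuousOn_fderiv_of_isOpen hΩ
      le_rfl).comp_continuous hwP fun t => hwΩ _ (hPm t)
  have hA : Continuous fun t => derivQ ψ (w (P t)) := hψ'.clm_comp continuous_const
  have hB : Continuous fun t => derivZ ψ (w (P t)) := hψ'.clm_comp continuous_const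
  obtain ⟨Φ, Ψ, -, hΦ, hΨ, hl, hr⟩ := exists_fundamentalSolution hA hab
  have hΦc : Continuous fun t => Φ (P t) :=
    ContinuousOn.comp_continuous (fun t ht => (hΦ t ht).continuousWithinAt) hPc hPm
  have hΨc : Continuous fun t => Ψ (P t) :=
    ContinuousOn.comp_continuous (fun t ht => (hΨ t ht).continuousWithinAt) hPc hPm
  -- the linear map `(y, v) ↦ (0, Φ y, v)`
  set J : ℝ → (E × F) →L[ℝ] ℝ × E × F := fun t =>
    ContinuousLinearMap.inr ℝ ℝ (E × F) ∘L
      ((Φ (P t) ∘L ContinuousLinearMap.fst ℝ E F).prod (ContinuousLinearMap.snd ℝ E F)) with hJ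
  have hJc : Continuous J := continuous_const.clm_comp
    ((ContinuousLinearMap.prodₗᵢ ℝ).continuous.comp
      ((hΦc.clm_comp continuous_const).prodMk continuous_const))
  refine ⟨fun t => Φ (P t), fun t => Ψ (P t), fun t => Ψ (P t) ∘L derivZ ψ (w (P t)),
    fun t => (ContinuousLinearMap.compL ℝ (E × F) (ℝ × E × F) ℝ).flip (J t) ∘L
      fderiv ℝ (fderiv ℝ ℓ) (w (P t)) ∘L J t, ?_⟩
  refine ⟨hΦc, hΨc, hΨc.clm_comp hB, ?_, fun t ht => ?_, fun t ht => ?_, fun t x => ?_,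
    fun t x => ?_, fun t ht => ?_, fun t ht y v y' v' => ?_, fun t v v' => ?_,
    fun t => ⟨P t, hPm t, ?_⟩⟩
  · exact ((ContinuousLinearMap.compL ℝ (E × F) (ℝ × E × F) ℝ).flip.continuous.comp hJc).clm_comp
      (hℓ'.clm_comp hJc)
  · have := hΦ t ht
    simp only [hPe t ht] at this ⊢
    exact this.congr (fun s hs => by rw [hPe s hs]) (by rw [hPe t ht])
  · have := hΨ t ht
    simp only [hPe t ht] at this ⊢
    exact this.congr (fun s hs => by rw [hPe s hs]) (by rw [hPe t ht])
  · exact congrArg (fun L : E →L[ℝ] E => L x) (hl _ (hPm t))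
  · exact congrArg (fun L : E →L[ℝ] E => L x) (hr _ (hPm t))
  · simp only [hPe t ht]
  · simp [hJ, hPe t ht]
  · exact ((hℓ.contDiffAt (hΩ.mem_nhds (hwΩ _ (hPm t)))).isSymmSndFDerivAt (by simp)) _ _
  · simp only [hPe _ (hPm t), hJ]

/-- The linearized Pontryagin equations along the trajectory `w`, in coordinates. -/
structure IsLinearized (ψ : ℝ × E × F → E) (ℓ : ℝ × E × F → ℝ) (w : ℝ → ℝ × E × F) (a b : ℝ)
    (X : ℝ → E) (Γ : ℝ → F) (ϖ : ℝ → E →L[ℝ] ℝ) : Prop where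
  variation : ∀ t ∈ Icc a b, HasDerivWithinAt X (fderiv ℝ ψ (w t) (0, X t, Γ t)) (Icc a b) t
  evolution : ∀ t ∈ Icc a b, HasDerivWithinAt ϖ
    (fderiv ℝ (fderiv ℝ ℓ) (w t) (0, X t, Γ t) ∘L ContinuousLinearMap.inr ℝ ℝ (E × F) ∘L
      ContinuousLinearMap.inl ℝ E F - ϖ t ∘L derivQ ψ (w t)) (Icc a b) t
  critical : ∀ t ∈ Icc a b, ∀ v, ϖ t (derivZ ψ (w t) v)
    = fderiv ℝ (fderiv ℝ ℓ) (w t) (0, X t, Γ t) (0, 0, v)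

variable {ψ : ℝ × E × F → E} {ℓ : ℝ × E × F → ℝ} {w : ℝ → ℝ × E × F} {a b : ℝ}
  {Φ Ψ : ℝ → E →L[ℝ] E} {β : ℝ → F →L[ℝ] E} {H : ℝ → (E × F) →L[ℝ] (E × F) →L[ℝ] ℝ}

theorem IsAccessory.isLQSolution (h : IsAccessory ψ ℓ w a b Φ Ψ β H) {X : ℝ → E} {Γ : ℝ → F}
    {ϖ : ℝ → E →L[ℝ] ℝ} (hs : IsLinearized ψ ℓ w a b X Γ ϖ) :
    IsLQSolution β H a b (fun t => Ψ t (X t)) Γ (fun t => ϖ t ∘L Φ t) where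
  state t ht := by
    refine ((h.hasDeriv_Ψ t ht).clm_apply (hs.variation t ht)).congr_deriv ?_
    rw [h.β_eq t ht, ← derivQ_add_derivZ]
    simp
  costate t ht := by
    refine ((hs.evolution t ht).clm_comp (h.hasDeriv_Φ t ht)).congr_deriv ?_
    ext y
    simp [h.H_apply t ht, h.right_inv]
  critical t ht v := by
    rw [h.H_apply t ht, h.right_inv, map_zero, ← hs.critical t ht, h.β_eq t ht]
    simp [h.right_inv]

theorem IsAccessory.isLinearized (h : IsAccessory ψ ℓ w a b Φ Ψ β H) {y : ℝ → E} {u : ℝ → F}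
    {π : ℝ → E →L[ℝ] ℝ} (hs : IsLQSolution β H a b y u π) :
    IsLinearized ψ ℓ w a b (fun t => Φ t (y t)) u (fun t => π t ∘L Ψ t) where
  variation t ht := by
    refine ((h.hasDeriv_Φ t ht).clm_apply (hs.state t ht)).congr_deriv ?_
    rw [h.β_eq t ht, ← derivQ_add_derivZ]
    simp [h.right_inv]
  evolution t ht := by
    refine ((hs.costate t ht).clm_comp (h.hasDeriv_Ψ t ht)).congr_deriv ?_
    ext x
    simp [h.H_apply t ht, h.right_inv, sub_eq_add_neg]
  critical t ht v := by
    have h1 := hs.critical t ht v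
    rw [h.H_apply t ht, map_zero, h.β_eq t ht] at h1
    exact h1

theorem IsAccessory.ctlPos (h : IsAccessory ψ ℓ w a b Φ Ψ β H)
    (hp : ∀ t ∈ Icc a b, ∀ v ≠ 0, 0 < fderiv ℝ (fderiv ℝ ℓ) (w t) (0, 0, v) (0, 0, v)) (t : ℝ) :
    CtlPos (H t) := fun v hv => by
  obtain ⟨s, hs, he⟩ := h.exists_eq t
  rw [he, h.H_apply s hs, map_zero]
  exact hp s hs v hv

/-- Normality of the accessory system: the covectors `φ Ψ` solve the adjoint linearized equation. -/
theorem IsAccessory.normalOn (h : IsAccessory ψ ℓ w a b Φ Ψ β H) {s₀ s₁ : ℝ} (h₀ : a ≤ s₀)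
    (h₀₁ : s₀ ≤ s₁) (h₁ : s₁ ≤ b)
    (hn : ∀ p : ℝ → E →L[ℝ] ℝ,
      (∀ t ∈ Icc s₀ s₁, HasDerivWithinAt p (-(p t ∘L derivQ ψ (w t))) (Icc s₀ s₁) t) →
      (∀ t ∈ Icc s₀ s₁, p t ∘L derivZ ψ (w t) = 0) → ∀ t ∈ Icc s₀ s₁, p t = 0) :
    NormalOn β s₀ s₁ := by
  intro φ hφ
  have hsub : Icc s₀ s₁ ⊆ Icc a b := Icc_subset_Icc h₀ h₁
  have h1 := hn (fun t => φ ∘L Ψ t) (fun t ht => ?_) (fun t ht => ?_) s₀ ⟨le_rfl, h₀₁⟩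
  · ext x
    have h2 := congrArg (fun L : E →L[ℝ] ℝ => L (Φ s₀ x)) h1
    simpa [h.left_inv] using h2
  · refine (((hasDerivWithinAt_const t _ φ).clm_comp
      ((h.hasDeriv_Ψ t (hsub ht)).mono hsub))).congr_deriv ?_
    ext x; simp
  · rw [ContinuousLinearMap.comp_assoc, ← h.β_eq t (hsub ht)]
    exact hφ t ht

end Accessory

theorem exists_contDiff_eq_near {X Y : Type*} [NormedAddCommGroup X] [NormedSpace ℝ X]
    [FiniteDimensional ℝ X] [NormedAddCommGroup Y] [NormedSpace ℝ Y] {k : ℕ∞} {f : X → Y}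
    {K Ω : Set X} (hK : IsCompact K) (hΩ : IsOpen Ω) (hKΩ : K ⊆ Ω) (hf : ContDiffOn ℝ k f Ω) :
    ∃ F : X → Y, ContDiff ℝ k F ∧ (∀ p ∈ K, F =ᶠ[𝓝 p] f) ∧
      ∃ ρ > 0, ∀ p ∈ K, ∀ h, ‖h‖ < ρ → p + h ∈ Ω ∧ F (p + h) = f (p + h) := by
  obtain ⟨F, hF, U, hU, hKU, hUΩ, hFU⟩ := exists_contDiff_cutoff hK hΩ hKΩ hf
  obtain ⟨ρ, hρ, hρU⟩ := hK.exists_thickening_subset_open hU hKU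
  refine ⟨F, hF, fun p hp => hFU.eventuallyEq_of_mem (hU.mem_nhds (hKU hp)), ρ, hρ,
    fun p hp h hh => ?_⟩
  have : p + h ∈ U := hρU (Metric.mem_thickening_iff.2 ⟨p, hp, by simpa [dist_eq_norm] using hh⟩)
  exact ⟨hUΩ this, hFU this⟩

theorem norm_inr_mk {E F : Type*} [SeminormedAddCommGroup E] [SeminormedAddCommGroup F] (x : E)
    (v : F) : ‖((0 : ℝ), x, v)‖ = ‖(x, v)‖ := by
  rw [Prod.norm_mk, norm_zero, max_eq_right (norm_nonneg _)]

section Accessory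

variable {E F : Type*} [NormedAddCommGroup E] [NormedSpace ℝ E] [FiniteDimensional ℝ E]
  [NormedAddCommGroup F] [NormedSpace ℝ F] [FiniteDimensional ℝ F]
  {ψ : ℝ × E × F → E} {ℓ : ℝ × E × F → ℝ} {w : ℝ → ℝ × E × F} {a b : ℝ}
  {Φ Ψ : ℝ → E →L[ℝ] E} {β : ℝ → F →L[ℝ] E} {H : ℝ → (E × F) →L[ℝ] (E × F) →L[ℝ] ℝ}
  {Ω : Set (ℝ × E × F)}

/-- The state of a solution of the nonlinear system near the trajectory. -/
theorem IsAccessory.hasDeriv_state (h : IsAccessory ψ ℓ w a b Φ Ψ β H) {x : ℝ → E} {v : ℝ → F}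
    {t : ℝ} (ht : t ∈ Icc a b)
    (hx : HasDerivWithinAt x (ψ (w t + (0, x t, v t)) - ψ (w t)) (Icc a b) t) :
    HasDerivWithinAt (fun t => Ψ t (x t))
      (Ψ t (ψ (w t + (0, x t, v t)) - ψ (w t) - derivQ ψ (w t) (x t))) (Icc a b) t := by
  refine ((h.hasDeriv_Ψ t ht).clm_apply hx).congr_deriv ?_
  rw [map_sub _ (ψ (w t + (0, x t, v t)) - ψ (w t))]
  simp only [neg_apply, ContinuousLinearMap.comp_apply]
  abel

set_option maxHeartbeats 1000000 in
theorem exists_pos_le_of_riccati (hβ : Continuous β) (hH : Continuous H)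
    {W W' : ℝ → E →L[ℝ] E →L[ℝ] ℝ} (hW : ContinuousOn W (Icc a b))
    (hW' : ContinuousOn W' (Icc a b)) (hpos : ∀ t ∈ Icc a b, ∀ x u, (x, u) ≠ 0 →
        0 < H t (x, u) (x, u) - W' t x x - 2 * W t x (β t u)) :
    ∃ c > 0, ∀ t ∈ Icc a b, ∀ x u, c * ‖(x, u)‖ ^ 2
      ≤ H t (x, u) (x, u) - W' t x x - 2 * W t x (β t u) := by
  let Q₁ : ℝ → (E × F) →L[ℝ] (E × F) →L[ℝ] ℝ := fun t =>
    (ContinuousLinearMap.compL ℝ (E × F) E ℝ).flip (ContinuousLinearMap.fst ℝ E F) ∘L W' t ∘L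
      ContinuousLinearMap.fst ℝ E F
  let Q₂ : ℝ → (E × F) →L[ℝ] (E × F) →L[ℝ] ℝ := fun t =>
    (ContinuousLinearMap.compL ℝ (E × F) E ℝ).flip (β t ∘L ContinuousLinearMap.snd ℝ E F) ∘L
      W t ∘L ContinuousLinearMap.fst ℝ E F
  have hQ₁ : ContinuousOn Q₁ (Icc a b) :=
    continuousOn_const.clm_comp (hW'.clm_comp continuousOn_const)
  have hQ₂ : ContinuousOn Q₂ (Icc a b) := ContinuousOn.clm_comp
    ((ContinuousLinearMap.compL ℝ (E × F) E ℝ).flip.continuous.comp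
      (hβ.clm_comp continuous_const)).continuousOn (hW.clm_comp continuousOn_const)
  have hQc : ContinuousOn (fun t => H t - Q₁ t - (2 : ℝ) • Q₂ t) (Icc a b) :=
    (hH.continuousOn.sub hQ₁).sub ((continuous_const_smul (2 : ℝ)).comp_continuousOn hQ₂)
  have hQ : ∀ t x u, (H t - Q₁ t - (2 : ℝ) • Q₂ t) (x, u) (x, u)
      = H t (x, u) (x, u) - W' t x x - 2 * W t x (β t u) := fun t x u => rfl
  obtain ⟨c, hc0, hc⟩ := exists_pos_le_quadratic hQc fun t ht p hp => by
    rw [← Prod.mk.eta (p := p), hQ]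
    exact hpos t ht p.1 p.2 hp
  exact ⟨c, hc0, fun t ht x u => by rw [← hQ]; exact hc t ht (x, u)⟩

/-- A solution of the Riccati inequality of the accessory problem is a calibration: it makes
`∫ ℓ` nonnegative on the neighbouring trajectories with the same end-points. -/
theorem IsAccessory.exists_integral_nonneg (h : IsAccessory ψ ℓ w a b Φ Ψ β H) (hab : a < b)
    (hΩ : IsOpen Ω) (hψ : ContDiffOn ℝ 1 ψ Ω) (hℓ : ContDiffOn ℝ 2 ℓ Ω)
    (hw : ContinuousOn w (Icc a b)) (hwΩ : ∀ t ∈ Icc a b, w t ∈ Ω)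
    (hℓ0 : ∀ t ∈ Icc a b, ℓ (w t) = 0) (hℓ1 : ∀ t ∈ Icc a b, fderiv ℝ ℓ (w t) = 0)
    {W W' : ℝ → E →L[ℝ] E →L[ℝ] ℝ} (hW'c : ContinuousOn W' (Icc a b))
    (hW : ∀ t ∈ Icc a b, HasDerivWithinAt W (W' t) (Icc a b) t)
    (hWs : ∀ t ∈ Icc a b, ∀ x y, W t x y = W t y x)
    (hpos : ∀ t ∈ Icc a b, ∀ x u, (x, u) ≠ 0 →
        0 < H t (x, u) (x, u) - W' t x x - 2 * W t x (β t u)) :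
    ∃ δ > 0, ∀ (x : ℝ → E) (v : ℝ → F), ContinuousOn v (Icc a b) →
      (∀ t ∈ Icc a b, HasDerivWithinAt x (ψ (w t + (0, x t, v t)) - ψ (w t)) (Icc a b) t) →
      x a = 0 → x b = 0 → (∀ t ∈ Icc a b, ‖(x t, v t)‖ < δ) →
      0 ≤ ∫ t in a..b, ℓ (w t + (0, x t, v t)) := by
  have hKc : IsCompact (w '' Icc a b) := isCompact_Icc.image_of_continuousOn hw
  have hKΩ : w '' Icc a b ⊆ Ω := by rintro _ ⟨t, ht, rfl⟩; exact hwΩ t ht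
  obtain ⟨ψ', hψ', hψe, ρ, hρ, hψρ⟩ := exists_contDiff_eq_near (k := 1) hKc hΩ hKΩ hψ
  obtain ⟨ℓ', hℓ', hℓe, σ, hσ, hℓσ⟩ := exists_contDiff_eq_near (k := 2) hKc hΩ hKΩ hℓ
  have hWc : ContinuousOn W (Icc a b) := fun t ht => (hW t ht).continuousWithinAt
  obtain ⟨c, hc0, hc'⟩ := exists_pos_le_of_riccati h.continuous_β h.continuous_H hWc hW'c hpos
  obtain ⟨MΦ, hMΦ⟩ := (isCompact_Icc (a := a) (b := b)).exists_bound_of_continuousOn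
    h.continuous_Φ.continuousOn
  obtain ⟨MΨ, hMΨ⟩ := (isCompact_Icc (a := a) (b := b)).exists_bound_of_continuousOn
    h.continuous_Ψ.continuousOn
  obtain ⟨MW, hMW⟩ := (isCompact_Icc (a := a) (b := b)).exists_bound_of_continuousOn hWc
  have ha : a ∈ Icc a b := ⟨le_rfl, hab.le⟩
  have hMΦ0 : 0 ≤ MΦ := (norm_nonneg _).trans (hMΦ a ha)
  have hMΨ0 : 0 ≤ MΨ := (norm_nonneg _).trans (hMΨ a ha)
  have hMW0 : 0 ≤ MW := (norm_nonneg _).trans (hMW a ha)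
  set M := MΦ + 1 with hM
  have hM1 : 1 ≤ M := by rw [hM]; linarith
  set ε := c / 2 / (M ^ 2 + MW * MΨ * M) with hε
  have hε0 : 0 < ε := by positivity
  have hεc : ε * (M ^ 2 + MW * MΨ * M) = c / 2 := by
    rw [hε]; field_simp
  obtain ⟨δ₁, hδ₁, h1⟩ := uniform_strict_deriv hψ' hKc hε0
  obtain ⟨δ₂, hδ₂, h2⟩ := uniform_taylor_two (f := ℓ') hℓ' hKc
    (fun p hp => by
      obtain ⟨t, ht, rfl⟩ := hp
      rw [(hℓe _ (mem_image_of_mem w ht)).eq_of_nhds, hℓ0 t ht])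
    (fun p hp => by
      obtain ⟨t, ht, rfl⟩ := hp
      rw [(hℓe _ (mem_image_of_mem w ht)).fderiv_eq, hℓ1 t ht]) hε0
  refine ⟨min (min ρ σ) (min δ₁ δ₂), by positivity, fun x v hv hx hxa hxb hsmall => ?_⟩
  have hsm : ∀ t ∈ Icc a b, ‖((0 : ℝ), x t, v t)‖ < min (min ρ σ) (min δ₁ δ₂) := fun t ht => by
    rw [norm_inr_mk]; exact hsmall t ht
  simp only [lt_min_iff] at hsm
  have hxc : ContinuousOn x (Icc a b) := fun t ht => (hx t ht).continuousWithinAt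
  have hcurve : ContinuousOn (fun t => w t + ((0 : ℝ), x t, v t)) (Icc a b) :=
    hw.add (continuousOn_const.prodMk (hxc.prodMk hv))
  have hmem : ∀ t ∈ Icc a b, w t + (0, x t, v t) ∈ Ω := fun t ht =>
    (hψρ _ (mem_image_of_mem w ht) _ (hsm t ht).1.1).1
  set y : ℝ → E := fun t => Ψ t (x t) with hy
  set y' : ℝ → E := fun t =>
    Ψ t (ψ (w t + (0, x t, v t)) - ψ (w t) - derivQ ψ (w t) (x t)) with hy'
  have hyd : ∀ t ∈ Icc a b, HasDerivWithinAt y (y' t) (Icc a b) t := fun t ht =>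
    h.hasDeriv_state ht (hx t ht)
  have hyc : ContinuousOn y (Icc a b) := fun t ht => (hyd t ht).continuousWithinAt
  have hψwc : ContinuousOn (fun t => fderiv ℝ ψ (w t)) (Icc a b) :=
    (hψ.continuousOn_fderiv_of_isOpen hΩ le_rfl).comp hw hwΩ
  have hy'c : ContinuousOn y' (Icc a b) := by
    refine h.continuous_Ψ.continuousOn.clm_apply (ContinuousOn.sub (ContinuousOn.sub ?_ ?_) ?_)
    · exact hψ.continuousOn.comp hcurve hmem
    · exact hψ.continuousOn.comp hw hwΩ
    · exact (hψwc.clm_comp continuousOn_const).clm_apply hxc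
  have hxy : ∀ t, x t = Φ t (y t) := fun t => (h.right_inv t (x t)).symm
  -- the total derivative which is subtracted from the integrand
  have hint := integral_eq_sub_of_hasDerivWithinAt_Icc (f := fun t => W t (y t) (y t) / 2) hab.le
    (f' := fun t => W' t (y t) (y t) / 2 + W t (y t) (y' t)) (fun t ht => by
      refine ((((hW t ht).clm_apply (hyd t ht)).clm_apply (hyd t ht)).div_const 2).congr_deriv ?_
      rw [add_apply, hWs t ht (y' t)]
      ring)
    ((((hW'c.clm_apply hyc).clm_apply hyc).div_const 2).add ((hWc.clm_apply hyc).clm_apply hy'c))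
  have hya : y a = 0 := by simp [hy, hxa]
  have hyb : y b = 0 := by simp [hy, hxb]
  rw [hya, hyb] at hint
  simp only [map_zero, zero_div, sub_zero] at hint
  suffices 0 ≤ ∫ t in a..b, (ℓ (w t + (0, x t, v t))
      - (W' t (y t) (y t) / 2 + W t (y t) (y' t))) by
    rwa [intervalIntegral.integral_sub, hint, sub_zero] at this
    · refine ContinuousOn.intervalIntegrable ?_
      rw [uIcc_of_le hab.le]
      exact hℓ.continuousOn.comp hcurve hmem
    · refine ContinuousOn.intervalIntegrable ?_
      rw [uIcc_of_le hab.le]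
      exact (((hW'c.clm_apply hyc).clm_apply hyc).div_const 2).add
        ((hWc.clm_apply hyc).clm_apply hy'c)
  · refine intervalIntegral.integral_nonneg hab.le fun t ht => ?_
    have hK := mem_image_of_mem w ht
    set N := ‖(y t, v t)‖ with hN
    have hN0 : 0 ≤ N := norm_nonneg _
    have hnorm : ‖((0 : ℝ), x t, v t)‖ ≤ M * N := by
      rw [norm_inr_mk, Prod.norm_mk]
      refine max_le ?_ ?_
      · rw [hxy t]
        refine ((Φ t).le_of_opNorm_le_of_le (hMΦ t ht) (norm_fst_le (y t, v t))).trans ?_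
        exact mul_le_mul_of_nonneg_right (by linarith) hN0
      · exact (norm_snd_le (y t, v t)).trans (le_mul_of_one_le_left hN0 hM1)
    have e1 := h1 _ hK (0, x t, v t) 0 (hsm t ht).2.1 (by simpa using hδ₁)
    rw [sub_zero, add_zero, (hψe _ hK).fderiv_eq, (hψe _ hK).eq_of_nhds,
      (hψρ _ hK _ (hsm t ht).1.1).2, ← derivQ_add_derivZ] at e1
    have e2 := h2 _ hK (0, x t, v t) (hsm t ht).2.2
    rw [(hℓe _ hK).fderiv.fderiv_eq, (hℓσ _ hK _ (hsm t ht).1.2).2] at e2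
    have e3 : fderiv ℝ (fderiv ℝ ℓ) (w t) (0, x t, v t) (0, x t, v t)
        = H t (y t, v t) (y t, v t) := by rw [h.H_apply t ht, ← hxy t]
    rw [e3] at e2
    have e4 : ‖y' t - β t (v t)‖ ≤ MΨ * (ε * (M * N)) := by
      have : y' t - β t (v t) = Ψ t (ψ (w t + (0, x t, v t)) - ψ (w t)
          - (derivQ ψ (w t) (x t) + derivZ ψ (w t) (v t))) := by
        rw [h.β_eq t ht, ContinuousLinearMap.comp_apply, ← map_sub]
        congr 1; abel
      rw [this]
      exact (Ψ t).le_of_opNorm_le_of_le (hMΨ t ht)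
        (e1.trans (mul_le_mul_of_nonneg_left hnorm hε0.le))
    have e5 : |W t (y t) (y' t - β t (v t))| ≤ MW * N * (MΨ * (ε * (M * N))) :=
      (W t (y t)).le_of_opNorm_le_of_le
        ((W t).le_of_opNorm_le_of_le (hMW t ht) (norm_fst_le (y t, v t))) e4
    have e6 : ‖((0 : ℝ), x t, v t)‖ ^ 2 ≤ (M * N) ^ 2 := pow_le_pow_left₀ (norm_nonneg _) hnorm 2
    have e7 := hc' t ht (y t) (v t)
    have e8 : ε * (M * N) ^ 2 + MW * N * (MΨ * (ε * (M * N))) = c / 2 * N ^ 2 := by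
      rw [← hεc]; ring
    rw [map_sub] at e5
    have e9 := mul_le_mul_of_nonneg_left e6 hε0.le
    have e10 := (abs_le.1 e2).1
    have e11 := (abs_le.1 e5).2
    linarith

end Accessory

section SecondVariation

variable {n r : ℕ} {ψ : ℝ × (Fin n → ℝ) × (Fin r → ℝ) → (Fin n → ℝ)}
  {ℓ : ℝ × (Fin n → ℝ) × (Fin r → ℝ) → ℝ} {w : ℝ → ℝ × (Fin n → ℝ) × (Fin r → ℝ)} {a b : ℝ}
  {Φ Ψ : ℝ → (Fin n → ℝ) →L[ℝ] (Fin n → ℝ)} {β : ℝ → (Fin r → ℝ) →L[ℝ] (Fin n → ℝ)}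
  {H : ℝ → ((Fin n → ℝ) × (Fin r → ℝ)) →L[ℝ] ((Fin n → ℝ) × (Fin r → ℝ)) →L[ℝ] ℝ}
  {Ω : Set (ℝ × (Fin n → ℝ) × (Fin r → ℝ))}

set_option maxHeartbeats 1000000 in
/-- The second variation at a minimum is nonnegative. Every admissible variation is tangent to a
family of neighbouring trajectories with the same end-points, along which `∫ ℓ` is, to the second
order, half of the quadratic functional. -/
theorem IsAccessory.quad_nonneg (h : IsAccessory ψ ℓ w a b Φ Ψ β H) (hab : a < b)
    (hΩ : IsOpen Ω) (hψ : ContDiffOn ℝ ∞ ψ Ω) (hℓ : ContDiffOn ℝ 2 ℓ Ω)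
    (hw : ContDiffOn ℝ ∞ w (Icc a b)) (hwΩ : ∀ t ∈ Icc a b, w t ∈ Ω)
    (hℓ0 : ∀ t ∈ Icc a b, ℓ (w t) = 0) (hℓ1 : ∀ t ∈ Icc a b, fderiv ℝ ℓ (w t) = 0)
    (hn : NormalOn β a b) {δ : ℝ} (hδ : 0 < δ)
    (hmin : ∀ (x : ℝ → Fin n → ℝ) (v : ℝ → Fin r → ℝ), ContDiffOn ℝ ∞ x (Icc a b) →
      ContDiffOn ℝ ∞ v (Icc a b) →
      (∀ t ∈ Icc a b, HasDerivWithinAt x (ψ (w t + (0, x t, v t)) - ψ (w t)) (Icc a b) t) →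
      x a = 0 → x b = 0 → (∀ t ∈ Icc a b, ‖(x t, v t)‖ < δ) →
      0 ≤ ∫ t in a..b, ℓ (w t + (0, x t, v t)))
    {u : ℝ → Fin r → ℝ} (hu : ContDiff ℝ ∞ u) (hub : traj β a u b = 0) :
    0 ≤ quad β H a b u := by
  have hKc : IsCompact (w '' Icc a b) := isCompact_Icc.image_of_continuousOn hw.continuousOn
  have hKΩ : w '' Icc a b ⊆ Ω := by rintro _ ⟨t, ht, rfl⟩; exact hwΩ t ht
  obtain ⟨ψ', hψ', hψe, ρ, hρ, hψρ⟩ := exists_contDiff_eq_near (k := ⊤) hKc hΩ hKΩ hψ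
  obtain ⟨ℓ', hℓ', hℓe, σ, hσ, hℓσ⟩ := exists_contDiff_eq_near (k := 2) hKc hΩ hKΩ hℓ
  have hψ'1 : ContDiff ℝ 1 ψ' := hψ'.of_le (by exact_mod_cast le_top)
  have hψ'c : Continuous ψ' := hψ'.continuous
  obtain ⟨MΦ, hMΦ⟩ := (isCompact_Icc (a := a) (b := b)).exists_bound_of_continuousOn
    h.continuous_Φ.continuousOn
  obtain ⟨MΨ, hMΨ⟩ := (isCompact_Icc (a := a) (b := b)).exists_bound_of_continuousOn
    h.continuous_Ψ.continuousOn
  have huc := hu.continuous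
  have hyc := continuous_traj h.continuous_β huc a
  set k : ℝ → (Fin n → ℝ) × (Fin r → ℝ) := fun t => (traj β a u t, u t) with hk
  have hkc : Continuous k := hyc.prodMk huc
  obtain ⟨Mk, hMk⟩ := (isCompact_Icc (a := a) (b := b)).exists_bound_of_continuousOn
    hkc.continuousOn
  obtain ⟨MH, hMH⟩ := (isCompact_Icc (a := a) (b := b)).exists_bound_of_continuousOn (f := H)
    h.continuous_H.continuousOn
  have ha : a ∈ Icc a b := ⟨le_rfl, hab.le⟩
  have hMΦ0 : 0 ≤ MΦ := (norm_nonneg _).trans (hMΦ a ha)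
  have hMΨ0 : 0 ≤ MΨ := (norm_nonneg _).trans (hMΨ a ha)
  have hMk0 : 0 ≤ Mk := (norm_nonneg _).trans (hMk a ha)
  have hMH0 : 0 ≤ MH := (norm_nonneg _).trans (hMH a ha)
  set M := MΦ + 1 with hM
  have hM1 : 1 ≤ M := by rw [hM]; linarith
  have hΦn : ∀ t ∈ Icc a b, ∀ (y : Fin n → ℝ) (v : Fin r → ℝ), ‖((0 : ℝ), Φ t y, v)‖ ≤ M * ‖(y, v)‖ := fun t ht y v => by
    rw [norm_inr_mk, Prod.norm_mk]
    refine max_le ?_ ?_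
    · refine ((Φ t).le_of_opNorm_le_of_le (hMΦ t ht) (norm_fst_le (y, v))).trans ?_
      exact mul_le_mul_of_nonneg_right (by linarith) (norm_nonneg _)
    · exact (norm_snd_le (y, v)).trans (le_mul_of_one_le_left (norm_nonneg _) hM1)
  -- the nonlinear system for the state `y`, made global in `t` and in `(y, v)`
  set P : ℝ → ℝ := fun t => projIcc a b hab.le t with hP
  have hPc : Continuous P := continuous_subtype_val.comp continuous_projIcc
  have hPm : ∀ t, P t ∈ Icc a b := fun t => (projIcc a b hab.le t).2
  have hPe : ∀ t ∈ Icc a b, P t = t := fun t ht => by simp [hP, projIcc_of_mem hab.le ht]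
  have hwP : Continuous fun t => w (P t) := hw.continuousOn.comp_continuous hPc hPm
  have hψw : ∀ t ∈ Icc a b, fderiv ℝ ψ' (w t) = fderiv ℝ ψ (w t) := fun t ht =>
    (hψe _ (mem_image_of_mem w ht)).fderiv_eq
  have hdQ : ∀ t ∈ Icc a b, derivQ ψ' (w t) = derivQ ψ (w t) := fun t ht => by
    rw [derivQ, hψw t ht]; rfl
  have hdQc : Continuous fun t => derivQ ψ' (w (P t)) :=
    ((hψ'1.continuous_fderiv one_ne_zero).comp hwP).clm_comp continuous_const
  set f : ℝ → (Fin n → ℝ) × (Fin r → ℝ) → (Fin n → ℝ) := fun t p =>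
    Ψ t (ψ' (w (P t) + (0, Φ t p.1, p.2)) - ψ' (w (P t)) - derivQ ψ' (w (P t)) (Φ t p.1)) with hf
  have hfc : Continuous (Function.uncurry f) := by
    have c1 : Continuous fun p : ℝ × (Fin n → ℝ) × (Fin r → ℝ) => Φ p.1 p.2.1 :=
      (h.continuous_Φ.comp continuous_fst).clm_apply (continuous_fst.comp continuous_snd)
    have c2 : Continuous fun p : ℝ × (Fin n → ℝ) × (Fin r → ℝ) => w (P p.1) :=
      hwP.comp continuous_fst
    refine (h.continuous_Ψ.comp continuous_fst).clm_apply (((hψ'c.comp (c2.add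
      (continuous_const.prodMk (c1.prodMk (continuous_snd.comp continuous_snd))))).sub
      (hψ'c.comp c2)).sub ((hdQc.comp continuous_fst).clm_apply c1))
  have hf0 : ∀ t ∈ Icc a b, f t 0 = 0 := fun t _ => by
    simp [hf, show ((0 : ℝ), (0 : Fin n → ℝ), (0 : Fin r → ℝ)) = 0 from rfl]
  have hfs : ∀ ε > 0, ∃ δ > 0, ∀ t ∈ Icc a b, ∀ p p', ‖p‖ < δ → ‖p'‖ < δ →
      ‖f t p - f t p' - β t (p.2 - p'.2)‖ ≤ ε * ‖p - p'‖ := fun ε hε => by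
    obtain ⟨δ₁, hδ₁, h1⟩ := uniform_strict_deriv hψ'1 hKc
      (show 0 < ε / ((MΨ + 1) * M) by positivity)
    refine ⟨δ₁ / M, by positivity, fun t ht p p' hp hp' => ?_⟩
    rw [lt_div_iff₀ (by linarith), mul_comm] at hp hp'
    have e1 := h1 (w t) (mem_image_of_mem w ht) (0, Φ t p.1, p.2) (0, Φ t p'.1, p'.2)
      ((hΦn t ht _ _).trans_lt hp) ((hΦn t ht _ _).trans_lt hp')
    have e0 : ((0 : ℝ), Φ t p.1, p.2) - (0, Φ t p'.1, p'.2)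
        = (0, Φ t (p.1 - p'.1), p.2 - p'.2) := by simp
    rw [e0, hψw t ht, ← derivQ_add_derivZ] at e1
    have e2 : f t p - f t p' - β t (p.2 - p'.2)
        = Ψ t (ψ' (w t + (0, Φ t p.1, p.2)) - ψ' (w t + (0, Φ t p'.1, p'.2))
          - (derivQ ψ (w t) (Φ t (p.1 - p'.1)) + derivZ ψ (w t) (p.2 - p'.2))) := by
      simp only [hf, hPe t ht, hdQ t ht, h.β_eq t ht, ContinuousLinearMap.comp_apply]
      rw [← map_sub, ← map_sub]
      congr 1
      rw [map_sub (Φ t), map_sub (derivQ ψ (w t))]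
      abel
    rw [e2]
    refine ((Ψ t).le_of_opNorm_le_of_le (hMΨ t ht) (e1.trans
      (mul_le_mul_of_nonneg_left (hΦn t ht _ _) (by positivity)))).trans ?_
    have e3 : MΨ * (ε / ((MΨ + 1) * M) * (M * ‖(p.1 - p'.1, p.2 - p'.2)‖))
        = MΨ / (MΨ + 1) * (ε * ‖p - p'‖) := by
      rw [show (p.1 - p'.1, p.2 - p'.2) = p - p' from rfl]
      field_simp
    rw [e3]
    refine mul_le_of_le_one_left (by positivity) ?_
    rw [div_le_one (by positivity)]
    linarith
  have hquad : quad β H a b u = ∫ t in a..b, H t (k t) (k t) := rfl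
  have hHkc : Continuous fun t => H t (k t) (k t) :=
    (h.continuous_H.clm_apply hkc).clm_apply hkc
  -- an upper bound of the integrand along the family
  refine le_of_forall_pos_le_add fun κ hκ => ?_
  set C := M ^ 2 * (Mk + 1) ^ 2 + MH * (2 * Mk + 1) with hC
  have hC0 : 0 < C := by positivity
  set ε := min 1 (κ / (2 * C * (b - a))) with hε
  have hba : 0 < b - a := sub_pos.2 hab
  have hε0 : 0 < ε := by positivity
  have hεκ : 2 * C * (b - a) * ε ≤ κ := by
    rw [mul_comm, ← le_div_iff₀ (by positivity)]; exact min_le_right _ _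
  obtain ⟨δ₂, hδ₂, h2⟩ := uniform_taylor_two (f := ℓ') hℓ' hKc
    (fun p hp => by
      obtain ⟨t, ht, rfl⟩ := hp
      rw [(hℓe _ (mem_image_of_mem w ht)).eq_of_nhds, hℓ0 t ht])
    (fun p hp => by
      obtain ⟨t, ht, rfl⟩ := hp
      rw [(hℓe _ (mem_image_of_mem w ht)).fderiv_eq, hℓ1 t ht]) hε0
  have hsmall : ∀ᶠ ξ in 𝓝 (0 : ℝ), M * ((Mk + 1) * |ξ|) < min (min ρ σ) (min δ δ₂) := by
    have : Filter.Tendsto (fun ξ : ℝ => M * ((Mk + 1) * |ξ|)) (𝓝 0)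
        (𝓝 (M * ((Mk + 1) * |(0 : ℝ)|))) := by
      exact (continuous_const.mul (continuous_const.mul continuous_abs)).tendsto 0
    rw [abs_zero, mul_zero, mul_zero] at this
    exact this.eventually_lt_const (by positivity)
  have hev := (hn.eventually_exists_solution h.continuous_β hab hfc hf0 hfs hu hub hε0).and hsmall
  obtain ⟨ξ, hξ0, ⟨y, v, hv, hya, hyb, hyd, hest⟩, hξ⟩ :
      ∃ ξ : ℝ, ξ ≠ 0 ∧ (∃ (y : ℝ → Fin n → ℝ) (v : ℝ → Fin r → ℝ), ContDiff ℝ ∞ v ∧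
      y a = 0 ∧ y b = 0 ∧
      (∀ t ∈ Icc a b, HasDerivWithinAt y (f t (y t, v t)) (Icc a b) t) ∧
      ∀ t ∈ Icc a b, ‖y t - ξ • traj β a u t‖ ≤ ε * |ξ| ∧ ‖v t - ξ • u t‖ ≤ ε * |ξ|) ∧
      M * ((Mk + 1) * |ξ|) < min (min ρ σ) (min δ δ₂) := by
    obtain ⟨ξ, hξ, hξ'⟩ := ((hev.filter_mono nhdsWithin_le_nhds).and
      (self_mem_nhdsWithin (a := (0 : ℝ)) (s := {0}ᶜ))).exists
    exact ⟨ξ, hξ', hξ⟩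
  have hξp : 0 < |ξ| := abs_pos.2 hξ0
  have hdev : ∀ t ∈ Icc a b, ‖(y t, v t) - ξ • k t‖ ≤ ε * |ξ| := fun t ht =>
    max_le (hest t ht).1 (hest t ht).2
  have hkb : ∀ t ∈ Icc a b, ‖ξ • k t‖ ≤ Mk * |ξ| := fun t ht => by
    rw [norm_smul, mul_comm, Real.norm_eq_abs]
    exact mul_le_mul_of_nonneg_right (hMk t ht) hξp.le
  have hnb : ∀ t ∈ Icc a b, ‖(y t, v t)‖ ≤ (Mk + 1) * |ξ| := fun t ht => by
    have e1 := norm_add_le ((y t, v t) - ξ • k t) (ξ • k t)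
    rw [sub_add_cancel] at e1
    have e2 := mul_le_of_le_one_left hξp.le (min_le_left 1 (κ / (2 * C * (b - a))))
    have e3 := hdev t ht
    have e4 := hkb t ht
    linarith
  set x : ℝ → Fin n → ℝ := fun t => Φ t (y t) with hx
  have hsm : ∀ t ∈ Icc a b, ‖((0 : ℝ), x t, v t)‖ < min (min ρ σ) (min δ δ₂) := fun t ht =>
    ((hΦn t ht _ _).trans (mul_le_mul_of_nonneg_left (hnb t ht) (by linarith))).trans_lt hξ
  have hsm' := hsm
  simp only [lt_min_iff] at hsm'
  have hxd' : ∀ t ∈ Icc a b, HasDerivWithinAt x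
      (ψ' (w t + (0, x t, v t)) - ψ' (w t)) (Icc a b) t := fun t ht => by
    refine ((h.hasDeriv_Φ t ht).clm_apply (hyd t ht)).congr_deriv ?_
    simp only [hf, hPe t ht, hdQ t ht, h.right_inv, ContinuousLinearMap.comp_apply]
    abel
  have hxd : ∀ t ∈ Icc a b, HasDerivWithinAt x
      (ψ (w t + (0, x t, v t)) - ψ (w t)) (Icc a b) t := fun t ht => by
    have hK := mem_image_of_mem w ht
    rw [← (hψe _ hK).eq_of_nhds, ← (hψρ _ hK _ (hsm' t ht).1.1).2]
    exact hxd' t ht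
  have hxs : ContDiffOn ℝ ∞ x (Icc a b) := by
    refine ODE.contDiffOn_enat_Icc_of_hasDerivWithinAt (n := ⊤) (u := univ)
      (f := fun t x => ψ' (w t + (0, x, v t)) - ψ' (w t)) ?_ hxd' (fun t _ => mem_univ _)
    have c1 : ContDiffOn ℝ ∞ (fun p : ℝ × (Fin n → ℝ) => w p.1) (Icc a b ×ˢ univ) :=
      hw.comp contDiff_fst.contDiffOn fun p hp => hp.1
    exact (hψ'.comp_contDiffOn (c1.add (contDiffOn_const.prodMk
      (contDiff_snd.contDiffOn.prodMk (hv.comp contDiff_fst).contDiffOn)))).sub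
      (hψ'.comp_contDiffOn c1)
  have hI := hmin x v hxs hv.contDiffOn hxd (by simp [hx, hya]) (by simp [hx, hyb]) fun t ht => by
    rw [← norm_inr_mk]; exact (hsm' t ht).2.1
  have hle : ∀ t ∈ Icc a b, ℓ (w t + (0, x t, v t))
      ≤ ξ ^ 2 * (H t (k t) (k t) / 2 + C * ε) := fun t ht => by
    have hK := mem_image_of_mem w ht
    have e2 := h2 _ hK (0, x t, v t) (hsm' t ht).2.2
    rw [(hℓe _ hK).fderiv.fderiv_eq, (hℓσ _ hK _ (hsm' t ht).1.2).2, hx,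
      ← h.H_apply t ht] at e2
    have e3 : ‖((0 : ℝ), x t, v t)‖ ^ 2 ≤ (M * ((Mk + 1) * |ξ|)) ^ 2 :=
      pow_le_pow_left₀ (norm_nonneg _) ((hΦn t ht _ _).trans
        (mul_le_mul_of_nonneg_left (hnb t ht) (by linarith))) 2
    set d := (y t, v t) - ξ • k t with hd
    have e4 : (y t, v t) = ξ • k t + d := by rw [hd]; abel
    have e5 : H t (y t, v t) (y t, v t) = ξ ^ 2 * H t (k t) (k t)
        + (2 * H t (ξ • k t) d + H t d d) := by
      rw [e4]
      simp only [map_add, add_apply]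
      rw [h.symm t d (ξ • k t)]
      simp only [map_smul, smul_apply, smul_eq_mul]
      ring
    have e6 : |H t (ξ • k t) d| ≤ MH * (Mk * |ξ|) * (ε * |ξ|) :=
      (H t _).le_of_opNorm_le_of_le ((H t).le_of_opNorm_le_of_le (hMH t ht) (hkb t ht)) (hdev t ht)
    have e7 : |H t d d| ≤ MH * (ε * |ξ|) * (ε * |ξ|) :=
      (H t _).le_of_opNorm_le_of_le ((H t).le_of_opNorm_le_of_le (hMH t ht) (hdev t ht)) (hdev t ht)
    have e8 : MH * (ε * |ξ|) * (ε * |ξ|) ≤ MH * |ξ| * (ε * |ξ|) := by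
      refine mul_le_mul_of_nonneg_right (mul_le_mul_of_nonneg_left ?_ hMH0) (by positivity)
      exact mul_le_of_le_one_left hξp.le (min_le_left _ _)
    have e9 := (abs_le.1 e2).2
    have e10 := mul_le_mul_of_nonneg_left e3 hε0.le
    have e11 := (abs_le.1 e6).2
    have e12 := (abs_le.1 e7).2
    have e13 : ξ ^ 2 * (H t (k t) (k t) / 2 + C * ε) = ξ ^ 2 * H t (k t) (k t) / 2
        + ε * (M * ((Mk + 1) * |ξ|)) ^ 2
        + (2 * (MH * (Mk * |ξ|) * (ε * |ξ|)) + MH * |ξ| * (ε * |ξ|)) := by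
      rw [hC, ← sq_abs ξ]; ring
    have e14 : 0 ≤ MH * |ξ| * (ε * |ξ|) := by positivity
    have e15 : 0 ≤ MH * (Mk * |ξ|) * (ε * |ξ|) := by positivity
    rw [e13]
    linarith
  have hic : ContinuousOn (fun t => ℓ (w t + (0, x t, v t))) (Icc a b) :=
    hℓ.continuousOn.comp (hw.continuousOn.add (continuousOn_const.prodMk
      (hxs.continuousOn.prodMk hv.continuous.continuousOn)))
      fun t ht => (hψρ _ (mem_image_of_mem w ht) _ (hsm' t ht).1.1).1
  have hfin := hI.trans (intervalIntegral.integral_mono_on hab.le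
    (ContinuousOn.intervalIntegrable (by rwa [uIcc_of_le hab.le]))
    ((((hHkc.div_const 2).add continuous_const).const_mul (ξ ^ 2)).intervalIntegrable _ _) hle)
  rw [intervalIntegral.integral_const_mul] at hfin
  have hfin2 := nonneg_of_mul_nonneg_right hfin (by positivity)
  simp only [Pi.add_apply] at hfin2
  rw [intervalIntegral.integral_add ((hHkc.div_const 2).intervalIntegrable _ _)
    (continuous_const.intervalIntegrable _ _), intervalIntegral.integral_div,
    intervalIntegral.integral_const, smul_eq_mul, ← hquad] at hfin2
  linarith

end SecondVariation

/-! ### Construction and gluing of charts -/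

section Charts

variable {X : Type*} [NormedAddCommGroup X] [NormedSpace ℝ X] [FiniteDimensional ℝ X]
  {M : Type*} [TopologicalSpace M] [ChartedSpace X M] [IsManifold 𝓘(ℝ, X) ∞ M]

theorem OpenPartialHomeomorph.contDiffAt_comp_symm {e e' : OpenPartialHomeomorph M X}
    (he : e ∈ IsManifold.maximalAtlas 𝓘(ℝ, X) ∞ M)
    (he' : e' ∈ IsManifold.maximalAtlas 𝓘(ℝ, X) ∞ M) {x : M} (hx : x ∈ e.source)
    (hx' : x ∈ e'.source) : ContDiffAt ℝ ∞ (e' ∘ e.symm) (e x) := by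
  rw [← contMDiffAt_iff_contDiffAt]
  refine ContMDiffAt.comp (e x) (I' := 𝓘(ℝ, X)) ?_
    (contMDiffAt_symm_of_mem_maximalAtlas he (e.map_source hx))
  rw [e.left_inv hx]
  exact contMDiffAt_of_mem_maximalAtlas he' hx'

/-- An injective local diffeomorphism from an open set to the model space is a chart. -/
theorem exists_chart_of_injOn [Nonempty M] {f : M → X} {U : Set M} (hU : IsOpen U)
    (hinj : InjOn f U)
    (hf : ∀ x ∈ U, ∃ e ∈ IsManifold.maximalAtlas 𝓘(ℝ, X) ∞ M, x ∈ e.source ∧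
      ContDiffAt ℝ ∞ (f ∘ e.symm) (e x) ∧ Function.Injective (fderiv ℝ (f ∘ e.symm) (e x))) :
    ∃ φ ∈ IsManifold.maximalAtlas 𝓘(ℝ, X) ∞ M, φ.source = U ∧ ∀ x, φ x = f x := by
  have hequiv : ∀ x (e : OpenPartialHomeomorph M X),
      ContDiffAt ℝ ∞ (f ∘ e.symm) (e x) → Function.Injective (fderiv ℝ (f ∘ e.symm) (e x)) →
      ∃ L : X ≃L[ℝ] X, HasStrictFDerivAt (f ∘ e.symm) (L : X →L[ℝ] X) (e x) := by
    intro x e h1 h2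
    obtain ⟨L, hL⟩ := isInvertible_of_injective rfl h2
    exact ⟨L, hL ▸ h1.hasStrictFDerivAt (by simp)⟩
  have hfs : ∀ x ∈ U, ContMDiffAt 𝓘(ℝ, X) 𝓘(ℝ, X) ∞ f x := by
    intro x hx
    obtain ⟨e, he, hxe, h1, -⟩ := hf x hx
    have h2 : ContMDiffAt 𝓘(ℝ, X) 𝓘(ℝ, X) ∞ ((f ∘ e.symm) ∘ e) x :=
      ContMDiffAt.comp x (contMDiffAt_iff_contDiffAt.2 h1) (contMDiffAt_of_mem_maximalAtlas he hxe)
    refine h2.congr_of_eventuallyEq ?_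
    filter_upwards [e.open_source.mem_nhds hxe] with y hy
    simp [e.left_inv hy]
  have hopen : ∀ x ∈ U, Filter.map f (𝓝 x) = 𝓝 (f x) := by
    intro x hx
    obtain ⟨e, he, hxe, h1, h2⟩ := hf x hx
    obtain ⟨L, hL⟩ := hequiv x e h1 h2
    have h3 := hL.map_nhds_eq_of_equiv
    rw [← Filter.map_map, e.symm.map_nhds_eq (by simpa using e.map_source hxe)] at h3
    simpa [e.left_inv hxe] using h3
  set p := (hinj.bijOn_image).toPartialEquiv f U (f '' U) with hp
  have hmap : IsOpenMap (U.domRestrict f) := by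
    rw [isOpenMap_iff_nhds_le]
    rintro ⟨x, hx⟩
    change 𝓝 (f x) ≤ Filter.map (f ∘ Subtype.val) _
    rw [← Filter.map_map, map_nhds_subtype_coe_eq_nhds hx (hU.mem_nhds hx), hopen x hx]
  set φ := OpenPartialHomeomorph.ofContinuousOpenRestrict p
    (fun x hx => (hfs x hx).continuousAt.continuousWithinAt) hmap hU with hφ
  have hφf : ⇑φ = f := rfl
  have hφU : φ.source = U := rfl
  refine ⟨φ, (IsManifold.mem_maximalAtlas_iff_contMDiffOn φ).2 ⟨fun x hx =>
    (hfs x hx).contMDiffWithinAt, fun y hy => ContMDiffAt.contMDiffWithinAt ?_⟩, rfl, fun x => rfl⟩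
  set x := φ.symm y with hx
  have hxU : x ∈ φ.source := φ.map_target hy
  have hfx : φ x = y := φ.right_inv hy
  obtain ⟨e, he, hxe, h1, h2⟩ := hf x hxU
  obtain ⟨L, hL⟩ := hequiv x e h1 h2
  set κ := e.symm.trans φ with hκ
  have hκy : y ∈ κ.target := by
    simp only [hκ, OpenPartialHomeomorph.trans_target, OpenPartialHomeomorph.symm_target]
    exact ⟨hy, hxe⟩
  have hκs : κ.symm y = e x := rfl
  have h3 : ContDiffAt ℝ ∞ κ.symm y :=
    κ.contDiffAt_symm hκy (f₀' := L) (by rw [hκs]; exact hL.hasFDerivAt) (by rw [hκs]; exact h1)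
  have h4 : ContMDiffAt 𝓘(ℝ, X) 𝓘(ℝ, X) ∞ (e.symm ∘ κ.symm) y :=
    ContMDiffAt.comp y (contMDiffAt_symm_of_mem_maximalAtlas he
      (by rw [hκs]; exact e.map_source hxe)) (contMDiffAt_iff_contDiffAt.2 h3)
  refine h4.congr_of_eventuallyEq ?_
  filter_upwards [κ.open_target.mem_nhds hκy] with z hz
  have hz' : φ.symm z ∈ e.source := by
    simp only [hκ, OpenPartialHomeomorph.trans_target, OpenPartialHomeomorph.symm_target] at hz
    exact hz.2
  exact (e.left_inv hz').symm

end Charts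

section Gluing

variable {K : Type*} [NormedAddCommGroup K] [NormedSpace ℝ K]
  {M : Type*} [TopologicalSpace M] [ChartedSpace (ℝ × K) M]

/-- The interpolation between two systems of coordinates `(t, k)`: the coordinates `(t, k₁)` where
`χ(t) = 1`, and the coordinates `(t, N k₂)` where `χ(t) = 0`. -/
noncomputable def glue (T : M → ℝ) (χ : ℝ → ℝ) (N : K →L[ℝ] K)
    (e₁ e₂ : OpenPartialHomeomorph M (ℝ × K)) (x : M) : ℝ × K :=
  (T x, χ (T x) • (e₁ x).2 + (1 - χ (T x)) • N (e₂ x).2)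

/-- The derivative in the direction of the fibres of the transition between two charts. -/
noncomputable def fibreDeriv (e₁ e₂ : OpenPartialHomeomorph M (ℝ × K)) (y : ℝ × K) : K →L[ℝ] K :=
  ContinuousLinearMap.snd ℝ ℝ K ∘L fderiv ℝ (e₂ ∘ e₁.symm) y ∘L ContinuousLinearMap.inr ℝ ℝ K

variable [FiniteDimensional ℝ K] [IsManifold 𝓘(ℝ, ℝ × K) ∞ M] {T : M → ℝ}
  {e₁ e₂ : OpenPartialHomeomorph M (ℝ × K)}

/-- Both charts have the time as their first coordinate, so that the transition preserves it. -/
theorem fderiv_transition_fst (he₁ : e₁ ∈ IsManifold.maximalAtlas 𝓘(ℝ, ℝ × K) ∞ M)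
    (he₂ : e₂ ∈ IsManifold.maximalAtlas 𝓘(ℝ, ℝ × K) ∞ M)
    (hT₁ : ∀ x ∈ e₁.source, (e₁ x).1 = T x) (hT₂ : ∀ x ∈ e₂.source, (e₂ x).1 = T x) {p : M}
    (h₁ : p ∈ e₁.source) (h₂ : p ∈ e₂.source) (v : ℝ × K) :
    (fderiv ℝ (e₂ ∘ e₁.symm) (e₁ p) v).1 = v.1 := by
  have h := (e₁.contDiffAt_comp_symm he₁ he₂ h₁ h₂).differentiableAt (by simp)
  have h3 : (fun y => (e₂ (e₁.symm y)).1) =ᶠ[𝓝 (e₁ p)] Prod.fst := by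
    have hc : ContinuousAt e₁.symm (e₁ p) := e₁.continuousAt_symm (e₁.map_source h₁)
    filter_upwards [e₁.open_target.mem_nhds (e₁.map_source h₁), hc.preimage_mem_nhds
      (by rw [e₁.left_inv h₁]; exact e₂.open_source.mem_nhds h₂)] with y hy hy2
    rw [hT₂ _ hy2, ← hT₁ _ (e₁.map_target hy), e₁.right_inv hy]
  have h4 := h3.fderiv_eq (𝕜 := ℝ)
  have h5 : fderiv ℝ (fun y => (e₂ (e₁.symm y)).1) (e₁ p)
      = ContinuousLinearMap.fst ℝ ℝ K ∘L fderiv ℝ (e₂ ∘ e₁.symm) (e₁ p) :=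
    ((ContinuousLinearMap.fst ℝ ℝ K).hasFDerivAt.comp _ h.hasFDerivAt).fderiv
  rw [h5, fderiv_fst] at h4
  exact congrArg (fun L : ℝ × K →L[ℝ] ℝ => L v) h4

theorem fderiv_transition_injective {X : Type*} [NormedAddCommGroup X] [NormedSpace ℝ X]
    [FiniteDimensional ℝ X] {M : Type*} [TopologicalSpace M] [ChartedSpace X M]
    [IsManifold 𝓘(ℝ, X) ∞ M] {e₁ e₂ : OpenPartialHomeomorph M X}
    (he₁ : e₁ ∈ IsManifold.maximalAtlas 𝓘(ℝ, X) ∞ M)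
    (he₂ : e₂ ∈ IsManifold.maximalAtlas 𝓘(ℝ, X) ∞ M) {p : M}
    (h₁ : p ∈ e₁.source) (h₂ : p ∈ e₂.source) :
    Function.Injective (fderiv ℝ (e₂ ∘ e₁.symm) (e₁ p)) := by
  have d12 := (e₁.contDiffAt_comp_symm he₁ he₂ h₁ h₂).differentiableAt (by simp)
  have d21 := (e₂.contDiffAt_comp_symm he₂ he₁ h₂ h₁).differentiableAt (by simp)
  have hp : (e₂ ∘ e₁.symm) (e₁ p) = e₂ p := by simp [e₁.left_inv h₁]
  have h3 : (e₁ ∘ e₂.symm) ∘ (e₂ ∘ e₁.symm) =ᶠ[𝓝 (e₁ p)] id := by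
    have hc : ContinuousAt e₁.symm (e₁ p) := e₁.continuousAt_symm (e₁.map_source h₁)
    filter_upwards [e₁.open_target.mem_nhds (e₁.map_source h₁), hc.preimage_mem_nhds
      (by rw [e₁.left_inv h₁]; exact e₂.open_source.mem_nhds h₂)] with y hy hy2
    simp [e₂.left_inv hy2, e₁.right_inv hy]
  have h4 := h3.fderiv_eq (𝕜 := ℝ)
  rw [fderiv_comp _ (by rw [hp]; exact d21) d12, fderiv_id] at h4
  exact Function.LeftInverse.injective (g := fderiv ℝ (e₁ ∘ e₂.symm) ((e₂ ∘ e₁.symm) (e₁ p)))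
    fun v => congrArg (fun L : X →L[ℝ] X => L v) h4

theorem fibreDeriv_isInvertible (he₁ : e₁ ∈ IsManifold.maximalAtlas 𝓘(ℝ, ℝ × K) ∞ M)
    (he₂ : e₂ ∈ IsManifold.maximalAtlas 𝓘(ℝ, ℝ × K) ∞ M)
    (hT₁ : ∀ x ∈ e₁.source, (e₁ x).1 = T x) (hT₂ : ∀ x ∈ e₂.source, (e₂ x).1 = T x) {p : M}
    (h₁ : p ∈ e₁.source) (h₂ : p ∈ e₂.source) : (fibreDeriv e₁ e₂ (e₁ p)).IsInvertible := by
  refine isInvertible_of_injective rfl ((injective_iff_map_eq_zero _).2 fun k hk => ?_)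
  have h3 : fderiv ℝ (e₂ ∘ e₁.symm) (e₁ p) (0, k) = 0 :=
    Prod.ext (fderiv_transition_fst he₁ he₂ hT₁ hT₂ h₁ h₂ (0, k)) hk
  have h4 := (injective_iff_map_eq_zero _).1 (fderiv_transition_injective he₁ he₂ h₁ h₂) _ h3
  exact congrArg Prod.snd h4

/-- Near a point where `N` inverts the fibre derivative of the transition, all interpolations of two
charts are charts: on the fibres they are perturbations of the identity with Lipschitz constant
`1 / 2`. -/
theorem exists_glued_chart [Nonempty M] (hT : Continuous T)
    (he₁ : e₁ ∈ IsManifold.maximalAtlas 𝓘(ℝ, ℝ × K) ∞ M)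
    (he₂ : e₂ ∈ IsManifold.maximalAtlas 𝓘(ℝ, ℝ × K) ∞ M)
    (hT₁ : ∀ x ∈ e₁.source, (e₁ x).1 = T x) (hT₂ : ∀ x ∈ e₂.source, (e₂ x).1 = T x) {p : M}
    (h₁ : p ∈ e₁.source) (h₂ : p ∈ e₂.source) :
    ∃ O : Set M, IsOpen O ∧ p ∈ O ∧ O ⊆ e₁.source ∩ e₂.source ∧
      ∀ η > 0, ∀ χ : ℝ → ℝ, ContDiff ℝ ∞ χ → (∀ t, χ t ∈ Icc (0 : ℝ) 1) →
      (∀ t ≤ T p - η, χ t = 1) → (∀ t, T p + η ≤ t → χ t = 0) → ∀ O' ⊆ O, IsOpen O' →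
      ∃ φ ∈ IsManifold.maximalAtlas 𝓘(ℝ, ℝ × K) ∞ M,
        φ.source = (e₁.source ∩ T ⁻¹' Iio (T p - η)) ∪ O' ∪ (e₂.source ∩ T ⁻¹' Ioi (T p + η)) ∧
        ∀ x, φ x = glue T χ (fibreDeriv e₁ e₂ (e₁ p)).inverse e₁ e₂ x := by
  have hinv := fibreDeriv_isInvertible he₁ he₂ hT₁ hT₂ h₁ h₂
  set N := (fibreDeriv e₁ e₂ (e₁ p)).inverse with hN
  set κ := e₂ ∘ e₁.symm with hκ
  have hκs : ∀ x, x ∈ e₁.source → x ∈ e₂.source → ContDiffAt ℝ ∞ κ (e₁ x) := fun x hx hx' =>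
    e₁.contDiffAt_comp_symm he₁ he₂ hx hx'
  set R : ℝ × K → K →L[ℝ] K := fun y => N ∘L fibreDeriv e₁ e₂ y - ContinuousLinearMap.id ℝ K
    with hR
  have hRc : ContinuousAt R (e₁ p) := by
    have : ContinuousAt (fderiv ℝ κ) (e₁ p) :=
      ((hκs p h₁ h₂).fderiv_right (m := 0) (by simp)).continuousAt
    exact (continuousAt_const.clm_comp (continuousAt_const.clm_comp
      (this.clm_comp continuousAt_const))).sub continuousAt_const
  have hR0 : R (e₁ p) = 0 := by
    ext k
    simp [hR, hN, hinv.inverse_apply_self]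
  have hB : ∀ᶠ y in 𝓝 (e₁ p), y ∈ e₁.target ∧ e₁.symm y ∈ e₂.source ∧ ‖R y‖ ≤ 1 / 2 := by
    have hc : ContinuousAt e₁.symm (e₁ p) := e₁.continuousAt_symm (e₁.map_source h₁)
    have hRn : Filter.Tendsto (fun y => ‖R y‖) (𝓝 (e₁ p)) (𝓝 0) := by
      have := hRc.norm.tendsto
      rwa [hR0, norm_zero] at this
    filter_upwards [e₁.open_target.mem_nhds (e₁.map_source h₁), hc.preimage_mem_nhds
      (by rw [e₁.left_inv h₁]; exact e₂.open_source.mem_nhds h₂),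
      hRn.eventually_le_const (by norm_num : (0 : ℝ) < 1 / 2)] with y hy hy2 hy3
    exact ⟨hy, hy2, hy3⟩
  obtain ⟨ρ, hρ, hBρ⟩ := Metric.eventually_nhds_iff_ball.1 hB
  have hO₁ : ∀ x ∈ e₁.source ∩ e₁ ⁻¹' Metric.ball (e₁ p) ρ, x ∈ e₁.source ∧ x ∈ e₂.source :=
    fun x hx => ⟨hx.1, by have := (hBρ _ hx.2).2.1; rwa [e₁.left_inv hx.1] at this⟩
  refine ⟨e₁.source ∩ e₁ ⁻¹' Metric.ball (e₁ p) ρ, e₁.isOpen_inter_preimage Metric.isOpen_ball,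
    ⟨h₁, Metric.mem_ball_self hρ⟩, hO₁, fun η hη χ hχ hχ01 hχ1 hχ0 O' hO' hO'o => ?_⟩
  have hUo : IsOpen ((e₁.source ∩ T ⁻¹' Iio (T p - η)) ∪ O' ∪
      (e₂.source ∩ T ⁻¹' Ioi (T p + η))) :=
    ((e₁.open_source.inter (isOpen_Iio.preimage hT)).union hO'o).union
      (e₂.open_source.inter (isOpen_Ioi.preimage hT))
  -- the deviation of the interpolation from `e₁` along the fibres is a contraction
  have hfib : ∀ t k k', (t, k) ∈ Metric.ball (e₁ p) ρ → (t, k') ∈ Metric.ball (e₁ p) ρ →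
      ‖(N (κ (t, k)).2 - k) - (N (κ (t, k')).2 - k')‖ ≤ 1 / 2 * ‖k - k'‖ := by
    intro t k k' hk hk'
    have hball : ∀ k, (t, k) ∈ Metric.ball (e₁ p) ρ →
        k ∈ Metric.ball (e₁ p).2 ρ := fun k hk =>
      lt_of_le_of_lt (le_max_right _ _) (Metric.mem_ball.1 hk)
    have hball' : ∀ j ∈ Metric.ball (e₁ p).2 ρ, (t, j) ∈ Metric.ball (e₁ p) ρ := fun j hj =>
      max_lt (lt_of_le_of_lt (le_max_left _ _) (Metric.mem_ball.1 hk)) hj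
    refine (convex_ball (e₁ p).2 ρ).norm_image_sub_le_of_norm_hasFDerivWithin_le (𝕜 := ℝ)
      (f := fun k => N (κ (t, k)).2 - k) (f' := fun k => R (t, k)) (fun j hj => ?_) (fun j hj => ?_)
      (hball k' hk') (hball k hk)
    · obtain ⟨ht, hs, -⟩ := hBρ _ (hball' j hj)
      have hd : HasFDerivAt κ (fderiv ℝ κ (t, j)) (t, j) := by
        have := hκs _ (e₁.map_target ht) hs
        rw [e₁.right_inv ht] at this
        exact (this.differentiableAt (by simp)).hasFDerivAt
      have h3 : HasFDerivAt (fun k => κ (t, k)) (fderiv ℝ κ (t, j) ∘L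
          ContinuousLinearMap.inr ℝ ℝ K) j := hd.comp j (hasFDerivAt_prodMk_right t j)
      exact ((((N ∘L ContinuousLinearMap.snd ℝ ℝ K).hasFDerivAt.comp j h3)).sub
        (hasFDerivAt_id j)).hasFDerivWithinAt
    · exact (hBρ _ (hball' j hj)).2.2
  have hNinj : Function.Injective N := by
    obtain ⟨L, hL⟩ := hinv
    rw [hN, ← hL, ContinuousLinearMap.inverse_equiv]
    exact L.symm.injective
  refine exists_chart_of_injOn hUo ?_ ?_
  · -- injectivity: the time tells which of the three regions matters
    intro x hx x' hx' hxx
    have hTT : T x = T x' := congrArg Prod.fst hxx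
    have h2 : χ (T x) • (e₁ x).2 + (1 - χ (T x)) • N (e₂ x).2
        = χ (T x) • (e₁ x').2 + (1 - χ (T x)) • N (e₂ x').2 := by
      have := congrArg Prod.snd hxx
      simp only [glue] at this
      rwa [← hTT] at this
    have hcase : ∀ z, T z = T x → z ∈ (e₁.source ∩ T ⁻¹' Iio (T p - η)) ∪ O' ∪
        (e₂.source ∩ T ⁻¹' Ioi (T p + η)) → (T x < T p - η → z ∈ e₁.source) ∧
        (T p + η < T x → z ∈ e₂.source) ∧ (¬ T x < T p - η → ¬ T p + η < T x → z ∈ O') := by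
      rintro z hz ((hz' | hz') | hz')
      · have : T x < T p - η := hz ▸ hz'.2
        exact ⟨fun _ => hz'.1, fun h => by linarith, fun h => absurd this h⟩
      · exact ⟨fun _ => (hO₁ _ (hO' hz')).1, fun _ => (hO₁ _ (hO' hz')).2, fun _ _ => hz'⟩
      · have : T p + η < T x := hz ▸ hz'.2
        exact ⟨fun h => by linarith, fun _ => hz'.1, fun _ h => absurd this h⟩
    have c1 := hcase x rfl hx
    have c2 := hcase x' hTT.symm hx'
    by_cases hl : T x < T p - η
    · rw [hχ1 _ hl.le] at h2
      simp only [one_smul, sub_self, zero_smul, add_zero] at h2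
      refine e₁.injOn (c1.1 hl) (c2.1 hl) (Prod.ext ?_ h2)
      rw [hT₁ _ (c1.1 hl), hT₁ _ (c2.1 hl), hTT]
    by_cases hr : T p + η < T x
    · rw [hχ0 _ hr.le] at h2
      simp only [zero_smul, sub_zero, one_smul, zero_add] at h2
      refine e₂.injOn (c1.2.1 hr) (c2.2.1 hr) (Prod.ext ?_ (hNinj h2))
      rw [hT₂ _ (c1.2.1 hr), hT₂ _ (c2.2.1 hr), hTT]
    · have hxO := hO' (c1.2.2 hl hr)
      have hxO' := hO' (c2.2.2 hl hr)
      have e1 : e₁ x = (T x, (e₁ x).2) := Prod.ext (hT₁ _ hxO.1) rfl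
      have e2 : e₁ x' = (T x, (e₁ x').2) := Prod.ext (by rw [hT₁ _ hxO'.1, hTT]) rfl
      have h3 := hfib (T x) (e₁ x).2 (e₁ x').2 (e1 ▸ hxO.2) (e2 ▸ hxO'.2)
      rw [← e1, ← e2] at h3
      simp only [hκ, Function.comp_apply, e₁.left_inv hxO.1, e₁.left_inv hxO'.1] at h3
      have h4 : (e₁ x).2 - (e₁ x').2 = -((1 - χ (T x)) •
          ((N (e₂ x).2 - (e₁ x).2) - (N (e₂ x').2 - (e₁ x').2))) := by
        rw [← sub_eq_zero] at h2
        rw [← sub_eq_zero, ← h2]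
        module
      have h5 : ‖(e₁ x).2 - (e₁ x').2‖ ≤ 1 / 2 * ‖(e₁ x).2 - (e₁ x').2‖ := by
        conv_lhs => rw [h4]
        rw [norm_neg, norm_smul, Real.norm_eq_abs, abs_of_nonneg (by linarith [(hχ01 (T x)).2])]
        exact (mul_le_of_le_one_left (norm_nonneg _) (by linarith [(hχ01 (T x)).1])).trans h3
      have h6 : ‖(e₁ x).2 - (e₁ x').2‖ = 0 := by
        linarith [norm_nonneg ((e₁ x).2 - (e₁ x').2)]
      refine e₁.injOn hxO.1 hxO'.1 ?_
      rw [e1, e2, sub_eq_zero.1 (norm_eq_zero.1 h6)]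
  · rintro x ((hx | hx) | hx)
    · refine ⟨e₁, he₁, hx.1, ?_⟩
      have heq : glue T χ N e₁ e₂ ∘ e₁.symm =ᶠ[𝓝 (e₁ x)] id := by
        have hc : ContinuousAt e₁.symm (e₁ x) := e₁.continuousAt_symm (e₁.map_source hx.1)
        filter_upwards [e₁.open_target.mem_nhds (e₁.map_source hx.1), hc.preimage_mem_nhds
          (by rw [e₁.left_inv hx.1]; exact (isOpen_Iio.preimage hT).mem_nhds hx.2)] with y hy hy2
        have hTy : T (e₁.symm y) = y.1 := by
          rw [← hT₁ _ (e₁.map_target hy), e₁.right_inv hy]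
        have hlt : T (e₁.symm y) < T p - η := hy2
        simp only [glue, Function.comp_apply]
        rw [hχ1 _ hlt.le, hTy, e₁.right_inv hy]
        simp
      refine ⟨contDiffAt_id.congr_of_eventuallyEq heq, ?_⟩
      rw [heq.fderiv_eq, fderiv_id]
      exact fun v w h => h
    · have hxO := hO' hx
      have hx12 := hO₁ x hxO
      refine ⟨e₁, he₁, hx12.1, ?_⟩
      set G : ℝ × K → ℝ × K := fun y => (y.1, χ y.1 • y.2 + (1 - χ y.1) • N (κ y).2) with hG
      have heq : glue T χ N e₁ e₂ ∘ e₁.symm =ᶠ[𝓝 (e₁ x)] G := by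
        filter_upwards [e₁.open_target.mem_nhds (e₁.map_source hx12.1)] with y hy
        have hTy : T (e₁.symm y) = y.1 := by
          rw [← hT₁ _ (e₁.map_target hy), e₁.right_inv hy]
        simp only [glue, Function.comp_apply, hG, hκ]
        rw [hTy, e₁.right_inv hy]
      have hκx := hκs x hx12.1 hx12.2
      have hGs : ContDiffAt ℝ ∞ G (e₁ x) := by
        have c1 : ContDiffAt ℝ ∞ (fun y : ℝ × K => χ y.1) (e₁ x) :=
          (hχ.comp contDiff_fst).contDiffAt
        have c2 : ContDiffAt ℝ ∞ (fun y : ℝ × K => N (κ y).2) (e₁ x) :=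
          N.contDiff.contDiffAt.comp _ (contDiff_snd.contDiffAt.comp _ hκx)
        exact contDiffAt_fst.prodMk ((c1.smul contDiffAt_snd).add ((contDiffAt_const.sub c1).smul c2))
      refine ⟨hGs.congr_of_eventuallyEq heq, ?_⟩
      rw [heq.fderiv_eq]
      refine (injective_iff_map_eq_zero _).2 fun v hv => ?_
      have hGd : HasFDerivAt G (fderiv ℝ G (e₁ x)) (e₁ x) :=
        (hGs.differentiableAt (by simp)).hasFDerivAt
      have hv1 : v.1 = 0 := by
        have h3 : HasFDerivAt (fun y => (G y).1) (ContinuousLinearMap.fst ℝ ℝ K ∘L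
            fderiv ℝ G (e₁ x)) (e₁ x) :=
          HasFDerivAt.comp (g := Prod.fst) (e₁ x) hasFDerivAt_fst hGd
        have h4 := h3.unique (hasFDerivAt_fst (𝕜 := ℝ) (p := e₁ x))
        have h5 := congrArg (fun L : ℝ × K →L[ℝ] ℝ => L v) h4
        simp only [ContinuousLinearMap.comp_apply, hv] at h5
        exact h5.symm
      have hv2 : v = (0, v.2) := Prod.ext hv1 rfl
      -- along the fibre
      have h6 : HasFDerivAt (fun k => G ((e₁ x).1, k)) (fderiv ℝ G (e₁ x) ∘L
          ContinuousLinearMap.inr ℝ ℝ K) (e₁ x).2 :=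
        HasFDerivAt.comp (g := G) (f := fun k => ((e₁ x).1, k)) (e₁ x).2 hGd
          (hasFDerivAt_prodMk_right (e₁ x).1 (e₁ x).2)
      have h7 : HasFDerivAt (fun k => κ ((e₁ x).1, k)) (fderiv ℝ κ (e₁ x) ∘L
          ContinuousLinearMap.inr ℝ ℝ K) (e₁ x).2 :=
        HasFDerivAt.comp (g := κ) (f := fun k => ((e₁ x).1, k)) (e₁ x).2
          (hκx.differentiableAt (by simp)).hasFDerivAt
          (hasFDerivAt_prodMk_right (e₁ x).1 (e₁ x).2)
      have h8 : HasFDerivAt (fun k => (G ((e₁ x).1, k)).2)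
          (χ (e₁ x).1 • ContinuousLinearMap.id ℝ K + (1 - χ (e₁ x).1) •
            (N ∘L fibreDeriv e₁ e₂ (e₁ x))) (e₁ x).2 :=
        ((hasFDerivAt_id (𝕜 := ℝ) (e₁ x).2).const_smul (χ (e₁ x).1)).add
          (((N ∘L ContinuousLinearMap.snd ℝ ℝ K).hasFDerivAt.comp (e₁ x).2 h7).const_smul
            (1 - χ (e₁ x).1))
      have h9 := h8.unique ((ContinuousLinearMap.snd ℝ ℝ K).hasFDerivAt.comp (e₁ x).2 h6)
      have h10 := congrArg (fun L : K →L[ℝ] K => L v.2) h9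
      simp only [ContinuousLinearMap.comp_apply, ContinuousLinearMap.inr_apply, ← hv2, hv,
        map_zero] at h10
      have h11 : v.2 = -((1 - χ (e₁ x).1) • R (e₁ x) v.2) := by
        have h12 : R (e₁ x) v.2 = N (fibreDeriv e₁ e₂ (e₁ x) v.2) - v.2 := rfl
        rw [← sub_eq_zero, ← h10, h12]
        simp only [add_apply, smul_apply, ContinuousLinearMap.id_apply,
          ContinuousLinearMap.comp_apply]
        module
      have h13 : ‖v.2‖ ≤ 1 / 2 * ‖v.2‖ := by
        conv_lhs => rw [h11]
        rw [norm_neg, norm_smul, Real.norm_eq_abs,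
          abs_of_nonneg (by linarith [(hχ01 (e₁ x).1).2])]
        exact (mul_le_of_le_one_left (norm_nonneg _) (by linarith [(hχ01 (e₁ x).1).1])).trans
          ((R (e₁ x)).le_of_opNorm_le (hBρ _ hxO.2).2.2 _)
      have h14 : ‖v.2‖ = 0 := by linarith [norm_nonneg v.2]
      rw [hv2, norm_eq_zero.1 h14]
      rfl
    · refine ⟨e₂, he₂, hx.1, ?_⟩
      set L : ℝ × K →L[ℝ] ℝ × K := (ContinuousLinearMap.id ℝ ℝ).prodMap N with hL
      have heq : glue T χ N e₁ e₂ ∘ e₂.symm =ᶠ[𝓝 (e₂ x)] L := by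
        have hc : ContinuousAt e₂.symm (e₂ x) := e₂.continuousAt_symm (e₂.map_source hx.1)
        filter_upwards [e₂.open_target.mem_nhds (e₂.map_source hx.1), hc.preimage_mem_nhds
          (by rw [e₂.left_inv hx.1]; exact (isOpen_Ioi.preimage hT).mem_nhds hx.2)] with y hy hy2
        have hTy : T (e₂.symm y) = y.1 := by
          rw [← hT₂ _ (e₂.map_target hy), e₂.right_inv hy]
        have hlt : T p + η < T (e₂.symm y) := hy2
        simp only [glue, Function.comp_apply]
        rw [hχ0 _ hlt.le, hTy, e₂.right_inv hy]
        simp [hL]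
        rfl
      refine ⟨L.contDiff.contDiffAt.congr_of_eventuallyEq heq, ?_⟩
      rw [heq.fderiv_eq, L.fderiv]
      exact Function.Injective.prodMap Function.injective_id hNinj

end Gluing

namespace ConstrainedVariation

/-! ### A fibred chart along the whole curve -/

variable {n r : ℕ} {V A : Type*}
  [TopologicalSpace V] [ChartedSpace (EventModel n) V] [IsManifold 𝓘(ℝ, EventModel n) ∞ V]
  [TopologicalSpace A] [ChartedSpace (VelocityModel n r) A]
  [IsManifold 𝓘(ℝ, VelocityModel n r) ∞ A]

/-- The projection `(t, q, z) ↦ (t, q)`. -/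
def projTQ (n r : ℕ) : VelocityModel n r →L[ℝ] EventModel n :=
  (ContinuousLinearMap.fst ℝ ℝ ((Fin n → ℝ) × (Fin r → ℝ))).prod
    (ContinuousLinearMap.fst ℝ (Fin n → ℝ) (Fin r → ℝ) ∘L ContinuousLinearMap.snd ℝ ℝ _)

@[simp]
theorem projTQ_apply (y : VelocityModel n r) : projTQ n r y = (y.1, y.2.1) := rfl

theorem FibredChart.projTQ_total {time : V → ℝ} {proj : A → V}
    (c : FibredChart (n := n) (r := r) time proj) {a : A} (ha : a ∈ c.total.source) :
    projTQ n r (c.total a) = c.base (proj a) :=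
  Prod.ext (c.total_time a ha) (c.total_q a ha)

namespace ConstrainedSystem

variable {B : ConstrainedSystem n r V A}

/-- The transition between two fibred charts covers the transition between their bases. -/
theorem Chart.projTQ_transition (c₁ c₂ : B.Chart) {a : A} (h₁ : a ∈ c₁.total.source)
    (h₂ : a ∈ c₂.total.source) :
    (fun y => projTQ n r ((c₂.total ∘ c₁.total.symm) y)) =ᶠ[𝓝 (c₁.total a)]
      fun y => (c₂.base ∘ c₁.base.symm) (projTQ n r y) := by
  have hc : ContinuousAt c₁.total.symm (c₁.total a) :=
    c₁.total.continuousAt_symm (c₁.total.map_source h₁)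
  filter_upwards [c₁.total.open_target.mem_nhds (c₁.total.map_source h₁), hc.preimage_mem_nhds
      (by rw [c₁.total.left_inv h₁]; exact c₂.total.open_source.mem_nhds h₂)] with y hy hy2
  have hy1 := c₁.total.map_target hy
  have e1 : projTQ n r y = c₁.base (B.proj (c₁.total.symm y)) := by
    rw [← c₁.projTQ_total hy1, c₁.total.right_inv hy]
  rw [e1]
  simp only [Function.comp_apply]
  rw [c₂.projTQ_total hy2, c₁.base.left_inv (c₁.mapsTo hy1)]

theorem Chart.fderiv_projTQ_transition (c₁ c₂ : B.Chart) {a : A} (h₁ : a ∈ c₁.total.source)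
    (h₂ : a ∈ c₂.total.source) (v : VelocityModel n r) :
    projTQ n r (fderiv ℝ (c₂.total ∘ c₁.total.symm) (c₁.total a) v)
      = fderiv ℝ (c₂.base ∘ c₁.base.symm) (c₁.base (B.proj a)) (projTQ n r v) := by
  have d1 := (c₁.total.contDiffAt_comp_symm c₁.total_mem c₂.total_mem h₁ h₂).differentiableAt
    (by simp)
  have d2 := (c₁.base.contDiffAt_comp_symm c₁.base_mem c₂.base_mem (c₁.mapsTo h₁)
    (c₂.mapsTo h₂)).differentiableAt (by simp)
  rw [← c₁.projTQ_total h₁] at d2 ⊢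
  have h3 := (Chart.projTQ_transition c₁ c₂ h₁ h₂).fderiv_eq (𝕜 := ℝ)
  have h4 := HasFDerivAt.comp (c₁.total a) (projTQ n r).hasFDerivAt d1.hasFDerivAt
  have h5 := HasFDerivAt.comp (f := fun y => projTQ n r y) (c₁.total a) d2.hasFDerivAt
    (projTQ n r).hasFDerivAt
  have h6 := h4.fderiv.symm.trans (h3.trans h5.fderiv)
  exact congrArg (fun L : VelocityModel n r →L[ℝ] EventModel n => L v) h6

/-- The linear maps by which the glued coordinates of `V` and of `A` are corrected are compatible
with the projection. -/
theorem Chart.fst_inverse_fibreDeriv (c₁ c₂ : B.Chart) {a : A} (h₁ : a ∈ c₁.total.source)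
    (h₂ : a ∈ c₂.total.source) (k : (Fin n → ℝ) × (Fin r → ℝ)) :
    ((fibreDeriv c₁.total c₂.total (c₁.total a)).inverse k).1
      = (fibreDeriv c₁.base c₂.base (c₁.base (B.proj a))).inverse k.1 := by
  have hb := fibreDeriv_isInvertible (T := B.time) c₁.base_mem c₂.base_mem c₁.base_time
    c₂.base_time (c₁.mapsTo h₁) (c₂.mapsTo h₂)
  have ht := fibreDeriv_isInvertible (T := B.time ∘ B.proj) c₁.total_mem c₂.total_mem
    (fun x hx => (c₁.total_time x hx).trans (c₁.base_time _ (c₁.mapsTo hx)))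
    (fun x hx => (c₂.total_time x hx).trans (c₂.base_time _ (c₂.mapsTo hx))) h₁ h₂
  have hcov : ∀ k, (fibreDeriv c₁.total c₂.total (c₁.total a) k).1
      = fibreDeriv c₁.base c₂.base (c₁.base (B.proj a)) k.1 := fun k =>
    congrArg Prod.snd (Chart.fderiv_projTQ_transition c₁ c₂ h₁ h₂ (0, k))
  have h3 := hcov ((fibreDeriv c₁.total c₂.total (c₁.total a)).inverse k)
  rw [ht.self_apply_inverse] at h3
  rw [h3, hb.inverse_apply_self]

/-- Two charts around adjacent arcs of a section can be interpolated to one around their union: the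
interpolation takes place in a short interval of time around the common point. -/
theorem Chart.exists_glue (c₁ c₂ : B.Chart) {g : ℝ → A} {a b d : ℝ} (hab : a ≤ b) (hbd : b ≤ d)
    (hg : ContinuousOn g (Icc a d)) (hgt : ∀ t ∈ Icc a d, B.time (B.proj (g t)) = t)
    (h₁ : ∀ t ∈ Icc a b, g t ∈ c₁.total.source) (h₂ : ∀ t ∈ Icc b d, g t ∈ c₂.total.source) :
    ∃ c : B.Chart, ∀ t ∈ Icc a d, g t ∈ c.total.source := by
  have hb : b ∈ Icc a d := ⟨hab, hbd⟩
  have hb₁ := h₁ b ⟨hab, le_rfl⟩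
  have hb₂ := h₂ b ⟨le_rfl, hbd⟩
  have : Nonempty A := ⟨g b⟩
  have : Nonempty V := ⟨B.proj (g b)⟩
  have hTc : Continuous B.time := B.time_smooth.continuous
  have hpc : Continuous B.proj := B.proj_smooth.continuous
  have hT₁ : ∀ x ∈ c₁.total.source, (c₁.total x).1 = (B.time ∘ B.proj) x := fun x hx =>
    (c₁.total_time x hx).trans (c₁.base_time _ (c₁.mapsTo hx))
  have hT₂ : ∀ x ∈ c₂.total.source, (c₂.total x).1 = (B.time ∘ B.proj) x := fun x hx =>
    (c₂.total_time x hx).trans (c₂.base_time _ (c₂.mapsTo hx))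
  obtain ⟨Ob, hOb, hpOb, hObs, hgb⟩ := exists_glued_chart hTc c₁.base_mem c₂.base_mem
    c₁.base_time c₂.base_time (c₁.mapsTo hb₁) (c₂.mapsTo hb₂)
  obtain ⟨Ot, hOt, hpOt, hOts, hgl⟩ := exists_glued_chart (hTc.comp hpc) c₁.total_mem c₂.total_mem
    hT₁ hT₂ hb₁ hb₂
  have hO'o : IsOpen (Ot ∩ B.proj ⁻¹' Ob) := hOt.inter (hOb.preimage hpc)
  obtain ⟨ε, hε, hgε⟩ : ∃ ε > 0, ∀ t ∈ Icc a d, dist t b < ε → g t ∈ Ot ∩ B.proj ⁻¹' Ob := by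
    have := Metric.mem_nhdsWithin_iff.1 ((hg b hb).preimage_mem_nhdsWithin
      (hO'o.mem_nhds ⟨hpOt, hpOb⟩))
    obtain ⟨ε, hε, h⟩ := this
    exact ⟨ε, hε, fun t ht htb => h ⟨htb, ht⟩⟩
  set η := ε / 2 with hη
  have hη0 : 0 < η := by positivity
  set χ : ℝ → ℝ := fun t => 1 - Real.smoothTransition ((t - (b - η)) / (2 * η)) with hχ
  have hχs : ContDiff ℝ ∞ χ := contDiff_const.sub (Real.smoothTransition.contDiff.comp
    ((contDiff_id.sub contDiff_const).div_const _))
  have hχ01 : ∀ t, χ t ∈ Icc (0 : ℝ) 1 := fun t =>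
    ⟨sub_nonneg.2 (Real.smoothTransition.le_one _), sub_le_self _ (Real.smoothTransition.nonneg _)⟩
  have hχ1 : ∀ t ≤ b - η, χ t = 1 := fun t ht => by
    rw [hχ]
    simp only
    rw [Real.smoothTransition.zero_of_nonpos (div_nonpos_of_nonpos_of_nonneg (by linarith)
      (by linarith)), sub_zero]
  have hχ0 : ∀ t, b + η ≤ t → χ t = 0 := fun t ht => by
    rw [hχ]
    simp only
    rw [Real.smoothTransition.one_of_one_le ((one_le_div (by linarith)).2 (by linarith)), sub_self]
  have hTb : B.time (B.proj (g b)) = b := hgt b hb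
  obtain ⟨φb, hφb, hφbs, hφbe⟩ := hgb η hη0 χ hχs hχ01 (by rwa [hTb]) (by rwa [hTb]) Ob le_rfl hOb
  obtain ⟨φt, hφt, hφts, hφte⟩ := hgl η hη0 χ hχs hχ01
    (by rw [Function.comp_apply, hTb]; exact hχ1) (by rw [Function.comp_apply, hTb]; exact hχ0)
    _ inter_subset_left hO'o
  rw [Function.comp_apply, hTb] at hφts
  rw [hTb] at hφbs
  refine ⟨⟨φb, φt, hφb, hφt, ?_, fun x _ => by rw [hφbe]; rfl,
    fun x _ => by rw [hφbe, hφte]; rfl, fun x hx => ?_⟩, fun t ht => ?_⟩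
  · intro x hx
    rw [hφts] at hx
    rw [hφbs]
    rcases hx with (hx | hx) | hx
    · exact Or.inl (Or.inl ⟨c₁.mapsTo hx.1, hx.2⟩)
    · exact Or.inl (Or.inr hx.2)
    · exact Or.inr ⟨c₂.mapsTo hx.1, hx.2⟩
  · rw [hφbe, hφte]
    simp only [glue, Function.comp_apply, Prod.fst_add, Prod.smul_fst,
      Chart.fst_inverse_fibreDeriv c₁ c₂ hb₁ hb₂]
    rw [hφts] at hx
    rcases hx with (hx | hx) | hx
    · have : χ (B.time (B.proj x)) = 1 := hχ1 _ (le_of_lt hx.2)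
      rw [this, c₁.total_q x hx.1, sub_self, zero_smul, zero_smul]
    · rw [c₁.total_q x (hOts hx.1).1, c₂.total_q x (hOts hx.1).2]
    · have : χ (B.time (B.proj x)) = 0 := hχ0 _ (le_of_lt hx.2)
      rw [this, c₂.total_q x hx.1, zero_smul, zero_smul]
  · change g t ∈ φt.source
    rw [hφts]
    have hTt : (B.time ∘ B.proj) (g t) = t := hgt t ht
    by_cases hl : t < b - η
    · exact Or.inl (Or.inl ⟨h₁ t ⟨ht.1, by linarith⟩, by rw [mem_preimage, hTt]; exact hl⟩)
    by_cases hr : b + η < t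
    · exact Or.inr ⟨h₂ t ⟨by linarith, ht.2⟩, by rw [mem_preimage, hTt]; exact hr⟩
    · refine Or.inl (Or.inr (hgε t ht ?_))
      rw [Real.dist_eq, abs_lt]
      constructor <;> linarith

/-- Every section is contained in the domain of a single fibred chart. -/
theorem exists_chart_along {g : ℝ → A} {a b : ℝ} (hab : a ≤ b) (hg : ContinuousOn g (Icc a b))
    (hgt : ∀ t ∈ Icc a b, B.time (B.proj (g t)) = t) :
    ∃ c : B.Chart, ∀ t ∈ Icc a b, g t ∈ c.total.source := by
  have hgr : Continuous ((Icc a b).domRestrict g) := continuousOn_iff_continuous_domRestrict.1 hg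
  obtain ⟨τ, hτ0, hτm, ⟨m, hm⟩, hτ⟩ := exists_monotone_Icc_subset_open_cover_Icc hab
    (c := fun c : B.Chart => (Icc a b).domRestrict g ⁻¹' c.total.source)
    (fun c => c.total.open_source.preimage hgr) (fun t _ => by
      obtain ⟨c, hc⟩ := B.exists_chart (g t)
      exact mem_iUnion.2 ⟨c, hc⟩)
  have key : ∀ k : ℕ, ∃ c : B.Chart, ∀ t ∈ Icc a (τ k : ℝ), g t ∈ c.total.source := by
    intro k
    induction k with
    | zero =>
      obtain ⟨c, hc⟩ := B.exists_chart (g a)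
      refine ⟨c, fun t ht => ?_⟩
      rw [hτ0] at ht
      rwa [le_antisymm ht.2 ht.1]
    | succ k ih =>
      obtain ⟨c₁, h₁⟩ := ih
      obtain ⟨c₂, h₂⟩ := hτ k
      have hsub : Icc a (τ (k + 1) : ℝ) ⊆ Icc a b := Icc_subset_Icc_right (τ (k + 1)).2.2
      refine Chart.exists_glue c₁ c₂ (τ k).2.1 (hτm (Nat.le_succ k)) (hg.mono hsub)
        (fun t ht => hgt t (hsub ht)) h₁ fun t ht => ?_
      exact h₂ (a := ⟨t, (τ k).2.1.trans ht.1, ht.2.trans (τ (k + 1)).2.2⟩) ⟨ht.1, ht.2⟩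
  obtain ⟨c, hc⟩ := key m
  rw [hm m le_rfl] at hc
  exact ⟨c, hc⟩

end ConstrainedSystem

end ConstrainedVariation

/-! ### Differentials in charts -/

section ChartDerivative

variable {X : Type*} [NormedAddCommGroup X] [NormedSpace ℝ X]
  {M : Type*} [TopologicalSpace M] [ChartedSpace X M] [IsManifold 𝓘(ℝ, X) ∞ M]
  {X' : Type*} [NormedAddCommGroup X'] [NormedSpace ℝ X']
  {M' : Type*} [TopologicalSpace M'] [ChartedSpace X' M']

theorem mdifferentiableAt_chart {e : OpenPartialHomeomorph M X}
    (he : e ∈ IsManifold.maximalAtlas 𝓘(ℝ, X) ∞ M) {x : M} (hx : x ∈ e.source) :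
    MDifferentiableAt 𝓘(ℝ, X) 𝓘(ℝ, X) e x :=
  (contMDiffAt_of_mem_maximalAtlas he hx).mdifferentiableAt (by simp)

theorem mdifferentiableAt_chart_symm {e : OpenPartialHomeomorph M X}
    (he : e ∈ IsManifold.maximalAtlas 𝓘(ℝ, X) ∞ M) {y : X} (hy : y ∈ e.target) :
    MDifferentiableAt 𝓘(ℝ, X) 𝓘(ℝ, X) e.symm y :=
  (contMDiffAt_symm_of_mem_maximalAtlas he hy).mdifferentiableAt (by simp)

/-- The differential of a map in a chart of its domain. -/
theorem mfderiv_eq_mfderiv_comp_symm {e : OpenPartialHomeomorph M X}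
    (he : e ∈ IsManifold.maximalAtlas 𝓘(ℝ, X) ∞ M) {x : M} (hx : x ∈ e.source) {f : M → M'}
    (hf : MDifferentiableAt 𝓘(ℝ, X) 𝓘(ℝ, X') f x) (v : TangentSpace 𝓘(ℝ, X) x) :
    (mfderiv 𝓘(ℝ, X) 𝓘(ℝ, X') f x v : X')
      = mfderiv 𝓘(ℝ, X) 𝓘(ℝ, X') (f ∘ e.symm) (e x) (mfderiv 𝓘(ℝ, X) 𝓘(ℝ, X) e x v) := by
  have hy := e.map_source hx
  have h1 : (f ∘ e.symm) ∘ e =ᶠ[𝓝 x] f := by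
    filter_upwards [e.open_source.mem_nhds hx] with y hy
    simp [e.left_inv hy]
  have h2 : MDifferentiableAt 𝓘(ℝ, X) 𝓘(ℝ, X') (f ∘ e.symm) (e x) := by
    refine MDifferentiableAt.comp (I' := 𝓘(ℝ, X)) _ ?_ (mdifferentiableAt_chart_symm he hy)
    rwa [e.left_inv hx]
  have h3 := h2.hasMFDerivAt.comp x (mdifferentiableAt_chart he hx).hasMFDerivAt
  have h4 := (h3.congr_of_eventuallyEq h1.symm).mfderiv
  exact congrArg (fun L : X →L[ℝ] X' => L v) h4

theorem mfderiv_eq_fderiv_comp_symm {e : OpenPartialHomeomorph M X}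
    (he : e ∈ IsManifold.maximalAtlas 𝓘(ℝ, X) ∞ M) {x : M} (hx : x ∈ e.source) {f : M → X'}
    (hf : MDifferentiableAt 𝓘(ℝ, X) 𝓘(ℝ, X') f x) (v : TangentSpace 𝓘(ℝ, X) x) :
    (mfderiv 𝓘(ℝ, X) 𝓘(ℝ, X') f x v : X')
      = fderiv ℝ (f ∘ e.symm) (e x) (mfderiv 𝓘(ℝ, X) 𝓘(ℝ, X) e x v : X) := by
  rw [mfderiv_eq_mfderiv_comp_symm he hx hf v, mfderiv_eq_fderiv]
  rfl

theorem mfderiv_symm_mfderiv_chart {e : OpenPartialHomeomorph M X}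
    (he : e ∈ IsManifold.maximalAtlas 𝓘(ℝ, X) ∞ M) {x : M} (hx : x ∈ e.source)
    (v : TangentSpace 𝓘(ℝ, X) x) :
    (mfderiv 𝓘(ℝ, X) 𝓘(ℝ, X) e.symm (e x) (mfderiv 𝓘(ℝ, X) 𝓘(ℝ, X) e x v) : X) = v := by
  have h := mfderiv_eq_mfderiv_comp_symm he hx (f := id) mdifferentiableAt_id v
  rw [mfderiv_id] at h
  exact h.symm

theorem mfderiv_chart_mfderiv_symm {e : OpenPartialHomeomorph M X}
    (he : e ∈ IsManifold.maximalAtlas 𝓘(ℝ, X) ∞ M) {x : M} (hx : x ∈ e.source) (v : X) :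
    (mfderiv 𝓘(ℝ, X) 𝓘(ℝ, X) e x (mfderiv 𝓘(ℝ, X) 𝓘(ℝ, X) e.symm (e x) v : X) : X) = v := by
  have hy := e.map_source hx
  have h1 : e ∘ e.symm =ᶠ[𝓝 (e x)] id := by
    filter_upwards [e.open_target.mem_nhds hy] with y hy
    simp [e.right_inv hy]
  have h2 : ∀ x', x' = x → HasMFDerivAt 𝓘(ℝ, X) 𝓘(ℝ, X) e x'
      (mfderiv 𝓘(ℝ, X) 𝓘(ℝ, X) e x : X →L[ℝ] X) := by
    rintro x' rfl
    exact (mdifferentiableAt_chart he hx).hasMFDerivAt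
  have h3 := (h2 _ (e.left_inv hx)).comp (e x) (mdifferentiableAt_chart_symm he hy).hasMFDerivAt
  have h4 := (h3.congr_of_eventuallyEq h1.symm).mfderiv
  rw [mfderiv_id] at h4
  exact (congrArg (fun L : X →L[ℝ] X => L v) h4).symm

/-- Transformation of the components of a tangent vector under a change of coordinates. -/
theorem mfderiv_chart_transition {e e' : OpenPartialHomeomorph M X}
    (he : e ∈ IsManifold.maximalAtlas 𝓘(ℝ, X) ∞ M)
    (he' : e' ∈ IsManifold.maximalAtlas 𝓘(ℝ, X) ∞ M) {x : M} (hx : x ∈ e.source)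
    (hx' : x ∈ e'.source) (v : TangentSpace 𝓘(ℝ, X) x) :
    (mfderiv 𝓘(ℝ, X) 𝓘(ℝ, X) e' x v : X)
      = fderiv ℝ (e' ∘ e.symm) (e x) (mfderiv 𝓘(ℝ, X) 𝓘(ℝ, X) e x v : X) :=
  mfderiv_eq_fderiv_comp_symm he hx (mdifferentiableAt_chart he' hx') v

theorem contDiffAt_comp_chart_symm {e : OpenPartialHomeomorph M X}
    (he : e ∈ IsManifold.maximalAtlas 𝓘(ℝ, X) ∞ M) {x : M} (hx : x ∈ e.source) {f : M → X'}
    {k : ℕ∞} (hf : ContMDiffAt 𝓘(ℝ, X) 𝓘(ℝ, X') k f x) : ContDiffAt ℝ k (f ∘ e.symm) (e x) := by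
  rw [← contMDiffAt_iff_contDiffAt]
  refine ContMDiffAt.comp (e x) (I' := 𝓘(ℝ, X)) ?_
    ((contMDiffAt_symm_of_mem_maximalAtlas he (e.map_source hx)).of_le (by exact_mod_cast le_top))
  rwa [e.left_inv hx]

end ChartDerivative

namespace ConstrainedVariation

variable {n r : ℕ} {V A : Type*}
  [TopologicalSpace V] [ChartedSpace (EventModel n) V] [IsManifold 𝓘(ℝ, EventModel n) ∞ V]
  [TopologicalSpace A] [ChartedSpace (VelocityModel n r) A]
  [IsManifold 𝓘(ℝ, VelocityModel n r) ∞ A]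

namespace ConstrainedSystem

variable {B : ConstrainedSystem n r V A}

namespace Chart

variable (c : B.Chart)

/-- The components `(dt, dq^i)` of a tangent vector of `V`. -/
noncomputable def baseComp (x : V) : TangentSpace 𝓘(ℝ, EventModel n) x →L[ℝ] EventModel n :=
  mfderiv 𝓘(ℝ, EventModel n) 𝓘(ℝ, EventModel n) c.base x

/-- The tangent vector of `V` with given components. -/
noncomputable def baseVec (x : V) : EventModel n →L[ℝ] TangentSpace 𝓘(ℝ, EventModel n) x :=
  mfderiv 𝓘(ℝ, EventModel n) 𝓘(ℝ, EventModel n) c.base.symm (c.base x)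

/-- The tangent vector of `A` with given components. -/
noncomputable def totalVec (a : A) :
    VelocityModel n r →L[ℝ] TangentSpace 𝓘(ℝ, VelocityModel n r) a :=
  mfderiv 𝓘(ℝ, VelocityModel n r) 𝓘(ℝ, VelocityModel n r) c.total.symm (c.total a)

theorem baseVec_baseComp {x : V} (hx : x ∈ c.base.source)
    (v : TangentSpace 𝓘(ℝ, EventModel n) x) : c.baseVec x (c.baseComp x v) = v :=
  mfderiv_symm_mfderiv_chart c.base_mem hx v

theorem baseComp_baseVec {x : V} (hx : x ∈ c.base.source) (v : EventModel n) :
    c.baseComp x (c.baseVec x v) = v :=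
  mfderiv_chart_mfderiv_symm c.base_mem hx v

theorem comp_totalVec {a : A} (ha : a ∈ c.total.source) (v : VelocityModel n r) :
    c.comp a (c.totalVec a v) = v :=
  mfderiv_chart_mfderiv_symm c.total_mem ha v

theorem baseComp_injective {x : V} (hx : x ∈ c.base.source) :
    Function.Injective (c.baseComp x) :=
  Function.LeftInverse.injective (c.baseVec_baseComp hx)

theorem diff_time {x : V} (hx : x ∈ c.base.source) (v : TangentSpace 𝓘(ℝ, EventModel n) x) :
    diff B.time x v = (c.baseComp x v).1 := by
  have h := mfderiv_eq_fderiv_comp_symm c.base_mem hx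
    ((B.time_smooth x).mdifferentiableAt (by simp)) v
  have h1 : B.time ∘ c.base.symm =ᶠ[𝓝 (c.base x)] Prod.fst := by
    filter_upwards [c.base.open_target.mem_nhds (c.base.map_source hx)] with y hy
    rw [Function.comp_apply, ← c.base_time _ (c.base.map_target hy), c.base.right_inv hy]
  rw [h1.fderiv_eq, fderiv_fst] at h
  exact h

theorem baseComp_vel {a : A} (ha : a ∈ c.total.source) :
    c.baseComp (B.proj a) (B.vel a) = (1, c.psi (c.total a)) := by
  refine Prod.ext ?_ ?_
  · rw [← c.diff_time (c.mapsTo ha), B.vel_time]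
  · rw [psi, c.total.left_inv ha]
    rfl

theorem baseComp_transition (c₁ c₂ : B.Chart) {x : V} (h₁ : x ∈ c₁.base.source)
    (h₂ : x ∈ c₂.base.source) (v : TangentSpace 𝓘(ℝ, EventModel n) x) :
    c₂.baseComp x v = fderiv ℝ (c₂.base ∘ c₁.base.symm) (c₁.base x) (c₁.baseComp x v) :=
  mfderiv_chart_transition c₁.base_mem c₂.base_mem h₁ h₂ v

theorem comp_transition (c₁ c₂ : B.Chart) {a : A} (h₁ : a ∈ c₁.total.source)
    (h₂ : a ∈ c₂.total.source) (v : TangentSpace 𝓘(ℝ, VelocityModel n r) a) :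
    c₂.comp a v = fderiv ℝ (c₂.total ∘ c₁.total.symm) (c₁.total a) (c₁.comp a v) :=
  mfderiv_chart_transition c₁.total_mem c₂.total_mem h₁ h₂ v

/-- Transformation law of the functions `ψ^i`. -/
theorem psi_transition (c₁ c₂ : B.Chart) {a : A} (h₁ : a ∈ c₁.total.source)
    (h₂ : a ∈ c₂.total.source) :
    c₂.psi (c₂.total a) = (fderiv ℝ (c₂.base ∘ c₁.base.symm) (c₁.base (B.proj a))
      (1, c₁.psi (c₁.total a))).2 := by
  rw [← c₁.baseComp_vel h₁, ← baseComp_transition c₁ c₂ (c₁.mapsTo h₁) (c₂.mapsTo h₂),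
    c₂.baseComp_vel h₂]

theorem contDiffOn_psi : ContDiffOn ℝ ∞ c.psi c.total.target := by
  have h1 : ContMDiffOn (𝓘(ℝ, EventModel n)).tangent (𝓘(ℝ, EventModel n)).tangent ∞
      (tangentMapWithin 𝓘(ℝ, EventModel n) 𝓘(ℝ, EventModel n) c.base c.base.source)
      (Bundle.TotalSpace.proj ⁻¹' c.base.source) :=
    (contMDiffOn_of_mem_maximalAtlas c.base_mem).contMDiffOn_tangentMapWithin (by simp)
      c.base.open_source.uniqueMDiffOn
  have h2 : ContMDiffOn 𝓘(ℝ, VelocityModel n r) (𝓘(ℝ, EventModel n)).tangent ∞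
      (fun y => (⟨B.proj (c.total.symm y), B.vel (c.total.symm y)⟩ :
        TangentBundle 𝓘(ℝ, EventModel n) V)) c.total.target :=
    B.vel_embedding.contMDiff.comp_contMDiffOn
      (contMDiffOn_symm_of_mem_maximalAtlas c.total_mem)
  have h3 := h1.comp h2 fun y hy => c.mapsTo (c.total.map_target hy)
  have h4 := (contMDiff_snd_tangentBundle_modelSpace (EventModel n)
    𝓘(ℝ, EventModel n)).comp_contMDiffOn h3
  have h5 := (contMDiffOn_iff_contDiffOn.1 h4).snd
  refine h5.congr fun y hy => ?_
  have h6 : mfderivWithin 𝓘(ℝ, EventModel n) 𝓘(ℝ, EventModel n) c.base c.base.source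
      (B.proj (c.total.symm y)) = mfderiv 𝓘(ℝ, EventModel n) 𝓘(ℝ, EventModel n) c.base
      (B.proj (c.total.symm y)) :=
    mfderivWithin_of_mem_nhds (c.base.open_source.mem_nhds (c.mapsTo (c.total.map_target hy)))
  exact congrArg (fun L : EventModel n →L[ℝ] EventModel n => (L (B.vel (c.total.symm y))).2) h6.symm

/-- The components of a covector of `V` on the fibres, as a linear form. -/
noncomputable def momL (x : V) (σ : TangentSpace 𝓘(ℝ, EventModel n) x →L[ℝ] ℝ) :
    (Fin n → ℝ) →L[ℝ] ℝ :=
  σ ∘L c.baseVec x ∘L ContinuousLinearMap.inr ℝ ℝ (Fin n → ℝ)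

theorem momL_apply (x : V) (σ : TangentSpace 𝓘(ℝ, EventModel n) x →L[ℝ] ℝ) (y : Fin n → ℝ) :
    c.momL x σ y = σ (c.baseVec x (0, y)) := rfl

theorem momL_single (x : V) (σ : TangentSpace 𝓘(ℝ, EventModel n) x →L[ℝ] ℝ) (i : Fin n) :
    c.momL x σ (Pi.single i 1) = c.mom x σ i := rfl

theorem sum_mom_mul (x : V) (σ : TangentSpace 𝓘(ℝ, EventModel n) x →L[ℝ] ℝ) (y : Fin n → ℝ) :
    ∑ k, c.mom x σ k * y k = c.momL x σ y := by
  conv_rhs => rw [pi_eq_sum_univ' y, map_sum]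
  refine Finset.sum_congr rfl fun k _ => ?_
  rw [map_smul, ← momL_single, smul_eq_mul, mul_comm]

/-- A covector which annihilates the velocity is determined by its components on the fibres. -/
theorem apply_of_contact {a : A} (ha : a ∈ c.total.source)
    {σ : TangentSpace 𝓘(ℝ, EventModel n) (B.proj a) →L[ℝ] ℝ} (hσ : σ (B.vel a) = 0)
    (v : TangentSpace 𝓘(ℝ, EventModel n) (B.proj a)) :
    σ v = c.momL (B.proj a) σ ((c.baseComp (B.proj a) v).2
      - (c.baseComp (B.proj a) v).1 • c.psi (c.total a)) := by
  have h2 : c.baseComp (B.proj a) (v - (c.baseComp (B.proj a) v).1 • B.vel a)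
      = (0, (c.baseComp (B.proj a) v).2
      - (c.baseComp (B.proj a) v).1 • c.psi (c.total a)) := by
    rw [map_sub, map_smul, c.baseComp_vel ha]
    ext <;> simp
  have h3 : σ v = σ (v - (c.baseComp (B.proj a) v).1 • B.vel a) := by
    rw [map_sub, map_smul, hσ, smul_zero, sub_zero]
  rw [h3, ← c.baseVec_baseComp (c.mapsTo ha) (v - _), h2, momL_apply]

/-- The contact covector `π_i (dq^i - ψ^i dt)` at `a` with given components `π_i`. -/
noncomputable def contactForm (a : A) (π : (Fin n → ℝ) →L[ℝ] ℝ) :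
    TangentSpace 𝓘(ℝ, EventModel n) (B.proj a) →L[ℝ] ℝ :=
  π ∘L (ContinuousLinearMap.snd ℝ ℝ (Fin n → ℝ)
    - (ContinuousLinearMap.fst ℝ ℝ (Fin n → ℝ)).smulRight (c.psi (c.total a))) ∘L
    c.baseComp (B.proj a)

theorem contactForm_apply (a : A) (π : (Fin n → ℝ) →L[ℝ] ℝ)
    (v : TangentSpace 𝓘(ℝ, EventModel n) (B.proj a)) :
    c.contactForm a π v = π ((c.baseComp (B.proj a) v).2
      - (c.baseComp (B.proj a) v).1 • c.psi (c.total a)) := rfl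

theorem contactForm_vel {a : A} (ha : a ∈ c.total.source) (π : (Fin n → ℝ) →L[ℝ] ℝ) :
    c.contactForm a π (B.vel a) = 0 := by
  rw [contactForm_apply, c.baseComp_vel ha]
  simp

/-- The components of a contact form in another chart. -/
theorem momL_contactForm (c₁ c₂ : B.Chart) {a : A} (h₁ : a ∈ c₁.total.source)
    (h₂ : a ∈ c₂.total.source) (π : (Fin n → ℝ) →L[ℝ] ℝ) (e : Fin n → ℝ) :
    c₂.momL (B.proj a) (c₁.contactForm a π) e
      = π (fderiv ℝ (c₁.base ∘ c₂.base.symm) (c₂.base (B.proj a)) (0, e)).2 := by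
  rw [momL_apply, contactForm_apply, baseComp_transition c₂ c₁ (c₂.mapsTo h₂) (c₁.mapsTo h₁),
    baseComp_baseVec _ (c₂.mapsTo h₂),
    fderiv_transition_fst c₂.base_mem c₁.base_mem c₂.base_time c₁.base_time
    (c₂.mapsTo h₂) (c₁.mapsTo h₁), zero_smul, sub_zero]

end Chart

end ConstrainedSystem

end ConstrainedVariation

/-! ### Covariance of the linearized equations -/

section Calculus

variable {E E' F F' : Type*} [NormedAddCommGroup E] [NormedSpace ℝ E]
  [NormedAddCommGroup E'] [NormedSpace ℝ E'] [NormedAddCommGroup F] [NormedSpace ℝ F]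
  [NormedAddCommGroup F'] [NormedSpace ℝ F']

theorem two_le_infty : (2 : WithTop ℕ∞) ≤ ∞ := WithTop.coe_le_coe.2 le_top

theorem fderiv_fderiv_apply {f : E → F} {p : E} (hf : ContDiffAt ℝ 2 f p) (v d : E) :
    fderiv ℝ (fun y => fderiv ℝ f y d) p v = fderiv ℝ (fderiv ℝ f) p v d := by
  have h : DifferentiableAt ℝ (fderiv ℝ f) p :=
    (hf.fderiv_right (m := 1) (by norm_num)).differentiableAt (by simp)
  have h1 := (h.hasFDerivAt.clm_apply (hasFDerivAt_const d p)).fderiv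
  have h2 := congrArg (fun L : E →L[ℝ] F => L v) h1
  simpa using h2

theorem fderiv_fderiv_symm {f : E → F} {p : E} (hf : ContDiffAt ℝ 2 f p) (v d : E) :
    fderiv ℝ (fderiv ℝ f) p v d = fderiv ℝ (fderiv ℝ f) p d v :=
  hf.isSymmSndFDerivAt (by simp) v d

/-- The Hessian of a function at a critical point is a tensor. -/
theorem fderiv_fderiv_comp_of_fderiv_eq_zero {f : E' → ℝ} {φ : E → E'} {f' : E → ℝ} {p : E}
    (hφ : ContDiffAt ℝ 2 φ p) (hf : ContDiffAt ℝ 2 f (φ p)) (h0 : fderiv ℝ f (φ p) = 0)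
    (hf' : f' =ᶠ[𝓝 p] f ∘ φ) (v d : E) :
    fderiv ℝ (fderiv ℝ f') p v d
      = fderiv ℝ (fderiv ℝ f) (φ p) (fderiv ℝ φ p v) (fderiv ℝ φ p d) := by
  have h1 : fderiv ℝ f' =ᶠ[𝓝 p] fun y => fderiv ℝ f (φ y) ∘L fderiv ℝ φ y := by
    have hf1 := hf.eventually (by simp)
    have hφ1 := hφ.eventually (by simp)
    filter_upwards [hf'.fderiv (𝕜 := ℝ), hφ.continuousAt.eventually hf1, hφ1] with y hy hy1 hy2
    rw [hy]
    exact fderiv_comp y (hy1.differentiableAt (by simp)) (hy2.differentiableAt (by simp))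
  rw [h1.fderiv_eq]
  have h2 : HasFDerivAt (fderiv ℝ f) (fderiv ℝ (fderiv ℝ f) (φ p)) (φ p) :=
    ((hf.fderiv_right (m := 1) (by norm_num)).differentiableAt (by simp)).hasFDerivAt
  have h3 : HasFDerivAt (fderiv ℝ φ) (fderiv ℝ (fderiv ℝ φ) p) p :=
    ((hφ.fderiv_right (m := 1) (by norm_num)).differentiableAt (by simp)).hasFDerivAt
  have h4 := (h2.comp p (hφ.differentiableAt (by simp)).hasFDerivAt).clm_comp h3
  have h5 := congrArg (fun L : E →L[ℝ] E →L[ℝ] ℝ => L v d) h4.fderiv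
  refine h5.trans ?_
  simp [h0]

/-- The derivative, in the directions of the fibres, of the transformation law `ψ₂(φ(Y)) = Dκ(1, ψ₁(Y))` of the functions `ψ`. -/
theorem fderiv_transition_law {κ : ℝ × E → ℝ × E'} {φ : ℝ × E × F → ℝ × E' × F'}
    {ψ₁ : ℝ × E × F → E} {ψ₂ : ℝ × E' × F' → E'} {w : ℝ × E × F}
    (hκ : ContDiffAt ℝ 2 κ (w.1, w.2.1)) (hφ : DifferentiableAt ℝ φ w)
    (h₁ : DifferentiableAt ℝ ψ₁ w) (h₂ : DifferentiableAt ℝ ψ₂ (φ w))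
    (h : (fun Y => ψ₂ (φ Y)) =ᶠ[𝓝 w] fun Y => (fderiv ℝ κ (Y.1, Y.2.1) (1, ψ₁ Y)).2) (e : E)
    (u : F) :
    fderiv ℝ ψ₂ (φ w) (fderiv ℝ φ w (0, e, u))
      = (fderiv ℝ (fderiv ℝ κ) (w.1, w.2.1) (0, e) (1, ψ₁ w)).2
        + (fderiv ℝ κ (w.1, w.2.1) (0, fderiv ℝ ψ₁ w (0, e, u))).2 := by
  have hk : HasFDerivAt (fderiv ℝ κ) (fderiv ℝ (fderiv ℝ κ) (w.1, w.2.1)) (w.1, w.2.1) :=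
    ((hκ.fderiv_right (m := 1) (by norm_num)).differentiableAt (by simp)).hasFDerivAt
  have hpr : HasFDerivAt (fun Y : ℝ × E × F => ((Y.1, Y.2.1) : ℝ × E))
      ((ContinuousLinearMap.fst ℝ ℝ (E × F)).prod
        (ContinuousLinearMap.fst ℝ E F ∘L ContinuousLinearMap.snd ℝ ℝ (E × F))) w :=
    ((ContinuousLinearMap.fst ℝ ℝ (E × F)).prod
        (ContinuousLinearMap.fst ℝ E F ∘L ContinuousLinearMap.snd ℝ ℝ (E × F))).hasFDerivAt
  have h3 := HasFDerivAt.comp (g := fderiv ℝ κ) (f := fun Y : ℝ × E × F => ((Y.1, Y.2.1) : ℝ × E))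
    w hk hpr
  have h4 : HasFDerivAt (fun Y => ((1, ψ₁ Y) : ℝ × E))
      ((0 : ℝ × E × F →L[ℝ] ℝ).prod (fderiv ℝ ψ₁ w)) w :=
    (hasFDerivAt_const (1 : ℝ) w).prodMk h₁.hasFDerivAt
  have h5 := (ContinuousLinearMap.snd ℝ ℝ E').hasFDerivAt.comp w (h3.clm_apply h4)
  have h6 := (h₂.hasFDerivAt.comp w hφ.hasFDerivAt).congr_of_eventuallyEq h.symm
  have h7 := congrArg (fun L : ℝ × E × F →L[ℝ] E' => L (0, e, u)) (h6.unique h5)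
  simpa [add_comm] using h7

/-- The derivative along a curve of the image of a vector field under a change of coordinates. -/
theorem hasDerivWithinAt_fderiv_comp {κ : ℝ × E → ℝ × E'} {b : ℝ → ℝ × E} {b' : ℝ × E}
    {y : ℝ → E} {y' : E} {s : Set ℝ} {t : ℝ} (hκ : ContDiffAt ℝ 2 κ (b t))
    (hb : HasDerivWithinAt b b' s t) (hy : HasDerivWithinAt y y' s t) :
    HasDerivWithinAt (fun τ => (fderiv ℝ κ (b τ) (0, y τ)).2)
      ((fderiv ℝ (fderiv ℝ κ) (b t) (0, y t) b').2 + (fderiv ℝ κ (b t) (0, y')).2) s t := by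
  have hk : HasFDerivAt (fderiv ℝ κ) (fderiv ℝ (fderiv ℝ κ) (b t)) (b t) :=
    ((hκ.fderiv_right (m := 1) (by norm_num)).differentiableAt (by simp)).hasFDerivAt
  have h1 := hk.comp_hasDerivWithinAt t hb
  have h2 := h1.clm_apply ((hasDerivWithinAt_const t s (0 : ℝ)).prodMk hy)
  have h3 := (ContinuousLinearMap.snd ℝ ℝ E').hasFDerivAt.comp_hasDerivWithinAt t h2
  refine h3.congr_deriv ?_
  rw [fderiv_fderiv_symm hκ]
  simp

theorem hasDerivWithinAt_clm_pi {ι : Type*} [Fintype ι] [DecidableEq ι]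
    {f : ℝ → (ι → ℝ) →L[ℝ] ℝ} {f' : (ι → ℝ) →L[ℝ] ℝ} {s : Set ℝ} {t : ℝ}
    (h : ∀ i, HasDerivWithinAt (fun τ => f τ (Pi.single i 1)) (f' (Pi.single i 1)) s t) :
    HasDerivWithinAt f f' s t := by
  have hrep : ∀ L : (ι → ℝ) →L[ℝ] ℝ, L = ∑ i, L (Pi.single i 1) •
      (ContinuousLinearMap.proj i : (ι → ℝ) →L[ℝ] ℝ) := by
    intro L
    ext x
    conv_lhs => rw [pi_eq_sum_univ' x, map_sum]
    simp [mul_comm]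
  have h1 : HasDerivWithinAt (fun τ => ∑ i, f τ (Pi.single i 1) •
      (ContinuousLinearMap.proj i : (ι → ℝ) →L[ℝ] ℝ)) (∑ i, f' (Pi.single i 1) •
      (ContinuousLinearMap.proj i : (ι → ℝ) →L[ℝ] ℝ)) s t :=
    HasDerivWithinAt.fun_sum fun i _ => (h i).smul_const _
  rw [← hrep f'] at h1
  exact h1.congr (fun τ _ => hrep (f τ)) (hrep (f t))

end Calculus

namespace ConstrainedVariation

variable {n r : ℕ} {V A : Type*}
  [TopologicalSpace V] [ChartedSpace (EventModel n) V] [IsManifold 𝓘(ℝ, EventModel n) ∞ V]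
  [TopologicalSpace A] [ChartedSpace (VelocityModel n r) A]
  [IsManifold 𝓘(ℝ, VelocityModel n r) ∞ A]

namespace ConstrainedSystem

variable {B : ConstrainedSystem n r V A}

namespace Chart

theorem differentiableAt_psi (c : B.Chart) {a : A} (ha : a ∈ c.total.source) :
    DifferentiableAt ℝ c.psi (c.total a) :=
  (c.contDiffOn_psi.contDiffAt (c.total.open_target.mem_nhds (c.total.map_source ha))).differentiableAt
    (by simp)

/-- Transformation law of the first derivatives of the functions `ψ^i`. -/
theorem fderiv_psi_transition (c₁ c₂ : B.Chart) {a : A} (h₁ : a ∈ c₁.total.source)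
    (h₂ : a ∈ c₂.total.source) (e : Fin n → ℝ) (u : Fin r → ℝ) :
    fderiv ℝ c₂.psi (c₂.total a)
        (fderiv ℝ (c₂.total ∘ c₁.total.symm) (c₁.total a) (0, e, u))
      = (fderiv ℝ (fderiv ℝ (c₂.base ∘ c₁.base.symm)) (c₁.base (B.proj a)) (0, e)
          (1, c₁.psi (c₁.total a))).2
        + (fderiv ℝ (c₂.base ∘ c₁.base.symm) (c₁.base (B.proj a))
          (0, fderiv ℝ c₁.psi (c₁.total a) (0, e, u))).2 := by
  have hb : c₁.base (B.proj a) = ((c₁.total a).1, (c₁.total a).2.1) := (c₁.projTQ_total h₁).symm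
  have hφa : (c₂.total ∘ c₁.total.symm) (c₁.total a) = c₂.total a := by simp [c₁.total.left_inv h₁]
  have hκ := c₁.base.contDiffAt_comp_symm c₁.base_mem c₂.base_mem (c₁.mapsTo h₁) (c₂.mapsTo h₂)
  have hφ := (c₁.total.contDiffAt_comp_symm c₁.total_mem c₂.total_mem h₁ h₂).differentiableAt
    (by simp)
  have h2 := c₂.differentiableAt_psi h₂
  rw [hb] at hκ ⊢
  rw [← hφa] at h2 ⊢
  refine fderiv_transition_law (hκ.of_le two_le_infty) hφ
    (c₁.differentiableAt_psi h₁) h2 ?_ e u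
  have hc : ContinuousAt c₁.total.symm (c₁.total a) :=
    c₁.total.continuousAt_symm (c₁.total.map_source h₁)
  filter_upwards [c₁.total.open_target.mem_nhds (c₁.total.map_source h₁), hc.preimage_mem_nhds
      (by rw [c₁.total.left_inv h₁]; exact c₂.total.open_source.mem_nhds h₂)] with y hy hy2
  have hy1 := c₁.total.map_target hy
  have h3 := psi_transition c₁ c₂ hy1 hy2
  rw [← c₁.projTQ_total hy1, c₁.total.right_inv hy] at h3
  exact h3

end Chart

variable {t₀ t₁ : ℝ} {g : ℝ → A}

theorem IsAdmissible.hasDerivWithinAt_base (hg : B.IsAdmissible t₀ t₁ g) (c : B.Chart) {t : ℝ}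
    (ht : t ∈ Icc t₀ t₁) (hc : g t ∈ c.total.source) :
    HasDerivWithinAt (fun s => c.base (B.proj (g s))) (1, c.psi (c.total (g t)))
      (Icc t₀ t₁) t := by
  have h1 : ContMDiffWithinAt 𝓘(ℝ, ℝ) 𝓘(ℝ, EventModel n) ∞ (fun s => B.proj (g s))
      (Icc t₀ t₁) t :=
    (B.proj_smooth.contMDiffAt).comp_contMDiffWithinAt t (hg.smooth t ht)
  have h2 := (h1.mdifferentiableWithinAt (by simp)).hasMFDerivWithinAt
  have h3 := HasMFDerivAt.comp_hasMFDerivWithinAt t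
    (mdifferentiableAt_chart c.base_mem (c.mapsTo hc)).hasMFDerivAt h2
  have h4 : HasFDerivWithinAt (fun s => c.base (B.proj (g s)))
      (c.baseComp (B.proj (g t)) ∘L mfderivWithin 𝓘(ℝ, ℝ) 𝓘(ℝ, EventModel n)
        (fun s => B.proj (g s)) (Icc t₀ t₁) t : ℝ →L[ℝ] EventModel n) (Icc t₀ t₁) t :=
    hasMFDerivWithinAt_iff_hasFDerivWithinAt.1 h3
  refine h4.hasDerivWithinAt.congr_deriv ?_
  rw [← c.baseComp_vel hc, ← hg.lift t ht]
  rfl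

theorem IsAdmissible.eventually_mem (hg : B.IsAdmissible t₀ t₁ g) (c : B.Chart) {t : ℝ}
    (ht : t ∈ Icc t₀ t₁) (hc : g t ∈ c.total.source) {s₀ s₁ : ℝ} (hs : Icc s₀ s₁ ⊆ Icc t₀ t₁) :
    ∀ᶠ s in 𝓝[Icc s₀ s₁] t, g s ∈ c.total.source :=
  ((hg.smooth.continuousOn t ht).mono hs).preimage_mem_nhdsWithin
    (c.total.open_source.mem_nhds hc)

/-- If a field of contact forms with components `ϖ` solves the adjoint linearized equations with
right-hand side `lam` in one chart, it does so in all charts. -/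
theorem IsAdmissible.adjoint_covariant (hg : B.IsAdmissible t₀ t₁ g) (c c' : B.Chart) {s₀ s₁ : ℝ}
    (hs : Icc s₀ s₁ ⊆ Icc t₀ t₁) (hcs : ∀ t ∈ Icc s₀ s₁, g t ∈ c.total.source) {t : ℝ}
    (ht : t ∈ Icc s₀ s₁) (hc' : g t ∈ c'.total.source)
    {ϖ : ℝ → (Fin n → ℝ) →L[ℝ] ℝ} {ϖ' : (Fin n → ℝ) →L[ℝ] ℝ} {lam : VelocityModel n r →L[ℝ] ℝ}
    (hϖ : HasDerivWithinAt ϖ ϖ' (Icc s₀ s₁) t)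
    (h : ∀ x u, ϖ' x + ϖ t (fderiv ℝ c.psi (c.total (g t)) (0, x, u)) = lam (0, x, u)) :
    (∀ e, HasDerivWithinAt (fun s => c'.momL (B.proj (g s)) (c.contactForm (g s) (ϖ s)) e)
      (lam (fderiv ℝ (c.total ∘ c'.total.symm) (c'.total (g t)) (0, e, 0))
        - c'.momL (B.proj (g t)) (c.contactForm (g t) (ϖ t))
          (fderiv ℝ c'.psi (c'.total (g t)) (0, e, 0))) (Icc s₀ s₁) t) ∧
    ∀ u, c'.momL (B.proj (g t)) (c.contactForm (g t) (ϖ t))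
        (fderiv ℝ c'.psi (c'.total (g t)) (0, 0, u))
      = lam (fderiv ℝ (c.total ∘ c'.total.symm) (c'.total (g t)) (0, 0, u)) := by
  have hc := hcs t ht
  have hκ := (c'.base.contDiffAt_comp_symm c'.base_mem c.base_mem (c'.mapsTo hc')
    (c.mapsTo hc)).of_le two_le_infty
  -- `h`, evaluated on the image of a vector tangent to the fibres over the time axis
  have key : ∀ e u, lam (fderiv ℝ (c.total ∘ c'.total.symm) (c'.total (g t)) (0, e, u))
      = ϖ' (fderiv ℝ (c.base ∘ c'.base.symm) (c'.base (B.proj (g t))) (0, e)).2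
        + ϖ t (fderiv ℝ (fderiv ℝ (c.base ∘ c'.base.symm)) (c'.base (B.proj (g t))) (0, e)
          (1, c'.psi (c'.total (g t)))).2
        + ϖ t (fderiv ℝ (c.base ∘ c'.base.symm) (c'.base (B.proj (g t)))
          (0, fderiv ℝ c'.psi (c'.total (g t)) (0, e, u))).2 := by
    intro e u
    have h1 := Chart.fderiv_projTQ_transition c' c hc' hc (0, e, u)
    have h2 := fderiv_transition_fst c'.base_mem c.base_mem c'.base_time c.base_time
      (c'.mapsTo hc') (c.mapsTo hc) (0, e)
    set D := fderiv ℝ (c.total ∘ c'.total.symm) (c'.total (g t)) (0, e, u) with hD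
    have h3 : D = (0, (fderiv ℝ (c.base ∘ c'.base.symm) (c'.base (B.proj (g t))) (0, e)).2,
        D.2.2) := by
      refine Prod.ext ?_ (Prod.ext ?_ rfl)
      · exact (congrArg Prod.fst h1).trans h2
      · exact congrArg Prod.snd h1
    have h4 := h (fderiv ℝ (c.base ∘ c'.base.symm) (c'.base (B.proj (g t))) (0, e)).2 D.2.2
    rw [← h3, hD, Chart.fderiv_psi_transition c' c hc' hc, map_add] at h4
    rw [← h4, add_assoc]
  constructor
  · intro e
    have h1 := hasDerivWithinAt_fderiv_comp (b := fun s => c'.base (B.proj (g s))) hκ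
      ((hg.hasDerivWithinAt_base c' (hs ht) hc').mono hs) (hasDerivWithinAt_const t (Icc s₀ s₁) e)
    have h2 := hϖ.clm_apply h1
    have h3 : (fun s => c'.momL (B.proj (g s)) (c.contactForm (g s) (ϖ s)) e)
        =ᶠ[𝓝[Icc s₀ s₁] t] fun s => ϖ s (fderiv ℝ (c.base ∘ c'.base.symm)
          (c'.base (B.proj (g s))) (0, e)).2 := by
      filter_upwards [hg.eventually_mem c' (hs ht) hc' hs, self_mem_nhdsWithin] with s hs1 hs2
      exact Chart.momL_contactForm c c' (hcs s hs2) hs1 _ _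
    refine (h2.congr_of_eventuallyEq h3 (h3.self_of_nhdsWithin ht)).congr_deriv ?_
    rw [key, Chart.momL_contactForm c c' hc hc', map_add]
    have h0 : ((0, (0 : Fin n → ℝ)) : EventModel n) = 0 := rfl
    rw [h0, map_zero, Prod.snd_zero, map_zero]
    ring
  · intro u
    rw [key, Chart.momL_contactForm c c' hc hc']
    have h0 : ((0, (0 : Fin n → ℝ)) : EventModel n) = 0 := rfl
    rw [h0, map_zero, map_zero]
    simp

/-- If a vector field solves the linearized equations of motion in one chart, it does so in all
charts. -/
theorem IsAdmissible.variation_covariant (hg : B.IsAdmissible t₀ t₁ g) (c c' : B.Chart)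
    (hcs : ∀ t ∈ Icc t₀ t₁, g t ∈ c.total.source) {t : ℝ}
    (ht : t ∈ Icc t₀ t₁) (hc' : g t ∈ c'.total.source)
    {X : ℝ → Fin n → ℝ} {Γ : ℝ → Fin r → ℝ}
    (hX : HasDerivWithinAt X (fderiv ℝ c.psi (c.total (g t)) (0, X t, Γ t)) (Icc t₀ t₁) t) :
    HasDerivWithinAt (fun s => (c'.comp (g s) (c.totalVec (g s) (0, X s, Γ s))).2.1)
      (fderiv ℝ c'.psi (c'.total (g t)) (c'.comp (g t) (c.totalVec (g t) (0, X t, Γ t))))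
      (Icc t₀ t₁) t := by
  have hc := hcs t ht
  have hκ := (c.base.contDiffAt_comp_symm c.base_mem c'.base_mem (c.mapsTo hc)
    (c'.mapsTo hc')).of_le two_le_infty
  have h1 := hasDerivWithinAt_fderiv_comp (b := fun s => c.base (B.proj (g s))) hκ
    (hg.hasDerivWithinAt_base c ht hc) hX
  have h3 : (fun s => (c'.comp (g s) (c.totalVec (g s) (0, X s, Γ s))).2.1)
      =ᶠ[𝓝[Icc t₀ t₁] t] fun s => (fderiv ℝ (c'.base ∘ c.base.symm)
        (c.base (B.proj (g s))) (0, X s)).2 := by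
    filter_upwards [hg.eventually_mem c' ht hc' subset_rfl, self_mem_nhdsWithin] with s hs1 hs2
    rw [Chart.comp_transition c c' (hcs s hs2) hs1, c.comp_totalVec (hcs s hs2)]
    exact congrArg Prod.snd (Chart.fderiv_projTQ_transition c c' (hcs s hs2) hs1 (0, X s, Γ s))
  refine (h1.congr_of_eventuallyEq h3 (h3.self_of_nhdsWithin ht)).congr_deriv ?_
  rw [Chart.comp_transition c c' hc hc', c.comp_totalVec hc,
    Chart.fderiv_psi_transition c c' hc hc']

end ConstrainedSystem

end ConstrainedVariation

/-! ### The Pontryagin equations in a chart -/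

section Calculus

theorem clm_pi_ext {ι G : Type*} [Fintype ι] [DecidableEq ι] [NormedAddCommGroup G]
    [NormedSpace ℝ G] {f f' : (ι → ℝ) →L[ℝ] G}
    (h : ∀ i, f (Pi.single i 1) = f' (Pi.single i 1)) : f = f' :=
  ContinuousLinearMap.coe_injective (LinearMap.pi_ext' fun i => LinearMap.ext_ring (h i))

/-- Hessians restrict to affine subspaces. -/
theorem fderiv_fderiv_comp_add {E F : Type*} [NormedAddCommGroup E] [NormedSpace ℝ E]
    [NormedAddCommGroup F] [NormedSpace ℝ F] {f : E → ℝ} {w : E} (hf : ContDiffAt ℝ 2 f w)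
    (T : F →L[ℝ] E) (v v' : F) :
    fderiv ℝ (fderiv ℝ fun z => f (w + T z)) 0 v v' = fderiv ℝ (fderiv ℝ f) w (T v) (T v') := by
  have hT : ∀ z, HasFDerivAt (fun z => w + T z) T z := fun z => T.hasFDerivAt.const_add w
  have h0 : w + T 0 = w := by simp
  have h1 : (fderiv ℝ fun z => f (w + T z)) =ᶠ[𝓝 0] fun z => fderiv ℝ f (w + T z) ∘L T := by
    have h2 := (hT 0).continuousAt.eventually
      (p := fun y => ContDiffAt ℝ 2 f y) (by simpa [h0] using hf.eventually (by simp))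
    filter_upwards [h2] with z hz
    exact (HasFDerivAt.comp (g := f) (f := fun z => w + T z) z
      (hz.differentiableAt (by simp)).hasFDerivAt (hT z)).fderiv
  rw [h1.fderiv_eq]
  have h2 : HasFDerivAt (fderiv ℝ f) (fderiv ℝ (fderiv ℝ f) w) (w + T 0) := by
    rw [h0]
    exact ((hf.fderiv_right (m := 1) (by norm_num)).differentiableAt (by simp)).hasFDerivAt
  have h3 := (HasFDerivAt.comp (g := fderiv ℝ f) (f := fun z => w + T z) 0 h2 (hT 0)).clm_comp
    (hasFDerivAt_const T (0 : F))
  have h4 := congrArg (fun L : F →L[ℝ] F →L[ℝ] ℝ => L v v') h3.fderiv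
  refine h4.trans ?_
  simp

theorem hasDerivWithinAt_fderiv_apply {E : Type*} [NormedAddCommGroup E] [NormedSpace ℝ E]
    {f : E → ℝ} {b : ℝ → E} {b' : E} {s : Set ℝ} {t : ℝ} (hf : ContDiffAt ℝ 2 f (b t))
    (hb : HasDerivWithinAt b b' s t) (d : E) :
    HasDerivWithinAt (fun τ => fderiv ℝ f (b τ) d) (fderiv ℝ (fderiv ℝ f) (b t) d b') s t := by
  have h1 : HasFDerivAt (fderiv ℝ f) (fderiv ℝ (fderiv ℝ f) (b t)) (b t) :=
    ((hf.fderiv_right (m := 1) (by norm_num)).differentiableAt (by simp)).hasFDerivAt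
  have h2 := (h1.comp_hasDerivWithinAt t hb).clm_apply (hasDerivWithinAt_const t s d)
  rw [fderiv_fderiv_symm hf]
  simpa using h2

theorem HasDerivWithinAt.clm_apply_const {E F : Type*} [NormedAddCommGroup E]
    [NormedSpace ℝ E] [NormedAddCommGroup F] [NormedSpace ℝ F] {f : ℝ → E →L[ℝ] F}
    {f' : E →L[ℝ] F} {s : Set ℝ} {t : ℝ} (h : HasDerivWithinAt f f' s t) (x : E) :
    HasDerivWithinAt (fun τ => f τ x) (f' x) s t := by
  simpa using h.clm_apply (hasDerivWithinAt_const t s x)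

/-- A function of `(t, q, z)` which vanishes along a section is critical there as soon as its
derivatives in the directions of the fibres vanish. -/
theorem fderiv_eq_zero_of_curve {E F : Type*} [NormedAddCommGroup E] [NormedSpace ℝ E]
    [NormedAddCommGroup F] [NormedSpace ℝ F] {a b : ℝ} (h01 : a < b) {ℓ : ℝ × E × F → ℝ}
    {w : ℝ → ℝ × E × F} {t : ℝ} (hℓ : DifferentiableAt ℝ ℓ (w t)) (ht : t ∈ Icc a b)
    (hw : DifferentiableWithinAt ℝ w (Icc a b) t) (hw1 : ∀ s ∈ Icc a b, (w s).1 = s)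
    (h0 : ∀ s ∈ Icc a b, ℓ (w s) = 0) (hQ : ∀ x, fderiv ℝ ℓ (w t) (0, x, 0) = 0)
    (hZ : ∀ v, fderiv ℝ ℓ (w t) (0, 0, v) = 0) : fderiv ℝ ℓ (w t) = 0 := by
  have hu := (uniqueDiffOn_Icc h01) t ht
  have hw := hw.hasDerivWithinAt
  set w' := derivWithin w (Icc a b) t
  have hT : fderiv ℝ ℓ (w t) w' = 0 :=
    hu.eq_deriv _ (hℓ.hasFDerivAt.comp_hasDerivWithinAt t hw)
      ((hasDerivWithinAt_const t (Icc a b) (0 : ℝ)).congr h0 (h0 t ht))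
  have hw'1 : w'.1 = 1 :=
    hu.eq_deriv _ ((ContinuousLinearMap.fst ℝ ℝ (E × F)).hasFDerivAt.comp_hasDerivWithinAt t hw)
      ((hasDerivWithinAt_id t _).congr hw1 (hw1 t ht))
  have hxv : ∀ x v, fderiv ℝ ℓ (w t) (0, x, v) = 0 := fun x v => by
    have : ((0, x, v) : ℝ × E × F) = (0, x, 0) + (0, 0, v) := by simp
    rw [this, map_add, hQ, hZ, add_zero]
  refine ContinuousLinearMap.ext fun y => ?_
  have : y = y.1 • w' + (0, y.2.1 - y.1 • w'.2.1, y.2.2 - y.1 • w'.2.2) := by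
    refine Prod.ext ?_ (Prod.ext ?_ ?_) <;> simp [hw'1]
  rw [this, map_add, map_smul, hT, hxv]
  simp

end Calculus

namespace ConstrainedVariation

variable {n r : ℕ} {V A : Type*}
  [TopologicalSpace V] [ChartedSpace (EventModel n) V] [IsManifold 𝓘(ℝ, EventModel n) ∞ V]
  [TopologicalSpace A] [ChartedSpace (VelocityModel n r) A]
  [IsManifold 𝓘(ℝ, VelocityModel n r) ∞ A]

namespace ConstrainedSystem

variable {B : ConstrainedSystem n r V A} {t₀ t₁ : ℝ} {g : ℝ → A}

theorem Chart.contDiffOn_rep (c : B.Chart) {L : A → ℝ}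
    (hL : ContMDiff 𝓘(ℝ, VelocityModel n r) 𝓘(ℝ, ℝ) ∞ L) :
    ContDiffOn ℝ ∞ (c.rep L) c.total.target :=
  contMDiffOn_iff_contDiffOn.1
    (hL.comp_contMDiffOn (contMDiffOn_symm_of_mem_maximalAtlas c.total_mem))

theorem Chart.momL_contactForm_self (c : B.Chart) {a : A} (h : a ∈ c.total.source)
    (π : (Fin n → ℝ) →L[ℝ] ℝ) : c.momL (B.proj a) (c.contactForm a π) = π := by
  ext e
  rw [Chart.momL_apply, Chart.contactForm_apply, c.baseComp_baseVec (c.mapsTo h)]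
  simp

theorem IsPontryaginLift.hasDerivWithinAt_momL {L : A → ℝ}
    {p : ∀ t : ℝ, TangentSpace 𝓘(ℝ, EventModel n) (B.proj (g t)) →L[ℝ] ℝ}
    (hp : B.IsPontryaginLift L t₀ t₁ g p) (c : B.Chart) {t : ℝ} (ht : t ∈ Icc t₀ t₁)
    (hc : g t ∈ c.total.source) :
    HasDerivWithinAt (fun s => c.momL (B.proj (g s)) (p s))
      (fderiv ℝ (c.rep L) (c.total (g t)) ∘L ContinuousLinearMap.inr ℝ ℝ _ ∘L
        ContinuousLinearMap.inl ℝ (Fin n → ℝ) (Fin r → ℝ)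
        - c.momL (B.proj (g t)) (p t) ∘L derivQ c.psi (c.total (g t))) (Icc t₀ t₁) t := by
  refine hasDerivWithinAt_clm_pi fun i => (hp.evolution c t ht hc i).congr_deriv ?_
  rw [Chart.sum_mom_mul]
  rfl

theorem IsPontryaginLift.momL_derivZ {L : A → ℝ}
    {p : ∀ t : ℝ, TangentSpace 𝓘(ℝ, EventModel n) (B.proj (g t)) →L[ℝ] ℝ}
    (hp : B.IsPontryaginLift L t₀ t₁ g p) (c : B.Chart) {t : ℝ} (ht : t ∈ Icc t₀ t₁)
    (hc : g t ∈ c.total.source) (v : Fin r → ℝ) :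
    c.momL (B.proj (g t)) (p t) (derivZ c.psi (c.total (g t)) v)
      = fderiv ℝ (c.rep L) (c.total (g t)) (0, 0, v) := by
  have h : c.momL (B.proj (g t)) (p t) ∘L derivZ c.psi (c.total (g t))
      = fderiv ℝ (c.rep L) (c.total (g t)) ∘L ContinuousLinearMap.inr ℝ ℝ _ ∘L
        ContinuousLinearMap.inr ℝ (Fin n → ℝ) (Fin r → ℝ) := by
    refine clm_pi_ext fun α => ?_
    have h1 := hp.critical c t ht hc α
    rw [Chart.sum_mom_mul] at h1
    exact h1
  exact congrArg (fun T : (Fin r → ℝ) →L[ℝ] ℝ => T v) h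

/-- Local normality in a chart. -/
theorem IsLocallyNormal.eq_zero (hn : B.IsLocallyNormal t₀ t₁ g) (hg : B.IsAdmissible t₀ t₁ g)
    (c : B.Chart) (hc : ∀ t ∈ Icc t₀ t₁, g t ∈ c.total.source) {s₀ s₁ : ℝ} (h₀ : t₀ ≤ s₀)
    (h : s₀ < s₁) (h₁ : s₁ ≤ t₁) {π : ℝ → (Fin n → ℝ) →L[ℝ] ℝ}
    (hπ : ∀ t ∈ Icc s₀ s₁,
      HasDerivWithinAt π (-(π t ∘L derivQ c.psi (c.total (g t)))) (Icc s₀ s₁) t)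
    (hπ' : ∀ t ∈ Icc s₀ s₁, π t ∘L derivZ c.psi (c.total (g t)) = 0) :
    ∀ t ∈ Icc s₀ s₁, π t = 0 := by
  have hs : Icc s₀ s₁ ⊆ Icc t₀ t₁ := Icc_subset_Icc h₀ h₁
  have hcov := fun (c' : B.Chart) (t : ℝ) (ht : t ∈ Icc s₀ s₁) (hc' : g t ∈ c'.total.source) =>
    hg.adjoint_covariant c c' hs (fun t ht => hc t (hs ht)) ht hc' (hπ t ht) (lam := 0)
      (fun x u => by
        rw [← derivQ_add_derivZ, map_add]
        have h2 := congrArg (fun T : (Fin r → ℝ) →L[ℝ] ℝ => T u) (hπ' t ht)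
        simp only [ContinuousLinearMap.comp_apply, _root_.zero_apply] at h2
        rw [h2]
        simp)
  have hrep : ∀ c' : B.Chart, c'.rep (fun _ => 0) = fun _ => 0 := fun _ => rfl
  have hz : B.IsPontryaginLift (fun _ => 0) s₀ s₁ g fun t => c.contactForm (g t) (π t) := by
    refine ⟨fun t ht => c.contactForm_vel (hc t (hs ht)) _, fun c' t ht hc' i => ?_,
      fun c' t ht hc' α => ?_⟩
    · refine ((hcov c' t ht hc').1 (Pi.single i 1)).congr_deriv ?_
      rw [Chart.sum_mom_mul, hrep, fderiv_fun_const]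
      simp [dirQ]
    · have h2 := (hcov c' t ht hc').2 (Pi.single α 1)
      rw [Chart.sum_mom_mul, hrep, fderiv_fun_const]
      exact h2
  intro t ht
  have h3 := hn s₀ s₁ h₀ h h₁ _ hz t ht
  rw [← c.momL_contactForm_self (hc t (hs ht)) (π t), h3]
  rfl

/-! ### The gauged Lagrangian in a chart -/

namespace Chart

variable (c : B.Chart)

/-- Coordinate representation of a function on `V`. -/
noncomputable def baseRep (S : V → ℝ) : EventModel n → ℝ := S ∘ c.base.symm

/-- The open part of the range of a chart of `A` over which `S` is of class `C³`. -/
def regularSet (S : V → ℝ) : Set (VelocityModel n r) :=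
  {y ∈ c.total.target | ContDiffAt ℝ 3 (c.baseRep S) (projTQ n r y)}

theorem isOpen_regularSet (S : V → ℝ) : IsOpen (c.regularSet S) := by
  refine c.total.open_target.inter (isOpen_iff_mem_nhds.2 fun y hy => ?_)
  exact (projTQ n r).continuous.continuousAt.eventually
    (ContDiffAt.eventually (n := 3) hy (by simp))

theorem diff_eq (S : V → ℝ) {x : V} (hx : x ∈ c.base.source)
    (hS : ContDiffAt ℝ 3 (c.baseRep S) (c.base x)) (v : TangentSpace 𝓘(ℝ, EventModel n) x) :
    diff S x v = fderiv ℝ (c.baseRep S) (c.base x) (c.baseComp x v) := by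
  refine mfderiv_eq_fderiv_comp_symm c.base_mem hx ?_ v
  have h1 : MDifferentiableAt 𝓘(ℝ, EventModel n) 𝓘(ℝ, ℝ) (c.baseRep S ∘ c.base) x :=
    MDifferentiableAt.comp x (hS.differentiableAt (by simp)).mdifferentiableAt
      (mdifferentiableAt_chart c.base_mem hx)
  refine h1.congr_of_eventuallyEq ?_
  filter_upwards [c.base.open_source.mem_nhds hx] with y hy
  simp [baseRep, c.base.left_inv hy]

theorem rep_gauged (L : A → ℝ) {S : V → ℝ} {y : VelocityModel n r} (hy : y ∈ c.regularSet S) :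
    c.rep (B.gauged L S) y
      = c.rep L y - fderiv ℝ (c.baseRep S) (projTQ n r y) (1, c.psi y) := by
  have ha := c.total.map_target hy.1
  have hb := c.projTQ_total ha
  have hy2 := hy.2
  rw [c.total.right_inv hy.1] at hb
  rw [hb] at hy2 ⊢
  rw [rep, gauged, c.diff_eq S (c.mapsTo ha) hy2, c.baseComp_vel ha, c.total.right_inv hy.1]
  rfl

theorem contDiffOn_rep_gauged {L : A → ℝ}
    (hL : ContMDiff 𝓘(ℝ, VelocityModel n r) 𝓘(ℝ, ℝ) ∞ L) (S : V → ℝ) :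
    ContDiffOn ℝ 2 (c.rep (B.gauged L S)) (c.regularSet S) := by
  have h1 : ContDiffOn ℝ 2 (c.rep L) (c.regularSet S) :=
    ((c.contDiffOn_rep hL).of_le two_le_infty).mono fun y hy => hy.1
  have h2 : ContDiffOn ℝ 2 c.psi (c.regularSet S) :=
    (c.contDiffOn_psi.of_le two_le_infty).mono fun y hy => hy.1
  have h3 : ContDiffOn ℝ 2 (fun y => fderiv ℝ (c.baseRep S) (projTQ n r y)) (c.regularSet S) :=
    fun y hy => (ContDiffAt.comp y (hy.2.fderiv_right (m := 2) (by norm_num))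
      (projTQ n r).contDiff.contDiffAt).contDiffWithinAt
  have h4 : ContDiffOn ℝ 2 (fun y => ((1, c.psi y) : EventModel n)) (c.regularSet S) :=
    contDiffOn_const.prodMk h2
  exact (h1.sub (h3.clm_apply h4)).congr fun y hy => c.rep_gauged L hy

theorem fderiv_rep_gauged {L : A → ℝ}
    (hL : ContMDiff 𝓘(ℝ, VelocityModel n r) 𝓘(ℝ, ℝ) ∞ L) {S : V → ℝ}
    {y : VelocityModel n r} (hy : y ∈ c.regularSet S) (v : VelocityModel n r) :
    fderiv ℝ (c.rep (B.gauged L S)) y v = fderiv ℝ (c.rep L) y v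
      - fderiv ℝ (fderiv ℝ (c.baseRep S)) (projTQ n r y) (projTQ n r v) (1, c.psi y)
      - fderiv ℝ (c.baseRep S) (projTQ n r y) (0, fderiv ℝ c.psi y v) := by
  have h0 : c.rep (B.gauged L S) =ᶠ[𝓝 y] fun y => c.rep L y
      - fderiv ℝ (c.baseRep S) (projTQ n r y) (1, c.psi y) := by
    filter_upwards [(c.isOpen_regularSet S).mem_nhds hy] with z hz using c.rep_gauged L hz
  have hn := c.total.open_target.mem_nhds hy.1
  have h1 : HasFDerivAt (c.rep L) (fderiv ℝ (c.rep L) y) y :=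
    (((c.contDiffOn_rep hL).contDiffAt hn).differentiableAt (by simp)).hasFDerivAt
  have h2 : HasFDerivAt c.psi (fderiv ℝ c.psi y) y :=
    ((c.contDiffOn_psi.contDiffAt hn).differentiableAt (by simp)).hasFDerivAt
  have h3 : HasFDerivAt (fderiv ℝ (c.baseRep S))
      (fderiv ℝ (fderiv ℝ (c.baseRep S)) (projTQ n r y)) (projTQ n r y) :=
    ((hy.2.fderiv_right (m := 2) (by norm_num)).differentiableAt (by simp)).hasFDerivAt
  have h4 := (HasFDerivAt.comp (g := fderiv ℝ (c.baseRep S)) (f := fun y => projTQ n r y) y h3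
    (projTQ n r).hasFDerivAt).clm_apply ((hasFDerivAt_const (1 : ℝ) y).prodMk h2)
  rw [((h1.sub h4).congr_of_eventuallyEq h0).fderiv]
  simp only [_root_.sub_apply, _root_.add_apply,
    ContinuousLinearMap.comp_apply, ContinuousLinearMap.flip_apply,
    ContinuousLinearMap.prod_apply, _root_.zero_apply, Function.comp_apply]
  ring

end Chart

theorem IsAdapted.contDiffAt {L : A → ℝ}
    {p : ∀ t : ℝ, TangentSpace 𝓘(ℝ, EventModel n) (B.proj (g t)) →L[ℝ] ℝ} {S : V → ℝ}
    (hS : B.IsAdapted L t₀ t₁ g p S) (c : B.Chart) {t : ℝ} (ht : t ∈ Icc t₀ t₁)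
    (hc : g t ∈ c.total.source) : ContDiffAt ℝ 3 (c.baseRep S) (c.base (B.proj (g t))) :=
  contDiffAt_comp_chart_symm (k := 3) c.base_mem (c.mapsTo hc) (hS t ht).1

theorem IsAdapted.mem_regularSet {L : A → ℝ}
    {p : ∀ t : ℝ, TangentSpace 𝓘(ℝ, EventModel n) (B.proj (g t)) →L[ℝ] ℝ} {S : V → ℝ}
    (hS : B.IsAdapted L t₀ t₁ g p S) (c : B.Chart) {t : ℝ} (ht : t ∈ Icc t₀ t₁)
    (hc : g t ∈ c.total.source) : c.total (g t) ∈ c.regularSet S :=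
  ⟨c.total.map_source hc, by rw [c.projTQ_total hc]; exact hS.contDiffAt c ht hc⟩

theorem IsAdapted.fderiv_baseRep {L : A → ℝ}
    {p : ∀ t : ℝ, TangentSpace 𝓘(ℝ, EventModel n) (B.proj (g t)) →L[ℝ] ℝ} {S : V → ℝ}
    (hS : B.IsAdapted L t₀ t₁ g p S) (c : B.Chart) {t : ℝ} (ht : t ∈ Icc t₀ t₁)
    (hc : g t ∈ c.total.source) (x : Fin n → ℝ) :
    fderiv ℝ (c.baseRep S) (c.base (B.proj (g t))) (0, x) = c.momL (B.proj (g t)) (p t) x := by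
  have h1 := (hS t ht).2 (c.baseVec (B.proj (g t)) (0, x))
  rw [c.diff_eq S (c.mapsTo hc) (hS.contDiffAt c ht hc), c.diff_time (c.mapsTo hc),
    c.baseComp_baseVec (c.mapsTo hc)] at h1
  rw [h1, Chart.momL_apply, mul_zero, zero_add]

theorem IsAdapted.gauged_eq_zero {L : A → ℝ}
    {p : ∀ t : ℝ, TangentSpace 𝓘(ℝ, EventModel n) (B.proj (g t)) →L[ℝ] ℝ} {S : V → ℝ}
    (hS : B.IsAdapted L t₀ t₁ g p S) (hp : B.IsPontryaginLift L t₀ t₁ g p) {t : ℝ}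
    (ht : t ∈ Icc t₀ t₁) : B.gauged L S (g t) = 0 := by
  rw [gauged, (hS t ht).2, B.vel_time, hp.contact t ht]
  ring

theorem IsAdmissible.contDiffOn_total (hg : B.IsAdmissible t₀ t₁ g) (c : B.Chart)
    (hc : ∀ t ∈ Icc t₀ t₁, g t ∈ c.total.source) :
    ContDiffOn ℝ ∞ (fun t => c.total (g t)) (Icc t₀ t₁) :=
  contMDiffOn_iff_contDiffOn.1
    ((contMDiffOn_of_mem_maximalAtlas c.total_mem).comp hg.smooth hc)

theorem IsAdapted.fderiv_rep_gauged_z {L : A → ℝ}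
    (hL : ContMDiff 𝓘(ℝ, VelocityModel n r) 𝓘(ℝ, ℝ) ∞ L)
    {p : ∀ t : ℝ, TangentSpace 𝓘(ℝ, EventModel n) (B.proj (g t)) →L[ℝ] ℝ} {S : V → ℝ}
    (hS : B.IsAdapted L t₀ t₁ g p S) (hp : B.IsPontryaginLift L t₀ t₁ g p)
    (c : B.Chart) {t : ℝ} (ht : t ∈ Icc t₀ t₁) (hc : g t ∈ c.total.source) (v : Fin r → ℝ) :
    fderiv ℝ (c.rep (B.gauged L S)) (c.total (g t)) (0, 0, v) = 0 := by
  rw [c.fderiv_rep_gauged hL (hS.mem_regularSet c ht hc), c.projTQ_total hc,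
    hS.fderiv_baseRep c ht hc, ← hp.momL_derivZ c ht hc v]
  have h3 : projTQ n r (0, 0, v) = 0 := rfl
  rw [h3, map_zero, _root_.zero_apply, sub_zero]
  exact sub_self _

/-- The derivative of `∂S/∂q` along the section is given by the evolution equation of the
momenta. -/
theorem IsAdapted.fderiv_rep_gauged_q {L : A → ℝ}
    (hL : ContMDiff 𝓘(ℝ, VelocityModel n r) 𝓘(ℝ, ℝ) ∞ L)
    {p : ∀ t : ℝ, TangentSpace 𝓘(ℝ, EventModel n) (B.proj (g t)) →L[ℝ] ℝ} {S : V → ℝ}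
    (hS : B.IsAdapted L t₀ t₁ g p S) (hp : B.IsPontryaginLift L t₀ t₁ g p)
    (hg : B.IsAdmissible t₀ t₁ g) (h01 : t₀ < t₁) (c : B.Chart)
    (hc : ∀ t ∈ Icc t₀ t₁, g t ∈ c.total.source) {t : ℝ} (ht : t ∈ Icc t₀ t₁) (x : Fin n → ℝ) :
    fderiv ℝ (c.rep (B.gauged L S)) (c.total (g t)) (0, x, 0) = 0 := by
  have hct := hc t ht
  have hσ2 : ContDiffAt ℝ 2 (c.baseRep S) (c.base (B.proj (g t))) :=
    (hS.contDiffAt c ht hct).of_le (by norm_num)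
  have h2 := hasDerivWithinAt_fderiv_apply hσ2 (hg.hasDerivWithinAt_base c ht hct) (0, x)
  have h3 : HasDerivWithinAt (fun s => fderiv ℝ (c.baseRep S) (c.base (B.proj (g s))) (0, x))
      (fderiv ℝ (c.rep L) (c.total (g t)) (0, x, 0)
        - c.momL (B.proj (g t)) (p t) (fderiv ℝ c.psi (c.total (g t)) (0, x, 0)))
      (Icc t₀ t₁) t :=
    ((hp.hasDerivWithinAt_momL c ht hct).clm_apply_const x).congr
      (fun s hs => hS.fderiv_baseRep c hs (hc s hs) x) (hS.fderiv_baseRep c ht hct x)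
  have h5 := ((uniqueDiffOn_Icc h01) t ht).eq_deriv _ h2 h3
  have h7 : projTQ n r (0, x, 0) = (0, x) := rfl
  rw [c.fderiv_rep_gauged hL (hS.mem_regularSet c ht hct), c.projTQ_total hct,
    hS.fderiv_baseRep c ht hct, h7, h5]
  ring

/-- A gauged Lagrangian is critical along the section to which it is adapted: it vanishes there, and
the Pontryagin equations say that its derivatives in the directions of the fibres vanish. -/
theorem IsAdapted.fderiv_rep_gauged_eq_zero {L : A → ℝ}
    (hL : ContMDiff 𝓘(ℝ, VelocityModel n r) 𝓘(ℝ, ℝ) ∞ L)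
    {p : ∀ t : ℝ, TangentSpace 𝓘(ℝ, EventModel n) (B.proj (g t)) →L[ℝ] ℝ} {S : V → ℝ}
    (hS : B.IsAdapted L t₀ t₁ g p S) (hp : B.IsPontryaginLift L t₀ t₁ g p)
    (hg : B.IsAdmissible t₀ t₁ g) (h01 : t₀ < t₁) (c : B.Chart)
    (hc : ∀ t ∈ Icc t₀ t₁, g t ∈ c.total.source) {t : ℝ} (ht : t ∈ Icc t₀ t₁) :
    fderiv ℝ (c.rep (B.gauged L S)) (c.total (g t)) = 0 := by
  have hℓ : DifferentiableAt ℝ (c.rep (B.gauged L S)) (c.total (g t)) :=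
    ((c.contDiffOn_rep_gauged hL S).contDiffAt ((c.isOpen_regularSet S).mem_nhds
      (hS.mem_regularSet c ht (hc t ht)))).differentiableAt (by simp)
  refine fderiv_eq_zero_of_curve (h01 := h01) hℓ ht
    ((hg.contDiffOn_total c hc).differentiableOn (by simp) t ht) (fun s hs => ?_) (fun s hs => ?_)
    (hS.fderiv_rep_gauged_q hL hp hg h01 c hc ht) (hS.fderiv_rep_gauged_z hL hp c ht (hc t ht))
  · rw [c.total_time _ (hc s hs), c.base_time _ (c.mapsTo (hc s hs)), hg.time_eq s hs]
  · rw [Chart.rep, c.total.left_inv (hc s hs)]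
    exact hS.gauged_eq_zero hp hs

/-- The matrix `G` is the Hessian of the gauged Lagrangian in the direction of the fibres of `A`
over `V`, on which `L - Ṡ` and `-ℋ` differ by a constant. -/
theorem IsAdapted.G_eq {L : A → ℝ}
    (hL : ContMDiff 𝓘(ℝ, VelocityModel n r) 𝓘(ℝ, ℝ) ∞ L)
    {p : ∀ t : ℝ, TangentSpace 𝓘(ℝ, EventModel n) (B.proj (g t)) →L[ℝ] ℝ} {S : V → ℝ}
    (hS : B.IsAdapted L t₀ t₁ g p S) (c : B.Chart) {t : ℝ} (ht : t ∈ Icc t₀ t₁)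
    (hc : g t ∈ c.total.source) (α β : Fin r) :
    c.G L (g t) (p t) α β = fderiv ℝ (fderiv ℝ (c.rep (B.gauged L S))) (c.total (g t))
      (dirZ n α) (dirZ n β) := by
  set w := c.total (g t) with hw
  set P := c.momL (B.proj (g t)) (p t) with hP
  have hreg : w ∈ c.regularSet S := hS.mem_regularSet c ht hc
  have hpr : projTQ n r w = c.base (B.proj (g t)) := c.projTQ_total hc
  have hn := c.total.open_target.mem_nhds hreg.1
  have hham : c.hamiltonian L (c.mom (B.proj (g t)) (p t)) = fun y => P (c.psi y) - c.rep L y := by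
    funext y
    rw [Chart.hamiltonian, Chart.sum_mom_mul]
  have hham2 : ContDiffAt ℝ 2 (fun y => P (c.psi y) - c.rep L y) w :=
    (ContDiffAt.comp w P.contDiff.contDiffAt
      ((c.contDiffOn_psi.contDiffAt hn).of_le two_le_infty)).sub
      (((c.contDiffOn_rep hL).contDiffAt hn).of_le two_le_infty)
  have hℓ2 : ContDiffAt ℝ 2 (c.rep (B.gauged L S)) w :=
    (c.contDiffOn_rep_gauged hL S).contDiffAt ((c.isOpen_regularSet S).mem_nhds hreg)
  set T : (Fin r → ℝ) →L[ℝ] VelocityModel n r := ContinuousLinearMap.inr ℝ ℝ _ ∘L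
    ContinuousLinearMap.inr ℝ (Fin n → ℝ) (Fin r → ℝ) with hT
  have hTs : ∀ γ : Fin r, T (Pi.single γ 1) = dirZ n γ := fun _ => rfl
  have h1 : (fun z => c.rep (B.gauged L S) (w + T z)) =ᶠ[𝓝 0]
      fun z => -fderiv ℝ (c.baseRep S) (projTQ n r w) (1, 0) - (P (c.psi (w + T z))
        - c.rep L (w + T z)) := by
    have hcont : ContinuousAt (fun z => w + T z) 0 := by fun_prop
    have := hcont.preimage_mem_nhds (t := c.regularSet S)
      (by simpa using (c.isOpen_regularSet S).mem_nhds hreg)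
    filter_upwards [this] with z hz
    have h2 : projTQ n r (w + T z) = projTQ n r w := by simp [hT]
    have h3 := hS.fderiv_baseRep c ht hc (c.psi (w + T z))
    have h4 : ((1, c.psi (w + T z)) : EventModel n) = (1, 0) + (0, c.psi (w + T z)) := by simp
    rw [c.rep_gauged L hz, h2, h4, map_add, hpr, h3]
    ring
  have h2 : fderiv ℝ (fun z => -fderiv ℝ (c.baseRep S) (projTQ n r w) (1, 0)
      - (P (c.psi (w + T z)) - c.rep L (w + T z)))
      = fun z => -fderiv ℝ (fun z => P (c.psi (w + T z)) - c.rep L (w + T z)) z := by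
    funext z
    rw [fderiv_const_sub]
  have h3 := fderiv_fderiv_comp_add hℓ2 T (Pi.single α 1) (Pi.single β 1)
  have h4 := fderiv_fderiv_comp_add hham2 T (Pi.single α 1) (Pi.single β 1)
  rw [h1.fderiv.fderiv_eq, h2, fderiv_fun_neg, _root_.neg_apply,
    _root_.neg_apply, h4, hTs, hTs] at h3
  rw [← h3, Chart.G, Matrix.of_apply, hham, fderiv_fderiv_apply hham2]

end ConstrainedSystem

end ConstrainedVariation

/-! ### Jacobi fields in a chart -/

namespace ConstrainedVariation

variable {n r : ℕ} {V A : Type*}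
  [TopologicalSpace V] [ChartedSpace (EventModel n) V] [IsManifold 𝓘(ℝ, EventModel n) ∞ V]
  [TopologicalSpace A] [ChartedSpace (VelocityModel n r) A]
  [IsManifold 𝓘(ℝ, VelocityModel n r) ∞ A]

namespace ConstrainedSystem

variable {B : ConstrainedSystem n r V A} {t₀ t₁ : ℝ} {g : ℝ → A} {L : A → ℝ}
  {p : ∀ t : ℝ, TangentSpace 𝓘(ℝ, EventModel n) (B.proj (g t)) →L[ℝ] ℝ} {S : V → ℝ}

theorem Chart.baseComp_mfderiv_proj (c : B.Chart) {a : A} (ha : a ∈ c.total.source)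
    (X : TangentSpace 𝓘(ℝ, VelocityModel n r) a) :
    c.baseComp (B.proj a) (mfderiv 𝓘(ℝ, VelocityModel n r) 𝓘(ℝ, EventModel n) B.proj a X)
      = projTQ n r (c.comp a X) := by
  have h1 := (mdifferentiableAt_chart c.base_mem (c.mapsTo ha)).hasMFDerivAt.comp a
    ((B.proj_smooth a).mdifferentiableAt (by simp)).hasMFDerivAt
  have h2 := ((projTQ n r).hasMFDerivAt (x := c.total a)).comp a
    (mdifferentiableAt_chart c.total_mem ha).hasMFDerivAt
  have h3 : c.base ∘ B.proj =ᶠ[𝓝 a] projTQ n r ∘ c.total := by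
    filter_upwards [c.total.open_source.mem_nhds ha] with x hx
    exact (c.projTQ_total hx).symm
  have h4 := h1.mfderiv.symm.trans ((h2.congr_of_eventuallyEq h3).mfderiv)
  exact congrArg (fun T : VelocityModel n r →L[ℝ] EventModel n => T X) h4

theorem Chart.mfderiv_proj_eq_zero_iff (c : B.Chart) {a : A} (ha : a ∈ c.total.source)
    {X : TangentSpace 𝓘(ℝ, VelocityModel n r) a} (hX : (c.comp a X).1 = 0) :
    mfderiv 𝓘(ℝ, VelocityModel n r) 𝓘(ℝ, EventModel n) B.proj a X = 0
      ↔ (c.comp a X).2.1 = 0 := by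
  rw [← (c.baseComp_injective (c.mapsTo ha)).eq_iff, c.baseComp_mfderiv_proj ha, map_zero,
    projTQ_apply, hX]
  constructor
  · intro h
    exact congrArg Prod.snd h
  · intro h
    rw [h]
    rfl

theorem IsAdapted.contDiffAt_rep (hL : ContMDiff 𝓘(ℝ, VelocityModel n r) 𝓘(ℝ, ℝ) ∞ L)
    (hS : B.IsAdapted L t₀ t₁ g p S) (c : B.Chart) {t : ℝ} (ht : t ∈ Icc t₀ t₁)
    (hc : g t ∈ c.total.source) : ContDiffAt ℝ 2 (c.rep (B.gauged L S)) (c.total (g t)) :=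
  (c.contDiffOn_rep_gauged hL S).contDiffAt
    ((c.isOpen_regularSet S).mem_nhds (hS.mem_regularSet c ht hc))

/-- A solution of the linearized Pontryagin equations in a chart. -/
theorem IsJacobiPair.isLinearized (hL : ContMDiff 𝓘(ℝ, VelocityModel n r) 𝓘(ℝ, ℝ) ∞ L)
    (hS : B.IsAdapted L t₀ t₁ g p S)
    {X : ∀ t : ℝ, TangentSpace 𝓘(ℝ, VelocityModel n r) (g t)}
    {ϖ : ∀ t : ℝ, TangentSpace 𝓘(ℝ, EventModel n) (B.proj (g t)) →L[ℝ] ℝ}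
    (hX : B.IsJacobiPair (B.gauged L S) t₀ t₁ g X ϖ) (c : B.Chart)
    (hc : ∀ t ∈ Icc t₀ t₁, g t ∈ c.total.source) :
    IsLinearized c.psi (c.rep (B.gauged L S)) (fun t => c.total (g t)) t₀ t₁
      (fun t => (c.comp (g t) (X t)).2.1) (fun t => (c.comp (g t) (X t)).2.2)
      (fun t => c.momL (B.proj (g t)) (ϖ t)) := by
  have hv : ∀ t ∈ Icc t₀ t₁, (0, (c.comp (g t) (X t)).2.1, (c.comp (g t) (X t)).2.2)
      = c.comp (g t) (X t) := fun t ht =>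
    Prod.ext (hX.vertical c t ht (hc t ht)).symm rfl
  refine ⟨fun t ht => ?_, fun t ht => ?_, fun t ht v => ?_⟩
  · rw [hv t ht]
    exact hX.variation c t ht (hc t ht)
  · refine hasDerivWithinAt_clm_pi fun i => (hX.evolution c t ht (hc t ht) i).congr_deriv ?_
    rw [Chart.sum_mom_mul, fderiv_fderiv_apply (hS.contDiffAt_rep hL c ht (hc t ht)), hv t ht]
    rfl
  · have h : c.momL (B.proj (g t)) (ϖ t) ∘L derivZ c.psi (c.total (g t))
        = fderiv ℝ (fderiv ℝ (c.rep (B.gauged L S))) (c.total (g t)) (c.comp (g t) (X t)) ∘L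
          ContinuousLinearMap.inr ℝ ℝ _ ∘L
          ContinuousLinearMap.inr ℝ (Fin n → ℝ) (Fin r → ℝ) := by
      refine clm_pi_ext fun α => ?_
      have h1 := hX.critical c t ht (hc t ht) α
      rw [Chart.sum_mom_mul, fderiv_fderiv_apply (hS.contDiffAt_rep hL c ht (hc t ht))] at h1
      exact h1
    rw [hv t ht]
    exact congrArg (fun T : (Fin r → ℝ) →L[ℝ] ℝ => T v) h

/-- The Hessian of a gauged Lagrangian along the section is a tensor, as the section is critical. -/
theorem IsAdapted.hessian_transition (hL : ContMDiff 𝓘(ℝ, VelocityModel n r) 𝓘(ℝ, ℝ) ∞ L)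
    (hS : B.IsAdapted L t₀ t₁ g p S) (hp : B.IsPontryaginLift L t₀ t₁ g p)
    (hg : B.IsAdmissible t₀ t₁ g) (h01 : t₀ < t₁) (c c' : B.Chart)
    (hc : ∀ t ∈ Icc t₀ t₁, g t ∈ c.total.source) {t : ℝ} (ht : t ∈ Icc t₀ t₁)
    (hc' : g t ∈ c'.total.source) (v d : VelocityModel n r) :
    fderiv ℝ (fderiv ℝ (c'.rep (B.gauged L S))) (c'.total (g t)) v d
      = fderiv ℝ (fderiv ℝ (c.rep (B.gauged L S))) (c.total (g t))
        (fderiv ℝ (c.total ∘ c'.total.symm) (c'.total (g t)) v)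
        (fderiv ℝ (c.total ∘ c'.total.symm) (c'.total (g t)) d) := by
  have hφ : (c.total ∘ c'.total.symm) (c'.total (g t)) = c.total (g t) := by
    simp [c'.total.left_inv hc']
  have h1 := hS.contDiffAt_rep hL c ht (hc t ht)
  have h2 := hS.fderiv_rep_gauged_eq_zero hL hp hg h01 c hc ht
  rw [← hφ] at h1 h2 ⊢
  refine fderiv_fderiv_comp_of_fderiv_eq_zero ((c'.total.contDiffAt_comp_symm c'.total_mem
    c.total_mem hc' (hc t ht)).of_le two_le_infty) h1 h2 ?_ v d
  have hcont : ContinuousAt c'.total.symm (c'.total (g t)) :=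
    c'.total.continuousAt_symm (c'.total.map_source hc')
  filter_upwards [hcont.preimage_mem_nhds
      (by rw [c'.total.left_inv hc']; exact c.total.open_source.mem_nhds (hc t ht))] with y hy
  simp only [Chart.rep, Function.comp_apply]
  rw [c.total.left_inv hy]

/-- A solution of the linearized equations in a chart along the section is a Jacobi pair. -/
theorem IsAdapted.isJacobiPair (hL : ContMDiff 𝓘(ℝ, VelocityModel n r) 𝓘(ℝ, ℝ) ∞ L)
    (hS : B.IsAdapted L t₀ t₁ g p S) (hp : B.IsPontryaginLift L t₀ t₁ g p)
    (hg : B.IsAdmissible t₀ t₁ g) (h01 : t₀ < t₁) (c : B.Chart)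
    (hc : ∀ t ∈ Icc t₀ t₁, g t ∈ c.total.source) {X : ℝ → Fin n → ℝ} {Γ : ℝ → Fin r → ℝ}
    {ϖ : ℝ → (Fin n → ℝ) →L[ℝ] ℝ}
    (h : IsLinearized c.psi (c.rep (B.gauged L S)) (fun t => c.total (g t)) t₀ t₁ X Γ ϖ) :
    B.IsJacobiPair (B.gauged L S) t₀ t₁ g (fun t => c.totalVec (g t) (0, X t, Γ t))
      (fun t => c.contactForm (g t) (ϖ t)) := by
  have hcov := fun (c' : B.Chart) (t : ℝ) (ht : t ∈ Icc t₀ t₁) (hc' : g t ∈ c'.total.source) =>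
    hg.adjoint_covariant c c' subset_rfl hc ht hc' (h.evolution t ht)
      (lam := fderiv ℝ (fderiv ℝ (c.rep (B.gauged L S))) (c.total (g t)) (0, X t, Γ t))
      (fun x u => by
        have h1 := h.critical t ht u
        have h3 : ((0, x, u) : VelocityModel n r) = (0, x, 0) + (0, 0, u) := by simp
        rw [← derivQ_add_derivZ, map_add, h1, h3, map_add]
        simp only [_root_.sub_apply, ContinuousLinearMap.comp_apply,
          ContinuousLinearMap.inl_apply, ContinuousLinearMap.inr_apply]
        ring)
  have hcomp : ∀ (c' : B.Chart) (t : ℝ), t ∈ Icc t₀ t₁ → g t ∈ c'.total.source →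
      fderiv ℝ (c.total ∘ c'.total.symm) (c'.total (g t))
        (c'.comp (g t) (c.totalVec (g t) (0, X t, Γ t))) = (0, X t, Γ t) := by
    intro c' t ht hc'
    rw [← Chart.comp_transition c' c hc' (hc t ht), c.comp_totalVec (hc t ht)]
  refine ⟨fun c' t ht hc' => ?_, fun t ht => c.contactForm_vel (hc t ht) _,
    fun c' t ht hc' => hg.variation_covariant c c' hc ht hc' (h.variation t ht),
    fun c' t ht hc' i => ?_, fun c' t ht hc' α => ?_⟩
  · rw [Chart.comp_transition c c' (hc t ht) hc', c.comp_totalVec (hc t ht)]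
    exact fderiv_transition_fst (T := B.time ∘ B.proj) c.total_mem c'.total_mem
      (fun x hx => (c.total_time x hx).trans (c.base_time _ (c.mapsTo hx)))
      (fun x hx => (c'.total_time x hx).trans (c'.base_time _ (c'.mapsTo hx))) (hc t ht) hc' _
  · refine ((hcov c' t ht hc').1 (Pi.single i 1)).congr_deriv ?_
    rw [Chart.sum_mom_mul, fderiv_fderiv_apply (hS.contDiffAt_rep hL c' ht hc'),
      hS.hessian_transition hL hp hg h01 c c' hc ht hc', hcomp c' t ht hc']
    rfl
  · rw [Chart.sum_mom_mul, fderiv_fderiv_apply (hS.contDiffAt_rep hL c' ht hc'),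
      hS.hessian_transition hL hp hg h01 c c' hc ht hc', hcomp c' t ht hc']
    exact (hcov c' t ht hc').2 (Pi.single α 1)

/-- A conjugate point gives a solution of the linearized equations in a chart along the section. -/
theorem IsConjugate.exists_isLinearized (hL : ContMDiff 𝓘(ℝ, VelocityModel n r) 𝓘(ℝ, ℝ) ∞ L)
    (c : B.Chart) (hc : ∀ t ∈ Icc t₀ t₁, g t ∈ c.total.source) {τ : ℝ}
    (h : B.IsConjugate L t₀ t₁ g p τ) : ∃ S, B.IsAdapted L t₀ t₁ g p S ∧ ∃ X Γ ϖ,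
      IsLinearized c.psi (c.rep (B.gauged L S)) (fun t => c.total (g t)) t₀ t₁ X Γ ϖ ∧
      X t₀ = 0 ∧ X τ = 0 ∧ ∃ t ∈ Icc t₀ t₁, X t ≠ 0 := by
  obtain ⟨hτ, J, ⟨S, hS, X, ϖ, hX, hJ⟩, h0, h1, t, ht, hne⟩ := h
  have hiff : ∀ t ∈ Icc t₀ t₁, J t = 0 ↔ (c.comp (g t) (X t)).2.1 = 0 := fun t ht => by
    rw [hJ t ht]
    exact c.mfderiv_proj_eq_zero_iff (hc t ht) (hX.vertical c t ht (hc t ht))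
  exact ⟨S, hS, _, _, _, hX.isLinearized hL hS c hc,
    (hiff t₀ ⟨le_rfl, hτ.1.le.trans hτ.2⟩).1 h0, (hiff τ ⟨hτ.1.le, hτ.2⟩).1 h1, t, ht,
    fun h => hne ((hiff t ht).2 h)⟩

/-- The linearized equations in a chart detect conjugate points by means of any one adapted
function. -/
theorem IsAdapted.isConjugate (hL : ContMDiff 𝓘(ℝ, VelocityModel n r) 𝓘(ℝ, ℝ) ∞ L)
    (hS : B.IsAdapted L t₀ t₁ g p S) (hp : B.IsPontryaginLift L t₀ t₁ g p)
    (hg : B.IsAdmissible t₀ t₁ g) (h01 : t₀ < t₁) (c : B.Chart)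
    (hc : ∀ t ∈ Icc t₀ t₁, g t ∈ c.total.source) {X : ℝ → Fin n → ℝ} {Γ : ℝ → Fin r → ℝ}
    {ϖ : ℝ → (Fin n → ℝ) →L[ℝ] ℝ}
    (h : IsLinearized c.psi (c.rep (B.gauged L S)) (fun t => c.total (g t)) t₀ t₁ X Γ ϖ)
    {τ : ℝ} (hτ : τ ∈ Ioc t₀ t₁) (h0 : X t₀ = 0) (h1 : X τ = 0) (hne : ∃ t ∈ Icc t₀ t₁, X t ≠ 0) :
    B.IsConjugate L t₀ t₁ g p τ := by
  have hX := hS.isJacobiPair hL hp hg h01 c hc h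
  have hiff : ∀ t ∈ Icc t₀ t₁, mfderiv 𝓘(ℝ, VelocityModel n r) 𝓘(ℝ, EventModel n) B.proj (g t)
      (c.totalVec (g t) (0, X t, Γ t)) = 0 ↔ X t = 0 := fun t ht => by
    rw [c.mfderiv_proj_eq_zero_iff (hc t ht) (hX.vertical c t ht (hc t ht)),
      c.comp_totalVec (hc t ht)]
  obtain ⟨t, ht, hne⟩ := hne
  exact ⟨hτ, _, ⟨S, hS, _, _, hX, fun t _ => rfl⟩, (hiff t₀ ⟨le_rfl, h01.le⟩).2 h0,
    (hiff τ ⟨hτ.1.le, hτ.2⟩).2 h1, t, ht, fun h => hne ((hiff t ht).1 h)⟩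

end ConstrainedSystem

end ConstrainedVariation

/-! ### Admissible sections and adapted functions in a chart -/

section Calculus

theorem contDiffOn_Icc_succ_of_hasDerivWithinAt {E : Type*} [NormedAddCommGroup E]
    [NormedSpace ℝ E] {a b : ℝ} (hab : a < b) {f f' : ℝ → E} {k : ℕ}
    (hf : ∀ t ∈ Icc a b, HasDerivWithinAt f (f' t) (Icc a b) t)
    (hf' : ContDiffOn ℝ k f' (Icc a b)) : ContDiffOn ℝ (k + 1 : ℕ) f (Icc a b) := by
  have hu := uniqueDiffOn_Icc hab
  push_cast
  rw [contDiffOn_succ_iff_derivWithin hu]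
  refine ⟨fun t ht => (hf t ht).differentiableWithinAt, fun h => by simp at h, ?_⟩
  exact hf'.congr fun t ht => (hf t ht).derivWithin (hu t ht)

/-- Solutions of linear equations with smooth coefficients are smooth. -/
theorem contDiffOn_costate {E F : Type*} [NormedAddCommGroup E]
    [NormedSpace ℝ E] [NormedAddCommGroup F] [NormedSpace ℝ F] {a b : ℝ} (hab : a < b)
    {P q : ℝ → E →L[ℝ] F} {T : ℝ → E →L[ℝ] E} (hq : ContDiffOn ℝ ∞ q (Icc a b))
    (hT : ContDiffOn ℝ ∞ T (Icc a b))
    (hP : ∀ t ∈ Icc a b, HasDerivWithinAt P (q t - P t ∘L T t) (Icc a b) t) (k : ℕ) :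
    ContDiffOn ℝ k P (Icc a b) := by
  induction k with
  | zero => exact contDiffOn_zero.2 fun t ht => (hP t ht).continuousWithinAt
  | succ k ih =>
    have hk : ((k : ℕ∞) : WithTop ℕ∞) ≤ ∞ := WithTop.coe_le_coe.2 le_top
    exact contDiffOn_Icc_succ_of_hasDerivWithinAt hab hP ((hq.of_le hk).sub
      (ih.clm_comp (hT.of_le hk)))

/-- A function `σ(t, q) = s(t) + P(t)(q - γ(t))` with prescribed differential along a curve. -/
theorem exists_function_of_differential {E : Type*} [NormedAddCommGroup E]
    [NormedSpace ℝ E] [FiniteDimensional ℝ E] {a b : ℝ} (hab : a < b) {l : ℝ → ℝ}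
    {P : ℝ → E →L[ℝ] ℝ} {γ γ' : ℝ → E}
    (hl : ContDiffOn ℝ 2 l (Icc a b)) (hP : ContDiffOn ℝ 3 P (Icc a b))
    (hγ : ContDiffOn ℝ 3 γ (Icc a b))
    (hγ' : ∀ t ∈ Icc a b, HasDerivWithinAt γ (γ' t) (Icc a b) t) :
    ∃ σ : ℝ × E → ℝ, ContDiff ℝ 3 σ ∧ ∀ t ∈ Icc a b, ∀ v,
      fderiv ℝ σ (t, γ t) v = l t * v.1 + P t (v.2 - v.1 • γ' t) := by
  have hu := uniqueDiffOn_Icc hab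
  obtain ⟨l₁, hl₁, hl₁e⟩ := exists_contDiff_extension hab 2 hl
  obtain ⟨P₁, hP₁, hP₁e⟩ := exists_contDiff_extension hab 3 hP
  obtain ⟨γ₁, hγ₁, hγ₁e⟩ := exists_contDiff_extension hab 3 hγ
  have hs : ∀ t, HasDerivAt (fun t => ∫ τ in a..t, l₁ τ) (l₁ t) t := fun t =>
    hl₁.continuous.integral_hasStrictDerivAt a t |>.hasDerivAt
  have hs3 : ContDiff ℝ 3 fun t => ∫ τ in a..t, l₁ τ := by
    have h1 : deriv (fun t => ∫ τ in a..t, l₁ τ) = l₁ := funext fun t => (hs t).deriv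
    have h2 : ContDiff ℝ (2 + 1) fun t => ∫ τ in a..t, l₁ τ := by
      rw [contDiff_succ_iff_deriv]
      exact ⟨fun t => (hs t).differentiableAt, fun h => by simp at h, by rw [h1]; exact hl₁⟩
    exact h2.of_le (by norm_num)
  refine ⟨fun y => (∫ τ in a..y.1, l₁ τ) + P₁ y.1 (y.2 - γ₁ y.1), ?_, fun t ht v => ?_⟩
  · exact (hs3.comp contDiff_fst).add ((hP₁.comp contDiff_fst).clm_apply
      (contDiff_snd.sub (hγ₁.comp contDiff_fst)))
  have hfst : HasFDerivAt (fun y : ℝ × E => y.1) (ContinuousLinearMap.fst ℝ ℝ E) (t, γ t) :=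
    hasFDerivAt_fst
  have hsnd : HasFDerivAt (fun y : ℝ × E => y.2) (ContinuousLinearMap.snd ℝ ℝ E) (t, γ t) :=
    hasFDerivAt_snd
  have hdγ := (hγ₁.differentiable (by simp) t).hasDerivAt
  have hdγ' : deriv γ₁ t = γ' t := (hu t ht).eq_deriv _
    (hdγ.hasDerivWithinAt.congr (fun s hs => (hγ₁e hs).symm) (hγ₁e ht).symm) (hγ' t ht)
  rw [hdγ'] at hdγ
  have hdP := (hP₁.differentiable (by simp) t).hasDerivAt
  have h1 := HasFDerivAt.comp (g := fun t => ∫ τ in a..t, l₁ τ) (f := fun y : ℝ × E => y.1)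
    (t, γ t) (hs t).hasFDerivAt hfst
  have h2 := HasFDerivAt.comp (g := P₁) (f := fun y : ℝ × E => y.1) (t, γ t) hdP.hasFDerivAt hfst
  have h3 := HasFDerivAt.comp (g := γ₁) (f := fun y : ℝ × E => y.1) (t, γ t) hdγ.hasFDerivAt hfst
  have h4 := (h1.add (h2.clm_apply (hsnd.sub h3))).fderiv
  have h5 := congrArg (fun T : ℝ × E →L[ℝ] ℝ => T v) h4
  refine h5.trans ?_
  simp [hγ₁e ht, hl₁e ht, hP₁e ht, mul_comm]

end Calculus

namespace ConstrainedVariation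

variable {n r : ℕ} {V A : Type*}
  [TopologicalSpace V] [ChartedSpace (EventModel n) V] [IsManifold 𝓘(ℝ, EventModel n) ∞ V]
  [TopologicalSpace A] [ChartedSpace (VelocityModel n r) A]
  [IsManifold 𝓘(ℝ, VelocityModel n r) ∞ A]

namespace ConstrainedSystem

variable {B : ConstrainedSystem n r V A} {t₀ t₁ : ℝ} {g : ℝ → A} {L : A → ℝ}
  {p : ∀ t : ℝ, TangentSpace 𝓘(ℝ, EventModel n) (B.proj (g t)) →L[ℝ] ℝ} {S : V → ℝ}

theorem IsAdmissible.total_fst {h : ℝ → A} (hh : B.IsAdmissible t₀ t₁ h) (c : B.Chart) {t : ℝ}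
    (ht : t ∈ Icc t₀ t₁) (hc : h t ∈ c.total.source) : (c.total (h t)).1 = t := by
  rw [c.total_time _ hc, c.base_time _ (c.mapsTo hc), hh.time_eq t ht]

theorem IsAdmissible.hasDerivWithinAt_total {h : ℝ → A} (hh : B.IsAdmissible t₀ t₁ h)
    (c : B.Chart) (hc : ∀ t ∈ Icc t₀ t₁, h t ∈ c.total.source) {t : ℝ} (ht : t ∈ Icc t₀ t₁) :
    HasDerivWithinAt (fun s => (c.total (h s)).2.1) (c.psi (c.total (h t))) (Icc t₀ t₁) t := by
  have h1 := (ContinuousLinearMap.snd ℝ ℝ (Fin n → ℝ)).hasFDerivAt.comp_hasDerivWithinAt t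
    (hh.hasDerivWithinAt_base c ht (hc t ht))
  exact h1.congr (fun s hs => c.total_q _ (hc s hs)) (c.total_q _ (hc t ht))

/-- Solutions of `q' = ψ(t, q, z)` in a chart are admissible. -/
theorem Chart.isAdmissible_symm (c : B.Chart) (h01 : t₀ < t₁) {y : ℝ → VelocityModel n r}
    (hy : ContDiffOn ℝ ∞ y (Icc t₀ t₁)) (hyt : ∀ t ∈ Icc t₀ t₁, y t ∈ c.total.target)
    (hy1 : ∀ t ∈ Icc t₀ t₁, (y t).1 = t)
    (hy2 : ∀ t ∈ Icc t₀ t₁, HasDerivWithinAt (fun s => (y s).2.1) (c.psi (y t)) (Icc t₀ t₁) t) :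
    B.IsAdmissible t₀ t₁ fun t => c.total.symm (y t) := by
  have hsm : ContMDiffOn 𝓘(ℝ, ℝ) 𝓘(ℝ, VelocityModel n r) ∞ (fun t => c.total.symm (y t))
      (Icc t₀ t₁) :=
    (contMDiffOn_symm_of_mem_maximalAtlas c.total_mem).comp hy.contMDiffOn hyt
  have hsrc : ∀ t ∈ Icc t₀ t₁, c.total.symm (y t) ∈ c.total.source := fun t ht =>
    c.total.map_target (hyt t ht)
  have hbase : ∀ t ∈ Icc t₀ t₁, c.base (B.proj (c.total.symm (y t))) = ((y t).1, (y t).2.1) :=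
    fun t ht => by
      rw [← c.projTQ_total (hsrc t ht), c.total.right_inv (hyt t ht)]
      rfl
  refine ⟨hsm, fun t ht => ?_, fun t ht => ?_⟩
  · rw [← c.base_time _ (c.mapsTo (hsrc t ht)), hbase t ht, hy1 t ht]
  · have h1 : ContMDiffWithinAt 𝓘(ℝ, ℝ) 𝓘(ℝ, EventModel n) ∞
        (fun s => B.proj (c.total.symm (y s))) (Icc t₀ t₁) t :=
      (B.proj_smooth.contMDiffAt).comp_contMDiffWithinAt t (hsm t ht)
    have h2 := (h1.mdifferentiableWithinAt (by simp)).hasMFDerivWithinAt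
    have h3 := HasMFDerivAt.comp_hasMFDerivWithinAt t
      (mdifferentiableAt_chart c.base_mem (c.mapsTo (hsrc t ht))).hasMFDerivAt h2
    have h4 : HasFDerivWithinAt (fun s => c.base (B.proj (c.total.symm (y s))))
        (c.baseComp (B.proj (c.total.symm (y t))) ∘L mfderivWithin 𝓘(ℝ, ℝ) 𝓘(ℝ, EventModel n)
          (fun s => B.proj (c.total.symm (y s))) (Icc t₀ t₁) t : ℝ →L[ℝ] EventModel n)
        (Icc t₀ t₁) t :=
      hasMFDerivWithinAt_iff_hasFDerivWithinAt.1 h3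
    have h5 : HasDerivWithinAt (fun s => c.base (B.proj (c.total.symm (y s))))
        (1, c.psi (y t)) (Icc t₀ t₁) t := by
      have h6 := (hasDerivWithinAt_id t (Icc t₀ t₁)).prodMk (hy2 t ht)
      refine h6.congr (fun s hs => ?_) ?_
      · rw [hbase s hs, hy1 s hs]; rfl
      · rw [hbase t ht, hy1 t ht]; rfl
    have h6 := ((uniqueDiffOn_Icc h01) t ht).eq_deriv _ h4.hasDerivWithinAt h5
    refine c.baseComp_injective (c.mapsTo (hsrc t ht)) ?_
    rw [c.baseComp_vel (hsrc t ht), c.total.right_inv (hyt t ht), ← h6]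
    rfl

/-- The actions of two gauge equivalent Lagrangians differ by a boundary term. -/
theorem IsAdmissible.action_eq (hL : ContMDiff 𝓘(ℝ, VelocityModel n r) 𝓘(ℝ, ℝ) ∞ L)
    {h : ℝ → A} (hh : B.IsAdmissible t₀ t₁ h) (h01 : t₀ < t₁) (c : B.Chart)
    (hc : ∀ t ∈ Icc t₀ t₁, h t ∈ c.total.source)
    (hr : ∀ t ∈ Icc t₀ t₁, c.total (h t) ∈ c.regularSet S) :
    B.action L t₀ t₁ h = (∫ t in t₀..t₁, c.rep (B.gauged L S) (c.total (h t)))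
      + (c.baseRep S (c.base (B.proj (h t₁))) - c.baseRep S (c.base (B.proj (h t₀)))) := by
  have hb : ∀ t ∈ Icc t₀ t₁, ContDiffAt ℝ 3 (c.baseRep S) (c.base (B.proj (h t))) :=
    fun t ht => by
      rw [← c.projTQ_total (hc t ht)]
      exact (hr t ht).2
  have hwc : ContinuousOn (fun t => c.total (h t)) (Icc t₀ t₁) :=
    (hh.contDiffOn_total c hc).continuousOn
  have hbc : ContinuousOn (fun t => c.base (B.proj (h t))) (Icc t₀ t₁) := fun t ht =>
    (hh.hasDerivWithinAt_base c ht (hc t ht)).continuousWithinAt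
  have hd : ∀ t ∈ Icc t₀ t₁, HasDerivWithinAt (fun t => c.baseRep S (c.base (B.proj (h t))))
      (fderiv ℝ (c.baseRep S) (c.base (B.proj (h t))) (1, c.psi (c.total (h t))))
      (Icc t₀ t₁) t := fun t ht =>
    HasFDerivAt.comp_hasDerivWithinAt (f := fun t => c.base (B.proj (h t)))
      (l := c.baseRep S) t ((hb t ht).differentiableAt (by simp)).hasFDerivAt
      (hh.hasDerivWithinAt_base c ht (hc t ht))
  have hψc : ContinuousOn (fun t => c.psi (c.total (h t))) (Icc t₀ t₁) :=
    c.contDiffOn_psi.continuousOn.comp hwc fun t ht => c.total.map_source (hc t ht)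
  have hdc : ContinuousOn (fun t => fderiv ℝ (c.baseRep S) (c.base (B.proj (h t)))
      (1, c.psi (c.total (h t)))) (Icc t₀ t₁) := by
    refine ContinuousOn.clm_apply (fun t ht => ?_) (continuousOn_const.prodMk hψc)
    exact ContinuousAt.comp_continuousWithinAt (f := fun t => c.base (B.proj (h t)))
      (g := fderiv ℝ (c.baseRep S))
      ((hb t ht).fderiv_right (m := 2) (by norm_num)).continuousAt (hbc t ht)
  have hℓc : ContinuousOn (fun t => c.rep (B.gauged L S) (c.total (h t))) (Icc t₀ t₁) :=
    (c.contDiffOn_rep_gauged hL S).continuousOn.comp hwc hr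
  rw [← integral_eq_sub_of_hasDerivWithinAt_Icc h01.le hd hdc,
    ← intervalIntegral.integral_add (hℓc.intervalIntegrable_of_Icc h01.le)
      (hdc.intervalIntegrable_of_Icc h01.le)]
  refine intervalIntegral.integral_congr fun t ht => ?_
  rw [uIcc_of_le h01.le] at ht
  rw [c.rep_gauged L (hr t ht), c.projTQ_total (hc t ht), sub_add_cancel, Chart.rep,
    c.total.left_inv (hc t ht)]

/-- Existence of adapted functions: in a chart, `S` may be taken affine in `q`. -/
theorem IsPontryaginLift.exists_isAdapted (hL : ContMDiff 𝓘(ℝ, VelocityModel n r) 𝓘(ℝ, ℝ) ∞ L)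
    (hp : B.IsPontryaginLift L t₀ t₁ g p) (hg : B.IsAdmissible t₀ t₁ g) (h01 : t₀ < t₁)
    (c : B.Chart) (hc : ∀ t ∈ Icc t₀ t₁, g t ∈ c.total.source) :
    ∃ S, B.IsAdapted L t₀ t₁ g p S := by
  have hw := hg.contDiffOn_total c hc
  have hwt : MapsTo (fun t => c.total (g t)) (Icc t₀ t₁) c.total.target := fun t ht =>
    c.total.map_source (hc t ht)
  have hl : ContDiffOn ℝ ∞ (fun t => L (g t)) (Icc t₀ t₁) :=
    contMDiffOn_iff_contDiffOn.1 (hL.comp_contMDiffOn hg.smooth)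
  have hDL : ContDiffOn ℝ ∞ (fun t => fderiv ℝ (c.rep L) (c.total (g t))) (Icc t₀ t₁) :=
    ((c.contDiffOn_rep hL).fderiv_of_isOpen c.total.open_target (m := ∞) (by simp)).comp hw hwt
  have hDψ : ContDiffOn ℝ ∞ (fun t => fderiv ℝ c.psi (c.total (g t))) (Icc t₀ t₁) :=
    (c.contDiffOn_psi.fderiv_of_isOpen c.total.open_target (m := ∞) (by simp)).comp hw hwt
  have hP := contDiffOn_costate h01 (hDL.clm_comp contDiffOn_const)
    (hDψ.clm_comp contDiffOn_const)
    (fun t ht => hp.hasDerivWithinAt_momL c ht (hc t ht)) 3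
  have h3 : (3 : WithTop ℕ∞) ≤ ∞ := WithTop.coe_le_coe.2 le_top
  obtain ⟨σ, hσ, hσd⟩ := exists_function_of_differential h01 (hl.of_le two_le_infty) hP
    ((hw.snd.fst).of_le h3) (fun t ht => hg.hasDerivWithinAt_total c hc ht)
  have hb : ∀ t ∈ Icc t₀ t₁, c.base (B.proj (g t)) = (t, (c.total (g t)).2.1) := fun t ht => by
    rw [← c.projTQ_total (hc t ht), projTQ_apply, hg.total_fst c ht (hc t ht)]
  refine ⟨σ ∘ c.base, fun t ht => ?_⟩
  have hx := c.mapsTo (hc t ht)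
  have hrep : c.baseRep (σ ∘ c.base) =ᶠ[𝓝 (c.base (B.proj (g t)))] σ := by
    filter_upwards [c.base.open_target.mem_nhds (c.base.map_source hx)] with y hy
    simp [Chart.baseRep, c.base.right_inv hy]
  refine ⟨ContMDiffAt.comp _ hσ.contDiffAt.contMDiffAt
    ((contMDiffAt_of_mem_maximalAtlas c.base_mem hx).of_le h3), fun v => ?_⟩
  rw [c.diff_eq _ hx (hσ.contDiffAt.congr_of_eventuallyEq hrep), hrep.fderiv_eq, hb t ht,
    hσd t ht, c.diff_time hx, c.apply_of_contact (hc t ht) (hp.contact t ht)]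

end ConstrainedSystem

end ConstrainedVariation

/-! ### Minima and the accessory problem -/

theorem dotProduct_mulVec_of_bilin {ι : Type*} [Fintype ι] [DecidableEq ι]
    {M : Matrix ι ι ℝ} {b : (ι → ℝ) →L[ℝ] (ι → ℝ) →L[ℝ] ℝ}
    (h : ∀ α β, M α β = b (Pi.single α 1) (Pi.single β 1)) (x y : ι → ℝ) :
    x ⬝ᵥ M.mulVec y = b x y := by
  conv_rhs => rw [pi_eq_sum_univ' x, pi_eq_sum_univ' y]
  simp only [map_sum, map_smul, _root_.sum_apply, _root_.smul_apply, smul_eq_mul,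
    dotProduct, Matrix.mulVec, h, Finset.mul_sum]
  rw [Finset.sum_comm]
  refine Finset.sum_congr rfl fun i _ => Finset.sum_congr rfl fun j _ => ?_
  ring

namespace ConstrainedVariation

variable {n r : ℕ} {V A : Type*}
  [TopologicalSpace V] [ChartedSpace (EventModel n) V] [IsManifold 𝓘(ℝ, EventModel n) ∞ V]
  [TopologicalSpace A] [ChartedSpace (VelocityModel n r) A]
  [IsManifold 𝓘(ℝ, VelocityModel n r) ∞ A]

namespace ConstrainedSystem

variable {B : ConstrainedSystem n r V A} {t₀ t₁ : ℝ} {g : ℝ → A} {L : A → ℝ}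
  {p : ∀ t : ℝ, TangentSpace 𝓘(ℝ, EventModel n) (B.proj (g t)) →L[ℝ] ℝ} {S : V → ℝ}

theorem IsAdapted.dotProduct_G_mulVec (hL : ContMDiff 𝓘(ℝ, VelocityModel n r) 𝓘(ℝ, ℝ) ∞ L)
    (hS : B.IsAdapted L t₀ t₁ g p S) (c : B.Chart) {t : ℝ} (ht : t ∈ Icc t₀ t₁)
    (hc : g t ∈ c.total.source) (x y : Fin r → ℝ) :
    x ⬝ᵥ (c.G L (g t) (p t)).mulVec y
      = fderiv ℝ (fderiv ℝ (c.rep (B.gauged L S))) (c.total (g t)) (0, 0, x) (0, 0, y) := by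
  set T : (Fin r → ℝ) →L[ℝ] VelocityModel n r := ContinuousLinearMap.inr ℝ ℝ _ ∘L
    ContinuousLinearMap.inr ℝ (Fin n → ℝ) (Fin r → ℝ) with hT
  exact dotProduct_mulVec_of_bilin
    (b := (fderiv ℝ (fderiv ℝ (c.rep (B.gauged L S))) (c.total (g t))).bilinearComp T T)
    (fun α β => hS.G_eq hL c ht hc α β) x y

/-- If the Hessian of the gauged Lagrangian is nonnegative on the fibres in one chart, then `G` is
positive definite in every chart in which it is regular. -/
theorem IsAdapted.posDef_G (hL : ContMDiff 𝓘(ℝ, VelocityModel n r) 𝓘(ℝ, ℝ) ∞ L)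
    (hS : B.IsAdapted L t₀ t₁ g p S) (hp : B.IsPontryaginLift L t₀ t₁ g p)
    (hg : B.IsAdmissible t₀ t₁ g) (h01 : t₀ < t₁) (c c' : B.Chart)
    (hc : ∀ t ∈ Icc t₀ t₁, g t ∈ c.total.source) {t : ℝ} (ht : t ∈ Icc t₀ t₁)
    (hc' : g t ∈ c'.total.source) (hdet : (c'.G L (g t) (p t)).det ≠ 0)
    (hnn : ∀ v, 0 ≤ fderiv ℝ (fderiv ℝ (c.rep (B.gauged L S))) (c.total (g t))
      (0, 0, v) (0, 0, v)) : (c'.G L (g t) (p t)).PosDef := by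
  refine (Matrix.PosSemidef.posDef_iff_det_ne_zero ?_).2 hdet
  refine Matrix.PosSemidef.of_dotProduct_mulVec_nonneg ?_ fun x => ?_
  · refine Matrix.IsHermitian.ext fun α β => ?_
    rw [hS.G_eq hL c' ht hc', hS.G_eq hL c' ht hc', star_trivial,
      fderiv_fderiv_symm (hS.contDiffAt_rep hL c' ht hc')]
  · rw [star_trivial, hS.dotProduct_G_mulVec hL c' ht hc',
      hS.hessian_transition hL hp hg h01 c c' hc ht hc']
    have h1 := Chart.fderiv_projTQ_transition c' c hc' (hc t ht) (0, 0, x)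
    have h2 : projTQ n r (0, 0, x) = 0 := rfl
    rw [h2, map_zero] at h1
    have h3 : fderiv ℝ (c.total ∘ c'.total.symm) (c'.total (g t)) (0, 0, x)
        = (0, 0, (fderiv ℝ (c.total ∘ c'.total.symm) (c'.total (g t)) (0, 0, x)).2.2) :=
      Prod.ext (congrArg (fun z : EventModel n => z.1) h1)
        (Prod.ext (congrArg (fun z : EventModel n => z.2) h1) rfl)
    rw [h3]
    exact hnn _

/-- Normality of the accessory problem on all subintervals. -/
theorem IsLocallyNormal.normalOn (hn : B.IsLocallyNormal t₀ t₁ g) (hg : B.IsAdmissible t₀ t₁ g)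
    (c : B.Chart) (hc : ∀ t ∈ Icc t₀ t₁, g t ∈ c.total.source) {ℓ : VelocityModel n r → ℝ}
    {Φ Ψ : ℝ → (Fin n → ℝ) →L[ℝ] (Fin n → ℝ)} {β : ℝ → (Fin r → ℝ) →L[ℝ] (Fin n → ℝ)}
    {H : ℝ → ((Fin n → ℝ) × (Fin r → ℝ)) →L[ℝ] ((Fin n → ℝ) × (Fin r → ℝ)) →L[ℝ] ℝ}
    (ha : IsAccessory c.psi ℓ (fun t => c.total (g t)) t₀ t₁ Φ Ψ β H) {s₀ s₁ : ℝ} (h₀ : t₀ ≤ s₀)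
    (h : s₀ < s₁) (h₁ : s₁ ≤ t₁) : NormalOn β s₀ s₁ :=
  ha.normalOn h₀ h.le h₁ fun _ h2 h3 => hn.eq_zero hg c hc h₀ h h₁ h2 h3

theorem IsAdapted.exists_isAccessory (hL : ContMDiff 𝓘(ℝ, VelocityModel n r) 𝓘(ℝ, ℝ) ∞ L)
    (hS : B.IsAdapted L t₀ t₁ g p S) (hg : B.IsAdmissible t₀ t₁ g) (h01 : t₀ < t₁) (c : B.Chart)
    (hc : ∀ t ∈ Icc t₀ t₁, g t ∈ c.total.source) :
    ∃ Φ Ψ β H, IsAccessory c.psi (c.rep (B.gauged L S)) (fun t => c.total (g t)) t₀ t₁ Φ Ψ β H :=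
  _root_.exists_isAccessory h01.le (c.isOpen_regularSet S)
    ((c.contDiffOn_psi.mono fun _ hy => hy.1).of_le (WithTop.coe_le_coe.2 le_top))
    (c.contDiffOn_rep_gauged hL S) (hg.contDiffOn_total c hc).continuousOn
    fun t ht => hS.mem_regularSet c ht (hc t ht)

theorem IsAdapted.rep_gauged_eq_zero (hS : B.IsAdapted L t₀ t₁ g p S)
    (hp : B.IsPontryaginLift L t₀ t₁ g p) (c : B.Chart)
    (hc : ∀ t ∈ Icc t₀ t₁, g t ∈ c.total.source) {t : ℝ} (ht : t ∈ Icc t₀ t₁) :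
    c.rep (B.gauged L S) (c.total (g t)) = 0 := by
  rw [Chart.rep, c.total.left_inv (hc t ht)]
  exact hS.gauged_eq_zero hp ht

/-- Comparison of the action of a section with that of a neighbouring one with the same
end-points. -/
theorem IsAdapted.action_eq_add (hL : ContMDiff 𝓘(ℝ, VelocityModel n r) 𝓘(ℝ, ℝ) ∞ L)
    (hS : B.IsAdapted L t₀ t₁ g p S) (hp : B.IsPontryaginLift L t₀ t₁ g p)
    (hg : B.IsAdmissible t₀ t₁ g) (h01 : t₀ < t₁) (c : B.Chart)
    (hc : ∀ t ∈ Icc t₀ t₁, g t ∈ c.total.source) {h : ℝ → A} (hh : B.IsAdmissible t₀ t₁ h)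
    (hhc : ∀ t ∈ Icc t₀ t₁, h t ∈ c.total.source)
    (hr : ∀ t ∈ Icc t₀ t₁, c.total (h t) ∈ c.regularSet S)
    (h0 : B.proj (h t₀) = B.proj (g t₀)) (h1 : B.proj (h t₁) = B.proj (g t₁)) :
    B.action L t₀ t₁ h
      = B.action L t₀ t₁ g + ∫ t in t₀..t₁, c.rep (B.gauged L S) (c.total (h t)) := by
  have hz : ∫ t in t₀..t₁, c.rep (B.gauged L S) (c.total (g t)) = 0 := by
    rw [intervalIntegral.integral_congr (g := fun _ => (0 : ℝ)) fun t ht => ?_]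
    · simp
    · rw [uIcc_of_le h01.le] at ht
      exact hS.rep_gauged_eq_zero hp c hc ht
  rw [hh.action_eq hL h01 c hhc hr, hg.action_eq hL h01 c hc
    (fun t ht => hS.mem_regularSet c ht (hc t ht)), h0, h1, hz]
  ring

/-- A weak local minimum, in a chart: the integral of the gauged Lagrangian is nonnegative on all
neighbouring trajectories with the same end-points. -/
theorem IsWeakLocalMin.exists_integral_nonneg
    (hL : ContMDiff 𝓘(ℝ, VelocityModel n r) 𝓘(ℝ, ℝ) ∞ L)
    (hm : B.IsWeakLocalMin L t₀ t₁ g)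
    (hS : B.IsAdapted L t₀ t₁ g p S) (hp : B.IsPontryaginLift L t₀ t₁ g p)
    (hg : B.IsAdmissible t₀ t₁ g) (h01 : t₀ < t₁) (c : B.Chart)
    (hc : ∀ t ∈ Icc t₀ t₁, g t ∈ c.total.source) :
    ∃ δ > 0, ∀ (x : ℝ → Fin n → ℝ) (v : ℝ → Fin r → ℝ), ContDiffOn ℝ ∞ x (Icc t₀ t₁) →
      ContDiffOn ℝ ∞ v (Icc t₀ t₁) →
      (∀ t ∈ Icc t₀ t₁, HasDerivWithinAt x (c.psi (c.total (g t) + (0, x t, v t))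
        - c.psi (c.total (g t))) (Icc t₀ t₁) t) →
      x t₀ = 0 → x t₁ = 0 → (∀ t ∈ Icc t₀ t₁, ‖(x t, v t)‖ < δ) →
      0 ≤ ∫ t in t₀..t₁, c.rep (B.gauged L S) (c.total (g t) + (0, x t, v t)) := by
  obtain ⟨W, hWo, hgW, hmin⟩ := hm
  have hw := hg.contDiffOn_total c hc
  set U := c.regularSet S ∩ (c.total.target ∩ c.total.symm ⁻¹' W) with hU
  have hUo : IsOpen U := (c.isOpen_regularSet S).inter (c.total.isOpen_inter_preimage_symm hWo)
  have hK : IsCompact ((fun t => c.total (g t)) '' Icc t₀ t₁) :=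
    isCompact_Icc.image_of_continuousOn hw.continuousOn
  have hKU : (fun t => c.total (g t)) '' Icc t₀ t₁ ⊆ U := by
    rintro _ ⟨t, ht, rfl⟩
    refine ⟨hS.mem_regularSet c ht (hc t ht), c.total.map_source (hc t ht), ?_⟩
    rw [mem_preimage, c.total.left_inv (hc t ht)]
    exact hgW t ht
  obtain ⟨δ, hδ, hδU⟩ := hK.exists_thickening_subset_open hUo hKU
  refine ⟨δ, hδ, fun x v hx hv hode hx0 hx1 hsmall => ?_⟩
  set y : ℝ → VelocityModel n r := fun t => c.total (g t) + (0, x t, v t) with hy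
  have hyU : ∀ t ∈ Icc t₀ t₁, y t ∈ U := fun t ht => by
    refine hδU (Metric.mem_thickening_iff.2 ⟨_, mem_image_of_mem _ ht, ?_⟩)
    rw [dist_eq_norm, hy]
    simp only [add_sub_cancel_left]
    rw [norm_inr_mk]
    exact hsmall t ht
  have hyt : ∀ t ∈ Icc t₀ t₁, y t ∈ c.total.target := fun t ht => (hyU t ht).1.1
  have hadm : B.IsAdmissible t₀ t₁ fun t => c.total.symm (y t) := by
    refine c.isAdmissible_symm h01 (hw.add (contDiffOn_const.prodMk (hx.prodMk hv))) hyt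
      (fun t ht => ?_) fun t ht => ?_
    · simp only [hy, Prod.fst_add, add_zero]
      exact hg.total_fst c ht (hc t ht)
    · have h1 := (hg.hasDerivWithinAt_total c hc ht).add (hode t ht)
      rw [add_sub_cancel] at h1
      exact h1
  have hend : ∀ t ∈ Icc t₀ t₁, x t = 0 → B.proj (c.total.symm (y t)) = B.proj (g t) := by
    intro t ht h0
    refine c.base.injOn (c.mapsTo (c.total.map_target (hyt t ht))) (c.mapsTo (hc t ht)) ?_
    rw [← c.projTQ_total (c.total.map_target (hyt t ht)), ← c.projTQ_total (hc t ht),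
      c.total.right_inv (hyt t ht)]
    simp [hy, h0]
  have h0 := hend t₀ ⟨le_rfl, h01.le⟩ hx0
  have h1 := hend t₁ ⟨h01.le, le_rfl⟩ hx1
  have h2 := hmin _ hadm (fun t ht => (hyU t ht).2.2) h0 h1
  rw [hS.action_eq_add hL hp hg h01 c hc hadm (fun t ht => c.total.map_target (hyt t ht))
    (fun t ht => by rw [c.total.right_inv (hyt t ht)]; exact (hyU t ht).1) h0 h1,
    le_add_iff_nonneg_right] at h2
  refine h2.trans_eq (intervalIntegral.integral_congr fun t ht => ?_)
  rw [uIcc_of_le h01.le] at ht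
  exact congrArg (c.rep (B.gauged L S)) (c.total.right_inv (hyt t ht))

/-- The section is a weak local minimum as soon as the integral of the gauged Lagrangian is
nonnegative on the neighbouring trajectories, in a chart, with the same end-points. -/
theorem IsAdapted.isWeakLocalMin
    (hL : ContMDiff 𝓘(ℝ, VelocityModel n r) 𝓘(ℝ, ℝ) ∞ L)
    (hS : B.IsAdapted L t₀ t₁ g p S) (hp : B.IsPontryaginLift L t₀ t₁ g p)
    (hg : B.IsAdmissible t₀ t₁ g) (h01 : t₀ < t₁) (c : B.Chart)
    (hc : ∀ t ∈ Icc t₀ t₁, g t ∈ c.total.source) {δ : ℝ} (hδ : 0 < δ)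
    (h : ∀ (x : ℝ → Fin n → ℝ) (v : ℝ → Fin r → ℝ), ContinuousOn v (Icc t₀ t₁) →
      (∀ t ∈ Icc t₀ t₁, HasDerivWithinAt x (c.psi (c.total (g t) + (0, x t, v t))
        - c.psi (c.total (g t))) (Icc t₀ t₁) t) →
      x t₀ = 0 → x t₁ = 0 → (∀ t ∈ Icc t₀ t₁, ‖(x t, v t)‖ < δ) →
      0 ≤ ∫ t in t₀..t₁, c.rep (B.gauged L S) (c.total (g t) + (0, x t, v t))) :
    B.IsWeakLocalMin L t₀ t₁ g := by
  have hw := (hg.contDiffOn_total c hc).continuousOn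
  -- the neighbourhood consists of the points of distance less than `δ` from the point of the
  -- section at the same time
  set wE : ℝ → VelocityModel n r := fun t => c.total (g (projIcc t₀ t₁ h01.le t)) with hwE
  have hwEc : Continuous wE := hw.comp_continuous
    (continuous_subtype_val.comp continuous_projIcc) fun t => (projIcc t₀ t₁ h01.le t).2
  have hwEe : ∀ t ∈ Icc t₀ t₁, wE t = c.total (g t) := fun t ht => by
    simp [hwE, projIcc_of_mem h01.le ht]
  set U : Set (VelocityModel n r) := {y | dist y (wE y.1) < δ} with hU
  have hUo : IsOpen U := isOpen_lt (continuous_id.dist (hwEc.comp continuous_fst)) continuous_const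
  refine ⟨c.total.source ∩ c.total ⁻¹' (c.regularSet S ∩ U),
    c.total.isOpen_inter_preimage ((c.isOpen_regularSet S).inter hUo), fun t ht =>
      ⟨hc t ht, hS.mem_regularSet c ht (hc t ht), ?_⟩, fun k hk hkW h0 h1 => ?_⟩
  · change dist (c.total (g t)) (wE (c.total (g t)).1) < δ
    rw [hg.total_fst c ht (hc t ht), hwEe t ht, dist_self]
    exact hδ
  have hkc : ∀ t ∈ Icc t₀ t₁, k t ∈ c.total.source := fun t ht => (hkW t ht).1
  rw [hS.action_eq_add hL hp hg h01 c hc hk hkc (fun t ht => (hkW t ht).2.1) h0 h1,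
    le_add_iff_nonneg_right]
  set x : ℝ → Fin n → ℝ := fun t => (c.total (k t)).2.1 - (c.total (g t)).2.1 with hx
  set v : ℝ → Fin r → ℝ := fun t => (c.total (k t)).2.2 - (c.total (g t)).2.2 with hv
  have hy : ∀ t ∈ Icc t₀ t₁, c.total (g t) + (0, x t, v t) = c.total (k t) := fun t ht => by
    refine Prod.ext ?_ (Prod.ext ?_ ?_)
    · simp only [Prod.fst_add, add_zero]
      rw [hg.total_fst c ht (hc t ht), hk.total_fst c ht (hkc t ht)]
    · simp [hx]
    · simp [hv]
  have hkw := (hk.contDiffOn_total c hkc).continuousOn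
  have h2 := h x v (hkw.snd.snd.sub hw.snd.snd) (fun t ht => ?_) ?_ ?_ fun t ht => ?_
  · refine h2.trans_eq (intervalIntegral.integral_congr fun t ht => ?_)
    rw [uIcc_of_le h01.le] at ht
    rw [hy t ht]
  · rw [hy t ht]
    exact (hk.hasDerivWithinAt_total c hkc ht).sub (hg.hasDerivWithinAt_total c hc ht)
  · have ht : t₀ ∈ Icc t₀ t₁ := ⟨le_rfl, h01.le⟩
    simp only [hx]
    rw [c.total_q _ (hkc _ ht), c.total_q _ (hc _ ht), h0, sub_self]
  · have ht : t₁ ∈ Icc t₀ t₁ := ⟨h01.le, le_rfl⟩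
    simp only [hx]
    rw [c.total_q _ (hkc _ ht), c.total_q _ (hc _ ht), h1, sub_self]
  · have h3 : dist (c.total (k t)) (wE (c.total (k t)).1) < δ := (hkW t ht).2.2
    rw [hk.total_fst c ht (hkc t ht), hwEe t ht, dist_eq_norm, ← hy t ht, add_sub_cancel_left,
      norm_inr_mk] at h3
    exact h3

end ConstrainedSystem

end ConstrainedVariation

/-! ### Necessary and sufficient conditions -/

namespace ConstrainedVariation

variable {n r : ℕ} {V A : Type*}
  [TopologicalSpace V] [ChartedSpace (EventModel n) V] [IsManifold 𝓘(ℝ, EventModel n) ∞ V]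
  [TopologicalSpace A] [ChartedSpace (VelocityModel n r) A]
  [IsManifold 𝓘(ℝ, VelocityModel n r) ∞ A]

namespace ConstrainedSystem

variable {B : ConstrainedSystem n r V A} {t₀ t₁ : ℝ} {g : ℝ → A} {L : A → ℝ}
  {p : ∀ t : ℝ, TangentSpace 𝓘(ℝ, EventModel n) (B.proj (g t)) →L[ℝ] ℝ} {S : V → ℝ}

/-- At a weak local minimum the second variation is nonnegative on the controls which steer the
accessory system from `0` to `0`. -/
theorem IsWeakLocalMin.quad_nonneg
    (hL : ContMDiff 𝓘(ℝ, VelocityModel n r) 𝓘(ℝ, ℝ) ∞ L)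
    (hm : B.IsWeakLocalMin L t₀ t₁ g) (hn : B.IsLocallyNormal t₀ t₁ g)
    (hS : B.IsAdapted L t₀ t₁ g p S) (hp : B.IsPontryaginLift L t₀ t₁ g p)
    (hg : B.IsAdmissible t₀ t₁ g) (h01 : t₀ < t₁) (c : B.Chart)
    (hc : ∀ t ∈ Icc t₀ t₁, g t ∈ c.total.source)
    {Φ Ψ : ℝ → (Fin n → ℝ) →L[ℝ] (Fin n → ℝ)} {β : ℝ → (Fin r → ℝ) →L[ℝ] (Fin n → ℝ)}
    {H : ℝ → ((Fin n → ℝ) × (Fin r → ℝ)) →L[ℝ] ((Fin n → ℝ) × (Fin r → ℝ)) →L[ℝ] ℝ}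
    (ha : IsAccessory c.psi (c.rep (B.gauged L S)) (fun t => c.total (g t)) t₀ t₁ Φ Ψ β H)
    {u : ℝ → Fin r → ℝ} (hu : ContDiff ℝ ∞ u) (hub : traj β t₀ u t₁ = 0) :
    0 ≤ quad β H t₀ t₁ u := by
  obtain ⟨δ, hδ, hmin⟩ := hm.exists_integral_nonneg hL hS hp hg h01 c hc
  exact ha.quad_nonneg h01 (c.isOpen_regularSet S) (c.contDiffOn_psi.mono fun _ hy => hy.1)
    (c.contDiffOn_rep_gauged hL S) (hg.contDiffOn_total c hc)
    (fun t ht => hS.mem_regularSet c ht (hc t ht))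
    (fun t ht => hS.rep_gauged_eq_zero hp c hc ht)
    (fun t ht => hS.fderiv_rep_gauged_eq_zero hL hp hg h01 c hc ht)
    (hn.normalOn hg c hc ha le_rfl h01 le_rfl) hδ hmin hu hub

/-- The Legendre condition: at a weak local minimum `G` is nonnegative, and so, if regular, positive
definite. -/
theorem IsWeakLocalMin.posDef_G
    (hL : ContMDiff 𝓘(ℝ, VelocityModel n r) 𝓘(ℝ, ℝ) ∞ L)
    (hm : B.IsWeakLocalMin L t₀ t₁ g) (hn : B.IsLocallyNormal t₀ t₁ g)
    (hp : B.IsPontryaginLift L t₀ t₁ g p) (hg : B.IsAdmissible t₀ t₁ g) (h01 : t₀ < t₁)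
    {t : ℝ} (ht : t ∈ Icc t₀ t₁) (c' : B.Chart) (hc' : g t ∈ c'.total.source)
    (hdet : (c'.G L (g t) (p t)).det ≠ 0) : (c'.G L (g t) (p t)).PosDef := by
  obtain ⟨c, hc⟩ := exists_chart_along (B := B) h01.le hg.smooth.continuousOn hg.time_eq
  obtain ⟨S, hS⟩ := hp.exists_isAdapted hL hg h01 c hc
  obtain ⟨Φ, Ψ, β, H, ha⟩ := hS.exists_isAccessory hL hg h01 c hc
  refine hS.posDef_G hL hp hg h01 c c' hc ht hc' hdet fun v => ?_
  have h1 := (hn.normalOn hg c hc ha le_rfl h01 le_rfl).legendre ha.continuous_β h01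
    ha.continuous_H ha.symm (fun u hu hub => hm.quad_nonneg hL hn hS hp hg h01 c hc ha hu hub) ht v
  rwa [ha.H_apply t ht, map_zero] at h1

theorem IsAdapted.hessian_pos (hL : ContMDiff 𝓘(ℝ, VelocityModel n r) 𝓘(ℝ, ℝ) ∞ L)
    (hS : B.IsAdapted L t₀ t₁ g p S) (c : B.Chart) {t : ℝ} (ht : t ∈ Icc t₀ t₁)
    (hc : g t ∈ c.total.source) (hG : (c.G L (g t) (p t)).PosDef) {v : Fin r → ℝ} (hv : v ≠ 0) :
    0 < fderiv ℝ (fderiv ℝ (c.rep (B.gauged L S))) (c.total (g t)) (0, 0, v) (0, 0, v) := by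
  rw [← hS.dotProduct_G_mulVec hL c ht hc]
  simpa using hG.dotProduct_mulVec_pos hv

/-- The Jacobi condition: a weak local minimum has no conjugate point before its end. -/
theorem IsWeakLocalMin.not_isConjugate
    (hL : ContMDiff 𝓘(ℝ, VelocityModel n r) 𝓘(ℝ, ℝ) ∞ L)
    (hm : B.IsWeakLocalMin L t₀ t₁ g) (hn : B.IsLocallyNormal t₀ t₁ g)
    (hp : B.IsPontryaginLift L t₀ t₁ g p) (hg : B.IsAdmissible t₀ t₁ g) (h01 : t₀ < t₁)
    (hG : ∀ t ∈ Icc t₀ t₁, ∀ c : B.Chart, g t ∈ c.total.source → (c.G L (g t) (p t)).PosDef)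
    {τ : ℝ} (hτ : τ ∈ Ioo t₀ t₁) : ¬ B.IsConjugate L t₀ t₁ g p τ := by
  intro hcj
  obtain ⟨c, hc⟩ := exists_chart_along (B := B) h01.le hg.smooth.continuousOn hg.time_eq
  obtain ⟨S, hS, X, Γ, ϖ, hX, h0, h1, t, ht, hne⟩ := hcj.exists_isLinearized hL c hc
  obtain ⟨Φ, Ψ, β, H, ha⟩ := hS.exists_isAccessory hL hg h01 c hc
  have hz := jacobi_necessary ha.continuous_β hτ
    (hn.normalOn hg c hc ha le_rfl hτ.1 hτ.2.le) (hn.normalOn hg c hc ha hτ.1.le hτ.2 le_rfl)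
    ha.continuous_H ha.symm
    (ha.ctlPos fun t ht v hv => hS.hessian_pos hL c ht (hc t ht) (hG t ht c (hc t ht)) hv)
    (fun u hu hub => hm.quad_nonneg hL hn hS hp hg h01 c hc ha hu hub) (ha.isLQSolution hX)
    (by simp only [h0, map_zero]) (by simp only [h1, map_zero]) t ht
  apply hne
  rw [← ha.right_inv t (X t)]
  rw [hz, map_zero]

/-- Sufficiency of the strengthened Legendre and Jacobi conditions. A field of extremals of the
accessory problem provides a calibration of the nonlinear problem. -/
theorem isWeakLocalMin_of_posDef
    (hL : ContMDiff 𝓘(ℝ, VelocityModel n r) 𝓘(ℝ, ℝ) ∞ L) (hn : B.IsLocallyNormal t₀ t₁ g)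
    (hp : B.IsPontryaginLift L t₀ t₁ g p) (hg : B.IsAdmissible t₀ t₁ g) (h01 : t₀ < t₁)
    (hG : ∀ t ∈ Icc t₀ t₁, ∀ c : B.Chart, g t ∈ c.total.source → (c.G L (g t) (p t)).PosDef)
    (hcj : ∀ τ ∈ Ioc t₀ t₁, ¬ B.IsConjugate L t₀ t₁ g p τ) : B.IsWeakLocalMin L t₀ t₁ g := by
  obtain ⟨c, hc⟩ := exists_chart_along (B := B) h01.le hg.smooth.continuousOn hg.time_eq
  obtain ⟨S, hS⟩ := hp.exists_isAdapted hL hg h01 c hc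
  obtain ⟨Φ, Ψ, β, H, ha⟩ := hS.exists_isAccessory hL hg h01 c hc
  obtain ⟨W, W', hW'c, hW, hWs, hpos⟩ := exists_riccati h01 ha.continuous_β
    (hn.normalOn hg c hc ha le_rfl h01 le_rfl) ha.continuous_H ha.symm
    (ha.ctlPos fun t ht v hv => hS.hessian_pos hL c ht (hc t ht) (hG t ht c (hc t ht)) hv)
    (fun y u π hs hy0 τ hτ hyτ t ht => by
      by_contra hne
      refine hcj τ hτ (hS.isConjugate hL hp hg h01 c hc (ha.isLinearized hs) hτ
        (by simp only [hy0, map_zero]) (by simp only [hyτ, map_zero]) ⟨t, ht, fun h0 => hne ?_⟩)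
      rw [← ha.left_inv t (y t)]
      rw [h0, map_zero])
  obtain ⟨δ, hδ, hmin⟩ := ha.exists_integral_nonneg h01 (c.isOpen_regularSet S)
    ((c.contDiffOn_psi.mono fun _ hy => hy.1).of_le (WithTop.coe_le_coe.2 le_top))
    (c.contDiffOn_rep_gauged hL S) (hg.contDiffOn_total c hc).continuousOn
    (fun t ht => hS.mem_regularSet c ht (hc t ht))
    (fun t ht => hS.rep_gauged_eq_zero hp c hc ht)
    (fun t ht => hS.fderiv_rep_gauged_eq_zero hL hp hg h01 c hc ht) hW'c hW hWs hpos
  exact hS.isWeakLocalMin hL hp hg h01 c hc hδ hmin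

end ConstrainedSystem

end ConstrainedVariation

theorem mainTheorem1 {n r : ℕ} {V A : Type*}
    [TopologicalSpace V] [T2Space V] [SecondCountableTopology V]
    [ChartedSpace (EventModel n) V] [IsManifold 𝓘(ℝ, EventModel n) ∞ V]
    [TopologicalSpace A] [T2Space A] [SecondCountableTopology A]
    [ChartedSpace (VelocityModel n r) A] [IsManifold 𝓘(ℝ, VelocityModel n r) ∞ A]
    (B : ConstrainedVariation.ConstrainedSystem n r V A)
    (L : A → ℝ) (hL : ContMDiff 𝓘(ℝ, VelocityModel n r) 𝓘(ℝ, ℝ) ∞ L)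
    (t₀ t₁ : ℝ) (h01 : t₀ < t₁)
    (g : ℝ → A) (hext : B.IsExtremal L t₀ t₁ g) (hnormal : B.IsLocallyNormal t₀ t₁ g)
    (p : ∀ t : ℝ, TangentSpace 𝓘(ℝ, EventModel n) (B.proj (g t)) →L[ℝ] ℝ)
    (hp : B.IsPontryaginLift L t₀ t₁ g p)
    (hreg : ∀ t ∈ Icc t₀ t₁, ∀ c : B.Chart, g t ∈ c.total.source →
      (c.G L (g t) (p t)).det ≠ 0) :
    (¬ B.IsConjugate L t₀ t₁ g p t₁ →
      (B.IsWeakLocalMin L t₀ t₁ g ↔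
        (∀ t ∈ Icc t₀ t₁, ∀ c : B.Chart, g t ∈ c.total.source → (c.G L (g t) (p t)).PosDef) ∧
        ∀ τ ∈ Ioc t₀ t₁, ¬ B.IsConjugate L t₀ t₁ g p τ)) ∧
    (B.IsWeakLocalMin L t₀ t₁ g →
      (∀ t ∈ Icc t₀ t₁, ∀ c : B.Chart, g t ∈ c.total.source → (c.G L (g t) (p t)).PosDef) ∧
      ∀ τ ∈ Ioo t₀ t₁, ¬ B.IsConjugate L t₀ t₁ g p τ) := by
  have hg := hext.1
  have hnec : B.IsWeakLocalMin L t₀ t₁ g →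
      (∀ t ∈ Icc t₀ t₁, ∀ c : B.Chart, g t ∈ c.total.source → (c.G L (g t) (p t)).PosDef) ∧
      ∀ τ ∈ Ioo t₀ t₁, ¬ B.IsConjugate L t₀ t₁ g p τ := fun hm => by
    have hG : ∀ t ∈ Icc t₀ t₁, ∀ c : B.Chart, g t ∈ c.total.source →
        (c.G L (g t) (p t)).PosDef := fun t ht c hc =>
      hm.posDef_G hL hnormal hp hg h01 ht c hc (hreg t ht c hc)
    exact ⟨hG, fun τ hτ => hm.not_isConjugate hL hnormal hp hg h01 hG hτ⟩
  refine ⟨fun hcj => ⟨fun hm => ⟨(hnec hm).1, fun τ hτ => ?_⟩, fun h =>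
    ConstrainedVariation.ConstrainedSystem.isWeakLocalMin_of_posDef hL hnormal hp hg h01 h.1 h.2⟩,
    hnec⟩
  rcases hτ.2.lt_or_eq with hlt | rfl
  · exact (hnec hm).2 τ ⟨hτ.1, hlt⟩
  · exact hcj
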